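/- \textbf{Lemma (kernel for Chordal Graph Sandwich).} An instance $(G_1,G_2,k)$ of \textsc{Chordal Graph Sandwich} consists of two finite simple graphs $G_1=(V,E_1)$ and $G_2=(V,E_2)$ on the same vertex set with $E_1\subseteq E_2$, and an integer $k\ge 0$. It is a YES instance if there is a set $F\subseteq E_2\setminus E_1$ with $|F|\le k$ such that the graph $(V,E_1\cup F)$ is chordal, i.e. has no induced cycle of length more than three. Write $n=|V|$ and $m=|E_1|$. There is an algorithm that, given an instance $(G_1,G_2,k)$, outputs an instance $(G_1',G_2',k')$ such that \begin{itemize} \item $(G_1',G_2',k')$ is a YES instance if and only if $(G_1,G_2,k)$ is a YES instance; \item $k'\le k$; moreover, if $k\le|E_2\setminus E_1|$ then $k'\le|E_2'\setminus E_1'|$, and if $k=|E_2\setminus E_1|$ then $k'=|E_2'\setminus E_1'|$; \item $|V(G_1')|\le\max\{4,\,32k^3+4k\}$, so that the number of vertices is $\mathcal{O}(k^3)$, and is at most $32k^3+4k$ whenever $k\ge1$; \item the running time is $\mathcal{O}(k^2nm)$, where a factor $k$, $n$ or $m$ that is $0$ is replaced by $1$. \end{itemize} Here $G_1$ and $G_2$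 are given, and $G_1'$ and $G_2'$ are returned, by adjacency lists (in any order), and the running time is the number of steps of a random access machine with addition, subtraction, comparison and indirect addressing on words of $\mathcal{O}(\log(N+k))$ bits, where $N$ is the number of cells that the input occupies. -/

import Mathlib

namespace ChordalSandwich

/-! ### The problem -/

/-- A graph is chordal if it has no induced cycle of length more than three. -/
def IsChordal {V : Type*} (G : SimpleGraph V) : Prop :=
  ∀ l : ℕ, 4 ≤ l → IsEmpty (SimpleGraph.cycleGraph l ↪g G)

/-- An instance of Chordal Graph Sandwich: two graphs on the same vertex set, the first one a
subgraph of the second one, and a number `k`. -/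
structure Instance where
  n : ℕ
  G₁ : SimpleGraph (Fin n)
  G₂ : SimpleGraph (Fin n)
  le : G₁ ≤ G₂
  k : ℕ

/-- The number of edges of the graph `G₁`. -/
noncomputable def Instance.m (I : Instance) : ℕ := I.G₁.edgeSet.ncard

/-- The number `|E₂ \ E₁|` of edges that may be added. -/
noncomputable def Instance.numFree (I : Instance) : ℕ :=
  (I.G₂.edgeSet \ I.G₁.edgeSet).ncard

/-- Is there `F ⊆ E₂ \ E₁` with `|F| ≤ k` such that `(V, E₁ ∪ F)` is a triangulation of `G₁`? -/
def Instance.IsYes (I : Instance) : Prop :=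
  ∃ F : Set (Sym2 (Fin I.n)), F ⊆ I.G₂.edgeSet \ I.G₁.edgeSet ∧ F.ncard ≤ I.k ∧
    IsChordal (SimpleGraph.fromEdgeSet (I.G₁.edgeSet ∪ F))

/-! ### Adjacency-list representation of instances -/

/-- `adj v` lists the neighbours of `v`, each of them once, in some order. -/
def IsAdjList {n : ℕ} (G : SimpleGraph (Fin n)) (adj : Fin n → List (Fin n)) : Prop :=
  ∀ v, (adj v).Nodup ∧ ∀ w, w ∈ adj v ↔ G.Adj v w

/-- The position at which the list of vertex number `i` starts in the concatenation of all lists. -/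
def offset {n : ℕ} (adj : Fin n → List (Fin n)) (i : ℕ) : ℕ :=
  ∑ v : Fin n, if v.val < i then (adj v).length else 0

/-- The array of the `n + 1` offsets, followed by the concatenation of all adjacency lists. -/
def adjArray {n : ℕ} (adj : Fin n → List (Fin n)) : List ℕ :=
  (List.range (n + 1)).map (offset adj) ++
    (List.finRange n).flatMap fun v => (adj v).map Fin.val

/-- The array `L` represents the instance `I`: it consists of `n`, `k`, and adjacency lists
of `G₁` and of `G₂`. -/
def Instance.RepresentedBy (I : Instance) (L : List ℕ) : Prop :=
  ∃ adj₁ adj₂ : Fin I.n → List (Fin I.n), IsAdjList I.G₁ adj₁ ∧ IsAdjList I.G₂ adj₂ ∧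
    L = I.n :: I.k :: (adjArray adj₁ ++ adjArray adj₂)

/-! ### Random access machine -/

/-- Programs of a random access machine. A program mentions only finitely many registers
`r₀, r₁, …`; the memory is an array of cells that is addressed indirectly, through registers. -/
inductive Prog where
  /-- no effect -/
  | skip : Prog
  /-- `r_x := c` -/
  | const (x c : ℕ) : Prog
  /-- `r_x := r_y + r_z` -/
  | add (x y z : ℕ) : Prog
  /-- `r_x := r_y - r_z`, or `0` if this is negative -/
  | sub (x y z : ℕ) : Prog
  /-- `r_x := mem[r_y]` -/
  | load (x y : ℕ) : Prog
  /-- `mem[r_x] := r_y` -/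
  | store (x y : ℕ) : Prog
  /-- first `p`, then `q` -/
  | seq (p q : Prog) : Prog
  /-- if `r_x < r_y` then `p` else `q` -/
  | ite (x y : ℕ) (p q : Prog) : Prog
  /-- while `r_x < r_y` do `p` -/
  | while (x y : ℕ) (p : Prog) : Prog

/-- The contents of the registers and of the memory. -/
structure State where
  reg : ℕ → ℕ
  mem : ℕ → ℕ

def State.setReg (s : State) (x a : ℕ) : State := ⟨Function.update s.reg x a, s.mem⟩

def State.setMem (s : State) (i a : ℕ) : State := ⟨s.reg, Function.update s.mem i a⟩

/-- `Exec W p s t s'`: on a machine whose words hold the numbers `0, …, W`, the program `p`,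
started in the state `s`, halts after exactly `t` steps in the state `s'`, without overflow.
Every elementary instruction and every test counts as one step. (Only `const` and `add`
can produce a number larger than all those present, so the others need no overflow check.) -/
inductive Exec (W : ℕ) : Prog → State → ℕ → State → Prop where
  | skip (s : State) : Exec W .skip s 1 s
  | const (x c : ℕ) (s : State) : c ≤ W → Exec W (.const x c) s 1 (s.setReg x c)
  | add (x y z : ℕ) (s : State) : s.reg y + s.reg z ≤ W →
      Exec W (.add x y z) s 1 (s.setReg x (s.reg y + s.reg z))
  | sub (x y z : ℕ) (s : State) : Exec W (.sub x y z) s 1 (s.setReg x (s.reg y - s.reg z))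
  | load (x y : ℕ) (s : State) : Exec W (.load x y) s 1 (s.setReg x (s.mem (s.reg y)))
  | store (x y : ℕ) (s : State) : Exec W (.store x y) s 1 (s.setMem (s.reg x) (s.reg y))
  | seq {p q : Prog} {s s' s'' : State} {t t' : ℕ} :
      Exec W p s t s' → Exec W q s' t' s'' → Exec W (.seq p q) s (t + t') s''
  | ite_true {x y : ℕ} {p q : Prog} {s s' : State} {t : ℕ} : s.reg x < s.reg y →
      Exec W p s t s' → Exec W (.ite x y p q) s (t + 1) s'
  | ite_false {x y : ℕ} {p q : Prog} {s s' : State} {t : ℕ} : ¬ s.reg x < s.reg y →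
      Exec W q s t s' → Exec W (.ite x y p q) s (t + 1) s'
  | while_true {x y : ℕ} {p : Prog} {s s' s'' : State} {t t' : ℕ} : s.reg x < s.reg y →
      Exec W p s t s' → Exec W (.while x y p) s' t' s'' →
      Exec W (.while x y p) s (t + t' + 1) s''
  | while_false {x y : ℕ} {p : Prog} {s : State} : ¬ s.reg x < s.reg y →
      Exec W (.while x y p) s 1 s

/-- The initial state: the input array stands at the beginning of the memory, and all
other cells and all registers are zero. -/
def State.init (L : List ℕ) : State := ⟨fun _ => 0, fun i => L.getD i 0⟩

/-- The array `L` stands in the memory, beginning at the address that is held by `r₀`. -/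
def State.HasOutput (s : State) (L : List ℕ) : Prop :=
  ∀ i : ℕ, (h : i < L.length) → s.mem (s.reg 0 + i) = L[i]

end ChordalSandwich

set_option linter.constructorNameAsVariable false
set_option linter.unusedSimpArgs false
set_option linter.unusedVariables false

namespace ChordalSandwich

/-! ### A small imperative language with named variables and arrays -/

/-! Call `Hit G x y z` the event that `y, x, z` are consecutive on a chordless cycle of length at
least four. Equivalently, `y` and `z` are nonadjacent neighbours of `x` that are joined by a path
whose inner vertices avoid the closed neighbourhood of `x`; a graph is chordal iff this never
happens (`isChordal_iff`). In a triangulation every hit forces either the edge `yz` or some added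
edge at `x` (`Hit.adj_or_exists`).

The set `A` is grown by moving to it, repeatedly, two vertices outside `A` that are consecutive on a
chordless cycle. One vertex of each such pair is incident with an added edge, and `k` edges have at
most `2k` ends, so more than `2k` disjoint pairs certify a NO instance (`Sandwich.le_of_hits`).
Otherwise `|A| ≤ 4k`, and no chordless cycle has two consecutive vertices outside `A`. A pair `y, z`
in `A` that is hit by more than `2k` vertices outside `A` is essential: without the edge `yz`, too
many vertices would need an added edge. The kernel `K` consists of `A` and all vertices that hit a
pair which is not essential; this gives at most `4k + (4k)² · 2k` vertices (`Input.ncard_ker_le`).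
Essential edges are added and paid for, and the instance is restricted to `K`.

One direction of the equivalence is `IsKernel.sandwich`: the essential edges lie in every solution,
and the rest of a solution, restricted to `K`, solves the kernel. For the converse, vertices outside
`K` lie on no chordless cycle even after the essential edges are added (`IsKernel.not_hit_sup`). Of
a solution of the kernel one keeps only the edges whose ends are not separated by the closed
neighbourhood of a vertex outside `K` (`exists_isChordal_sup`). Such edges create no chordless cycle
through outside vertices. A chordless cycle within `K` would have a discarded edge as a chord; the
two arcs between the ends of this chord would each cross the neighbourhood of the separating vertex
`x`, which yields a chordless cycle through `x` in the original graph.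

For the running time, with `M = 2m`, a round that looks for a new pair must take `O(k n m)` steps.
Maximum cardinality search on `G - A` either fails at a vertex that lies, next to another vertex
outside `A`, on a chordless cycle (`MaxCard.exists_hit`), so that a search around this single vertex
suffices; or it shows that `G - A` is chordal, and then a wanted cycle leaves `A` through two
consecutive vertices (`no_hit_of_chordal`), so that searching around the vertices of `A` suffices. A
search around one vertex is a breadth-first search for each of its neighbours, `O(n m)` in total.
There are at most `2k + 1` rounds, whence `O(k² n m)`. Memory is initially zero, so no matrix is
cleared, and rows of the second graph are read only for kernel vertices.

The algorithm is written in a small language with arrays, whose commands are verified by weakest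
preconditions with running times; `CExec.sim` transfers the result to the machine with a constant
factor. -/

/-- The variables of the kernelization program. -/
inductive Var where
  | out | n | k | lim | sq | cub | lb | len | fin | i | j | row | ni | p | e | x | y | z | p' | e'
  | u | w | hd | tl | go | it | bc | b | q | bad | bv | found | px | py | na | no | kk | nk | free
  | pos | off | cnt | ia
  deriving DecidableEq

/-- The arrays of the kernelization program. -/
inductive Arr where
  | row | mat | mark | queue | inA | alist | ni | mc | ord | pos | cnt | inK | mat' | klist
  deriving DecidableEq

theorem Var.ctorIdx_injective : Function.Injective Var.ctorIdx := fun a b h => by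
  have := congrArg Var.ofNat h
  simpa [Var.ofNat_ctorIdx] using this

theorem Arr.ctorIdx_injective : Function.Injective Arr.ctorIdx := fun a b h => by
  have := congrArg Arr.ofNat h
  simpa [Arr.ofNat_ctorIdx] using this

/-- The arrays are interleaved in memory with stride 16, which four doublings compute; offsets below
the stride keep their cells apart. -/
theorem Arr.ctorIdx_lt (j : Arr) : j.ctorIdx < 16 := by cases j <;> decide

/-- The contents of the variables, of the arrays, and of the input and output region. -/
structure St where
  v : Var → ℕ
  a : Arr → ℕ → ℕ
  io : ℕ → ℕ

/-- Expressions. -/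
inductive Exp where
  | v (x : Var)
  | c (n : ℕ)
  | add (e f : Exp)
  | sub (e f : Exp)
  | a (j : Arr) (e : Exp)

/-- Commands. -/
inductive Cmd where
  | skip
  | set (x : Var) (e : Exp)
  | put (j : Arr) (i e : Exp)
  | get (x : Var) (e : Exp)
  | wr (i e : Exp)
  | seq (p q : Cmd)
  | ite (e f : Exp) (p q : Cmd)
  | while (e f : Exp) (p : Cmd)

def St.setV (s : St) (x : Var) (a : ℕ) : St := { s with v := Function.update s.v x a }

def St.setA (s : St) (j : Arr) (i a : ℕ) : St :=
  { s with a := Function.update s.a j (Function.update (s.a j) i a) }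

def St.setCell (s : St) (i a : ℕ) : St := { s with io := Function.update s.io i a }

def Exp.eval (s : St) : Exp → ℕ
  | .v x => s.v x
  | .c n => n
  | .add e f => e.eval s + f.eval s
  | .sub e f => e.eval s - f.eval s
  | .a j e => s.a j (e.eval s)

/-- A sufficient condition for the value of the expression not to exceed `W`. -/
def Exp.chk (W : ℕ) (s : St) : Exp → Prop
  | .v _ => True
  | .c n => n ≤ W
  | .add e f => e.eval s + f.eval s ≤ W
  | .sub e _ => e.chk W s
  | .a _ _ => True

/-- `CExec W N c s t s'`: the command `c`, started in `s`, halts in `s'` after `t` steps; all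
values that are assigned are at most `W`, and only cells `0, …, N - 1` of the input and output
region are accessed. -/
inductive CExec (W N : ℕ) : Cmd → St → ℕ → St → Prop where
  | skip (s) : CExec W N .skip s 1 s
  | set (x e s) : e.chk W s → CExec W N (.set x e) s 1 (s.setV x (e.eval s))
  | put (j i e s) : e.chk W s → CExec W N (.put j i e) s 1 (s.setA j (i.eval s) (e.eval s))
  | get (x e s) : e.eval s < N → CExec W N (.get x e) s 1 (s.setV x (s.io (e.eval s)))
  | wr (i e s) : i.eval s < N → e.chk W s →
      CExec W N (.wr i e) s 1 (s.setCell (i.eval s) (e.eval s))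
  | seq {p q s s' s'' t t'} : CExec W N p s t s' → CExec W N q s' t' s'' →
      CExec W N (.seq p q) s (t + t') s''
  | ite_true {e f p q s s' t} : e.eval s < f.eval s → CExec W N p s t s' →
      CExec W N (.ite e f p q) s (t + 1) s'
  | ite_false {e f p q s s' t} : ¬ e.eval s < f.eval s → CExec W N q s t s' →
      CExec W N (.ite e f p q) s (t + 1) s'
  | while_true {e f p s s' s'' t t'} : e.eval s < f.eval s → CExec W N p s t s' →
      CExec W N (.while e f p) s' t' s'' → CExec W N (.while e f p) s (t + t' + 1) s''
  | while_false {e f p s} : ¬ e.eval s < f.eval s → CExec W N (.while e f p) s 1 s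

/-! ### Compilation -/

/-- Temporary registers. Register `1` holds the beginning of the arrays. -/
def tmp (d : ℕ) : ℕ := 2 * d + 3

/-- Code that turns the index in the register `tmp d` into the address of a cell of an array. -/
def addr (j : Arr) (d : ℕ) : Prog :=
  .seq (.add (tmp d) (tmp d) (tmp d)) (.seq (.add (tmp d) (tmp d) (tmp d))
    (.seq (.add (tmp d) (tmp d) (tmp d)) (.seq (.add (tmp d) (tmp d) (tmp d))
    (.seq (.add (tmp d) (tmp d) 1) (.seq (.const (tmp (d + 1)) j.ctorIdx)
    (.add (tmp d) (tmp d) (tmp (d + 1))))))))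

/-- Code that puts the value of the expression into the register `tmp d`. -/
def Exp.comp : Exp → ℕ → Prog
  | .v x, d => .seq (.const (tmp (d + 1)) 0) (.add (tmp d) (2 * x.ctorIdx) (tmp (d + 1)))
  | .c n, d => .const (tmp d) n
  | .add e f, d => .seq (e.comp d) (.seq (f.comp (d + 1)) (.add (tmp d) (tmp d) (tmp (d + 1))))
  | .sub e f, d => .seq (e.comp d) (.seq (f.comp (d + 1)) (.sub (tmp d) (tmp d) (tmp (d + 1))))
  | .a j e, d => .seq (e.comp d) (.seq (addr j d) (.load (tmp d) (tmp d)))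

def Exp.size : Exp → ℕ
  | .v _ => 1
  | .c n => n + 1
  | .add e f => e.size + f.size
  | .sub e f => e.size + f.size
  | .a _ e => e.size + 1

def Cmd.comp : Cmd → Prog
  | .skip => .skip
  | .set x e => .seq (e.comp 0) (.seq (.const (tmp 1) 0) (.add (2 * x.ctorIdx) (tmp 0) (tmp 1)))
  | .put j i e => .seq (i.comp 0) (.seq (addr j 0) (.seq (e.comp 1) (.store (tmp 0) (tmp 1))))
  | .get x e => .seq (e.comp 0) (.load (2 * x.ctorIdx) (tmp 0))
  | .wr i e => .seq (i.comp 0) (.seq (e.comp 1) (.store (tmp 0) (tmp 1)))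
  | .seq p q => .seq p.comp q.comp
  | .ite e f p q => .seq (.seq (e.comp 0) (f.comp 1)) (.ite (tmp 0) (tmp 1) p.comp q.comp)
  | .while e f p => .seq (.seq (e.comp 0) (f.comp 1))
      (.while (tmp 0) (tmp 1) (.seq p.comp (.seq (e.comp 0) (f.comp 1))))

/-- The size of the largest expression. -/
def Cmd.size : Cmd → ℕ
  | .skip => 1
  | .set _ e => e.size
  | .put _ i e => max i.size e.size
  | .get _ e => e.size
  | .wr i e => max i.size e.size
  | .seq p q => max p.size q.size
  | .ite e f p q => max (max e.size f.size) (max p.size q.size)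
  | .while e f p => max (max e.size f.size) p.size

/-- The state `σ` of the machine represents `s`. -/
structure Sim (W N : ℕ) (s : St) (σ : State) : Prop where
  var : ∀ x, σ.reg (2 * x.ctorIdx) = s.v x
  base : σ.reg 1 = N
  io : ∀ i < N, σ.mem i = s.io i
  arr : ∀ j i, σ.mem (N + 16 * i + j.ctorIdx) = s.a j i
  var_le : ∀ x, s.v x ≤ W
  arr_le : ∀ j i, s.a j i ≤ W
  io_le : ∀ i < N, s.io i ≤ W

/-- Variables live in even registers and the base address in register 1, so the temporaries (odd, at
least 3) are invisible to the simulation. -/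
theorem Sim.of_reg {W N : ℕ} {s : St} {σ σ' : State} (h : Sim W N s σ) (hm : σ'.mem = σ.mem)
    (hr : ∀ r, (∀ d, r ≠ tmp d) → σ'.reg r = σ.reg r) : Sim W N s σ' where
  var x := by rw [hr _ (fun d => by unfold tmp; omega), h.var]
  base := by rw [hr _ (fun d => by unfold tmp; omega), h.base]
  io := by rw [hm]; exact h.io
  arr := by rw [hm]; exact h.arr
  var_le := h.var_le
  arr_le := h.arr_le
  io_le := h.io_le

/-- Only values that are stored are checked against `W`. Intermediate results and array indices may
exceed it, but by no more than a factor that the program text determines; this is why the machine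
words have their own, larger bound. -/
theorem Sim.eval_le {W N : ℕ} {s : St} {σ : State} (h : Sim W N s σ) (hW : 1 ≤ W) (e : Exp) :
    e.eval s ≤ e.size * W := by
  induction e with
  | v x => simpa [Exp.eval, Exp.size] using h.var_le x
  | c n => simp only [Exp.eval, Exp.size]; nlinarith
  | add e f he hf => simp only [Exp.eval, Exp.size]; nlinarith
  | sub e f he hf => simp only [Exp.eval, Exp.size]; nlinarith [Nat.sub_le (e.eval s) (f.eval s)]
  | a j e he => simp only [Exp.eval, Exp.size]; nlinarith [h.arr_le j (e.eval s)]

theorem Sim.chk_le {W N : ℕ} {s : St} {σ : State} (h : Sim W N s σ) (e : Exp)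
    (he : e.chk W s) : e.eval s ≤ W := by
  induction e with
  | v x => exact h.var_le x
  | c n => exact he
  | add e f _ _ => exact he
  | sub e f h1 _ => exact (Nat.sub_le _ _).trans (h1 he)
  | a j e _ => exact h.arr_le _ _

@[simp] theorem tmp_inj {d d' : ℕ} : tmp d = tmp d' ↔ d = d' := by unfold tmp; omega

@[simp] theorem one_ne_tmp {d : ℕ} : 1 ≠ tmp d := by unfold tmp; omega

@[simp] theorem two_mul_ne_tmp {d a : ℕ} : 2 * a ≠ tmp d := by unfold tmp; omega

theorem exec_add {Wr : ℕ} (x y z : ℕ) (σ : State) (a : ℕ) (h : σ.reg y + σ.reg z = a)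
    (ha : a ≤ Wr) : ∃ σ', Exec Wr (.add x y z) σ 1 σ' ∧ σ'.mem = σ.mem ∧ σ'.reg x = a ∧
      ∀ r, r ≠ x → σ'.reg r = σ.reg r := by
  subst h
  exact ⟨_, .add _ _ _ _ ha, rfl, by simp [State.setReg],
    fun r hr => by simp [State.setReg, hr]⟩

theorem exec_addr {N Wr : ℕ} (j : Arr) (d : ℕ) (σ : State) (a : ℕ) (hb : σ.reg 1 = N)
    (ha : σ.reg (tmp d) = a) (hW : N + 16 * a + 16 ≤ Wr) :
    ∃ σ', Exec Wr (addr j d) σ 7 σ' ∧ σ'.mem = σ.mem ∧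
      σ'.reg (tmp d) = N + 16 * a + j.ctorIdx ∧
      ∀ r, (∀ d' ≥ d, r ≠ tmp d') → σ'.reg r = σ.reg r := by
  have hj := j.ctorIdx_lt
  obtain ⟨σ₁, x1, m1, v1, r1⟩ :=
    exec_add (Wr := Wr) (tmp d) (tmp d) (tmp d) σ (2 * a) (by omega) (by omega)
  obtain ⟨σ₂, x2, m2, v2, r2⟩ :=
    exec_add (Wr := Wr) (tmp d) (tmp d) (tmp d) σ₁ (4 * a) (by omega) (by omega)
  obtain ⟨σ₃, x3, m3, v3, r3⟩ :=
    exec_add (Wr := Wr) (tmp d) (tmp d) (tmp d) σ₂ (8 * a) (by omega) (by omega)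
  obtain ⟨σ₄, x4, m4, v4, r4⟩ :=
    exec_add (Wr := Wr) (tmp d) (tmp d) (tmp d) σ₃ (16 * a) (by omega) (by omega)
  have hb4 : σ₄.reg 1 = N := by simp [r4, r3, r2, r1, hb]
  obtain ⟨σ₅, x5, m5, v5, r5⟩ :=
    exec_add (Wr := Wr) (tmp d) (tmp d) 1 σ₄ (N + 16 * a) (by omega) (by omega)
  obtain ⟨σ₇, x7, m7, v7, r7⟩ := exec_add (Wr := Wr) (tmp d) (tmp d) (tmp (d + 1))
    (σ₅.setReg (tmp (d + 1)) j.ctorIdx) (N + 16 * a + j.ctorIdx)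
    (by simp [State.setReg, Function.update_apply, v5]) (by omega)
  refine ⟨σ₇, .seq x1 (.seq x2 (.seq x3 (.seq x4 (.seq x5 (.seq
    (.const _ _ _ (by omega)) x7))))), ?_, v7, fun r hr => ?_⟩
  · rw [m7, State.setReg, m5, m4, m3, m2, m1]
  · have h1 := hr d le_rfl
    have h2 := hr (d + 1) (by omega)
    rw [r7 _ h1]
    simp only [State.setReg, Function.update_apply, h2, if_false]
    rw [r5 _ h1, r4 _ h1, r3 _ h1, r2 _ h1, r1 _ h1]

/-- Evaluation at depth `d` touches temporaries of depth at least `d` only, so a left operand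
survives the evaluation of the right one. The slack 4 in the time bound pays for the instruction
that combines two operands. -/
theorem Exp.exec_comp {W N Wr : ℕ} (hW : 1 ≤ W) {s : St} (e : Exp) (d : ℕ) (σ : State)
    (h : Sim W N s σ) (hr : N + 16 * (e.size * W) + 16 ≤ Wr) :
    ∃ t σ', Exec Wr (e.comp d) σ t σ' ∧ t + 4 ≤ 12 * e.size ∧ σ'.mem = σ.mem ∧
      σ'.reg (tmp d) = e.eval s ∧ ∀ r, (∀ d' ≥ d, r ≠ tmp d') → σ'.reg r = σ.reg r := by
  have hev := h.eval_le hW e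
  induction e generalizing d σ with
  | v x =>
    refine ⟨_, _, .seq (.const _ _ _ (by omega)) (.add _ _ _ _ ?_), ?_, rfl, ?_, ?_⟩
    · simp only [Exp.size, Exp.eval] at *
      simp [State.setReg, h.var x]; omega
    · simp [Exp.size]
    · simp [State.setReg, Function.update_apply, h.var x, Exp.eval]
    · intro r hr
      have h1 := hr d le_rfl
      have h2 := hr (d + 1) (by omega)
      simp [State.setReg, h1, h2]
  | c n =>
    refine ⟨_, _, .const _ _ _ ?_, ?_, rfl, ?_, ?_⟩
    · simp only [Exp.size, Exp.eval] at *
      nlinarith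
    · simp [Exp.size]; omega
    · simp [State.setReg, Exp.eval]
    · intro r hr
      have h1 := hr d le_rfl
      simp [State.setReg, h1]
  | add e f he hf =>
    simp only [Exp.size, add_mul] at hr hev
    obtain ⟨t, σ₁, x1, t1, m1, v1, r1⟩ := he d σ h (by omega) (h.eval_le hW e)
    have S1 : Sim W N s σ₁ := h.of_reg m1 fun r hr => r1 r fun d' _ => hr d'
    obtain ⟨t', σ₂, x2, t2, m2, v2, r2⟩ := hf (d + 1) σ₁ S1 (by omega) (h.eval_le hW f)
    have e1 : σ₂.reg (tmp d) = e.eval s := by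
      rw [r2 _ (fun d' hd' => by simp; omega), v1]
    have h1 := h.eval_le hW e
    have h2 := h.eval_le hW f
    refine ⟨_, _, .seq x1 (.seq x2 (.add _ _ _ _ ?_)), ?_, ?_, ?_, ?_⟩
    · rw [e1, v2]; omega
    · simp only [Exp.size]; omega
    · simp [State.setReg, m1, m2]
    · simp [State.setReg, e1, v2, Exp.eval]
    · intro r hr
      have h1 := hr d le_rfl
      simp only [State.setReg, Function.update_apply, h1, if_false]
      rw [r2 _ fun d' hd' => hr d' (by omega), r1 _ hr]
  | sub e f he hf =>
    simp only [Exp.size, add_mul] at hr hev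
    obtain ⟨t, σ₁, x1, t1, m1, v1, r1⟩ := he d σ h (by omega) (h.eval_le hW e)
    have S1 : Sim W N s σ₁ := h.of_reg m1 fun r hr => r1 r fun d' _ => hr d'
    obtain ⟨t', σ₂, x2, t2, m2, v2, r2⟩ := hf (d + 1) σ₁ S1 (by omega) (h.eval_le hW f)
    have e1 : σ₂.reg (tmp d) = e.eval s := by
      rw [r2 _ (fun d' hd' => by simp; omega), v1]
    refine ⟨_, _, .seq x1 (.seq x2 (.sub _ _ _ _)), ?_, ?_, ?_, ?_⟩
    · simp only [Exp.size]; omega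
    · simp [State.setReg, m1, m2]
    · simp [State.setReg, e1, v2, Exp.eval]
    · intro r hr
      have h1 := hr d le_rfl
      simp only [State.setReg, Function.update_apply, h1, if_false]
      rw [r2 _ fun d' hd' => hr d' (by omega), r1 _ hr]
  | a j e he =>
    simp only [Exp.size, add_mul] at hr hev
    have hle := h.eval_le hW e
    obtain ⟨t, σ₁, x1, t1, m1, v1, r1⟩ := he d σ h (by omega) hle
    have S1 : Sim W N s σ₁ := h.of_reg m1 fun r hr => r1 r fun d' _ => hr d'
    obtain ⟨σ₂, x2, m2, v2, r2⟩ :=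
      exec_addr (Wr := Wr) j d σ₁ (e.eval s) S1.base v1 (by omega)
    refine ⟨_, _, .seq x1 (.seq x2 (.load _ _ _)), ?_, ?_, ?_, ?_⟩
    · simp only [Exp.size]; omega
    · simp [State.setReg, m2, m1]
    · simp [State.setReg, Exp.eval, v2, m2, S1.arr]
    · intro r hr
      have h1 := hr d le_rfl
      simp only [State.setReg, Function.update_apply, h1, if_false]
      rw [r2 r hr, r1 r hr]

/-- Two expressions are evaluated side by side, for the tests of branches and loops and for writing
to the output region. The slack 8 leaves room for the instruction that follows. -/
theorem Cmd.exec_test {W N Wr Z : ℕ} (hW : 1 ≤ W) (hr : N + 16 * (Z * W) + 16 ≤ Wr) {s : St}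
    {σ : State} (h : Sim W N s σ) (e f : Exp) (he : e.size ≤ Z) (hf : f.size ≤ Z) :
    ∃ t σ', Exec Wr (.seq (e.comp 0) (f.comp 1)) σ t σ' ∧ t + 8 ≤ 24 * Z ∧ σ'.mem = σ.mem ∧
      σ'.reg (tmp 0) = e.eval s ∧ σ'.reg (tmp 1) = f.eval s ∧ Sim W N s σ' := by
  have h1 := Nat.mul_le_mul_right W he
  have h2 := Nat.mul_le_mul_right W hf
  obtain ⟨t, σ₁, x1, t1, m1, v1, r1⟩ := e.exec_comp (Wr := Wr) hW 0 σ h (by omega)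
  have S1 : Sim W N s σ₁ := h.of_reg m1 fun r hr => r1 r fun d' _ => hr d'
  obtain ⟨t', σ₂, x2, t2, m2, v2, r2⟩ := f.exec_comp (Wr := Wr) hW 1 σ₁ S1 (by omega)
  refine ⟨_, _, .seq x1 x2, by omega, by rw [m2, m1], ?_, v2,
    S1.of_reg m2 fun r hr => r2 r fun d' _ => hr d'⟩
  rw [r2 _ (fun d' hd' => by simp; omega), v1]

theorem Sim.setV {W N : ℕ} {s : St} {σ : State} (h : Sim W N s σ) (x : Var) (a : ℕ)
    (ha : a ≤ W) : Sim W N (s.setV x a) (σ.setReg (2 * x.ctorIdx) a) where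
  var y := by
    by_cases hy : y = x
    · subst hy; simp [State.setReg, St.setV]
    · have : y.ctorIdx ≠ x.ctorIdx := fun h => hy (Var.ctorIdx_injective h)
      simp [State.setReg, St.setV, Function.update_apply, hy, this, h.var]
  base := by
    have : 1 ≠ 2 * x.ctorIdx := by omega
    simp [State.setReg, Function.update_apply, this, h.base]
  io := h.io
  arr := h.arr
  var_le y := by
    by_cases hy : y = x
    · subst hy; simpa [St.setV]
    · simpa [St.setV, Function.update_apply, hy] using h.var_le y
  arr_le := h.arr_le
  io_le := h.io_le

theorem Sim.setA {W N : ℕ} {s : St} {σ : State} (h : Sim W N s σ) (j : Arr) (i a : ℕ)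
    (ha : a ≤ W) : Sim W N (s.setA j i a) (σ.setMem (N + 16 * i + j.ctorIdx) a) where
  var := h.var
  base := h.base
  io i' hi' := by
    have : i' ≠ N + 16 * i + j.ctorIdx := by omega
    simp [State.setMem, Function.update_apply, this, h.io i' hi', St.setA]
  arr j' i' := by
    have hj := j.ctorIdx_lt
    have hj' := j'.ctorIdx_lt
    by_cases hjj : j' = j
    · subst hjj
      by_cases hi : i' = i
      · subst hi; simp [State.setMem, St.setA]
      · have : N + 16 * i' + j'.ctorIdx ≠ N + 16 * i + j'.ctorIdx := by omega
        simp [State.setMem, St.setA, Function.update_apply, hi, h.arr]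
    · have h1 : j'.ctorIdx ≠ j.ctorIdx := fun h => hjj (Arr.ctorIdx_injective h)
      have : N + 16 * i' + j'.ctorIdx ≠ N + 16 * i + j.ctorIdx := by omega
      simp [State.setMem, St.setA, Function.update_apply, hjj, this, h.arr]
  var_le := h.var_le
  arr_le j' i' := by
    by_cases hjj : j' = j
    · subst hjj
      by_cases hi : i' = i
      · subst hi; simpa [St.setA]
      · simpa [St.setA, Function.update_apply, hi] using h.arr_le j' i'
    · simpa [St.setA, Function.update_apply, hjj] using h.arr_le j' i'
  io_le := h.io_le

theorem Sim.setCell {W N : ℕ} {s : St} {σ : State} (h : Sim W N s σ) (i a : ℕ) (hi : i < N)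
    (ha : a ≤ W) : Sim W N (s.setCell i a) (σ.setMem i a) where
  var := h.var
  base := h.base
  io i' hi' := by
    by_cases hii : i' = i
    · subst hii; simp [State.setMem, St.setCell]
    · simp [State.setMem, Function.update_apply, hii, h.io i' hi', St.setCell]
  arr j' i' := by
    have : N + 16 * i' + j'.ctorIdx ≠ i := by omega
    simp [State.setMem, St.setCell, Function.update_apply, this, h.arr]
  var_le := h.var_le
  arr_le := h.arr_le
  io_le i' hi' := by
    by_cases hii : i' = i
    · subst hii; simpa [St.setCell]
    · simpa [St.setCell, Function.update_apply, hii] using h.io_le i' hi'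

/-- The compiled program simulates the command. -/
theorem CExec.sim {W N Wr Z : ℕ} (hW : 1 ≤ W) (hr : N + 16 * (Z * W) + 16 ≤ Wr) {c : Cmd}
    {s s' : St} {t : ℕ} (hx : CExec W N c s t s') (hc : c.size ≤ Z) (σ : State)
    (h : Sim W N s σ) :
    ∃ t' σ', Exec Wr c.comp σ t' σ' ∧ t' ≤ 24 * Z * t ∧ Sim W N s' σ' := by
  induction hx generalizing σ with
  | skip s =>
    simp only [Cmd.size] at hc
    exact ⟨_, _, .skip _, by omega, h⟩
  | set x e s he =>
    simp only [Cmd.size] at hc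
    have h1 := Nat.mul_le_mul_right W hc
    obtain ⟨t, σ₁, x1, t1, m1, v1, r1⟩ := e.exec_comp (Wr := Wr) hW 0 σ h (by omega)
    have S1 : Sim W N s σ₁ := h.of_reg m1 fun r hr => r1 r fun d' _ => hr d'
    have S2 : Sim W N s (σ₁.setReg (tmp 1) 0) :=
      S1.of_reg rfl fun r hr => by simp [State.setReg, Function.update_apply, hr 1]
    have hle := h.chk_le e he
    have hv : (σ₁.setReg (tmp 1) 0).reg (tmp 0) + (σ₁.setReg (tmp 1) 0).reg (tmp 1)
        = e.eval s := by
      simp [State.setReg, Function.update_apply, v1]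
    have S3 := S2.setV x (e.eval s) hle
    have hZ : e.eval s ≤ Wr := by have := h.eval_le hW e; omega
    have e1 := Exec.add (W := Wr) (2 * x.ctorIdx) (tmp 0) (tmp 1) (σ₁.setReg (tmp 1) 0)
      (by rw [hv]; exact hZ)
    rw [hv] at e1
    exact ⟨_, _, .seq x1 (.seq (.const _ _ _ (by omega)) e1), by omega, S3⟩
  | put j i e s he =>
    simp only [Cmd.size, max_le_iff] at hc
    have h1 := Nat.mul_le_mul_right W hc.1
    have h2 := Nat.mul_le_mul_right W hc.2
    have hi := h.eval_le hW i
    obtain ⟨t, σ₁, x1, t1, m1, v1, r1⟩ := i.exec_comp (Wr := Wr) hW 0 σ h (by omega)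
    have S1 : Sim W N s σ₁ := h.of_reg m1 fun r hr => r1 r fun d' _ => hr d'
    obtain ⟨σ₂, x2, m2, v2, r2⟩ :=
      exec_addr (Wr := Wr) j 0 σ₁ (i.eval s) S1.base v1 (by omega)
    have S2 : Sim W N s σ₂ := S1.of_reg m2 fun r hr => r2 r fun d' _ => hr d'
    obtain ⟨t3, σ₃, x3, t3', m3, v3, r3⟩ := e.exec_comp (Wr := Wr) hW 1 σ₂ S2 (by omega)
    have S3 : Sim W N s σ₃ := S2.of_reg m3 fun r hr => r3 r fun d' _ => hr d'
    have S4 := S3.setA j (i.eval s) (e.eval s) (h.chk_le e he)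
    have e4 := Exec.store (W := Wr) (tmp 0) (tmp 1) σ₃
    rw [v3, r3 _ (fun d' hd' => by simp; omega), v2] at e4
    exact ⟨_, _, .seq x1 (.seq x2 (.seq x3 e4)), by omega, S4⟩
  | get x e s he =>
    simp only [Cmd.size] at hc
    have h1 := Nat.mul_le_mul_right W hc
    obtain ⟨t, σ₁, x1, t1, m1, v1, r1⟩ := e.exec_comp (Wr := Wr) hW 0 σ h (by omega)
    have S1 : Sim W N s σ₁ := h.of_reg m1 fun r hr => r1 r fun d' _ => hr d'
    have S2 := S1.setV x (s.io (e.eval s)) (h.io_le _ he)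
    have e2 := Exec.load (W := Wr) (2 * x.ctorIdx) (tmp 0) σ₁
    rw [v1, S1.io _ he] at e2
    exact ⟨_, _, .seq x1 e2, by omega, S2⟩
  | wr i e s hi he =>
    simp only [Cmd.size, max_le_iff] at hc
    obtain ⟨t, σ₁, x1, t1, m1, v1, w1, S1⟩ := Cmd.exec_test hW hr h i e hc.1 hc.2
    have S2 := S1.setCell (i.eval s) (e.eval s) hi (h.chk_le e he)
    have e4 := Exec.store (W := Wr) (tmp 0) (tmp 1) σ₁
    rw [v1, w1] at e4
    cases x1 with
    | seq x1 x2 => exact ⟨_, _, .seq x1 (.seq x2 e4), by omega, S2⟩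
  | seq h1 h2 ih1 ih2 =>
    simp only [Cmd.size, max_le_iff] at hc
    obtain ⟨t1, σ₁, x1, t1', S1⟩ := ih1 hc.1 σ h
    obtain ⟨t2, σ₂, x2, t2', S2⟩ := ih2 hc.2 σ₁ S1
    exact ⟨_, _, .seq x1 x2, by rw [Nat.mul_add]; omega, S2⟩
  | ite_true hlt _ ih =>
    simp only [Cmd.size, max_le_iff] at hc
    obtain ⟨t1, σ₁, x1, t1', m1, v1, w1, S1⟩ := Cmd.exec_test hW hr h _ _ hc.1.1 hc.1.2
    obtain ⟨t2, σ₂, x2, t2', S2⟩ := ih hc.2.1 σ₁ S1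
    exact ⟨_, _, .seq x1 (.ite_true (by rw [v1, w1]; exact hlt) x2),
      by rw [Nat.mul_add]; omega, S2⟩
  | ite_false hlt _ ih =>
    simp only [Cmd.size, max_le_iff] at hc
    obtain ⟨t1, σ₁, x1, t1', m1, v1, w1, S1⟩ := Cmd.exec_test hW hr h _ _ hc.1.1 hc.1.2
    obtain ⟨t2, σ₂, x2, t2', S2⟩ := ih hc.2.2 σ₁ S1
    exact ⟨_, _, .seq x1 (.ite_false (by rw [v1, w1]; exact hlt) x2),
      by rw [Nat.mul_add]; omega, S2⟩
  | while_true hlt _ _ ih1 ih2 =>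
    have hc' := hc
    simp only [Cmd.size, max_le_iff] at hc
    obtain ⟨t1, σ₁, x1, t1', m1, v1, w1, S1⟩ := Cmd.exec_test hW hr h _ _ hc.1.1 hc.1.2
    obtain ⟨t2, σ₂, x2, t2', S2⟩ := ih1 hc.2 σ₁ S1
    obtain ⟨t3, σ₃, x3, t3', S3⟩ := ih2 hc' σ₂ S2
    -- The compiled loop evaluates its test once in front and again at the end of each pass. The
    -- front test of the remaining loop is therefore split off and becomes the end of the present
    -- pass.
    cases x3 with
    | seq x3 x4 =>
      refine ⟨_, _, .seq x1 (.while_true (by rw [v1, w1]; exact hlt) (.seq x2 x3) x4), ?_, S3⟩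
      simp only [Nat.mul_add]; omega
  | while_false hlt =>
    simp only [Cmd.size, max_le_iff] at hc
    obtain ⟨t1, σ₁, x1, t1', m1, v1, w1, S1⟩ := Cmd.exec_test hW hr h _ _ hc.1.1 hc.1.2
    exact ⟨_, _, .seq x1 (.while_false (by rw [v1, w1]; exact hlt)), by omega, S1⟩

/-! ### Weakest preconditions -/

infixr:60 " ;; " => Cmd.seq

@[simp] theorem St.setV_v (s : St) (x y : Var) (a : ℕ) :
    (s.setV x a).v y = if y = x then a else s.v y := Function.update_apply ..

@[simp] theorem St.setV_a (s : St) (x : Var) (a : ℕ) : (s.setV x a).a = s.a := rfl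

@[simp] theorem St.setV_io (s : St) (x : Var) (a : ℕ) : (s.setV x a).io = s.io := rfl

@[simp] theorem St.setA_v (s : St) (j : Arr) (i a : ℕ) : (s.setA j i a).v = s.v := rfl

@[simp] theorem St.setA_a (s : St) (j j' : Arr) (i a : ℕ) :
    (s.setA j i a).a j' = if j' = j then Function.update (s.a j) i a else s.a j' := by
  simp only [St.setA, Function.update_apply]

@[simp] theorem St.setA_io (s : St) (j : Arr) (i a : ℕ) : (s.setA j i a).io = s.io := rfl

@[simp] theorem St.setCell_v (s : St) (i a : ℕ) : (s.setCell i a).v = s.v := rfl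

@[simp] theorem St.setCell_a (s : St) (i a : ℕ) : (s.setCell i a).a = s.a := rfl

@[simp] theorem St.setCell_io (s : St) (i a : ℕ) :
    (s.setCell i a).io = Function.update s.io i a := rfl

attribute [simp] Exp.eval Exp.chk

section
variable {W N : ℕ}

/-- The command halts, and the running time and the final state satisfy `Q`. -/
def wp (W N : ℕ) (c : Cmd) (s : St) (Q : ℕ → St → Prop) : Prop :=
  ∃ t s', CExec W N c s t s' ∧ Q t s'

theorem wp_mono {c : Cmd} {s : St} {Q Q' : ℕ → St → Prop} (h : wp W N c s Q)
    (hQ : ∀ t s', Q t s' → Q' t s') : wp W N c s Q' := by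
  obtain ⟨t, s', hx, hq⟩ := h
  exact ⟨t, s', hx, hQ _ _ hq⟩

@[simp] theorem wp_skip {s : St} {Q : ℕ → St → Prop} : wp W N .skip s Q ↔ Q 1 s :=
  ⟨fun ⟨_, _, h, hq⟩ => by cases h; exact hq, fun h => ⟨_, _, .skip _, h⟩⟩

@[simp] theorem wp_set {x : Var} {e : Exp} {s : St} {Q : ℕ → St → Prop} :
    wp W N (.set x e) s Q ↔ e.chk W s ∧ Q 1 (s.setV x (e.eval s)) :=
  ⟨fun ⟨_, _, h, hq⟩ => by cases h; exact ⟨‹_›, hq⟩, fun h => ⟨_, _, .set _ _ _ h.1, h.2⟩⟩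

@[simp] theorem wp_put {j : Arr} {i e : Exp} {s : St} {Q : ℕ → St → Prop} :
    wp W N (.put j i e) s Q ↔ e.chk W s ∧ Q 1 (s.setA j (i.eval s) (e.eval s)) :=
  ⟨fun ⟨_, _, h, hq⟩ => by cases h; exact ⟨‹_›, hq⟩, fun h => ⟨_, _, .put _ _ _ _ h.1, h.2⟩⟩

@[simp] theorem wp_get {x : Var} {e : Exp} {s : St} {Q : ℕ → St → Prop} :
    wp W N (.get x e) s Q ↔ e.eval s < N ∧ Q 1 (s.setV x (s.io (e.eval s))) :=
  ⟨fun ⟨_, _, h, hq⟩ => by cases h; exact ⟨‹_›, hq⟩, fun h => ⟨_, _, .get _ _ _ h.1, h.2⟩⟩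

@[simp] theorem wp_wr {i e : Exp} {s : St} {Q : ℕ → St → Prop} :
    wp W N (.wr i e) s Q ↔
      i.eval s < N ∧ e.chk W s ∧ Q 1 (s.setCell (i.eval s) (e.eval s)) :=
  ⟨fun ⟨_, _, h, hq⟩ => by cases h; exact ⟨‹_›, ‹_›, hq⟩,
    fun h => ⟨_, _, .wr _ _ _ h.1 h.2.1, h.2.2⟩⟩

@[simp] theorem wp_seq {p q : Cmd} {s : St} {Q : ℕ → St → Prop} :
    wp W N (p ;; q) s Q ↔ wp W N p s fun t s' => wp W N q s' fun t' s'' => Q (t + t') s'' :=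
  ⟨fun ⟨_, _, h, hq⟩ => by
    cases h with
    | seq h1 h2 => exact ⟨_, _, h1, _, _, h2, hq⟩,
    fun ⟨_, _, h1, _, _, h2, hq⟩ => ⟨_, _, .seq h1 h2, hq⟩⟩

@[simp] theorem wp_ite {e f : Exp} {p q : Cmd} {s : St} {Q : ℕ → St → Prop} :
    wp W N (.ite e f p q) s Q ↔ (e.eval s < f.eval s → wp W N p s fun t => Q (t + 1)) ∧
      (¬ e.eval s < f.eval s → wp W N q s fun t => Q (t + 1)) := by
  constructor
  · rintro ⟨_, _, h, hq⟩
    cases h with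
    | ite_true hl h => exact ⟨fun _ => ⟨_, _, h, hq⟩, fun hn => absurd hl hn⟩
    | ite_false hl h => exact ⟨fun hn => absurd hn hl, fun _ => ⟨_, _, h, hq⟩⟩
  · intro ⟨h1, h2⟩
    by_cases hl : e.eval s < f.eval s
    · obtain ⟨_, _, h, hq⟩ := h1 hl
      exact ⟨_, _, .ite_true hl h, hq⟩
    · obtain ⟨_, _, h, hq⟩ := h2 hl
      exact ⟨_, _, .ite_false hl h, hq⟩

/-- The rule for loops: `I` is an invariant and `Φ` bounds the remaining running time. -/
theorem wp_while {e f : Exp} {p : Cmd} (I : St → Prop) (Φ : St → ℕ) {s : St} (hI : I s)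
    (step : ∀ s, I s → e.eval s < f.eval s →
      wp W N p s fun t s' => I s' ∧ t + 1 + Φ s' ≤ Φ s) :
    wp W N (.while e f p) s fun t s' => t ≤ Φ s + 1 ∧ I s' ∧ ¬ e.eval s' < f.eval s' := by
  induction h : Φ s using Nat.strong_induction_on generalizing s with
  | _ m ih =>
    by_cases hl : e.eval s < f.eval s
    · obtain ⟨t, s', hx, hI', ht⟩ := step s hI hl
      obtain ⟨t', s'', hx', ht', hI'', hn⟩ := ih (Φ s') (by omega) hI' rfl
      exact ⟨_, _, .while_true hl hx hx', by omega, hI'', hn⟩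
    · exact ⟨_, _, .while_false hl, by omega, hI, hl⟩

/-! ### Frames -/

/-- The variables that may be assigned. -/
def Cmd.wv : Cmd → List Var
  | .skip | .put .. | .wr .. => []
  | .set x _ | .get x _ => [x]
  | .seq p q | .ite _ _ p q => p.wv ++ q.wv
  | .while _ _ p => p.wv

/-- The arrays that may be modified. -/
def Cmd.wa : Cmd → List Arr
  | .skip | .set .. | .get .. | .wr .. => []
  | .put j _ _ => [j]
  | .seq p q | .ite _ _ p q => p.wa ++ q.wa
  | .while _ _ p => p.wa

/-- May the output region be modified? -/
def Cmd.wio : Cmd → Bool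
  | .skip | .set .. | .get .. | .put .. => false
  | .wr .. => true
  | .seq p q | .ite _ _ p q => p.wio || q.wio
  | .while _ _ p => p.wio

/-- `s'` agrees with `s` except for the targets of assignments in `c`. -/
structure Keeps (c : Cmd) (s s' : St) : Prop where
  v : ∀ x, x ∉ c.wv → s'.v x = s.v x
  a : ∀ j, j ∉ c.wa → s'.a j = s.a j
  io : c.wio = false → s'.io = s.io

theorem CExec.keeps {c : Cmd} {s s' : St} {t : ℕ} (h : CExec W N c s t s') : Keeps c s s' := by
  induction h with
  | skip s => exact ⟨fun _ _ => rfl, fun _ _ => rfl, fun _ => rfl⟩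
  | set x e s _ =>
    exact ⟨fun y hy => by simp_all [Cmd.wv], fun _ _ => rfl, fun _ => rfl⟩
  | put j i e s _ =>
    exact ⟨fun _ _ => rfl, fun y hy => by simp_all [Cmd.wa], fun _ => rfl⟩
  | get x e s _ =>
    exact ⟨fun y hy => by simp_all [Cmd.wv], fun _ _ => rfl, fun _ => rfl⟩
  | wr i e s _ _ => exact ⟨fun _ _ => rfl, fun _ _ => rfl, fun h => by simp [Cmd.wio] at h⟩
  | seq _ _ h1 h2 =>
    refine ⟨fun x hx => ?_, fun j hj => ?_, fun hio => ?_⟩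
    · simp only [Cmd.wv, List.mem_append, not_or] at hx; rw [h2.v x hx.2, h1.v x hx.1]
    · simp only [Cmd.wa, List.mem_append, not_or] at hj; rw [h2.a j hj.2, h1.a j hj.1]
    · simp only [Cmd.wio, Bool.or_eq_false_iff] at hio; rw [h2.io hio.2, h1.io hio.1]
  | ite_true _ _ h1 =>
    refine ⟨fun x hx => ?_, fun j hj => ?_, fun hio => ?_⟩
    · simp only [Cmd.wv, List.mem_append, not_or] at hx; rw [h1.v x hx.1]
    · simp only [Cmd.wa, List.mem_append, not_or] at hj; rw [h1.a j hj.1]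
    · simp only [Cmd.wio, Bool.or_eq_false_iff] at hio; rw [h1.io hio.1]
  | ite_false _ _ h1 =>
    refine ⟨fun x hx => ?_, fun j hj => ?_, fun hio => ?_⟩
    · simp only [Cmd.wv, List.mem_append, not_or] at hx; rw [h1.v x hx.2]
    · simp only [Cmd.wa, List.mem_append, not_or] at hj; rw [h1.a j hj.2]
    · simp only [Cmd.wio, Bool.or_eq_false_iff] at hio; rw [h1.io hio.2]
  | while_true _ _ _ h1 h2 =>
    exact ⟨fun x hx => by rw [h2.v x hx, h1.v x hx], fun j hj => by rw [h2.a j hj, h1.a j hj],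
      fun hio => by rw [h2.io hio, h1.io hio]⟩
  | while_false _ => exact ⟨fun _ _ => rfl, fun _ _ => rfl, fun _ => rfl⟩

/-- Specifications mention only what a command computes. What it leaves alone is read off its text,
so that the side conditions can usually be settled by `decide`. -/
theorem wp_frame {c : Cmd} {s : St} {Q : ℕ → St → Prop} (h : wp W N c s Q) :
    wp W N c s fun t s' => Q t s' ∧ Keeps c s s' := by
  obtain ⟨t, s', hx, hq⟩ := h
  exact ⟨t, s', hx, hq, hx.keeps⟩

/-! ### Counting loops -/

def inc (x : Var) : Cmd := .set x (.add (.v x) (.c 1))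

/-- Run the body while `i < e`, increasing `i` each time. -/
def loop (i : Var) (e : Exp) (body : Cmd) : Cmd := .while (.v i) e (body ;; inc i)

/-- Run the body for `i = 0, 1, …` while `i < e`. -/
def forTo (i : Var) (e : Exp) (body : Cmd) : Cmd := .set i (.c 0) ;; loop i e body

/-- The potential is the sum of `f j + 2` over the passes still to come; the 2 accounts for the
increment and the test. The upper limit is re-evaluated in each pass, so the invariant has to
determine its value. -/
theorem wp_loop {i : Var} {e : Exp} {body : Cmd} {s : St} (a len : ℕ) (I : ℕ → St → Prop)
    (f : ℕ → ℕ) (hW : a + len ≤ W) (hi : i ∉ body.wv) (hs : s.v i = a) (hI : I 0 s)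
    (he : ∀ j s, I j s → e.eval s = a + len)
    (step : ∀ j s, j < len → I j s → s.v i = a + j →
      wp W N body s fun t s' => t ≤ f j ∧ I (j + 1) (s'.setV i (a + j + 1))) :
    wp W N (loop i e body) s fun t s' =>
      t ≤ ∑ j ∈ Finset.range len, (f j + 2) + 1 ∧ I len s' ∧ s'.v i = a + len := by
  have hbig := wp_while (W := W) (N := N) (e := .v i) (f := e) (p := body ;; inc i) (s := s)
    (fun s => ∃ j ≤ len, s.v i = a + j ∧ I j s)
    (fun s => ∑ j ∈ Finset.Ico (s.v i - a) len, (f j + 2)) ⟨0, by omega, hs, hI⟩ ?_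
  · refine wp_mono hbig fun t s' ⟨ht, ⟨j, hj, hj', hI'⟩, hn⟩ => ?_
    have h1 := he _ _ hI'
    simp only [Exp.eval, h1, hj'] at hn
    have : j = len := by omega
    subst this
    refine ⟨?_, hI', hj'⟩
    rwa [hs, Nat.sub_self, ← Finset.range_eq_Ico] at ht
  · rintro s ⟨j, hj, hj', hI'⟩ hlt
    have h1 := he _ _ hI'
    simp only [Exp.eval, h1, hj'] at hlt
    rw [wp_seq]
    refine wp_mono (wp_frame (step j s (by omega) hI' hj')) fun t s' ⟨⟨ht, hI''⟩, hk⟩ => ?_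
    have h2 : s'.v i = a + j := by rw [hk.v i hi, hj']
    simp only [inc, wp_set, Exp.chk, Exp.eval, h2, St.setV_v, if_true]
    refine ⟨by omega, ⟨j + 1, by omega, by omega, hI''⟩, ?_⟩
    have h3 : a + j + 1 - a = j + 1 := by omega
    have h4 : s.v i - a = j := by omega
    rw [h3, h4, Finset.sum_eq_sum_Ico_succ_bot (by omega : j < len)]
    omega

theorem wp_forTo {i : Var} {e : Exp} {body : Cmd} {s : St} (len : ℕ) (I : ℕ → St → Prop)
    (f : ℕ → ℕ) (hW : len ≤ W) (hi : i ∉ body.wv) (hI : I 0 (s.setV i 0))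
    (he : ∀ j s, I j s → e.eval s = len)
    (step : ∀ j s, j < len → I j s → s.v i = j →
      wp W N body s fun t s' => t ≤ f j ∧ I (j + 1) (s'.setV i (j + 1))) :
    wp W N (forTo i e body) s fun t s' =>
      t ≤ ∑ j ∈ Finset.range len, (f j + 2) + 2 ∧ I len s' ∧ s'.v i = len := by
  simp only [forTo, wp_seq, wp_set, Exp.chk, Exp.eval]
  refine ⟨Nat.zero_le _, wp_mono (wp_loop 0 len I f (by omega) hi (by simp) hI
    (by simpa using he) ?_) fun t s' ⟨h1, h2, h3⟩ => ⟨by omega, h2, by omega⟩⟩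
  simpa using step

/-- The rule for a loop whose body takes bounded time. -/
theorem wp_forTo_const {i : Var} {e : Exp} {body : Cmd} {s : St} (len F : ℕ)
    (I : ℕ → St → Prop) (hW : len ≤ W) (hi : i ∉ body.wv) (hI : I 0 (s.setV i 0))
    (he : ∀ j s, I j s → e.eval s = len)
    (step : ∀ j s, j < len → I j s → s.v i = j →
      wp W N body s fun t s' => t ≤ F ∧ I (j + 1) (s'.setV i (j + 1))) :
    wp W N (forTo i e body) s fun t s' =>
      t ≤ len * (F + 2) + 2 ∧ I len s' ∧ s'.v i = len := by
  simpa using wp_forTo (N := N) len I (fun _ => F) hW hi hI he step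

end

/-! ### Chordless cycles -/

section Graph
variable {V : Type*} {G H : SimpleGraph V}

/-- `a` is neither `x` nor a neighbour of `x`. -/
def Far (G : SimpleGraph V) (x a : V) : Prop := a ≠ x ∧ ¬ G.Adj x a

/-- Adjacency in the graph without the closed neighbourhood of `x`. -/
def FarAdj (G : SimpleGraph V) (x a b : V) : Prop := G.Adj a b ∧ Far G x a ∧ Far G x b

/-- Connectedness in the graph without the closed neighbourhood of `x`. -/
abbrev Linked (G : SimpleGraph V) (x : V) : V → V → Prop := Relation.ReflTransGen (FarAdj G x)

/-- There is a chordless cycle of length at least four in which `y, x, z` are consecutive. -/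
def Hit (G : SimpleGraph V) (x y z : V) : Prop :=
  G.Adj x y ∧ G.Adj x z ∧ y ≠ z ∧ ¬ G.Adj y z ∧
    ∃ c d, Far G x c ∧ G.Adj y c ∧ Linked G x c d ∧ G.Adj d z

/-- The vertices `f 0, …, f (l - 1)` form an induced cycle of length at least four. -/
structure IndCyc (G : SimpleGraph V) (l : ℕ) (f : ℕ → V) : Prop where
  four_le : 4 ≤ l
  ne : ∀ i j, i < j → j < l → f i ≠ f j
  adj : ∀ i j, i < j → j < l → (G.Adj (f i) (f j) ↔ j = i + 1 ∨ (i = 0 ∧ j + 1 = l))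

theorem FarAdj.symm {x a b : V} (h : FarAdj G x a b) : FarAdj G x b a :=
  ⟨h.1.symm, h.2.2, h.2.1⟩

theorem Linked.symm {x a b : V} (h : Linked G x a b) : Linked G x b a :=
  haveI : Std.Symm (FarAdj G x) := ⟨fun _ _ h => h.symm⟩
  Std.Symm.symm _ _ h

theorem Linked.far {x a b : V} (h : Linked G x a b) (ha : Far G x a) : Far G x b := by
  induction h with
  | refl => exact ha
  | tail _ h _ => exact h.2.2

theorem Hit.symm {x y z : V} (h : Hit G x y z) : Hit G x z y := by
  obtain ⟨h1, h2, h3, h4, c, d, hc, hyc, hcd, hdz⟩ := h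
  exact ⟨h2, h1, h3.symm, fun h => h4 h.symm, d, c, hcd.far hc, hdz.symm, hcd.symm, hyc.symm⟩

/-- Allows any vertex of a cycle to be taken as its first one; indices are reduced by a case
distinction so that `omega` can follow. -/
theorem IndCyc.rotate {l : ℕ} {f : ℕ → V} (h : IndCyc G l f) {a : ℕ} (ha : a < l) :
    IndCyc G l fun i => if i + a < l then f (i + a) else f (i + a - l) where
  four_le := h.four_le
  ne i j hij hj := by
    split_ifs
    · exact h.ne _ _ (by omega) (by omega)
    · exact (h.ne _ _ (by omega) (by omega)).symm
    · omega
    · exact h.ne _ _ (by omega) (by omega)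
  adj i j hij hj := by
    have := h.four_le
    split_ifs
    · rw [h.adj _ _ (by omega) (by omega)]; omega
    · rw [G.adj_comm, h.adj _ _ (by omega) (by omega)]; omega
    · omega
    · rw [h.adj _ _ (by omega) (by omega)]; omega

/-- The vertices `f 2, …, f (l - 2)` are far from `f 0` and form the required path; `4 ≤ l` makes
this stretch nonempty. -/
theorem IndCyc.hit_zero {l : ℕ} {f : ℕ → V} (h : IndCyc G l f) :
    Hit G (f 0) (f 1) (f (l - 1)) := by
  have h4 := h.four_le
  have hfar : ∀ i, 2 ≤ i → i + 2 ≤ l → Far G (f 0) (f i) := fun i h2 hi =>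
    ⟨(h.ne 0 i (by omega) (by omega)).symm, by rw [h.adj 0 i (by omega) (by omega)]; omega⟩
  refine ⟨?_, ?_, h.ne _ _ (by omega) (by omega), ?_, f 2, f (l - 2), hfar 2 le_rfl (by omega),
    ?_, ?_, ?_⟩
  · rw [h.adj _ _ (by omega) (by omega)]; omega
  · rw [h.adj _ _ (by omega) (by omega)]; omega
  · rw [h.adj _ _ (by omega) (by omega)]; omega
  · rw [h.adj _ _ (by omega) (by omega)]; omega
  · have : ∀ k, 2 + k + 2 ≤ l → Linked G (f 0) (f 2) (f (2 + k)) := by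
      intro k
      induction k with
      | zero => intro _; exact .refl
      | succ k ih =>
        intro hk
        refine (ih (by omega)).tail ⟨?_, hfar _ (by omega) (by omega),
          hfar _ (by omega) (by omega)⟩
        rw [h.adj _ _ (by omega) (by omega)]; omega
    have h2 := this (l - 4) (by omega)
    rwa [show 2 + (l - 4) = l - 2 by omega] at h2
  · rw [h.adj _ _ (by omega) (by omega)]; omega

theorem IndCyc.hit {l : ℕ} {f : ℕ → V} (h : IndCyc G l f) {i : ℕ} (hi : i + 2 < l) :
    Hit G (f (i + 1)) (f (i + 2)) (f i) := by
  have h4 := h.four_le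
  have := (h.rotate (by omega : i + 1 < l)).hit_zero
  simp only [zero_add] at this
  rwa [if_pos (by omega), if_pos (by omega), if_neg (by omega),
    show 1 + (i + 1) = i + 2 by omega, show l - 1 + (i + 1) - l = i by omega] at this

/-- A path of length `r` from `y` to `z` whose inner vertices are far from `x`. -/
structure FarPath (G : SimpleGraph V) (x y z : V) (r : ℕ) (p : ℕ → V) : Prop where
  zero : p 0 = y
  last : p r = z
  adj : ∀ i < r, G.Adj (p i) (p (i + 1))
  far : ∀ i, 0 < i → i < r → Far G x (p i)

theorem FarPath.snoc {x y z w : V} {r : ℕ} {p : ℕ → V} (h : FarPath G x y z r p)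
    (hz : 0 < r → Far G x z) (hw : G.Adj z w) :
    FarPath G x y w (r + 1) fun i => if i ≤ r then p i else w where
  zero := by simp [h.zero]
  last := by simp
  adj i hi := by
    by_cases hir : i = r
    · subst hir; simpa [h.last] using hw
    · have h1 : i ≤ r := by omega
      have h2 : i + 1 ≤ r := by omega
      simpa [h1, h2] using h.adj i (by omega)
  far i h0 hi := by
    have h1 : i ≤ r := by omega
    simp only [h1, if_true]
    by_cases hir : i = r
    · subst hir; rw [h.last]; exact hz h0
    · exact h.far i h0 (by omega)

/-- A shortest path from `y` to `z` with inner vertices far from `x` is induced. It has length at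
least two because `y` and `z` are distinct and nonadjacent, so `x` closes it to a chordless cycle.
-/
theorem Hit.exists_indCyc {x y z : V} (h : Hit G x y z) :
    ∃ l f, IndCyc G l f ∧ f 0 = x ∧ f 1 = y ∧ f (l - 1) = z := by
  classical
  obtain ⟨hxy, hxz, hne, hnadj, c, d, hc, hyc, hcd, hdz⟩ := h
  have hpath : ∃ r p, FarPath G x y z r p := by
    have : ∃ r p, 0 < r ∧ FarPath G x y d r p := by
      clear hdz
      induction hcd with
      | refl =>
        have h0 : FarPath G x y y 0 fun _ => y :=
          ⟨rfl, rfl, fun i hi => by omega, fun i _ hi => by omega⟩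
        exact ⟨_, _, by omega, h0.snoc (by omega) hyc⟩
      | tail _ hab ih =>
        obtain ⟨r, p, hr, hp⟩ := ih
        exact ⟨_, _, by omega, hp.snoc (fun _ => hab.2.1) hab.1⟩
    obtain ⟨r, p, hr, hp⟩ := this
    exact ⟨_, _, hp.snoc (fun _ => hcd.far hc) hdz⟩
  obtain ⟨p, hp⟩ := Nat.find_spec hpath
  have hmin : ∀ r' p', FarPath G x y z r' p' → Nat.find hpath ≤ r' :=
    fun r' p' h => Nat.find_min' hpath ⟨p', h⟩
  generalize Nat.find hpath = r at hp hmin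
  -- A repeated vertex would allow the part between its two occurrences to be cut out.
  have hpne : ∀ i j, i < j → j ≤ r → p i ≠ p j := by
    intro i j hij hj he
    have := hmin (r - (j - i)) (fun k => if k ≤ i then p k else p (k + (j - i))) ?_
    · omega
    refine ⟨by simp [hp.zero], ?_, fun k hk => ?_, fun k h0 hk => ?_⟩
    · by_cases hjr : j = r
      · subst hjr
        rw [if_pos (by omega), show j - (j - i) = i by omega, he, hp.last]
      · rw [if_neg (by omega), show r - (j - i) + (j - i) = r by omega, hp.last]
    · split_ifs with h1 h2 h2
      · exact hp.adj _ (by omega)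
      · have : k = i := by omega
        subst this
        rw [he, show k + 1 + (j - k) = j + 1 by omega]
        exact hp.adj _ (by omega)
      · omega
      · rw [show k + 1 + (j - i) = k + (j - i) + 1 by omega]
        exact hp.adj _ (by omega)
    · split_ifs
      · exact hp.far _ h0 (by omega)
      · exact hp.far _ (by omega) (by omega)
  -- A chord would be a shortcut. The shift is smaller by one than before because the chord itself
  -- is a step of the new path.
  have hpadj : ∀ i j, i + 1 < j → j ≤ r → ¬ G.Adj (p i) (p j) := by
    intro i j hij hj he
    have := hmin (r - (j - i - 1)) (fun k => if k ≤ i then p k else p (k + (j - i - 1))) ?_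
    · omega
    refine ⟨by simp [hp.zero], ?_, fun k hk => ?_, fun k h0 hk => ?_⟩
    · rw [if_neg (by omega), show r - (j - i - 1) + (j - i - 1) = r by omega, hp.last]
    · split_ifs with h1 h2 h2
      · exact hp.adj _ (by omega)
      · have : k = i := by omega
        subst this
        rwa [show k + 1 + (j - k - 1) = j by omega]
      · omega
      · rw [show k + 1 + (j - i - 1) = k + (j - i - 1) + 1 by omega]
        exact hp.adj _ (by omega)
    · split_ifs
      · exact hp.far _ h0 (by omega)
      · exact hp.far _ (by omega) (by omega)
  have hr : 2 ≤ r := by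
    have h0 := hp.zero
    have h1 := hp.last
    have h2 := hp.adj
    rcases r with _ | _ | r
    · exact absurd (h0.symm.trans h1) hne
    · have := h2 0 (by omega)
      rw [h0, h1] at this
      exact absurd this hnadj
    · omega
  have hx : ∀ j ≤ r, p j ≠ x := by
    intro j hj
    by_cases h0 : j = 0
    · subst h0; rw [hp.zero]; exact hxy.ne'
    · by_cases h1 : j = r
      · subst h1; rw [hp.last]; exact hxz.ne'
      · exact (hp.far j (by omega) (by omega)).1
  refine ⟨r + 2, fun i => if i = 0 then x else p (i - 1), ⟨by omega, ?_, ?_⟩, by simp,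
    by simp [hp.zero], ?_⟩
  · intro i j hij hj
    have hj0 : j ≠ 0 := by omega
    by_cases hi : i = 0
    · simpa [hi, hj0] using (hx (j - 1) (by omega)).symm
    · simpa [hi, hj0] using hpne (i - 1) (j - 1) (by omega) (by omega)
  · intro i j hij hj
    have hj0 : j ≠ 0 := by omega
    by_cases hi : i = 0
    · simp only [hi, hj0, if_true, if_false]
      by_cases h0 : j = 1
      · subst h0; simp [hp.zero, hxy]
      · by_cases h1 : j = r + 1
        · subst h1; simp [hp.last, hxz]
        · have := (hp.far (j - 1) (by omega) (by omega)).2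
          simp only [this, false_iff]; omega
    · simp only [hi, hj0, if_false, false_and, or_false]
      by_cases h1 : j = i + 1
      · subst h1
        have := hp.adj (i - 1) (by omega)
        rw [show i - 1 + 1 = i by omega] at this
        simpa using this
      · simpa [h1] using hpadj (i - 1) (j - 1) (by omega) (by omega)
  · simp [hp.last]

theorem cycleGraph_adj_iff {l : ℕ} {u v : Fin l} (huv : u < v) :
    (SimpleGraph.cycleGraph l).Adj u v ↔ v.val = u.val + 1 ∨ (u.val = 0 ∧ v.val + 1 = l) := by
  rw [SimpleGraph.cycleGraph_adj', Fin.coe_sub_iff_le.2 huv.le, Fin.coe_sub_iff_lt.2 huv]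
  omega

theorem isChordal_iff_indCyc : IsChordal G ↔ ∀ l f, ¬ IndCyc G l f := by
  constructor
  · intro h l f hf
    refine (h l hf.four_le).false ⟨⟨fun i => f i, fun i j hij => ?_⟩, fun {i j} => ?_⟩
    · rcases lt_trichotomy i j with h1 | h1 | h1
      · exact absurd hij (hf.ne _ _ h1 j.2)
      · exact h1
      · exact absurd hij.symm (hf.ne _ _ h1 i.2)
    · show G.Adj (f i) (f j) ↔ _
      rcases lt_trichotomy i j with h1 | h1 | h1
      · rw [hf.adj _ _ h1 j.2, cycleGraph_adj_iff h1]
      · subst h1; simp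
      · rw [G.adj_comm, (SimpleGraph.cycleGraph l).adj_comm, hf.adj _ _ h1 i.2,
          cycleGraph_adj_iff h1]
  · intro h l hl
    refine ⟨fun φ => h l (fun i => if hi : i < l then φ ⟨i, hi⟩ else φ ⟨0, by omega⟩)
      ⟨hl, fun i j hij hj => ?_, fun i j hij hj => ?_⟩⟩
    · rw [dif_pos (by omega), dif_pos hj]
      exact fun h => by simpa [hij.ne] using φ.injective h
    · rw [dif_pos (by omega), dif_pos hj, φ.map_adj_iff, cycleGraph_adj_iff (by simpa)]

/-- The form in which chordality is used below: it speaks of connectivity instead of cycles, so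
paths need not be kept induced. -/
theorem isChordal_iff : IsChordal G ↔ ∀ x y z, ¬ Hit G x y z := by
  rw [isChordal_iff_indCyc]
  constructor
  · intro h x y z hh
    obtain ⟨l, f, hf, _⟩ := hh.exists_indCyc
    exact h l f hf
  · intro h l f hf
    exact h _ _ _ hf.hit_zero

/-! ### Induced subgraphs -/

/-- The subgraph induced by `K`, all other vertices being kept as isolated vertices. -/
def restr (G : SimpleGraph V) (K : Set V) : SimpleGraph V where
  Adj u v := G.Adj u v ∧ u ∈ K ∧ v ∈ K
  symm := ⟨fun _ _ h => ⟨h.1.symm, h.2.2, h.2.1⟩⟩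
  loopless := ⟨fun _ h => G.loopless.irrefl _ h.1⟩

theorem restr_adj {K : Set V} {u v : V} :
    (restr G K).Adj u v ↔ G.Adj u v ∧ u ∈ K ∧ v ∈ K := Iff.rfl

/-- Every vertex of a cycle has an edge, hence lies in `K`; keeping the other vertices as isolated
ones is harmless and avoids changing the vertex type. -/
theorem indCyc_restr {K : Set V} {l : ℕ} {f : ℕ → V} :
    IndCyc (restr G K) l f ↔ IndCyc G l f ∧ ∀ i < l, f i ∈ K := by
  constructor
  · intro h
    have h4 := h.four_le
    have hK : ∀ i < l, f i ∈ K := by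
      intro i hi
      by_cases hil : i + 1 < l
      · exact ((h.adj i (i + 1) (by omega) hil).2 (by omega)).2.1
      · exact ((h.adj (i - 1) i (by omega) (by omega)).2 (by omega)).2.2
    refine ⟨⟨h4, h.ne, fun i j hij hj => ?_⟩, hK⟩
    rw [← h.adj i j hij hj, restr_adj]
    simp [hK i (by omega), hK j hj]
  · rintro ⟨h, hK⟩
    refine ⟨h.four_le, h.ne, fun i j hij hj => ?_⟩
    rw [← h.adj i j hij hj, restr_adj]
    simp [hK i (by omega), hK j hj]

theorem isChordal_restr_iff {K : Set V} :
    IsChordal (restr G K) ↔ ∀ l f, IndCyc G l f → ∃ i < l, f i ∉ K := by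
  simp only [isChordal_iff_indCyc, indCyc_restr, not_and, not_forall, exists_prop]

theorem IsChordal.restr (h : IsChordal G) (K : Set V) : IsChordal (restr G K) := by
  rw [isChordal_restr_iff]
  exact fun l f hf => absurd hf (isChordal_iff_indCyc.1 h l f)

/-- Adding a vertex whose neighbourhood is a clique keeps a graph chordal. -/
theorem isChordal_restr_insert {S : Set V} {v : V} (h : IsChordal (restr G S))
    (hv : ∀ a ∈ S, ∀ b ∈ S, a ≠ b → G.Adj v a → G.Adj v b → G.Adj a b) :
    IsChordal (restr G (insert v S)) := by
  rw [isChordal_iff]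
  rw [isChordal_restr_iff] at h
  -- The two cycle neighbours of `v` would be nonadjacent members of its neighbourhood in `S`, which
  -- is a clique.
  have key : ∀ l f, IndCyc G l f → (∀ i < l, f i ∈ insert v S) → ∀ i < l, f i ≠ v := by
    intro l f hf hm i hi he
    have hf' := hf.rotate hi
    have hm' : ∀ j < l, (if j + i < l then f (j + i) else f (j + i - l)) ∈ insert v S := by
      intro j hj
      split_ifs
      · exact hm _ (by omega)
      · exact hm _ (by omega)
    have h0 : (if 0 + i < l then f (0 + i) else f (0 + i - l)) = v := by
      rw [if_pos (by omega), zero_add, he]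
    generalize hg : (fun j => if j + i < l then f (j + i) else f (j + i - l)) = g at hf'
    have hg' : ∀ j, (if j + i < l then f (j + i) else f (j + i - l)) = g j := fun j => by
      rw [← hg]
    simp only [hg'] at hm' h0
    obtain ⟨h1, h2, h3, h4, -⟩ := hf'.hit_zero
    have h5 := hf'.four_le
    rw [h0] at h1 h2
    exact h4 (hv _ ((hm' 1 (by omega)).resolve_left h1.ne') _
      ((hm' (l - 1) (by omega)).resolve_left h2.ne') h3 h1 h2)
  intro x y z hh
  obtain ⟨l, f, hf, -⟩ := hh.exists_indCyc
  rw [indCyc_restr] at hf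
  obtain ⟨i, hi, hiS⟩ := h l f hf.1
  exact hiS ((hf.2 i hi).resolve_left (key l f hf.1 hf.2 i hi))

end Graph

section Graph
variable {V : Type*} {G H : SimpleGraph V}

/-! ### Maximum cardinality search -/

/-- Adjacency within `U`. -/
def AdjIn (G : SimpleGraph V) (U : Set V) (a b : V) : Prop := G.Adj a b ∧ a ∈ U ∧ b ∈ U

/-- Connectedness within `U`. -/
abbrev LinkIn (G : SimpleGraph V) (U : Set V) : V → V → Prop :=
  Relation.ReflTransGen (AdjIn G U)

theorem LinkIn.symm {U : Set V} {a b : V} (h : LinkIn G U a b) : LinkIn G U b a :=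
  haveI : Std.Symm (AdjIn G U) := ⟨fun _ _ h => ⟨h.1.symm, h.2.2, h.2.1⟩⟩
  Std.Symm.symm _ _ h

theorem LinkIn.mono {U U' : Set V} (hU : U ⊆ U') {a b : V} (h : LinkIn G U a b) :
    LinkIn G U' a b :=
  Relation.ReflTransGen.mono (fun _ _ h => ⟨h.1, hU h.2.1, hU h.2.2⟩) _ _ h

theorem LinkIn.mem {U : Set V} {a b : V} (h : LinkIn G U a b) (ha : a ∈ U) : b ∈ U := by
  induction h with
  | refl => exact ha
  | tail _ h _ => exact h.2.2

/-- In a chordal graph, a clique all of whose vertices have neighbours in a connected set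
has a common neighbour in that set. -/
theorem exists_common_neighbour (hG : IsChordal G) {U : Set V} {v : V} (hv : v ∈ U)
    (K : Finset V) (hK : ∀ a ∈ K, ∀ b ∈ K, a ≠ b → G.Adj a b) (hU : ∀ a ∈ K, a ∉ U)
    (hadj : ∀ a ∈ K, ∃ d, LinkIn G U v d ∧ G.Adj d a) :
    ∃ c, LinkIn G U v c ∧ ∀ a ∈ K, G.Adj c a := by
  classical
  rw [isChordal_iff] at hG
  induction K using Finset.induction_on with
  | empty => exact ⟨v, .refl, by simp⟩
  | insert k K' hk ih =>
    obtain ⟨c, hc, hcK⟩ := ih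
      (fun a ha b hb => hK a (Finset.mem_insert_of_mem ha) b (Finset.mem_insert_of_mem hb))
      (fun a ha => hU a (Finset.mem_insert_of_mem ha))
      (fun a ha => hadj a (Finset.mem_insert_of_mem ha))
    by_cases hck : G.Adj c k
    · exact ⟨c, hc, fun a ha => (Finset.mem_insert.1 ha).elim (fun h => h ▸ hck) (hcK a)⟩
    obtain ⟨d, hd, hdk⟩ := hadj k (Finset.mem_insert_self _ _)
    have hkU := hU k (Finset.mem_insert_self _ _)
    have hcU := hc.mem hv
    -- the first neighbour of `k` on a path from `c` to `d`
    have first : ∀ e, LinkIn G U c e → LinkIn G {a ∈ U | ¬ G.Adj a k} c e ∨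
        ∃ q₀ q, LinkIn G {a ∈ U | ¬ G.Adj a k} c q₀ ∧ G.Adj q₀ q ∧ q ∈ U ∧ G.Adj q k := by
      intro e he
      induction he with
      | refl => exact .inl .refl
      | @tail b e hb hbe ih =>
        rcases ih with ih | ih
        · by_cases hek : G.Adj e k
          · exact .inr ⟨b, e, ih, hbe.1, hbe.2.2, hek⟩
          · have hbk := (ih.mem (show c ∈ {a ∈ U | ¬ G.Adj a k} from ⟨hcU, hck⟩))
            exact .inl (ih.tail ⟨hbe.1, hbk, hbe.2.2, hek⟩)
        · exact .inr ih
    have hcmem : c ∈ {a ∈ U | ¬ G.Adj a k} := ⟨hcU, hck⟩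
    obtain ⟨q₀, q, hq₀, hqq, hqU, hqk⟩ := (first d (hc.symm.trans hd)).resolve_left
      fun h => (h.mem hcmem).2 hdk
    have hq₀' := hq₀.mono (Set.sep_subset U _)
    refine ⟨q, (hc.trans hq₀').tail ⟨hqq, hq₀'.mem hcU, hqU⟩, fun k' hk' => ?_⟩
    rcases Finset.mem_insert.1 hk' with rfl | hk'K
    · exact hqk
    by_contra hqk'
    have hkk' : G.Adj k' k := hK k' hk' k (Finset.mem_insert_self _ _) fun h => hk (h ▸ hk'K)
    have hk'U := hU k' hk'
    have hqfar : Far G k' q := ⟨fun h => hk'U (h ▸ hqU), fun h => hqk' h.symm⟩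
    -- Suppose `q` misses `k'`. The path from `c` to `q` consists of nonneighbours of `k` until `q`,
    -- and it begins at a neighbour of `k'`. Following it backwards from `q` to the nearest
    -- neighbour `e` of `k'` gives a chordless cycle with `k, k', e` consecutive. The induction runs
    -- from the `c` end: vertices far from `k'` are absorbed into the part linked to `q`.
    have claim : ∀ e, LinkIn G {a ∈ U | ¬ G.Adj a k} c e → ∀ u, Linked G k' q u →
        ¬ G.Adj u e := by
      intro e he
      induction he with
      | refl =>
        intro u hu hue
        exact hG k' k c ⟨hkk', (hcK k' hk'K).symm, fun h => hkU (h ▸ hcU),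
          fun h => hck h.symm, q, u, hqfar, hqk.symm, hu, hue⟩
      | @tail b e _ hbe ih =>
        intro u hu hue
        by_cases hek : G.Adj k' e
        · exact hG k' k e ⟨hkk', hek, fun h => hkU (h ▸ hbe.2.2.1),
            fun h => hbe.2.2.2 h.symm, q, u, hqfar, hqk.symm, hu, hue⟩
        · exact ih e (hu.tail ⟨hue, hu.far hqfar, fun h => hk'U (h ▸ hbe.2.2.1), hek⟩)
            hbe.1.symm
    exact claim q₀ hq₀ q .refl hqq.symm

/-- The number of neighbours of `v` among `o 0, …, o (i - 1)`. -/
noncomputable def numBefore (G : SimpleGraph V) (o : ℕ → V) (i : ℕ) (v : V) : ℕ :=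
  haveI := Classical.decPred fun a => G.Adj v (o a)
  ((Finset.range i).filter fun a => G.Adj v (o a)).card

/-- Each of the vertices `o 0, …, o (r - 1)` has, among the vertices that come later, the largest
number of neighbours that come earlier. -/
structure MaxCard (G : SimpleGraph V) (o : ℕ → V) (r : ℕ) : Prop where
  ne : ∀ i j, i < j → j < r → o i ≠ o j
  le : ∀ i j, i < j → j < r → numBefore G o i (o j) ≤ numBefore G o i (o i)

/-- The invariant of the search is stronger: at each stage, any two earlier vertices with neighbours
in the same component of the remaining graph are adjacent. For the component of `o i` these earlier
vertices form a clique by induction, and `exists_common_neighbour` supplies a remaining vertex that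
sees all of them. Since `o i` has at least as many earlier neighbours, all within this clique, it
sees all of them too, and the invariant passes to the next stage. -/
theorem MaxCard.clique_of_isChordal {o : ℕ → V} {r : ℕ} (h : MaxCard G o r)
    (hG : IsChordal G) {i a b : ℕ} (hi : i < r) (ha : a < i) (hb : b < i) (hab : a ≠ b)
    (hia : G.Adj (o i) (o a)) (hib : G.Adj (o i) (o b)) : G.Adj (o a) (o b) := by
  classical
  have hinj : ∀ i j, i < r → j < r → o i = o j → i = j := by
    intro i j hi hj he
    rcases lt_trichotomy i j with h1 | h1 | h1
    · exact absurd he (h.ne i j h1 hj)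
    · exact h1
    · exact absurd he.symm (h.ne j i h1 hi)
  let U : ℕ → Set V := fun i => {w | ∃ j, i ≤ j ∧ j < r ∧ o j = w}
  have hUo : ∀ i a, a < i → a < r → o a ∉ U i := by
    rintro i a hai har ⟨j, hij, hjr, he⟩
    have := hinj _ _ hjr har he
    omega
  have key : ∀ i ≤ r, ∀ a b, a < i → b < i → a ≠ b → ∀ c d, c ∈ U i → LinkIn G (U i) c d →
      G.Adj (o a) c → G.Adj d (o b) → G.Adj (o a) (o b) := by
    intro i
    induction i with
    | zero => intro _ a b ha; omega
    | succ i ih =>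
      intro hir
      have ih := ih (by omega)
      have hv : o i ∈ U i := ⟨i, le_rfl, by omega, rfl⟩
      have hsub : U (i + 1) ⊆ U i := fun w ⟨j, h1, h2, h3⟩ => ⟨j, by omega, h2, h3⟩
      -- Here `K` is the set of earlier vertices attached to the component of `o i`; the claim is
      -- that `o i` is adjacent to all of `K`.
      have nbr : ∀ a < i, ∀ d, LinkIn G (U i) (o i) d → G.Adj d (o a) → G.Adj (o i) (o a) := by
        let K : Finset V := ((Finset.range i).filter fun a =>
          ∃ d, LinkIn G (U i) (o i) d ∧ G.Adj d (o a)).image o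
        obtain ⟨c, hc, hcK⟩ := exists_common_neighbour hG hv K
          (by
            simp only [K, Finset.mem_image, Finset.mem_filter, Finset.mem_range]
            rintro _ ⟨a, ⟨ha, d, hd, hda⟩, rfl⟩ _ ⟨b, ⟨hb, e, he, heb⟩, rfl⟩ hab
            exact ih a b ha hb (fun h => hab (h ▸ rfl)) d e (hd.mem hv) (hd.symm.trans he)
              hda.symm heb)
          (by
            simp only [K, Finset.mem_image, Finset.mem_filter, Finset.mem_range]
            rintro _ ⟨a, ⟨ha, _⟩, rfl⟩
            exact hUo i a ha (by omega))
          (by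
            simp only [K, Finset.mem_image, Finset.mem_filter, Finset.mem_range]
            rintro _ ⟨a, ⟨ha, hd⟩, rfl⟩
            exact hd)
        obtain ⟨j, hij, hjr, rfl⟩ := hc.mem hv
        have hle : numBefore G o i (o j) ≤ numBefore G o i (o i) := by
          rcases hij.eq_or_lt with rfl | hij
          · exact le_rfl
          · exact h.le i j hij hjr
        intro a ha d hd hda
        -- The earlier neighbours of `o i` belong to `K`, so they are neighbours of the common
        -- neighbour `o j` as well; comparing cardinalities makes the two sets equal.
        have hsub : (Finset.range i).filter (fun a => G.Adj (o i) (o a)) ⊆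
            (Finset.range i).filter fun a => G.Adj (o j) (o a) := by
          intro b hb
          simp only [Finset.mem_filter, Finset.mem_range] at hb ⊢
          refine ⟨hb.1, hcK _ (Finset.mem_image_of_mem _ ?_)⟩
          simp only [Finset.mem_filter, Finset.mem_range]
          exact ⟨hb.1, o i, .refl, hb.2⟩
        have heq := Finset.eq_of_subset_of_card_le hsub (by
          convert hle using 1 <;> unfold numBefore <;> congr!)
        have hmem : a ∈ (Finset.range i).filter fun a => G.Adj (o j) (o a) := by
          simp only [Finset.mem_filter, Finset.mem_range]
          refine ⟨ha, hcK _ (Finset.mem_image_of_mem _ ?_)⟩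
          simp only [Finset.mem_filter, Finset.mem_range]
          exact ⟨ha, d, hd, hda⟩
        rw [← heq, Finset.mem_filter] at hmem
        exact hmem.2
      intro a b ha hb hab c d hcU hcd hac hdb
      have hcd' := hcd.mono hsub
      have hcU' := hsub hcU
      by_cases hai : a = i
      · subst hai
        exact nbr b (by omega) d (.head ⟨hac, hv, hcU'⟩ hcd') hdb
      · by_cases hbi : b = i
        · subst hbi
          exact (nbr a (by omega) c (.head ⟨hdb.symm, hv, hcd'.mem hcU'⟩ hcd'.symm)
            hac.symm).symm
        · exact ih a b (by omega) (by omega) hab c d hcU' hcd' hac hdb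
  exact key i hi.le a b ha hb hab (o i) (o i) ⟨i, le_rfl, hi, rfl⟩ .refl hia.symm hib

/-- If maximum cardinality search fails at a vertex, it lies on a chordless cycle. -/
theorem MaxCard.exists_hit {o : ℕ → V} {i a b : ℕ} (h : MaxCard G o (i + 1))
    (hS : IsChordal (restr G (o '' Set.Iio i))) (ha : a < i) (hb : b < i) (hab : a ≠ b)
    (hia : G.Adj (o i) (o a)) (hib : G.Adj (o i) (o b)) (hn : ¬ G.Adj (o a) (o b)) :
    ∃ j < i, ∃ z, Hit G (o j) (o i) z := by
  classical
  set T := o '' Set.Iio (i + 1) with hT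
  have hmem : ∀ j, j ≤ i → o j ∈ T := fun j hj => ⟨j, by simp; omega, rfl⟩
  have hnum : ∀ j j', j ≤ i → j' ≤ i → numBefore (restr G T) o j (o j') =
      numBefore G o j (o j') := by
    intro j j' hj hj'
    unfold numBefore
    congr 1
    ext c
    simp only [Finset.mem_filter, Finset.mem_range, restr_adj]
    constructor
    · rintro ⟨h1, h2, -⟩; exact ⟨h1, h2⟩
    · rintro ⟨h1, h2⟩; exact ⟨h1, h2, hmem _ hj', hmem _ (by omega)⟩
  have h' : MaxCard (restr G T) o (i + 1) :=
    ⟨h.ne, fun j j' hj hj' => by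
      rw [hnum _ _ (by omega) (by omega), hnum _ _ (by omega) (by omega)]
      exact h.le j j' hj hj'⟩
  -- Within `T`, the vertices processed so far together with `o i`, the order is still a maximum
  -- cardinality search. The nonadjacent earlier neighbours thus refute chordality, and as the
  -- earlier vertices alone induce a chordal graph, the chordless cycle passes through `o i`.
  have hnc : ¬ IsChordal (restr G T) := fun hc =>
    hn (h'.clique_of_isChordal hc (by omega) ha hb hab ⟨hia, hmem _ le_rfl, hmem _ ha.le⟩
      ⟨hib, hmem _ le_rfl, hmem _ hb.le⟩).1
  rw [isChordal_iff_indCyc] at hnc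
  push Not at hnc
  obtain ⟨l, f, hf⟩ := hnc
  rw [indCyc_restr] at hf
  obtain ⟨hf, hfT⟩ := hf
  rw [isChordal_restr_iff] at hS
  obtain ⟨m, hm, hmS⟩ := hS l f hf
  have hfm : f m = o i := by
    obtain ⟨j, hj, hj'⟩ := hfT m hm
    have : j = i := by
      by_contra hji
      exact hmS ⟨j, by simp at hj ⊢; omega, hj'⟩
    rw [← hj', this]
  have h4 := hf.four_le
  have hr := (hf.rotate hm)
  -- the vertex after `o i` on the cycle
  have hr1 : ∃ w z, Hit G w (o i) z ∧ w ∈ T := by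
    by_cases h2 : m = 0
    · have := (hf.rotate (by omega : 1 < l)).hit_zero
      simp only [zero_add] at this
      rw [if_pos (by omega), if_pos (by omega), if_neg (by omega),
        show l - 1 + 1 - l = 0 by omega, ← h2, hfm] at this
      exact ⟨_, _, this.symm, hfT _ (by omega)⟩
    · have := (hf.rotate (by omega : m - 1 < l)).hit_zero
      simp only [zero_add] at this
      rw [if_pos (by omega), if_pos (by omega), show 1 + (m - 1) = m by omega, hfm] at this
      exact ⟨_, _, this, hfT _ (by omega)⟩
  obtain ⟨w, z, hw, j, hj, rfl⟩ := hr1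
  refine ⟨j, ?_, z, hw⟩
  simp only [Set.mem_Iio] at hj
  have : j ≠ i := by rintro rfl; exact hw.1.ne rfl
  omega

/-- If every vertex forms a clique with its earlier neighbours, then the graph is chordal. -/
theorem isChordal_restr_image {o : ℕ → V} (r : ℕ)
    (h : ∀ i < r, ∀ a b, a < i → b < i → a ≠ b → G.Adj (o i) (o a) → G.Adj (o i) (o b) →
      G.Adj (o a) (o b)) : IsChordal (restr G (o '' Set.Iio r)) := by
  induction r with
  | zero =>
    rw [isChordal_restr_iff]
    exact fun l f hf => ⟨0, by have := hf.four_le; omega, by simp⟩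
  | succ r ih =>
    have : o '' Set.Iio (r + 1) = insert (o r) (o '' Set.Iio r) := by
      rw [← Set.image_insert_eq]; congr 1; ext; simp [le_iff_eq_or_lt]
    rw [this]
    refine isChordal_restr_insert (ih fun i hi => h i (by omega)) ?_
    rintro _ ⟨a, ha, rfl⟩ _ ⟨b, hb, rfl⟩ hab
    exact h r (by omega) a b ha hb fun h => hab (h ▸ rfl)

/-- If there is no chordless cycle outside `A`, and none that leaves `A` through two vertices,
then no chordless cycle has two consecutive vertices outside `A`. -/
theorem no_hit_of_chordal {A : Set V} (hB : IsChordal (restr G Aᶜ))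
    (hA : ∀ a ∈ A, ∀ x ∉ A, ∀ z ∉ A, ¬ Hit G x a z) {x y z : V} (hx : x ∉ A) (hy : y ∉ A) :
    ¬ Hit G x y z := by
  classical
  intro hh
  obtain ⟨l, f, hf, h0, h1, -⟩ := hh.exists_indCyc
  rw [isChordal_restr_iff] at hB
  -- The cycle starts with `x, y` outside `A`. At the first vertex that belongs to `A`, the two
  -- vertices before it are outside `A`, and these three are consecutive.
  have hex : ∃ i, i < l ∧ f i ∈ A := by simpa using hB l f hf
  obtain ⟨h2, h3⟩ := Nat.find_spec hex
  have h4 : ∀ i, i < l → i < Nat.find hex → f i ∉ A := fun i hi h hA =>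
    Nat.find_min hex h ⟨hi, hA⟩
  generalize Nat.find hex = i at h2 h3 h4
  have hi0 : i ≠ 0 := by rintro rfl; exact hx (h0 ▸ h3)
  have hi1 : i ≠ 1 := by rintro rfl; exact hy (h1 ▸ h3)
  have := hf.hit (i := i - 2) (by omega)
  rw [show i - 2 + 1 = i - 1 by omega, show i - 2 + 2 = i by omega] at this
  exact hA _ h3 _ (h4 _ (by omega) (by omega)) _ (h4 _ (by omega) (by omega)) this

end Graph

section Graph
variable {V : Type*} {G H : SimpleGraph V}

/-! ### Sandwiches -/

/-- A set of at most `k` edges can be added to `G₁`, within `G₂`, so that `G₁` becomes chordal. -/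
def Sandwich (G₁ G₂ : SimpleGraph V) (k : ℕ) : Prop :=
  ∃ F : Finset (Sym2 V), F.card ≤ k ∧ SimpleGraph.fromEdgeSet (F : Set (Sym2 V)) ≤ G₂ ∧
    IsChordal (G₁ ⊔ SimpleGraph.fromEdgeSet (F : Set (Sym2 V)))

/-- If `x` gets no new edge, then vertices far from `x` stay far, the connecting path survives in
`H`, and only the edge `yz` can destroy the hit. -/
theorem Hit.adj_or_exists (hH : IsChordal H) (hGH : G ≤ H) {x y z : V} (h : Hit G x y z) :
    H.Adj y z ∨ ∃ w, H.Adj x w ∧ ¬ G.Adj x w := by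
  by_contra! hn
  obtain ⟨hyz, hx⟩ := hn
  obtain ⟨h1, h2, h3, -, c, d, hc, hyc, hcd, hdz⟩ := h
  have hfar : ∀ a, Far G x a → Far H x a := fun a ha => ⟨ha.1, fun h => ha.2 (hx a h)⟩
  refine isChordal_iff.1 hH x y z ⟨hGH h1, hGH h2, h3, hyz, c, d, hfar c hc, hGH hyc, ?_,
    hGH hdz⟩
  exact Relation.ReflTransGen.mono
    (fun a b h => ⟨hGH h.1, hfar a h.2.1, hfar b h.2.2⟩) _ _ hcd

theorem Hit.exists_fill (hH : IsChordal H) (hGH : G ≤ H) {x y z : V} (h : Hit G x y z) :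
    (∃ w, H.Adj x w ∧ ¬ G.Adj x w) ∨ ∃ w, H.Adj y w ∧ ¬ G.Adj y w :=
  (h.adj_or_exists hH hGH).symm.imp_right fun h' => ⟨z, h', h.2.2.2.1⟩

theorem mem_of_adj_sup {F : Finset (Sym2 V)} {u v : V}
    (h : (G ⊔ SimpleGraph.fromEdgeSet (F : Set (Sym2 V))).Adj u v) (hn : ¬ G.Adj u v) :
    s(u, v) ∈ F := by
  rw [SimpleGraph.sup_adj, SimpleGraph.fromEdgeSet_adj] at h
  exact (h.resolve_left hn).1

/-- At most `2 |F|` vertices are incident with the edges in `F`. -/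
theorem card_le_of_incident (F : Finset (Sym2 V)) (S : Finset V)
    (h : ∀ x ∈ S, ∃ w, s(x, w) ∈ F) : S.card ≤ 2 * F.card := by
  classical
  have : S ⊆ F.biUnion Sym2.toFinset := by
    intro x hx
    obtain ⟨w, hw⟩ := h x hx
    exact Finset.mem_biUnion.2 ⟨_, hw, by simp⟩
  refine (Finset.card_le_card this).trans ?_
  rw [mul_comm]
  refine Finset.card_biUnion_le_card_mul _ _ _ fun e _ => ?_
  induction e with
  | _ a b =>
    rw [Sym2.toFinset_mk_eq]
    exact Finset.card_le_two

/-- Disjoint pairs of consecutive vertices of chordless cycles: there are at most `2 k`. -/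
theorem Sandwich.le_of_hits {G₂ : SimpleGraph V} {k : ℕ} (h : Sandwich G G₂ k) (r : ℕ)
    (p : ℕ → V) (hp : ∀ i j, i < j → j < 2 * r → p i ≠ p j)
    (hh : ∀ i < r, ∃ z, Hit G (p (2 * i)) (p (2 * i + 1)) z) : r ≤ 2 * k := by
  classical
  obtain ⟨F, hF, -, hH⟩ := h
  have hGH : G ≤ G ⊔ SimpleGraph.fromEdgeSet (F : Set (Sym2 V)) := le_sup_left
  -- `b` tells which vertex of the `i`-th pair is incident with an added edge. The pairs are
  -- disjoint, so the chosen vertices are `r` distinct ends of edges of `F`.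
  have hex : ∀ i, ∃ b, b < 2 ∧ (i < r → ∃ w, s(p (2 * i + b), w) ∈ F) := by
    intro i
    by_cases hi : i < r
    · obtain ⟨z, hz⟩ := hh i hi
      rcases hz.exists_fill hH hGH with ⟨w, h1, h2⟩ | ⟨w, h1, h2⟩
      · exact ⟨0, by omega, fun _ => ⟨w, mem_of_adj_sup h1 h2⟩⟩
      · exact ⟨1, by omega, fun _ => ⟨w, mem_of_adj_sup h1 h2⟩⟩
    · exact ⟨0, by omega, fun h => absurd h hi⟩
  choose b hb hbF using hex
  have hcard : ((Finset.range r).image fun i => p (2 * i + b i)).card = r := by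
    rw [Finset.card_image_of_injOn, Finset.card_range]
    intro i hi j hj he
    simp only [Finset.coe_range, Set.mem_Iio] at hi hj
    have h1 := hb i
    have h2 := hb j
    rcases lt_trichotomy i j with h | h | h
    · exact absurd he (hp _ _ (by omega) (by omega))
    · exact h
    · exact absurd he.symm (hp _ _ (by omega) (by omega))
  have := card_le_of_incident F ((Finset.range r).image fun i => p (2 * i + b i)) (by
    simp only [Finset.mem_image, Finset.mem_range]
    rintro _ ⟨i, hi, rfl⟩
    exact hbF i hi)
  omega

/-! ### Essential edges -/

/-- If additional edges do not leave the components of the graph without the closed neighbourhood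
of `x`, and their neighbourhoods, then chordless cycles through `x` arise from paths in the
original graph. -/
theorem Hit.of_near {x y z : V} (hx : ∀ w, H.Adj x w → G.Adj x w) (hGH : G ≤ H)
    (hn : ∀ a w, Far G x a → H.Adj a w → w ≠ x →
      ∃ d, Linked G x a d ∧ (d = w ∨ G.Adj d w)) (h : Hit H x y z) : Hit G x y z := by
  obtain ⟨h1, h2, h3, h4, c, d, hc, hyc, hcd, hdz⟩ := h
  have hfar : ∀ a, Far H x a → Far G x a := fun a ha => ⟨ha.1, fun h => ha.2 (hGH h)⟩
  -- Each step of the path in `H` is replaced by a connection in `G` that stays far from `x`.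
  have hlink : Linked G x c d := by
    clear hdz
    induction hcd with
    | refl => exact .refl
    | @tail a b _ hab ih =>
      have hb := hfar b hab.2.2
      obtain ⟨e, he, rfl | heb⟩ := hn a b (hfar a hab.2.1) hab.1 hb.1
      · exact ih.trans he
      · exact (ih.trans he).tail ⟨heb, he.far (hfar a hab.2.1), hb⟩
  have hd : Far G x d := hlink.far (hfar c hc)
  -- The end `y` is a neighbour of `x`, so it cannot itself be linked to `c`; it is adjacent to
  -- something linked to `c`.
  obtain ⟨c', hc', rfl | hcy⟩ := hn c y (hfar c hc) hyc.symm h1.ne'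
  · exact absurd (hx _ h1) (hc'.far (hfar c hc)).2
  obtain ⟨d', hd', rfl | hdz'⟩ := hn d z hd hdz h2.ne'
  · exact absurd (hx _ h2) (hd'.far hd).2
  exact ⟨hx _ h1, hx _ h2, h3, fun h => h4 (hGH h), c', d', hc'.far (hfar c hc), hcy.symm,
    hc'.symm.trans (hlink.trans hd'), hdz'⟩

/-- `E` consists of pairs of vertices in `A` that are the neighbours on chordless cycles of many
vertices outside `A`, and `K` contains `A` and all other vertices on chordless cycles. -/
structure IsKernel (G E : SimpleGraph V) (A K : Set V) (k : ℕ) : Prop where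
  no_hit : ∀ x y z, x ∉ A → y ∉ A → ¬ Hit G x y z
  many : ∀ y z, E.Adj y z → ∃ S : Finset V, 2 * k < S.card ∧ ∀ x ∈ S, x ∉ A ∧ Hit G x y z
  mem : ∀ y z, E.Adj y z → y ∈ A
  subset : A ⊆ K
  adj : ∀ x y z, x ∉ K → y ∈ A → z ∈ A → Hit G x y z → E.Adj y z

/-- Vertices outside `K` are not on chordless cycles after adding the essential edges. -/
theorem IsKernel.not_hit_sup {E : SimpleGraph V} {A K : Set V} {k : ℕ}
    (h : IsKernel G E A K k) {x y z : V} (hx : x ∉ K) : ¬ Hit (G ⊔ E) x y z := by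
  intro hh
  have hxA : x ∉ A := fun hA => hx (h.subset hA)
  have hG : Hit G x y z := by
    refine hh.of_near (fun w hw => ?_) le_sup_left fun c w hc hcw hwx => ?_
    · exact ((SimpleGraph.sup_adj _ _ _ _).1 hw).resolve_right fun hE => hxA (h.mem _ _ hE)
    · rw [SimpleGraph.sup_adj] at hcw
      rcases hcw with hcw | hcw
      · exact ⟨c, .refl, .inr hcw⟩
      -- An essential edge `cw` is bypassed through any of the vertices `x'` that hit it: directly
      -- as `c, x', w` if `x'` is not adjacent to `x`, and otherwise along the rest of the chordless
      -- cycle.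
      obtain ⟨S, hS, hSh⟩ := h.many _ _ hcw
      obtain ⟨x', hx'⟩ := Finset.card_pos.1 (by omega : 0 < S.card)
      obtain ⟨hxA', h1, h2, -, -, c₁, d₁, hc₁, hcc₁, hcd, hdw⟩ := hSh x' hx'
      have hxx : x' ≠ x := by rintro rfl; exact hc.2 h1
      by_cases hadj : G.Adj x x'
      · have step : ∀ e e', Linked G x c e → G.Adj e e' → Far G x e → Far G x' e' →
            Far G x e' := by
          intro e e' hl hee he he'
          refine ⟨fun hex => he'.2 (hex ▸ hadj.symm), fun hxe => ?_⟩
          exact h.no_hit x x' e' hxA hxA' ⟨hadj, hxe, he'.1.symm, he'.2, c, e, hc, h1, hl, hee⟩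
        have claim : ∀ e, Linked G x' c₁ e → Linked G x c e := by
          intro e he
          induction he with
          | refl => exact .single ⟨hcc₁, hc, step c c₁ .refl hcc₁ hc hc₁⟩
          | @tail a b _ hab ih =>
            have ha := ih.far hc
            exact ih.tail ⟨hab.1, ha, step a b ih hab.1 ha hab.2.2⟩
        exact ⟨d₁, claim _ hcd, .inr hdw⟩
      · exact ⟨x', .single ⟨h1.symm, hc, hxx, hadj⟩, .inr h2⟩
  -- Both cycle neighbours of `x` lie in `A`, and `x` is outside `K`, so `yz` is essential and has
  -- become a chord.
  have hy : y ∈ A := by_contra fun hy => h.no_hit x y z hxA hy hG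
  have hz : z ∈ A := by_contra fun hz => h.no_hit x z y hxA hz hG.symm
  exact hh.2.2.2.1 (.inr (h.adj x y z hx hy hz hG))

/-- The beginning of a sequence of vertices that leaves the component of its first vertex, in the
graph without the closed neighbourhood of `x`, and the neighbourhood of this component. -/
theorem exists_boundary {x : V} {h : ℕ → V} {M : ℕ} (h0 : Far G x (h 0))
    (hne : ∀ i ≤ M, h i ≠ x)
    (hstep : ∀ i < M, Far G x (h i) →
      ∃ d, Linked G x (h i) d ∧ (d = h (i + 1) ∨ G.Adj d (h (i + 1))))
    (hM : ∀ d, Linked G x (h 0) d → d ≠ h M ∧ ¬ G.Adj d (h M)) :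
    ∃ q, 0 < q ∧ q < M ∧ G.Adj x (h q) ∧ ∃ d, Linked G x (h 0) d ∧ G.Adj d (h q) := by
  -- Either a neighbour of `x` at the boundary of the component has already been met, or the
  -- sequence is still inside the component.
  have claim : ∀ p ≤ M, (∃ q, 0 < q ∧ q ≤ p ∧ G.Adj x (h q) ∧
      ∃ d, Linked G x (h 0) d ∧ G.Adj d (h q)) ∨ Linked G x (h 0) (h p) := by
    intro p
    induction p with
    | zero => intro _; exact .inr .refl
    | succ p ih =>
      intro hp
      rcases ih (by omega) with ⟨q, h1, h2, h3⟩ | hl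
      · exact .inl ⟨q, h1, by omega, h3⟩
      · have hpf := hl.far h0
        obtain ⟨d, hd, rfl | hdp⟩ := hstep p (by omega) hpf
        · exact .inr (hl.trans hd)
        · by_cases hx : G.Adj x (h (p + 1))
          · exact .inl ⟨p + 1, by omega, le_rfl, hx, d, hl.trans hd, hdp⟩
          · exact .inr ((hl.trans hd).tail ⟨hdp, hd.far hpf, hne _ hp, hx⟩)
  rcases claim M le_rfl with ⟨q, h1, h2, h3, d, hd, hdq⟩ | hl
  · refine ⟨q, h1, h2.lt_of_ne ?_, h3, d, hd, hdq⟩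
    rintro rfl
    exact (hM d hd).2 hdq
  · exact absurd rfl (hM _ hl).1

/-- A triangulation of an induced subgraph that contains all chordless cycles yields a
triangulation of the whole graph. -/
theorem exists_isChordal_sup {D : SimpleGraph V} {K : Set V}
    (hG : ∀ x ∉ K, ∀ y z, ¬ Hit G x y z) (hD : ∀ u v, D.Adj u v → u ∈ K)
    (hc : IsChordal (restr G K ⊔ D)) : ∃ D' ≤ D, IsChordal (G ⊔ D') := by
  classical
  -- If `u` is far from `x`, then `v` belongs to the component of `u`, or to its boundary. An added
  -- edge that violates this could merge components around `x` and thereby create a chordless cycle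
  -- through `x`; such edges are discarded.
  let Near : V → V → V → Prop := fun x u v =>
    Far G x u → ∃ d, Linked G x u d ∧ (d = v ∨ G.Adj d v)
  let D' : SimpleGraph V :=
    { Adj := fun u v => D.Adj u v ∧ ∀ x ∉ K, Near x u v ∧ Near x v u
      symm := ⟨fun u v h => ⟨h.1.symm, fun x hx => (h.2 x hx).symm⟩⟩
      loopless := ⟨fun u h => D.loopless.irrefl u h.1⟩ }
  have hD' : D' ≤ D := fun u v h => h.1
  refine ⟨D', hD', ?_⟩
  have near : ∀ x ∉ K, ∀ a w, Far G x a → (G ⊔ D').Adj a w →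
      ∃ d, Linked G x a d ∧ (d = w ∨ G.Adj d w) := by
    intro x hx a w ha haw
    rw [SimpleGraph.sup_adj] at haw
    rcases haw with haw | haw
    · exact ⟨a, .refl, .inr haw⟩
    · exact (haw.2 x hx).1 ha
  have nohit : ∀ x ∉ K, ∀ y z, ¬ Hit (G ⊔ D') x y z := by
    intro x hx y z hh
    refine hG x hx y z (hh.of_near (fun w hw => ?_) le_sup_left
      fun a w ha haw _ => near x hx a w ha haw)
    rw [SimpleGraph.sup_adj] at hw
    exact hw.resolve_right fun h => hx (hD _ _ (hD' h))
  rw [isChordal_iff_indCyc]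
  intro l f hf
  have h4 := hf.four_le
  have hfK : ∀ i < l, f i ∈ K := by
    intro i hi
    by_contra hiK
    have := (hf.rotate hi).hit_zero
    simp only [zero_add] at this
    rw [if_pos (by omega : i < l)] at this
    exact nohit _ hiK _ _ this
  have hle : ∀ u v, u ∈ K → v ∈ K → (G ⊔ D').Adj u v → (restr G K ⊔ D).Adj u v := by
    intro u v hu hv h
    rw [SimpleGraph.sup_adj] at h ⊢
    exact h.imp (fun h => ⟨h, hu, hv⟩) fun h => hD' h
  -- a chord of the cycle
  have hchord : ∃ i j, i + 1 < j ∧ j < l ∧ (i ≠ 0 ∨ j + 1 ≠ l) ∧ D.Adj (f i) (f j) ∧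
      ¬ (G ⊔ D').Adj (f i) (f j) := by
    by_contra hn
    -- Without a discarded edge as chord, the cycle would be chordless in the triangulated kernel
    -- too.
    refine isChordal_iff_indCyc.1 hc l f ⟨h4, hf.ne, fun i j hij hj => ?_⟩
    rw [← hf.adj i j hij hj]
    refine ⟨fun h => ?_, hle _ _ (hfK i (by omega)) (hfK j hj)⟩
    by_contra hnadj
    have hcons := (hf.adj i j hij hj).not.1 hnadj
    refine hn ⟨i, j, by omega, hj, by omega, ?_, hnadj⟩
    rw [SimpleGraph.sup_adj] at h
    exact h.resolve_left fun h => hnadj (.inl h.1)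
  obtain ⟨i, j, hij, hj, hends, hDij, hnadj⟩ := hchord
  have hsep : ∃ x, x ∉ K ∧ (¬ Near x (f i) (f j) ∨ ¬ Near x (f j) (f i)) := by
    by_contra! hn
    exact hnadj (.inr ⟨hDij, hn⟩)
  obtain ⟨x, hxK, hsep⟩ := hsep
  -- rotate the cycle so that it begins at the end that is not near `x`
  have hrot : ∃ g m, IndCyc (G ⊔ D') l g ∧ (∀ i < l, g i ∈ K) ∧ 2 ≤ m ∧ m + 2 ≤ l ∧
      ¬ Near x (g 0) (g m) := by
    rcases hsep with hsep | hsep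
    · refine ⟨_, j - i, hf.rotate (by omega : i < l), fun a ha => ?_, by omega, by omega, ?_⟩
      · split_ifs
        · exact hfK _ (by omega)
        · exact hfK _ (by omega)
      · rw [if_pos (by omega), if_pos (by omega), zero_add, show j - i + i = j by omega]
        exact hsep
    · refine ⟨_, l - (j - i), hf.rotate (by omega : j < l), fun a ha => ?_, by omega, by omega,
        ?_⟩
      · split_ifs
        · exact hfK _ (by omega)
        · exact hfK _ (by omega)
      · rw [if_pos (by omega), if_neg (by omega), zero_add,
          show l - (j - i) + j - l = i by omega]
        exact hsep
  obtain ⟨g, m, hg, hgK, hm2, hml, hnear⟩ := hrot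
  have hfar : Far G x (g 0) := by_contra fun h => hnear fun h' => absurd h' h
  have hnear' : ∀ d, Linked G x (g 0) d → d ≠ g m ∧ ¬ G.Adj d (g m) := by
    intro d hd
    by_contra! hn
    refine hnear fun _ => ⟨d, hd, ?_⟩
    by_cases h : d = g m
    · exact .inl h
    · exact .inr (hn h)
  have hnex : ∀ i < l, g i ≠ x := fun i hi h => hxK (h ▸ hgK i hi)
  -- The arc from `g 0` forward to `g m` meets a neighbour of `x` on the boundary of the component
  -- of `g 0`; so does the other arc, which is traversed backwards next.
  obtain ⟨q, hq0, hqm, hxq, d, hd, hdq⟩ := exists_boundary (h := g) (M := m) hfar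
    (fun i hi => hnex i (by omega))
    (fun i hi hif => near x hxK _ _ hif ((hg.adj i (i + 1) (by omega) (by omega)).2 (.inl rfl)))
    hnear'
  obtain ⟨q', hq0', hqm', hxq', d', hd', hdq'⟩ :=
    exists_boundary (h := fun i => if i = 0 then g 0 else g (l - i)) (M := l - m) (by simpa)
    (fun i hi => by
      split_ifs
      · exact hnex 0 (by omega)
      · exact hnex _ (by omega))
    (fun i hi hif => near x hxK _ _ hif (by
      have : i + 1 ≠ 0 := by omega
      simp only [this, if_false]
      split_ifs with hi0
      · exact (hg.adj 0 (l - (i + 1)) (by omega) (by omega)).2 (by omega)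
      · exact ((hg.adj (l - (i + 1)) (l - i) (by omega) (by omega)).2 (by omega)).symm))
    (by
      have : l - m ≠ 0 := by omega
      simpa only [this, if_true, if_false, show l - (l - m) = m by omega] using hnear')
  have hq'0 : q' ≠ 0 := by omega
  simp only [hq'0, if_true, if_false] at hxq' hd' hdq'
  have hne := hg.ne q (l - q') (by omega) (by omega)
  have hnadj' : ¬ (G ⊔ D').Adj (g q) (g (l - q')) := by
    rw [hg.adj q (l - q') (by omega) (by omega)]; omega
  -- The two boundary vertices are inner vertices of different arcs, hence not consecutive on the
  -- chordless cycle and not adjacent, while both attach to the component of `g 0`.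
  exact hG x hxK _ _ ⟨hxq, hxq', hne, fun h => hnadj' (.inl h), d, d', hd.far hfar, hdq.symm,
    hd.symm.trans hd', hdq'⟩

/-- The essential edges belong to every small triangulation. -/
theorem IsKernel.sandwich {E G₂ : SimpleGraph V} {A K : Set V} {k : ℕ}
    (h : IsKernel G E A K k) (EF : Finset (Sym2 V)) (hEF : ∀ e, e ∈ EF ↔ e ∈ E.edgeSet)
    (hs : Sandwich G G₂ k) :
    E ≤ G₂ ∧ EF.card ≤ k ∧ Sandwich (restr (G ⊔ E) K) (restr G₂ K) (k - EF.card) := by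
  classical
  obtain ⟨F, hF, hFG, hH⟩ := hs
  have hGH : G ≤ G ⊔ SimpleGraph.fromEdgeSet (F : Set (Sym2 V)) := le_sup_left
  -- If `yz` is not added, each of the more than `2k` vertices hitting it is an end of an added
  -- edge, but there are at most `2k` ends.
  have hE : ∀ y z, E.Adj y z → s(y, z) ∈ F := by
    intro y z hyz
    obtain ⟨S, hS, hSh⟩ := h.many y z hyz
    obtain ⟨x, hx⟩ := Finset.card_pos.1 (by omega : 0 < S.card)
    have hn := (hSh x hx).2.2.2.2.1
    by_contra hyzF
    have := card_le_of_incident F S fun x hx => by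
      rcases (hSh x hx).2.adj_or_exists hH hGH with h' | ⟨w, h1, h2⟩
      · exact absurd (mem_of_adj_sup h' hn) hyzF
      · exact ⟨w, mem_of_adj_sup h1 h2⟩
    omega
  have hEF' : EF ⊆ F := by
    intro e he
    induction e with
    | _ y z => exact hE y z ((hEF _).1 he)
  have hcard := Finset.card_le_card hEF'
  refine ⟨fun y z hyz => hFG ?_, by omega, ?_⟩
  · rw [SimpleGraph.fromEdgeSet_adj]
    exact ⟨hE y z hyz, hyz.ne⟩
  · refine ⟨(F \ EF).filter fun e => ∀ v ∈ e, v ∈ K, ?_, fun u v huv => ?_, ?_⟩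
    · refine (Finset.card_filter_le _ _).trans ?_
      rw [Finset.card_sdiff_of_subset hEF']
      omega
    · rw [SimpleGraph.fromEdgeSet_adj] at huv
      simp only [Finset.coe_filter, Set.mem_ofPred_eq, Finset.mem_sdiff] at huv
      refine ⟨hFG ?_, huv.1.2 u (by simp), huv.1.2 v (by simp)⟩
      rw [SimpleGraph.fromEdgeSet_adj]
      exact ⟨huv.1.1.1, huv.2⟩
    · convert hH.restr K using 1
      ext u v
      simp only [SimpleGraph.sup_adj, restr_adj, SimpleGraph.fromEdgeSet_adj, Finset.coe_filter,
        Set.mem_ofPred_eq, Finset.mem_sdiff, Sym2.mem_iff, forall_eq_or_imp, forall_eq,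
        Finset.mem_coe]
      rw [hEF, SimpleGraph.mem_edgeSet]
      have h1 := hE u v
      have h2 : E.Adj u v → u ≠ v := fun h => h.ne
      tauto

/-- The solution consists of the essential edges and those edges of the kernel's solution that
`exists_isChordal_sup` retains; its hypothesis on outside vertices is `IsKernel.not_hit_sup`. -/
theorem IsKernel.sandwich_of {E G₂ : SimpleGraph V} {A K : Set V} {k : ℕ}
    (h : IsKernel G E A K k) (EF : Finset (Sym2 V)) (hEF : ∀ e, e ∈ EF ↔ e ∈ E.edgeSet)
    (hE : E ≤ G₂) (hk : EF.card ≤ k)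
    (hs : Sandwich (restr (G ⊔ E) K) (restr G₂ K) (k - EF.card)) : Sandwich G G₂ k := by
  classical
  obtain ⟨F, hF, hFG, hH⟩ := hs
  obtain ⟨D', hD', hc⟩ := exists_isChordal_sup (G := G ⊔ E)
    (D := SimpleGraph.fromEdgeSet (F : Set (Sym2 V))) (K := K)
    (fun x hx y z => h.not_hit_sup hx) (fun u v huv => (hFG huv).2.1) hH
  refine ⟨EF ∪ F.filter fun e => e ∈ D'.edgeSet, ?_, fun u v huv => ?_, ?_⟩
  · have := Finset.card_union_le EF (F.filter fun e => e ∈ D'.edgeSet)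
    have := Finset.card_filter_le F fun e => e ∈ D'.edgeSet
    omega
  · rw [SimpleGraph.fromEdgeSet_adj] at huv
    simp only [Finset.coe_union, Finset.coe_filter, Set.mem_union, Set.mem_ofPred_eq,
      Finset.mem_coe] at huv
    rcases huv.1 with h1 | h1
    · exact hE ((hEF _).1 h1)
    · refine (hFG ?_).1
      rw [SimpleGraph.fromEdgeSet_adj]
      exact ⟨h1.1, huv.2⟩
  · convert hc using 1
    ext u v
    simp only [SimpleGraph.sup_adj, SimpleGraph.fromEdgeSet_adj, Finset.coe_union,
      Finset.coe_filter, Set.mem_union, Set.mem_ofPred_eq, Finset.mem_coe]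
    rw [hEF, SimpleGraph.mem_edgeSet, SimpleGraph.mem_edgeSet]
    have h1 : D'.Adj u v → s(u, v) ∈ F := fun h => by
      have := hD' h
      rw [SimpleGraph.fromEdgeSet_adj] at this
      exact this.1
    have h2 : E.Adj u v → u ≠ v := fun h => h.ne
    have h3 : D'.Adj u v → u ≠ v := fun h => h.ne
    tauto

end Graph

/-! ### Transport of chordality and of instances along embeddings -/

section Transport
variable {V W : Type*}

/-- Vertices outside the image are isolated, so cycles lie in the image. This permits all graphs to
live on `ℕ`. -/
theorem isChordal_map_iff {G : SimpleGraph W} (f : W ↪ V) :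
    IsChordal (G.map f) ↔ IsChordal G := by
  simp only [isChordal_iff_indCyc]
  constructor
  · intro h l p hp
    refine h l (fun i => f (p i)) ⟨hp.four_le, fun i j hij hj he => hp.ne i j hij hj
      (f.injective he), fun i j hij hj => ?_⟩
    rw [SimpleGraph.map_adj_apply]
    exact hp.adj i j hij hj
  · intro h l p hp
    have h4 := hp.four_le
    have hr : ∀ i, ∃ a, i < l → f a = p i := by
      have h1 : ∀ i < l, ∃ a, f a = p i := by
        intro i hi
        have h2 : ∃ v, (G.map f).Adj (p i) v := by
          by_cases hil : i + 1 < l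
          · exact ⟨_, (hp.adj i (i + 1) (by omega) hil).2 (by omega)⟩
          · exact ⟨_, ((hp.adj (i - 1) i (by omega) (by omega)).2 (by omega)).symm⟩
        obtain ⟨v, hv⟩ := h2
        rw [SimpleGraph.map_adj] at hv
        obtain ⟨a, -, -, ha, -⟩ := hv
        exact ⟨a, ha⟩
      obtain ⟨a₀, -⟩ := h1 0 (by omega)
      intro i
      by_cases hi : i < l
      · exact (h1 i hi).imp fun a ha _ => ha
      · exact ⟨a₀, fun h => absurd h hi⟩
    choose q hq using hr
    refine h l q ⟨h4, fun i j hij hj he => hp.ne i j hij hj ?_, fun i j hij hj => ?_⟩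
    · rw [← hq i (by omega), ← hq j hj, he]
    · rw [← hp.adj i j hij hj, ← hq i (by omega), ← hq j hj, SimpleGraph.map_adj_apply]

/-- Members of a solution outside `E₂ \ E₁` have no effect and can be dropped. Hence the parameter
can be lowered to the number of free edges, as the output requires. -/
theorem Sandwich.mono_min {G₁ G₂ : SimpleGraph V}
    (hf : (G₂.edgeSet \ G₁.edgeSet).Finite) (k : ℕ) :
    Sandwich G₁ G₂ (min k (G₂.edgeSet \ G₁.edgeSet).ncard) ↔ Sandwich G₁ G₂ k := by
  classical
  constructor
  · rintro ⟨F, h1, h2⟩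
    exact ⟨F, h1.trans (min_le_left _ _), h2⟩
  · rintro ⟨F, h1, h2, h3⟩
    refine ⟨F.filter fun e => e ∈ G₂.edgeSet \ G₁.edgeSet,
      le_min ((Finset.card_filter_le _ _).trans h1) ?_, ?_, ?_⟩
    · rw [← Set.ncard_coe_finset]
      exact Set.ncard_le_ncard (fun e he => (Finset.mem_filter.1 he).2) hf
    · exact (SimpleGraph.fromEdgeSet_mono (Finset.coe_subset.2 (Finset.filter_subset _ _))).trans
        h2
    · convert h3 using 1
      ext u v
      have h4 := @h2 u v
      simp only [SimpleGraph.sup_adj, SimpleGraph.fromEdgeSet_adj, Finset.coe_filter,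
        Set.mem_ofPred_eq, Set.mem_sdiff, SimpleGraph.mem_edgeSet, Finset.mem_coe] at h4 ⊢
      tauto

/-- The two notions differ in that `Sandwich` tolerates loops and edges of `G₁` in the added set; on
the way back, the added set is intersected with the free edges. -/
theorem Instance.isYes_iff (I : Instance) (f : Fin I.n ↪ V) :
    I.IsYes ↔ Sandwich (I.G₁.map f) (I.G₂.map f) I.k := by
  classical
  have hinj : Function.Injective (Sym2.map f) := Sym2.map.injective f.injective
  constructor
  · rintro ⟨F, hF, hk, hc⟩
    have hfin : F.Finite := Set.toFinite _
    refine ⟨hfin.toFinset.image (Sym2.map f), ?_, fun u v huv => ?_, ?_⟩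
    · rw [Finset.card_image_of_injective _ hinj, ← Set.ncard_eq_toFinset_card _ hfin]
      exact hk
    · rw [SimpleGraph.fromEdgeSet_adj] at huv
      obtain ⟨h1, -⟩ := huv
      simp only [Finset.coe_image, Set.Finite.coe_toFinset, Set.mem_image] at h1
      obtain ⟨e, he, he'⟩ := h1
      have := (hF he).1
      induction e with
      | _ a b =>
        rw [Sym2.map_mk, ← SimpleGraph.mem_edgeSet] at *
        rw [← he', SimpleGraph.mem_edgeSet, SimpleGraph.map_adj_apply]
        exact this
    · convert (isChordal_map_iff f).2 hc using 1
      ext u v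
      simp only [SimpleGraph.sup_adj, SimpleGraph.map_adj, SimpleGraph.fromEdgeSet_adj,
        Finset.coe_image, Set.Finite.coe_toFinset, Set.mem_image, Set.mem_union,
        SimpleGraph.mem_edgeSet]
      constructor
      · rintro (⟨a, b, h, rfl, rfl⟩ | ⟨⟨e, he, he'⟩, hne⟩)
        · exact ⟨a, b, ⟨.inl h, h.ne⟩, rfl, rfl⟩
        · induction e with
          | _ a b =>
            rw [Sym2.map_mk, Sym2.eq_iff] at he'
            rcases he' with ⟨rfl, rfl⟩ | ⟨rfl, rfl⟩
            · exact ⟨a, b, ⟨.inr he, fun h => hne (h ▸ rfl)⟩, rfl, rfl⟩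
            · exact ⟨b, a, ⟨.inr (Sym2.eq_swap ▸ he), fun h => hne (h ▸ rfl)⟩, rfl, rfl⟩
      · rintro ⟨a, b, ⟨h | h, hne⟩, rfl, rfl⟩
        · exact .inl ⟨a, b, h, rfl, rfl⟩
        · exact .inr ⟨⟨_, h, by simp⟩, fun h => hne (f.injective h)⟩
  · rintro ⟨F, hk, hF, hc⟩
    refine ⟨{e | e ∈ I.G₂.edgeSet \ I.G₁.edgeSet ∧ e.map f ∈ F}, fun e he => he.1, ?_, ?_⟩
    · refine le_trans ?_ hk
      rw [← Set.ncard_image_of_injective _ hinj, ← Set.ncard_coe_finset]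
      refine Set.ncard_le_ncard ?_ (Finset.finite_toSet _)
      rintro _ ⟨e, he, rfl⟩
      exact he.2
    · rw [← isChordal_map_iff f]
      convert hc using 1
      ext u v
      simp only [SimpleGraph.sup_adj, SimpleGraph.map_adj, SimpleGraph.fromEdgeSet_adj,
        Set.mem_union, SimpleGraph.mem_edgeSet, Set.mem_ofPred_eq, Set.mem_sdiff,
        Finset.mem_coe]
      constructor
      · rintro ⟨a, b, ⟨h | ⟨h, h'⟩, hne⟩, rfl, rfl⟩
        · exact .inl ⟨a, b, h, rfl, rfl⟩
        · exact .inr ⟨h', fun h => hne (f.injective h)⟩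
      · rintro (⟨a, b, h, rfl, rfl⟩ | ⟨h, hne⟩)
        · exact ⟨a, b, ⟨.inl h, h.ne⟩, rfl, rfl⟩
        · have h2 : (I.G₂.map f).Adj u v := hF (by
            rw [SimpleGraph.fromEdgeSet_adj]; exact ⟨h, hne⟩)
          rw [SimpleGraph.map_adj] at h2
          obtain ⟨a, b, hab, rfl, rfl⟩ := h2
          refine ⟨a, b, ⟨?_, hab.ne⟩, rfl, rfl⟩
          by_cases h1 : I.G₁.Adj a b
          · exact .inl h1
          · exact .inr ⟨⟨hab, h1⟩, h⟩

theorem Instance.numFree_eq (I : Instance) (f : Fin I.n ↪ V) :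
    I.numFree = ((I.G₂.map f).edgeSet \ (I.G₁.map f).edgeSet).ncard := by
  have hinj : Function.Injective (Sym2.map f) := Sym2.map.injective f.injective
  rw [Instance.numFree, ← Set.ncard_image_of_injective _ hinj]
  congr 1
  have h : ∀ G : SimpleGraph (Fin I.n), (G.map f).edgeSet = Sym2.map f '' G.edgeSet := by
    intro G
    rw [SimpleGraph.edgeSet_map]
    rfl
  rw [h, h, Set.image_sdiff hinj]

end Transport

/-! ### Arrays of adjacency lists -/

/-- The offsets of the lists `nb 0, …, nb (n - 1)`, followed by their concatenation. -/
def listArray (n : ℕ) (nb : ℕ → List ℕ) : List ℕ :=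
  (List.range (n + 1)).map (fun i => ∑ u ∈ Finset.range i, (nb u).length) ++
    (List.range n).flatMap nb

theorem length_flatMap_range (n : ℕ) (nb : ℕ → List ℕ) :
    ((List.range n).flatMap nb).length = ∑ u ∈ Finset.range n, (nb u).length := by
  induction n with
  | zero => simp
  | succ n ih => simp [List.range_succ, Finset.sum_range_succ] at ih ⊢; omega

theorem length_listArray (n : ℕ) (nb : ℕ → List ℕ) :
    (listArray n nb).length = n + 1 + ∑ u ∈ Finset.range n, (nb u).length := by
  rw [listArray, List.length_append, length_flatMap_range]; simp

theorem getD_flatMap_range {n u j : ℕ} (nb : ℕ → List ℕ) (hu : u < n)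
    (hj : j < (nb u).length) :
    ((List.range n).flatMap nb).getD (∑ v ∈ Finset.range u, (nb v).length + j) 0 =
      (nb u).getD j 0 := by
  induction n with
  | zero => omega
  | succ n ih =>
    have hl := length_flatMap_range n nb
    rw [List.range_succ, List.flatMap_append]
    rcases (Nat.lt_succ_iff_lt_or_eq.1 hu) with h | rfl
    · rw [List.getD_append, ih h]
      rw [hl]
      have := Finset.sum_le_sum_of_subset (f := fun v => (nb v).length)
        (Finset.range_subset_range.2 (Nat.succ_le_of_lt h))
      rw [Finset.sum_range_succ] at this
      omega
    · rw [List.getD_append_right _ _ _ _ (by omega), hl]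
      simp

theorem getD_listArray_left {n i : ℕ} (nb : ℕ → List ℕ) (hi : i ≤ n) :
    (listArray n nb).getD i 0 = ∑ u ∈ Finset.range i, (nb u).length := by
  rw [listArray, List.getD_append _ _ _ _ (by simp; omega), List.getD_eq_getElem _ _ (by simp; omega)]
  simp

theorem getD_listArray_right {n u j : ℕ} (nb : ℕ → List ℕ) (hu : u < n)
    (hj : j < (nb u).length) :
    (listArray n nb).getD (n + 1 + ∑ v ∈ Finset.range u, (nb v).length + j) 0 =
      (nb u).getD j 0 := by
  rw [listArray, List.getD_append_right _ _ _ _ (by simp; omega), ← getD_flatMap_range nb hu hj]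
  congr 1
  simp only [List.length_map, List.length_range]; omega

/-- The lists of numbers that correspond to lists of vertices. -/
def numLists {n : ℕ} (adj : Fin n → List (Fin n)) (u : ℕ) : List ℕ :=
  if h : u < n then (adj ⟨u, h⟩).map Fin.val else []

theorem numLists_val {n : ℕ} (adj : Fin n → List (Fin n)) (u : Fin n) :
    numLists adj u = (adj u).map Fin.val := by simp [numLists]

theorem adjArray_eq_listArray {n : ℕ} (adj : Fin n → List (Fin n)) :
    adjArray adj = listArray n (numLists adj) := by
  unfold adjArray listArray
  congr 1
  · refine List.map_congr_left fun i hi => ?_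
    rw [List.mem_range] at hi
    have h1 := Fin.sum_univ_eq_sum_range
      (fun u => if u < i then (numLists adj u).length else 0) n
    simp only [numLists_val, List.length_map] at h1
    rw [offset, h1, ← Finset.sum_filter]
    congr 1
    ext u
    simp only [Finset.mem_filter, Finset.mem_range]
    omega
  · rw [← List.map_coe_finRange_eq_range, List.flatMap_map]
    simp only [numLists_val]

/-- The input of the program, with numbers as vertices. -/
structure Input where
  n : ℕ
  k : ℕ
  G₁ : SimpleGraph ℕ
  G₂ : SimpleGraph ℕ
  nb₁ : ℕ → List ℕ
  nb₂ : ℕ → List ℕ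
  le : G₁ ≤ G₂
  lt : ∀ u v, G₂.Adj u v → u < n
  nodup₁ : ∀ u, (nb₁ u).Nodup
  nodup₂ : ∀ u, (nb₂ u).Nodup
  mem₁ : ∀ u w, w ∈ nb₁ u ↔ G₁.Adj u w
  mem₂ : ∀ u w, w ∈ nb₂ u ↔ G₂.Adj u w

/-! ### Positions in the input array and degree sums -/

namespace Input
variable (D : Input)

def off₁ (i : ℕ) : ℕ := ∑ u ∈ Finset.range i, (D.nb₁ u).length

def off₂ (i : ℕ) : ℕ := ∑ u ∈ Finset.range i, (D.nb₂ u).length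

/-- The total length of the lists of the first graph. -/
def M : ℕ := D.off₁ D.n

/-- Cells 0 and 1 hold `n` and `k`. The offsets of the first graph begin at cell 2 and its lists at
`n + 3`; the offsets of the second graph begin at `n + 3 + M` and its lists at `2n + 4 + M`. -/
def list : List ℕ := D.n :: D.k :: (listArray D.n D.nb₁ ++ listArray D.n D.nb₂)

theorem length_list : D.list.length = 2 * D.n + 4 + D.M + D.off₂ D.n := by
  simp only [list, List.length_cons, List.length_append, length_listArray, M, off₁, off₂]
  omega

theorem off₁_succ (i : ℕ) : D.off₁ (i + 1) = D.off₁ i + (D.nb₁ i).length :=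
  Finset.sum_range_succ _ _

theorem off₂_succ (i : ℕ) : D.off₂ (i + 1) = D.off₂ i + (D.nb₂ i).length :=
  Finset.sum_range_succ _ _

theorem off₁_mono {i j : ℕ} (h : i ≤ j) : D.off₁ i ≤ D.off₁ j :=
  Finset.sum_le_sum_of_subset (Finset.range_subset_range.2 h)

theorem off₂_mono {i j : ℕ} (h : i ≤ j) : D.off₂ i ≤ D.off₂ j :=
  Finset.sum_le_sum_of_subset (Finset.range_subset_range.2 h)

theorem list_zero : D.list.getD 0 0 = D.n := rfl

theorem list_one : D.list.getD 1 0 = D.k := rfl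

theorem list_off₁ {i : ℕ} (hi : i ≤ D.n) : D.list.getD (i + 2) 0 = D.off₁ i := by
  simp only [list, List.getD_cons_succ]
  rw [List.getD_append _ _ _ _ (by rw [length_listArray]; omega), getD_listArray_left _ hi]
  rfl

theorem list_nb₁ {u j : ℕ} (hu : u < D.n) (hj : j < (D.nb₁ u).length) :
    D.list.getD (D.n + 3 + (D.off₁ u + j)) 0 = (D.nb₁ u).getD j 0 := by
  have h1 := D.off₁_succ u
  have h2 := D.off₁_mono (show u + 1 ≤ D.n from hu)
  rw [show D.n + 3 + (D.off₁ u + j) = D.n + 1 + D.off₁ u + j + 2 by omega]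
  simp only [list, List.getD_cons_succ]
  rw [List.getD_append _ _ _ _ (by rw [length_listArray]; unfold off₁ at *; omega), off₁,
    getD_listArray_right _ hu hj]

theorem list_off₂ {i : ℕ} (hi : i ≤ D.n) : D.list.getD (D.n + 3 + D.M + i) 0 = D.off₂ i := by
  rw [show D.n + 3 + D.M + i = D.n + 1 + D.M + i + 2 by omega]
  simp only [list, List.getD_cons_succ]
  have hl := length_listArray D.n D.nb₁
  change _ = D.n + 1 + D.M at hl
  rw [List.getD_append_right _ _ _ _ (by omega), hl, Nat.add_sub_cancel_left,
    getD_listArray_left _ hi]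
  rfl

theorem list_nb₂ {u j : ℕ} (hu : u < D.n) (hj : j < (D.nb₂ u).length) :
    D.list.getD (2 * D.n + 4 + D.M + (D.off₂ u + j)) 0 = (D.nb₂ u).getD j 0 := by
  rw [show 2 * D.n + 4 + D.M + (D.off₂ u + j) =
    D.n + 1 + D.M + (D.n + 1 + D.off₂ u + j) + 2 by omega]
  simp only [list, List.getD_cons_succ]
  have hl := length_listArray D.n D.nb₁
  change _ = D.n + 1 + D.M at hl
  rw [List.getD_append_right _ _ _ _ (by omega), hl, Nat.add_sub_cancel_left, off₂,
    getD_listArray_right _ hu hj]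

theorem lt' {u v : ℕ} (h : D.G₁.Adj u v) : u < D.n ∧ v < D.n :=
  ⟨D.lt _ _ (D.le h), D.lt _ _ (D.le h).symm⟩

theorem length_nb₁_le (u : ℕ) : (D.nb₁ u).length ≤ D.n := by
  have : (D.nb₁ u).toFinset ⊆ Finset.range D.n := fun w hw => by
    rw [List.mem_toFinset, D.mem₁] at hw
    exact Finset.mem_range.2 (D.lt' hw).2
  have := Finset.card_le_card this
  rwa [List.toFinset_card_of_nodup (D.nodup₁ u), Finset.card_range] at this

theorem length_nb₂_le (u : ℕ) : (D.nb₂ u).length ≤ D.n := by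
  have : (D.nb₂ u).toFinset ⊆ Finset.range D.n := fun w hw => by
    rw [List.mem_toFinset, D.mem₂] at hw
    exact Finset.mem_range.2 (D.lt _ _ hw.symm)
  have := Finset.card_le_card this
  rwa [List.toFinset_card_of_nodup (D.nodup₂ u), Finset.card_range] at this

/-- Distinct vertices have at most `M` neighbours in total. -/
theorem sum_length_le {o : ℕ → ℕ} {r : ℕ} (ho : ∀ i j, i < j → j < r → o i ≠ o j)
    (hn : ∀ i < r, o i < D.n) : ∑ i ∈ Finset.range r, (D.nb₁ (o i)).length ≤ D.M := by
  classical
  have hinj : Set.InjOn o (Finset.range r) := by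
    intro i hi j hj he
    simp only [Finset.coe_range, Set.mem_Iio] at hi hj
    rcases lt_trichotomy i j with h1 | h1 | h1
    · exact absurd he (ho i j h1 hj)
    · exact h1
    · exact absurd he.symm (ho j i h1 hi)
  rw [← Finset.sum_image (f := fun u => (D.nb₁ u).length) hinj]
  rw [M, off₁]
  refine Finset.sum_le_sum_of_subset fun u hu => ?_
  obtain ⟨i, hi, rfl⟩ := Finset.mem_image.1 hu
  exact Finset.mem_range.2 (hn i (Finset.mem_range.1 hi))

end Input

theorem isAdjList_nodup {n : ℕ} {G : SimpleGraph (Fin n)} {adj : Fin n → List (Fin n)}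
    (h : IsAdjList G adj) (u : ℕ) : (numLists adj u).Nodup := by
  unfold numLists
  split_ifs
  · exact (h _).1.map Fin.val_injective
  · exact List.nodup_nil

theorem isAdjList_mem {n : ℕ} {G : SimpleGraph (Fin n)} {adj : Fin n → List (Fin n)}
    (h : IsAdjList G adj) (u w : ℕ) :
    w ∈ numLists adj u ↔ (G.map Fin.valEmbedding).Adj u w := by
  rw [SimpleGraph.map_adj]
  unfold numLists
  split_ifs with hu
  · simp only [List.mem_map, (h _).2, Fin.valEmbedding_apply]
    constructor
    · rintro ⟨a, ha, rfl⟩; exact ⟨_, a, ha, rfl, rfl⟩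
    · rintro ⟨a, b, hab, rfl, rfl⟩; exact ⟨b, hab, rfl⟩
  · simp only [List.not_mem_nil, false_iff]
    rintro ⟨a, b, hab, rfl, rfl⟩
    exact hu a.2

/-- Numbers from `n` on become isolated vertices. The lists of the first graph have total length
`2m` by the handshake lemma, which converts all later bounds in `M`. -/
theorem Instance.RepresentedBy.exists_input {I : Instance} {L : List ℕ}
    (h : I.RepresentedBy L) : ∃ D : Input, D.n = I.n ∧ D.k = I.k ∧
      D.G₁ = I.G₁.map Fin.valEmbedding ∧ D.G₂ = I.G₂.map Fin.valEmbedding ∧ D.list = L ∧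
      D.M = 2 * I.m := by
  classical
  obtain ⟨adj₁, adj₂, h1, h2, rfl⟩ := h
  refine ⟨⟨I.n, I.k, I.G₁.map Fin.valEmbedding, I.G₂.map Fin.valEmbedding, numLists adj₁,
    numLists adj₂, SimpleGraph.map_monotone _ I.le, ?_, isAdjList_nodup h1, isAdjList_nodup h2,
    isAdjList_mem h1, isAdjList_mem h2⟩, rfl, rfl, rfl, rfl, ?_, ?_⟩
  · intro u v huv
    rw [SimpleGraph.map_adj] at huv
    obtain ⟨a, b, -, rfl, -⟩ := huv
    exact a.2
  · simp only [Input.list, adjArray_eq_listArray]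
  · simp only [Input.M, Input.off₁]
    rw [← Fin.sum_univ_eq_sum_range (fun u => (numLists adj₁ u).length) I.n, Instance.m,
      ← SimpleGraph.coe_edgeFinset, Set.ncard_coe_finset,
      ← SimpleGraph.sum_degrees_eq_twice_card_edges]
    refine Finset.sum_congr rfl fun v _ => ?_
    rw [numLists_val, List.length_map, ← List.toFinset_card_of_nodup (h1 v).1,
      ← SimpleGraph.card_neighborFinset_eq_degree]
    congr 1
    ext w
    rw [List.mem_toFinset, (h1 v).2, SimpleGraph.mem_neighborFinset]

/-! ### Traversal of neighbours -/

/-- The entry of a matrix in row `u` and column `v`. -/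
def Exp.entry (j : Arr) (u v : Var) : Exp := .a j (.add (.a .row (.v u)) (.v v))

@[simp] theorem Exp.eval_entry (s : St) (j : Arr) (u v : Var) :
    (Exp.entry j u v).eval s = s.a j (s.a .row (s.v u) + s.v v) := rfl

@[simp] theorem Exp.chk_entry (W : ℕ) (s : St) (j : Arr) (u v : Var) :
    (Exp.entry j u v).chk W s ↔ True := Iff.rfl

/-- Run the body for all neighbours `x` of `y`. -/
def forNb (p e x y : Var) (body : Cmd) : Cmd :=
  .get p (.add (.v y) (.c 2)) ;; .get e (.add (.v y) (.c 3)) ;;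
    loop p (.v e) (.get x (.add (.v .lb) (.v p)) ;; body)

/-- Bounds for the numbers that occur. -/
structure Env (D : Input) (W N : ℕ) : Prop where
  len : D.list.length + 2 * (D.n * D.n) + 2 * D.n + 40 ≤ N
  N_le : N ≤ W
  lim : 32 * D.k ^ 3 + 4 * D.k + 4 ≤ W

/-- The input is available. -/
structure Io (D : Input) (s : St) : Prop where
  lb : s.v .lb = D.n + 3
  io : ∀ i < D.list.length, s.io i = D.list.getD i 0

theorem Env.n_le {D : Input} {W N : ℕ} (h : Env D W N) : D.n * D.n + 2 * D.n + 40 ≤ W := by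
  have := h.len
  have := h.N_le
  omega

theorem Io.congr {D : Input} {s s' : St} (h : Io D s) (h1 : s'.v .lb = s.v .lb)
    (h2 : s'.io = s.io) : Io D s' := ⟨h1 ▸ h.lb, h2 ▸ h.io⟩

/-- The `j`-th neighbour of `u`. -/
def Input.nbr (D : Input) (u j : ℕ) : ℕ := (D.nb₁ u).getD j 0

section
variable {D : Input} {W N : ℕ}

/-- The invariant must not depend on the loop counter `p` and the limit `e`, and the body may not
assign them. Per neighbour, three steps are spent on loading, incrementing and testing. -/
theorem wp_forNb (hE : Env D W N) {p e x y : Var} {body : Cmd} {s : St} {u : ℕ}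
    (hu : u < D.n) (hy : s.v y = u) (hIo : Io D s) (I : ℕ → St → Prop) (f : ℕ → ℕ)
    (hpe : p ≠ e) (hpx : p ≠ x) (hex : e ≠ x) (hpy : p ≠ y)
    (hp : p ∉ Cmd.wv body) (he : e ∉ body.wv) (hpl : p ≠ .lb) (hel : e ≠ .lb)
    (hI : I 0 s) (hIp : ∀ j s a, I j s → I j (s.setV p a))
    (hIe : ∀ j s a, I j s → I j (s.setV e a)) (hIio : ∀ j s, I j s → Io D s)
    (step : ∀ j s, j < (D.nb₁ u).length → I j s →
      wp W N body (s.setV x (D.nbr u j)) fun t s' => t ≤ f j ∧ I (j + 1) s') :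
    wp W N (forNb p e x y body) s fun t s' =>
      t ≤ ∑ j ∈ Finset.range (D.nb₁ u).length, (f j + 3) + 3 ∧ I (D.nb₁ u).length s' := by
  have hW := hE.n_le
  have hlen := hE.len
  have hN := hE.N_le
  have hl := D.length_list
  have hM : D.off₁ (u + 1) ≤ D.M := D.off₁_mono hu
  have hs1 := D.off₁_succ u
  have io1 := hIo.io (u + 2) (by omega)
  rw [D.list_off₁ hu.le] at io1
  have io2 := hIo.io (u + 1 + 2) (by omega)
  rw [D.list_off₁ (by omega), hs1] at io2
  simp only [forNb, wp_seq, wp_get, Exp.eval, hy, St.setV_v, St.setV_io, Ne.symm hpy, if_false]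
  refine ⟨by omega, by omega, ?_⟩
  rw [show u + 3 = u + 1 + 2 by omega, io1, io2]
  refine wp_mono (wp_loop (D.off₁ u) (D.nb₁ u).length
    (fun j s => I j s ∧ s.v e = D.off₁ u + (D.nb₁ u).length) (fun j => f j + 1) (by omega)
    ?_ (by simp [hpe]) ⟨hIe _ _ _ (hIp _ _ _ hI), by simp⟩ (fun j s h => by simpa using h.2)
    ?_) ?_
  · simp only [Cmd.wv, List.mem_append, not_or]
    exact ⟨by simpa using hpx, hp⟩
  · rintro j s hj ⟨hIj, hse⟩ hsp
    have hIo' := hIio j s hIj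
    simp only [wp_seq, wp_get, Exp.eval, hIo'.lb, hsp]
    have hio := hIo'.io (D.n + 3 + (D.off₁ u + j)) (by omega)
    rw [D.list_nb₁ hu hj, ← Input.nbr] at hio
    refine ⟨by omega, ?_⟩
    rw [hio]
    refine wp_mono (wp_frame (step j s hj hIj)) ?_
    rintro t s' ⟨⟨h1, h2⟩, hk⟩
    refine ⟨by omega, hIp _ _ _ h2, ?_⟩
    have := hk.v e he
    simp only [St.setV_v, hpe.symm, if_false, hex] at this ⊢
    rw [this, hse]
  · rintro t s' ⟨h1, ⟨h2, h3⟩, h4⟩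
    refine ⟨?_, h2⟩
    simp only [add_assoc] at h1 ⊢
    norm_num at h1 ⊢
    omega

theorem wp_forNb_const (hE : Env D W N) {p e x y : Var} {body : Cmd} {s : St} {u : ℕ}
    (hu : u < D.n) (hy : s.v y = u) (hIo : Io D s) (I : ℕ → St → Prop) (F : ℕ)
    (hpe : p ≠ e) (hpx : p ≠ x) (hex : e ≠ x) (hpy : p ≠ y)
    (hp : p ∉ Cmd.wv body) (he : e ∉ body.wv) (hpl : p ≠ .lb) (hel : e ≠ .lb)
    (hI : I 0 s) (hIp : ∀ j s a, I j s → I j (s.setV p a))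
    (hIe : ∀ j s a, I j s → I j (s.setV e a)) (hIio : ∀ j s, I j s → Io D s)
    (step : ∀ j s, j < (D.nb₁ u).length → I j s →
      wp W N body (s.setV x (D.nbr u j)) fun t s' => t ≤ F ∧ I (j + 1) s') :
    wp W N (forNb p e x y body) s fun t s' =>
      t ≤ (D.nb₁ u).length * (F + 3) + 3 ∧ I (D.nb₁ u).length s' := by
  simpa using wp_forNb hE hu hy hIo I (fun _ => F) hpe hpx hex hpy hp he hpl hel hI hIp hIe
    hIio step

theorem Input.getD_adj (D : Input) {u j : ℕ} (hj : j < (D.nb₁ u).length) :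
    D.G₁.Adj u (D.nbr u j) := by
  rw [← D.mem₁, Input.nbr, List.getD_eq_getElem _ _ hj]
  exact List.getElem_mem _

theorem Input.exists_getD (D : Input) {u w : ℕ} (h : D.G₁.Adj u w) :
    ∃ j < (D.nb₁ u).length, D.nbr u j = w := by
  rw [← D.mem₁, List.mem_iff_getElem] at h
  obtain ⟨j, hj, rfl⟩ := h
  exact ⟨j, hj, List.getD_eq_getElem _ _ hj⟩

theorem Input.getD_inj (D : Input) {u i j : ℕ} (hi : i < (D.nb₁ u).length)
    (hj : j < (D.nb₁ u).length) (h : D.nbr u i = D.nbr u j) : i = j := by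
  rw [Input.nbr, Input.nbr, List.getD_eq_getElem _ _ hi, List.getD_eq_getElem _ _ hj] at h
  exact (D.nodup₁ u).getElem_inj_iff.1 h

/-! ### Breadth-first search -/

/-- The input is available, and `mat` is the adjacency matrix of the first graph. -/
structure Ctx (D : Input) (s : St) : Prop extends Io D s where
  n : s.v .n = D.n
  row : ∀ u < D.n, s.a .row u = u * D.n
  mat : ∀ u v, u < D.n → v < D.n → (0 < s.a .mat (u * D.n + v) ↔ D.G₁.Adj u v)

theorem Ctx.congr {s s' : St} (h : Ctx D s) (h1 : s'.v .lb = s.v .lb) (h2 : s'.v .n = s.v .n)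
    (h3 : s'.a .row = s.a .row) (h4 : s'.a .mat = s.a .mat) (h5 : s'.io = s.io) :
    Ctx D s' where
  toIo := h.toIo.congr h1 h5
  n := h2 ▸ h.n
  row := h3 ▸ h.row
  mat := h4 ▸ h.mat

/-- The vertices that can be reached from `b` without passing through `a` and its neighbours. -/
inductive Reach (G : SimpleGraph ℕ) (a b : ℕ) : ℕ → Prop where
  | base : Reach G a b b
  | step {u w : ℕ} : Reach G a b u → (u = b ∨ ¬ G.Adj a u) → G.Adj u w → w ≠ a → Reach G a b w

theorem Reach.ne {G : SimpleGraph ℕ} {a b w : ℕ} (h : Reach G a b w) (hab : G.Adj a b) :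
    w ≠ a := by
  cases h with
  | base => exact hab.ne'
  | step _ _ _ h => exact h

theorem Reach.exists_adj {G : SimpleGraph ℕ} {a b w : ℕ} (h : Reach G a b w)
    (hab : G.Adj a b) : ∃ v, G.Adj w v := by
  cases h with
  | base => exact ⟨a, hab.symm⟩
  | step _ _ h _ => exact ⟨_, h.symm⟩

/-- A search from `b` that records neighbours of `a` without expanding them (except `b` itself)
finds exactly the boundary of the components next to `b`. A single search thus decides the hit for
all `z` simultaneously. -/
theorem hit_iff_reach {G : SimpleGraph ℕ} {a b z : ℕ} (hab : G.Adj a b) :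
    Hit G a b z ↔ G.Adj a z ∧ b ≠ z ∧ ¬ G.Adj b z ∧ Reach G a b z := by
  constructor
  · rintro ⟨-, h2, h3, h4, c, d, hc, hbc, hcd, hdz⟩
    refine ⟨h2, h3, h4, ?_⟩
    have : Reach G a b d := by
      clear hdz
      induction hcd with
      | refl => exact .step .base (.inl rfl) hbc hc.1
      | tail _ h ih => exact ih.step (.inr h.2.1.2) h.1 h.2.2.1
    exact this.step (.inr (hcd.far hc).2) hdz h2.ne'
  · rintro ⟨h2, h3, h4, h⟩
    have key : ∀ w, Reach G a b w → w = b ∨ G.Adj b w ∨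
        ∃ c d, Far G a c ∧ G.Adj b c ∧ Linked G a c d ∧ G.Adj d w := by
      intro w hw
      induction hw with
      | base => exact .inl rfl
      | @step u w hu h huw hwa ih =>
        by_cases hub : u = b
        · subst hub; exact .inr (.inl huw)
        · have hfar : Far G a u := ⟨hu.ne hab, h.resolve_left hub⟩
          rcases ih with rfl | ih | ⟨c, d, hc, hbc, hcd, hdu⟩
          · exact absurd rfl hub
          · exact .inr (.inr ⟨u, u, hfar, ih, .refl, huw⟩)
          · exact .inr (.inr ⟨c, u, hc, hbc, hcd.tail ⟨hdu, hcd.far hc, hfar⟩, huw⟩)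
    exact ⟨hab, h2, h3, h4, ((key z h).resolve_left h3.symm).resolve_left h4⟩

/-- Breadth-first search from `y` that does not pass through `x` and its neighbours. -/
def bfs : Cmd :=
  .put .mark (.v .x) (.c 1) ;; .put .mark (.v .y) (.c 1) ;; .put .queue (.c 0) (.v .y) ;;
  .set .tl (.c 1) ;; .set .hd (.c 0) ;;
  .while (.v .hd) (.v .tl)
    (.set .u (.a .queue (.v .hd)) ;; .set .go (.c 0) ;;
      .ite (.entry .mat .x .u) (.c 1) (.set .go (.c 1)) .skip ;;
      .ite (.v .hd) (.c 1) (.set .go (.c 1)) .skip ;;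
      .ite (.c 0) (.v .go)
        (forNb .p' .e' .w .u
          (.ite (.a .mark (.v .w)) (.c 1)
            (.put .mark (.v .w) (.c 1) ;; .put .queue (.v .tl) (.v .w) ;; inc .tl) .skip))
        .skip ;;
      inc .hd)

/-- The queue contains vertices that can be reached, and these are marked. -/
structure Queue (D : Input) (a b : ℕ) (s : St) : Prop extends Ctx D s where
  lt : ∀ i < s.v .tl, s.a .queue i < D.n
  inj : ∀ i j, i < j → j < s.v .tl → s.a .queue i ≠ s.a .queue j
  pos : 0 < s.v .tl
  zero : s.a .queue 0 = b
  reach : ∀ i < s.v .tl, Reach D.G₁ a b (s.a .queue i)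
  mark : ∀ v < D.n, 0 < s.a .mark v ↔ v = a ∨ ∃ i < s.v .tl, s.a .queue i = v

theorem Queue.congr {a b : ℕ} {s s' : St} (h : Queue D a b s) (h1 : s'.v .lb = s.v .lb)
    (h2 : s'.v .n = s.v .n) (h6 : s'.v .tl = s.v .tl) (ha : s'.a = s.a) (h5 : s'.io = s.io) :
    Queue D a b s' where
  toCtx := h.toCtx.congr h1 h2 (by rw [ha]) (by rw [ha]) h5
  lt := by rw [h6, ha]; exact h.lt
  inj := by rw [h6, ha]; exact h.inj
  pos := by rw [h6]; exact h.pos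
  zero := by rw [ha]; exact h.zero
  reach := by rw [h6, ha]; exact h.reach
  mark := by rw [h6, ha]; exact h.mark

theorem le_of_inj {n r : ℕ} {o : ℕ → ℕ} (hlt : ∀ i < r, o i < n)
    (hinj : ∀ i j, i < j → j < r → o i ≠ o j) : r ≤ n := by
  have := Finset.card_le_card_of_injOn (s := Finset.range r) (t := Finset.range n) o
    (fun i hi => by simpa using hlt i (by simpa using hi)) (fun i hi j hj he => by
      simp only [Finset.coe_range, Set.mem_Iio] at hi hj
      rcases lt_trichotomy i j with h1 | h1 | h1
      · exact absurd he (hinj i j h1 hj)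
      · exact h1
      · exact absurd he.symm (hinj j i h1 hi))
  simpa using this

theorem Queue.push {a b w : ℕ} {s : St} (h : Queue D a b s) (hw : w < D.n) (hwa : w ≠ a)
    (hr : Reach D.G₁ a b w) (hm : ¬ 0 < s.a .mark w) :
    Queue D a b (((s.setA .mark w 1).setA .queue (s.v .tl) w).setV .tl (s.v .tl + 1)) := by
  have hnew : ∀ i < s.v .tl, s.a .queue i ≠ w := fun i hi he =>
    hm ((h.mark w hw).2 (.inr ⟨i, hi, he⟩))
  have hq : ∀ i, ((s.setA .mark w 1).setA .queue (s.v .tl) w).a .queue i =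
      if i = s.v .tl then w else s.a .queue i := fun i => by
    simp [Function.update_apply]
  refine ⟨h.toCtx.congr (by simp) (by simp) (by simp) (by simp) rfl, ?_, ?_, ?_, ?_, ?_, ?_⟩
  all_goals simp only [St.setV_v, St.setV_a, if_true, hq]
  · intro i hi
    split_ifs with h1
    · exact hw
    · exact h.lt i (by omega)
  · intro i j hij hj
    rw [if_neg (by omega)]
    split_ifs with h1
    · exact hnew i (by omega)
    · exact h.inj i j hij (by omega)
  · omega
  · rw [if_neg h.pos.ne, h.zero]
  · intro i hi
    split_ifs with h1
    · exact hr
    · exact h.reach i (by omega)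
  · intro x hx
    have := h.mark x hx
    simp only [St.setA_a, reduceCtorEq, if_false, if_true, Function.update_apply]
    by_cases hxw : x = w
    · subst hxw
      simp only [if_true, Nat.zero_lt_one, true_iff]
      exact .inr ⟨s.v .tl, by omega, by simp⟩
    · rw [if_neg hxw, this]
      constructor
      · rintro (h1 | ⟨i, hi, hi'⟩)
        · exact .inl h1
        · exact .inr ⟨i, by omega, by rw [if_neg (by omega), hi']⟩
      · rintro (h1 | ⟨i, hi, hi'⟩)
        · exact .inl h1
        · split_ifs at hi' with h2
          · exact absurd hi'.symm hxw
          · exact .inr ⟨i, by omega, hi'⟩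

/-- The time is charged to the degrees of the vertices taken from the queue. These vertices are
distinct, so the total is bounded by `M`, without a term in `n`. -/
theorem wp_bfs (hE : Env D W N) {s : St} {a b : ℕ} (hC : Ctx D s) (hx : s.v .x = a)
    (hy : s.v .y = b) (hab : D.G₁.Adj a b) (hm : ∀ v < D.n, s.a .mark v = 0) :
    wp W N bfs s fun t s' => t ≤ 20 * D.M + 6 ∧ Queue D a b s' ∧
      ∀ w, Reach D.G₁ a b w → ∃ i < s'.v .tl, s'.a .queue i = w := by
  have hW := hE.n_le
  obtain ⟨ha, hb⟩ := D.lt' hab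
  simp only [bfs, wp_seq, wp_put, wp_set, Exp.eval, Exp.chk, true_and, St.setA_v, hx, hy]
  refine ⟨by omega, by omega, by omega, Nat.zero_le _, ?_⟩
  have hQ0 : Queue D a b (St.setV (St.setV (((s.setA .mark a 1).setA .mark b 1).setA .queue 0 b)
      .tl 1) .hd 0) := by
    refine ⟨hC.congr (by simp) (by simp) (by simp) (by simp) (by simp), ?_, ?_, ?_, ?_, ?_, ?_⟩
    · intro i hi
      simp at hi
      subst hi; simpa
    · intro i j hij hj
      simp at hj; omega
    · simp
    · simp
    · intro i hi
      simp at hi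
      subst hi; simpa using Reach.base
    · intro v hv
      simp only [St.setV_a, St.setV_v, St.setA_a, reduceCtorEq, if_true, if_false]
      simp only [Function.update_apply, hm v hv, Nat.lt_one_iff, exists_eq_left, if_true]
      split_ifs with h1 h2
      · simp [h1]
      · simp [h2]
      · simp; exact ⟨h2, fun h => h1 h.symm⟩
  refine wp_mono (wp_while (fun s => Queue D a b s ∧ s.v .hd ≤ s.v .tl ∧ s.v .x = a ∧
      ∀ i < s.v .hd, (i = 0 ∨ ¬ D.G₁.Adj a (s.a .queue i)) → ∀ w, D.G₁.Adj (s.a .queue i) w →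
        w ≠ a → ∃ i' < s.v .tl, s.a .queue i' = w)
    (fun s => 20 * (D.M - ∑ i ∈ Finset.range (s.v .hd), (D.nb₁ (s.a .queue i)).length))
    ⟨hQ0, by simp, by simpa, by simp⟩ ?_) ?_
  · rintro s ⟨hQ, hle, hx, hcl⟩ hlt
    simp only [Exp.eval] at hlt
    set h := s.v .hd with hh
    set u := s.a .queue h with hu
    have hun : u < D.n := hQ.lt h hlt
    have hur : Reach D.G₁ a b u := hQ.reach h hlt
    have htn : s.v .tl ≤ D.n := le_of_inj hQ.lt hQ.inj
    -- A reached vertex is not isolated, so the constant overhead of dequeuing it is covered by its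
    -- degree.
    have hdeg : 1 ≤ (D.nb₁ u).length := by
      obtain ⟨w, hw⟩ := hur.exists_adj hab
      rw [← D.mem₁] at hw
      exact List.length_pos_of_mem hw
    have hsum : ∑ i ∈ Finset.range (h + 1), (D.nb₁ (s.a .queue i)).length ≤ D.M :=
      D.sum_length_le (fun i j hij hj => hQ.inj i j hij (by omega))
        (fun i hi => hQ.lt i (by omega))
    rw [Finset.sum_range_succ, ← hu] at hsum
    -- the decision whether `u` is expanded
    have hgo : wp W N (.set .u (.a .queue (.v .hd)) ;; .set .go (.c 0) ;;
        .ite (.entry .mat .x .u) (.c 1) (.set .go (.c 1)) .skip ;;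
        .ite (.v .hd) (.c 1) (.set .go (.c 1)) .skip) s fun t s' => t = 6 ∧
          (0 < s'.v .go ↔ h = 0 ∨ ¬ D.G₁.Adj a u) ∧ s'.v .u = u ∧ s'.a = s.a ∧
          s'.io = s.io ∧ ∀ x, x ≠ .u → x ≠ .go → s'.v x = s.v x := by
      have hmat := hQ.mat a u ha hun
      simp [← hh, ← hu, hx, hQ.row a ha]
      refine ⟨fun h1 => ?_, fun h1 => ?_⟩
      · have : ¬ D.G₁.Adj a u := by rw [← hmat]; omega
        exact ⟨by omega, fun h2 => ⟨by omega, by simp [this], by simp +contextual⟩,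
          fun h2 => ⟨by simp [this], by simp +contextual⟩⟩
      · have : D.G₁.Adj a u := by rw [← hmat]; omega
        exact ⟨fun h2 => ⟨by omega, by simp [h2], by simp +contextual⟩,
          fun h2 => ⟨⟨h2, this⟩, by simp +contextual⟩⟩
    simp only [wp_seq] at hgo ⊢
    refine wp_mono hgo fun t₁ s₁ h₁ => wp_mono h₁ fun t₂ s₂ h₂ => wp_mono h₂ fun t₃ s₃ h₃ =>
      wp_mono h₃ fun t₄ s₄ h₄ => ?_
    obtain ⟨ht, hgo, hu4, ha4, hio4, hv4⟩ := h₄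
    have hQ4 : Queue D a b s₄ := hQ.congr (hv4 _ (by simp) (by simp)) (hv4 _ (by simp) (by simp))
      (hv4 _ (by simp) (by simp)) ha4 hio4
    -- the expansion
    have hexp : wp W N (.ite (.c 0) (.v .go)
        (forNb .p' .e' .w .u
          (.ite (.a .mark (.v .w)) (.c 1)
            (.put .mark (.v .w) (.c 1) ;; .put .queue (.v .tl) (.v .w) ;; inc .tl) .skip))
        .skip) s₄ fun t s' => t ≤ (D.nb₁ u).length * 8 + 4 ∧ Queue D a b s' ∧
          s.v .tl ≤ s'.v .tl ∧ (∀ i < s.v .tl, s'.a .queue i = s.a .queue i) ∧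
          ((h = 0 ∨ ¬ D.G₁.Adj a u) → ∀ w, D.G₁.Adj u w → w ≠ a →
            ∃ i' < s'.v .tl, s'.a .queue i' = w) := by
      rw [wp_ite]
      constructor
      · intro hg
        have hcond := hgo.1 hg
        refine wp_mono (wp_forNb_const hE hun hu4 hQ4.toIo (fun j s' => Queue D a b s' ∧
          s.v .tl ≤ s'.v .tl ∧ (∀ i < s.v .tl, s'.a .queue i = s.a .queue i) ∧
          ∀ i < j, D.nbr u i ≠ a →
            ∃ i' < s'.v .tl, s'.a .queue i' = D.nbr u i) 5
          (by simp) (by simp) (by simp) (by simp) (by simp [Cmd.wv, inc])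
          (by simp [Cmd.wv, inc]) (by simp) (by simp)
          ⟨hQ4, by rw [hv4 _ (by simp) (by simp)], by simp [ha4], by simp⟩
          (fun j s' c ⟨h1, h2⟩ => ⟨h1.congr (by simp) (by simp) (by simp) rfl rfl, by simpa⟩)
          (fun j s' c ⟨h1, h2⟩ => ⟨h1.congr (by simp) (by simp) (by simp) rfl rfl, by simpa⟩)
          (fun j s' h1 => h1.1.toIo) ?_) ?_
        · rintro j s' hj ⟨hQ', hle', hpre, hall⟩
          set w := D.nbr u j with hw
          have huw : D.G₁.Adj u w := D.getD_adj hj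
          have hwn := (D.lt' huw).2
          have htn' : s'.v .tl ≤ D.n := le_of_inj hQ'.lt hQ'.inj
          have hQw : Queue D a b (s'.setV .w w) :=
            hQ'.congr (by simp) (by simp) (by simp) rfl rfl
          simp only [wp_ite, wp_seq, wp_put, inc, wp_set, Exp.eval, Exp.chk, wp_skip, St.setV_v,
            St.setV_a, St.setA_v, if_true, true_and, reduceCtorEq, if_false]
          refine ⟨fun hm => ⟨by omega, by omega, by omega, ?_⟩, fun hm => ⟨by omega, ?_⟩⟩
          · have hm' : ¬ 0 < s'.a .mark w := by omega
            have hwa : w ≠ a := fun h => hm' ((hQ'.mark w hwn).2 (.inl h))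
            have hr : Reach D.G₁ a b w := by
              refine hur.step ?_ huw hwa
              refine hcond.imp (fun h0 => ?_) id
              rw [hu, h0, hQ.zero]
            refine ⟨?_, ?_, ?_, ?_⟩
            · exact hQw.push hwn hwa hr hm'
            · omega
            · intro i hi
              simp [Function.update_apply, hpre i hi]; omega
            · intro i hi hia
              rcases Nat.lt_succ_iff_lt_or_eq.1 hi with h1 | rfl
              · obtain ⟨i', h2, h3⟩ := hall i h1 hia
                exact ⟨i', by simp; omega, by
                  simp [Function.update_apply]; rw [if_neg (by omega), h3]⟩
              · exact ⟨s'.v .tl, by simp, by simp [hw]⟩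
          · refine ⟨hQw, by simpa, by simpa, fun i hi hia => ?_⟩
            rcases Nat.lt_succ_iff_lt_or_eq.1 hi with h1 | rfl
            · simpa using hall i h1 hia
            · simpa using ((hQ'.mark w hwn).1 (by omega)).resolve_left hia
        · rintro t s' ⟨ht, h1, h2, h3, h4⟩
          refine ⟨by omega, h1, h2, h3, fun _ w huw hwa => ?_⟩
          obtain ⟨j, hj, rfl⟩ := D.exists_getD huw
          exact h4 j hj hwa
      · intro hg
        have hcond := hgo.not.1 hg
        rw [wp_skip]
        exact ⟨by omega, hQ4, by rw [hv4 _ (by simp) (by simp)], by simp [ha4],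
          fun h => absurd h hcond⟩
    refine wp_mono (wp_frame hexp) ?_
    rintro t₅ s₅ ⟨⟨ht5, hQ5, hle5, hpre5, hcl5⟩, hk⟩
    have hhd : s₅.v .hd = h := by
      rw [hk.v .hd (by simp [Cmd.wv, forNb, loop, inc]), hv4 _ (by simp) (by simp)]
    have hx5 : s₅.v .x = a := by
      rw [hk.v .x (by simp [Cmd.wv, forNb, loop, inc]), hv4 _ (by simp) (by simp), hx]
    have htn5 : s₅.v .tl ≤ D.n := le_of_inj hQ5.lt hQ5.inj
    simp only [inc, wp_set, Exp.chk, Exp.eval, hhd, St.setV_v, St.setV_a, if_true]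
    refine ⟨by omega, ⟨hQ5.congr (by simp) (by simp) (by simp) rfl rfl, by simp; omega,
      by simpa, ?_⟩, ?_⟩
    · intro i hi hcond w hw hwa
      simp only [reduceCtorEq, if_false]
      rcases Nat.lt_succ_iff_lt_or_eq.1 hi with h1 | rfl
      · rw [hpre5 i (by omega)] at hcond hw
        obtain ⟨i', h2, h3⟩ := hcl i h1 hcond w hw hwa
        exact ⟨i', by omega, by rw [hpre5 _ h2, h3]⟩
      · rw [hpre5 h hlt, ← hu] at hcond hw
        exact hcl5 hcond w hw hwa
    · have hsum5 : ∑ i ∈ Finset.range (h + 1), (D.nb₁ (s₅.a .queue i)).length =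
          ∑ i ∈ Finset.range h, (D.nb₁ (s.a .queue i)).length + (D.nb₁ u).length := by
        rw [Finset.sum_range_succ, hpre5 h hlt]
        congr 1
        refine Finset.sum_congr rfl fun i hi => ?_
        rw [hpre5 i (by have := Finset.mem_range.1 hi; omega)]
      rw [hsum5]
      omega
  · rintro t s' ⟨ht, ⟨hQ, hle, hx, hcl⟩, hn⟩
    simp only [Exp.eval] at hn
    refine ⟨?_, hQ, fun w hw => ?_⟩
    · simp at ht; omega
    · induction hw with
      | base => exact ⟨0, hQ.pos, hQ.zero⟩
      | @step v w hv h huw hwa ih =>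
        obtain ⟨i, hi, rfl⟩ := ih
        -- The program recognizes `b` by its position 0 in the queue; as queue entries are distinct,
        -- no other position holds `b`.
        refine hcl i (by omega) (h.imp_left fun h0 => ?_) w huw hwa
        by_contra hi0
        exact hQ.inj 0 i (by omega) hi (by rw [hQ.zero, h0])

end

/-! ### Enumeration of hits -/

/-- Run `act` for all `z` in the queue such that `Hit G₁ x y z`, and clear the marks. -/
def visit (act : Cmd) : Cmd :=
  forTo .it (.v .tl) (.set .z (.a .queue (.v .it)) ;; .put .mark (.v .z) (.c 0) ;;
    .ite (.c 0) (.entry .mat .x .z) (.ite (.entry .mat .y .z) (.c 1)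
      (.ite (.c 0) (.v .it) act .skip) .skip) .skip) ;;
  .put .mark (.v .x) (.c 0)

/-- Run `act` for all `x` outside of `A` and all `z` such that `Hit G₁ x y z`. -/
def search (act : Cmd) : Cmd :=
  forNb .p .e .x .y (.ite (.a .inA (.v .x)) (.c 1) (bfs ;; visit act) .skip)

/-- Run `act` for all `x` outside of `A`, all `y` in `A` and all `z` such that
`Hit G₁ x y z`. -/
def searchA (act : Cmd) : Cmd :=
  forTo .ia (.v .na) (.set .y (.a .alist (.v .ia)) ;; search act)

/-- The variables that are modified by a search. -/
def scratchV : List Var := [.y, .ia, .p, .e, .x, .z, .p', .e', .u, .w, .hd, .tl, .go, .it]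

/-- A property that does not depend on what a search modifies. -/
def Stable (J : St → Prop) : Prop :=
  ∀ s s', (∀ v, v ∉ scratchV → s'.v v = s.v v) →
    (∀ j, j ≠ .mark → j ≠ .queue → s'.a j = s.a j) → J s → J s'

/-- An action that may be taken for each hit. -/
structure IsAct (act : Cmd) : Prop where
  v : ∀ v ∈ [Var.lb, .n, .na] ++ scratchV, v ∉ act.wv
  a : ∀ j ∈ [Arr.row, .mat, .mark, .queue, .inA, .alist], j ∉ act.wa
  io : act.wio = false

/-- The search is prepared. -/
structure Mid (D : Input) (A : Set ℕ) (s : St) : Prop extends Ctx D s where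
  inA : ∀ v < D.n, 0 < s.a .inA v ↔ v ∈ A
  mark : ∀ v < D.n, s.a .mark v = 0

section
variable {D : Input} {W N : ℕ} {A Y : Set ℕ} {act : Cmd}
  {J : Finset (ℕ × ℕ × ℕ) → St → Prop}

/-- The finite set `T` is a ghost: it records the hits handled so far, and `(x, y, z) ∉ T`
guarantees that each is handled once, which matters for counting. Marks are erased only at vertices
in the queue and at `x`, so a search never pays for clearing the whole array. -/
theorem wp_visit (hE : Env D W N) (hact : IsAct act) (hJ : ∀ T, Stable (J T))
    (step : ∀ T s x y z, J T s → Ctx D s → s.v .x = x → s.v .y = y → s.v .z = z → x ∉ A → y ∈ Y →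
      Hit D.G₁ x y z → (∀ v < D.n, 0 < s.a .inA v ↔ v ∈ A) → (x, y, z) ∉ T →
      wp W N act s fun t s' => t ≤ 8 ∧ J (insert (x, y, z) T) s')
    {s : St} {a b : ℕ} {T : Finset (ℕ × ℕ × ℕ)} (hbY : b ∈ Y) (hQ : Queue D a b s)
    (hcomp : ∀ w, Reach D.G₁ a b w → ∃ i < s.v .tl, s.a .queue i = w) (hx : s.v .x = a)
    (hy : s.v .y = b) (hab : D.G₁.Adj a b) (hA : ∀ v < D.n, 0 < s.a .inA v ↔ v ∈ A)
    (haA : a ∉ A) (hT : ∀ z, (a, b, z) ∉ T) (hJs : J T s) :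
    wp W N (visit act) s fun t s' => t ≤ 15 * D.n + 3 ∧ Mid D A s' ∧ s'.v .y = b ∧
      ∃ T', J T' s' ∧ ∀ x y z, (x, y, z) ∈ T' ↔
        (x, y, z) ∈ T ∨ (x = a ∧ y = b ∧ Hit D.G₁ a b z) := by
  have hW := hE.n_le
  have htn : s.v .tl ≤ D.n := le_of_inj hQ.lt hQ.inj
  obtain ⟨ha, hb⟩ := D.lt' hab
  have hmv : ∀ v, v ∈ [Var.lb, .n, .na] ++ scratchV → v ∉ act.wv := hact.v
  rw [visit, wp_seq]
  refine wp_mono (wp_forTo_const (s.v .tl) 13 (fun j s' => Ctx D s' ∧ s'.v .x = a ∧ s'.v .y = b ∧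
    s'.v .tl = s.v .tl ∧ s'.a .queue = s.a .queue ∧ (∀ v < D.n, 0 < s'.a .inA v ↔ v ∈ A) ∧
    (∀ v < D.n, s'.a .mark v = 0 ∨ v = a ∨ ∃ i, j ≤ i ∧ i < s.v .tl ∧ s.a .queue i = v) ∧
    ∃ T', J T' s' ∧ ∀ x y z, (x, y, z) ∈ T' ↔ (x, y, z) ∈ T ∨
      (x = a ∧ y = b ∧ Hit D.G₁ a b z ∧ ∃ i < j, s.a .queue i = z)) (by omega) ?_ ?_ ?_ ?_) ?_
  · have := hmv .it (by decide)
    simpa [Cmd.wv] using this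
  · refine ⟨hQ.toCtx.congr (by simp) (by simp) rfl rfl rfl, by simpa, by simpa, by simp, rfl,
      by simpa, fun v hv => ?_, T, hJ _ s _ (fun v hv => ?_) (fun _ _ _ => rfl) hJs, by simp⟩
    · by_cases h : 0 < s.a .mark v
      · rcases (hQ.mark v hv).1 h with h | ⟨i, hi, h⟩
        · exact .inr (.inl h)
        · exact .inr (.inr ⟨i, by omega, hi, h⟩)
      · exact .inl (by simp; omega)
    · have : v ≠ .it := by rintro rfl; exact hv (by decide)
      simp [this]
  · rintro j s' ⟨-, -, -, h, -⟩
    simpa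
  · rintro j s' hj ⟨hC, hx', hy', htl, hq, hA', hmark, T', hJ', hT'⟩ hit
    set c := s.a .queue j with hc
    have hcn : c < D.n := hQ.lt j hj
    simp only [wp_seq, wp_set, wp_put, Exp.eval, Exp.chk, hit, hq, ← hc, true_and, St.setV_v,
      St.setV_a, if_true]
    refine ⟨Nat.zero_le _, ?_⟩
    set s₁ := (s'.setV .z c).setA .mark c 0 with hs1
    have hC1 : Ctx D s₁ := hC.congr (by simp [s₁]) (by simp [s₁]) (by simp [s₁]) (by simp [s₁]) rfl
    have hst : ∀ s₂ : St, (∀ v, v ∉ scratchV → s₂.v v = s₁.v v) →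
        (∀ j, j ≠ .mark → j ≠ .queue → s₂.a j = s₁.a j) → J T' s₂ := fun s₂ h1 h2 => by
      refine hJ _ s' _ (fun v hv => ?_) (fun k h3 h4 => ?_) hJ'
      · have : v ≠ .z := by rintro rfl; exact hv (by decide)
        simp [h1 v hv, s₁, this]
      · simp [h2 k h3 h4, s₁, h3]
    have hm1 : ∀ v < D.n, s₁.a .mark v = 0 ∨ v = a ∨
        ∃ i, j + 1 ≤ i ∧ i < s.v .tl ∧ s.a .queue i = v := by
      intro v hv
      by_cases hvc : v = c
      · left; simp [s₁, hvc]
      · rcases hmark v hv with h | h | ⟨i, h1, h2, h3⟩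
        · left; simp [s₁, hvc, Function.update_apply, h]
        · exact .inr (.inl h)
        · refine .inr (.inr ⟨i, ?_, h2, h3⟩)
          rcases h1.eq_or_lt with rfl | h1
          · exact absurd h3.symm hvc
          · exact h1
    -- the end of the body
    have hend : ∀ s₂ T₂, (∀ v ∈ [Var.lb, .n, .na, .x, .y, .tl], s₂.v v = s₁.v v) →
        (∀ j ∈ [Arr.row, .mat, .mark, .queue, .inA, .alist], s₂.a j = s₁.a j) →
        s₂.io = s₁.io → J T₂ s₂ → (∀ x y z, (x, y, z) ∈ T₂ ↔ (x, y, z) ∈ T ∨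
          (x = a ∧ y = b ∧ Hit D.G₁ a b z ∧ ∃ i < j + 1, s.a .queue i = z)) →
        (fun s' : St => Ctx D s' ∧ s'.v .x = a ∧ s'.v .y = b ∧
          s'.v .tl = s.v .tl ∧ s'.a .queue = s.a .queue ∧ (∀ v < D.n, 0 < s'.a .inA v ↔ v ∈ A) ∧
          (∀ v < D.n, s'.a .mark v = 0 ∨ v = a ∨ ∃ i, j + 1 ≤ i ∧ i < s.v .tl ∧ s.a .queue i = v) ∧
          ∃ T', J T' s' ∧ ∀ x y z, (x, y, z) ∈ T' ↔ (x, y, z) ∈ T ∨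
            (x = a ∧ y = b ∧ Hit D.G₁ a b z ∧ ∃ i < j + 1, s.a .queue i = z))
          (s₂.setV .it (j + 1)) := by
      intro s₂ T₂ h1 h2 h3 h4 h5
      refine ⟨hC1.congr ?_ ?_ ?_ ?_ ?_, ?_, ?_, ?_, ?_, ?_, ?_, T₂, ?_, h5⟩
      · simp [h1 .lb (by decide)]
      · simp [h1 .n (by decide)]
      · simp [h2 .row (by decide)]
      · simp [h2 .mat (by decide)]
      · simpa using h3
      · simp [h1 .x (by decide), s₁, hx']
      · simp [h1 .y (by decide), s₁, hy']
      · simp [h1 .tl (by decide), s₁, htl]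
      · simp [h2 .queue (by decide), s₁, hq]
      · simpa [h2 .inA (by decide), s₁] using hA'
      · simpa only [h2 .mark (by decide), St.setV_a] using hm1
      · refine hJ _ s₂ _ (fun v hv => ?_) (fun _ _ _ => rfl) h4
        have : v ≠ .it := by rintro rfl; exact hv (by decide)
        simp [this]
    have hskip : ¬ Hit D.G₁ a b c → ∀ x y z, (x, y, z) ∈ T' ↔ (x, y, z) ∈ T ∨
        (x = a ∧ y = b ∧ Hit D.G₁ a b z ∧ ∃ i < j + 1, s.a .queue i = z) := by
      intro hn x y z
      rw [hT']
      refine or_congr_right (and_congr_right fun _ => and_congr_right fun _ =>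
        and_congr_right fun hh => ⟨fun ⟨i, h1, h2⟩ => ⟨i, by omega, h2⟩, fun ⟨i, h1, h2⟩ => ?_⟩)
      rcases Nat.lt_succ_iff_lt_or_eq.1 h1 with h1 | rfl
      · exact ⟨i, h1, h2⟩
      · rw [← h2, ← hc] at hh; exact absurd hh hn
    have hmata := hC1.mat a c ha hcn
    have hmatb := hC1.mat b c hb hcn
    have hx1 : s₁.v .x = a := by simp [s₁, hx']
    have hy1 : s₁.v .y = b := by simp [s₁, hy']
    have hz1 : s₁.v .z = c := by simp [s₁]
    have hit1 : s₁.v .it = j := by simp [s₁, hit]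
    have hA1 : ∀ v < D.n, 0 < s₁.a .inA v ↔ v ∈ A := by simpa [s₁] using hA'
    have hreach : Reach D.G₁ a b c := hQ.reach j hj
    -- This justifies testing the queue position instead of comparing the vertices.
    have hbc : b ≠ c ↔ 0 < j := by
      rw [← hQ.zero, hc]
      constructor
      · intro h
        by_contra h0
        exact h (by rw [show j = 0 by omega])
      · intro h
        exact hQ.inj 0 j h hj
    simp only [wp_ite, wp_skip, Exp.eval, Exp.eval_entry, hx1, hy1, hz1, hit1, hC1.row a ha,
      hC1.row b hb]
    have hs : J T' s₁ := hst s₁ (fun _ _ => rfl) (fun _ _ _ => rfl)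
    have hfin : ¬ Hit D.G₁ a b c → _ := fun hn =>
      hend s₁ T' (fun _ _ => rfl) (fun _ _ => rfl) rfl hs (hskip hn)
    refine ⟨fun h1 => ⟨fun h2 => ⟨fun h3 => ?_, fun h3 => ?_⟩, fun h2 => ?_⟩, fun h1 => ?_⟩
    · have hhit : Hit D.G₁ a b c :=
        (hit_iff_reach hab).2 ⟨hmata.1 h1, hbc.2 h3, fun h => by
          have := hmatb.2 h
          omega, hreach⟩
      refine wp_mono (wp_frame (step T' s₁ a b c hs hC1 hx1 hy1 hz1 haA hbY hhit hA1 ?_)) ?_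
      · rw [hT']
        rintro (h | ⟨-, -, -, i, hi, h⟩)
        · exact hT _ h
        · exact hQ.inj i j hi hj h
      · rintro t s₂ ⟨⟨ht, hJ2⟩, hk⟩
        refine ⟨by omega, hend s₂ _ (fun v hv => hk.v v (hmv v ?_))
          (fun j hj => hk.a j (hact.a j hj)) (hk.io hact.io) hJ2 ?_⟩
        · revert hv; revert v; decide
        · intro x y z
          rw [Finset.mem_insert, hT']
          simp only [Prod.mk.injEq]
          constructor
          · rintro (⟨rfl, rfl, rfl⟩ | h | ⟨h7, h8, h9, i, h4, h5⟩)
            · exact .inr ⟨rfl, rfl, hhit, j, by omega, rfl⟩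
            · exact .inl h
            · exact .inr ⟨h7, h8, h9, i, by omega, h5⟩
          · rintro (h | ⟨h7, h8, h9, i, h4, h5⟩)
            · exact .inr (.inl h)
            · rcases Nat.lt_succ_iff_lt_or_eq.1 h4 with h4 | rfl
              · exact .inr (.inr ⟨h7, h8, h9, i, h4, h5⟩)
              · exact .inl ⟨h7, h8, h5.symm⟩
    · refine ⟨by omega, ?_⟩
      simpa only [St.setV_v, St.setV_a, hx1, hy1] using hfin fun h => h3 (hbc.1 h.2.2.1)
    · refine ⟨by omega, ?_⟩
      simpa only [St.setV_v, St.setV_a, hx1, hy1] using hfin fun h => h.2.2.2.1 (hmatb.1 (by omega))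
    · refine ⟨by omega, ?_⟩
      simpa only [St.setV_v, St.setV_a, hx1, hy1] using hfin fun h => h1 (hmata.2 h.2.1)
  · rintro t s' ⟨ht, ⟨hC, hx', hy', htl, hq, hA', hmark, T', hJ', hT'⟩, -⟩
    simp only [wp_put, Exp.eval, Exp.chk, hx']
    refine ⟨Nat.zero_le _, ?_, ⟨hC.congr rfl rfl (by simp) (by simp) rfl, by simpa, ?_⟩, by simpa,
      T', hJ _ s' _ (fun _ _ => rfl) (fun k h _ => by simp [h]) hJ', fun x y z => ?_⟩
    · nlinarith
    · intro v hv
      by_cases hva : v = a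
      · simp [hva]
      · rcases hmark v hv with h | h | ⟨i, h1, h2, -⟩
        · simp [Function.update_apply, h]
        · exact absurd h hva
        · omega
    · rw [hT']
      refine or_congr_right (and_congr_right fun _ => and_congr_right fun _ => ?_)
      refine ⟨fun h => h.1, fun h => ⟨h, hcomp z ((hit_iff_reach hab).1 h).2.2.2⟩⟩

/-- One breadth-first search and one pass over the queue per neighbour of `b` cost `O(M + n)`. The
degree of `b` is at most `n` and at most `M`; using the first bound for the term in `M` and the
second for the term in `n` gives `O(n (M + 1))`. -/
theorem wp_search (hE : Env D W N) (hact : IsAct act) (hJ : ∀ T, Stable (J T))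
    (step : ∀ T s x y z, J T s → Ctx D s → s.v .x = x → s.v .y = y → s.v .z = z → x ∉ A → y ∈ Y →
      Hit D.G₁ x y z → (∀ v < D.n, 0 < s.a .inA v ↔ v ∈ A) → (x, y, z) ∉ T →
      wp W N act s fun t s' => t ≤ 8 ∧ J (insert (x, y, z) T) s')
    {s : St} {b : ℕ} {T : Finset (ℕ × ℕ × ℕ)} (hM : Mid D A s) (hb : b < D.n) (hbY : b ∈ Y)
    (hy : s.v .y = b) (hT : ∀ x z, (x, b, z) ∉ T) (hJs : J T s) :
    wp W N (search act) s fun t s' => t ≤ 60 * (D.n * (D.M + 1)) ∧ Mid D A s' ∧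
      ∃ T', J T' s' ∧ ∀ x y z, (x, y, z) ∈ T' ↔
        (x, y, z) ∈ T ∨ (x ∉ A ∧ y = b ∧ Hit D.G₁ x b z) := by
  have hdegM : (D.nb₁ b).length ≤ D.M := by
    have := D.off₁_mono (i := b + 1) (j := D.n) hb
    rw [D.off₁_succ] at this
    exact (Nat.le_add_left _ _).trans this
  have hdegn := D.length_nb₁_le b
  have hJv : ∀ T s (v : Var) c, v ∈ scratchV → J T s → J T (s.setV v c) := by
    intro T s v c hv h
    refine hJ _ s _ (fun v' hv' => ?_) (fun _ _ _ => rfl) h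
    have : v' ≠ v := by rintro rfl; exact hv' hv
    simp [this]
  have hMv : ∀ s (v : Var) c, v ∈ scratchV → Mid D A s → Mid D A (s.setV v c) := by
    intro s v c hv h
    refine ⟨h.toCtx.congr ?_ ?_ rfl rfl rfl, h.inA, h.mark⟩
    · have : Var.lb ≠ v := by rintro rfl; revert hv; decide
      simp [this]
    · have : Var.n ≠ v := by rintro rfl; revert hv; decide
      simp [this]
  have hwv : (Cmd.ite (.a .inA (.v .x)) (.c 1) (bfs ;; visit act) .skip).wv =
      bfs.wv ++ [.it, .z] ++ act.wv ++ [.it] := by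
    simp [Cmd.wv, visit, forTo, loop, inc]
  have hp : ∀ v ∈ [Var.p, .e], v ∉ bfs.wv ++ [.it, .z] ++ [.it] := by decide
  refine wp_mono (wp_forNb_const hE hb hy hM.toIo (fun j s' => Mid D A s' ∧ s'.v .y = b ∧
    ∃ T', J T' s' ∧ ∀ x y z, (x, y, z) ∈ T' ↔ (x, y, z) ∈ T ∨
      (x ∉ A ∧ y = b ∧ Hit D.G₁ x b z ∧ ∃ i < j, D.nbr b i = x)) (20 * D.M + 15 * D.n + 10)
    (by simp) (by simp) (by simp) (by simp) ?_ ?_ (by simp) (by simp) ?_ ?_ ?_ ?_ ?_) ?_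
  · rw [hwv]
    have h1 := hp .p (by decide)
    have h2 := hact.v .p (by decide)
    simp only [List.mem_append, not_or] at h1 ⊢
    exact ⟨⟨h1.1, h2⟩, h1.2⟩
  · rw [hwv]
    have h1 := hp .e (by decide)
    have h2 := hact.v .e (by decide)
    simp only [List.mem_append, not_or] at h1 ⊢
    exact ⟨⟨h1.1, h2⟩, h1.2⟩
  · exact ⟨hM, hy, T, hJs, by simp⟩
  · rintro j s' c ⟨h1, h2, T', h3, h4⟩
    exact ⟨hMv _ _ _ (by decide) h1, by simpa, T', hJv _ _ _ _ (by decide) h3, h4⟩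
  · rintro j s' c ⟨h1, h2, T', h3, h4⟩
    exact ⟨hMv _ _ _ (by decide) h1, by simpa, T', hJv _ _ _ _ (by decide) h3, h4⟩
  · rintro j s' h
    exact h.1.toIo
  · rintro j s' hj ⟨hM', hy', T', hJ', hT'⟩
    set a := D.nbr b j with ha
    have hab : D.G₁.Adj a b := (D.getD_adj hj).symm
    have han := (D.lt' hab).1
    have hM1 : Mid D A (s'.setV .x a) := hMv _ _ _ (by decide) hM'
    have hJ1 : J T' (s'.setV .x a) := hJv _ _ _ _ (by decide) hJ'
    have hx1 : (s'.setV .x a).v .x = a := by simp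
    have hy1 : (s'.setV .x a).v .y = b := by simpa
    have hinA := hM1.inA a han
    simp only [wp_ite, wp_seq, wp_skip, Exp.eval, hx1]
    refine ⟨fun h => ?_, fun h => ⟨by omega, hM1, hy1, T', hJ1, fun x y z => ?_⟩⟩
    · have haA : a ∉ A := by rw [← hinA]; omega
      refine wp_mono (wp_frame (wp_bfs hE hM1.toCtx hx1 hy1 hab hM1.mark)) ?_
      rintro t₂ s₂ ⟨⟨ht2, hQ, hcomp⟩, hk⟩
      have hb1 : ∀ v ∈ bfs.wv, v ∈ scratchV := by decide
      have hb2 : ∀ j ∈ bfs.wa, j = .mark ∨ j = .queue := by decide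
      have hJ2 : J T' s₂ := hJ _ _ _ (fun v hv => hk.v v (mt (hb1 v) hv))
        (fun j h1 h2 => hk.a j (mt (hb2 j) (by simp [h1, h2]))) hJ1
      refine wp_mono (wp_visit hE hact hJ step hbY hQ hcomp (by rw [hk.v _ (by decide), hx1])
        (by rw [hk.v _ (by decide), hy1]) hab (by rw [hk.a _ (by decide)]; exact hM1.inA) haA
        (fun z => ?_) hJ2) ?_
      · rw [hT']
        rintro (h | ⟨-, -, -, i, hi, h⟩)
        · exact hT _ _ h
        · exact absurd (D.getD_inj (by omega) hj h) (by omega)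
      · rintro t₃ s₃ ⟨ht3, hM3, hy3, T₃, hJ3, hT3⟩
        refine ⟨by omega, hM3, hy3, T₃, hJ3, fun x y z => ?_⟩
        rw [hT3, hT']
        constructor
        · rintro ((h | ⟨h1, h2, h3, i, hi, h4⟩) | ⟨rfl, h2, h3⟩)
          · exact .inl h
          · exact .inr ⟨h1, h2, h3, i, by omega, h4⟩
          · exact .inr ⟨haA, h2, h3, j, by omega, ha.symm⟩
        · rintro (h | ⟨h1, h2, h3, i, hi, h4⟩)
          · exact .inl (.inl h)
          · rcases Nat.lt_succ_iff_lt_or_eq.1 hi with hi | rfl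
            · exact .inl (.inr ⟨h1, h2, h3, i, hi, h4⟩)
            · rw [← ha] at h4
              subst h4
              exact .inr ⟨rfl, h2, h3⟩
    · have haA : a ∈ A := by rw [← hinA]; omega
      rw [hT']
      refine or_congr_right (and_congr_right fun hxA => and_congr_right fun _ =>
        and_congr_right fun hh => ⟨fun ⟨i, h1, h2⟩ => ⟨i, by omega, h2⟩, fun ⟨i, h1, h2⟩ => ?_⟩)
      rcases Nat.lt_succ_iff_lt_or_eq.1 h1 with h1 | rfl
      · exact ⟨i, h1, h2⟩
      · rw [← ha] at h2
        exact absurd (h2 ▸ haA) hxA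
  · rintro t s' ⟨ht, hM', hy', T', hJ', hT'⟩
    refine ⟨?_, hM', T', hJ', fun x y z => ?_⟩
    · nlinarith
    · rw [hT']
      refine or_congr_right (and_congr_right fun _ => and_congr_right fun _ =>
        ⟨fun h => h.1, fun h => ⟨h, ?_⟩⟩)
      obtain ⟨i, hi, h⟩ := D.exists_getD h.1.symm
      exact ⟨i, hi, h⟩

/-- The array `alist` lists the elements of `A`. -/
structure AList (D : Input) (A : Set ℕ) (s : St) : Prop where
  lt : ∀ i < s.v .na, s.a .alist i < D.n
  inj : ∀ i j, i < j → j < s.v .na → s.a .alist i ≠ s.a .alist j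
  mem : ∀ v, v ∈ A ↔ ∃ i < s.v .na, s.a .alist i = v

theorem AList.congr {s s' : St} (h : AList D A s) (h1 : s'.v .na = s.v .na)
    (h2 : s'.a .alist = s.a .alist) : AList D A s' where
  lt := by rw [h1, h2]; exact h.lt
  inj := by rw [h1, h2]; exact h.inj
  mem := by rw [h1, h2]; exact h.mem

theorem AList.le {s : St} (h : AList D A s) : s.v .na ≤ D.n := le_of_inj h.lt h.inj

theorem search_wv : ∀ v, v ∈ (search act).wv → v ∈ scratchV.erase .ia ∨ v ∈ act.wv := by
  intro v hv
  have h1 : (search act).wv = [.p, .e, .x] ++ bfs.wv ++ [.it, .z] ++ act.wv ++ [.it, .p] := by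
    simp [search, forNb, loop, inc, Cmd.wv, visit, forTo]
  have h2 : ∀ v, v ∈ [.p, .e, .x] ++ bfs.wv ++ [.it, .z] → v ∈ scratchV.erase .ia := by decide
  have h3 : ∀ v, v ∈ [.it, .p] → v ∈ scratchV.erase .ia := by decide
  rw [h1, List.mem_append, List.mem_append] at hv
  rcases hv with (hv | hv) | hv
  · exact .inl (h2 v hv)
  · exact .inr hv
  · exact .inl (h3 v hv)

theorem search_wa : ∀ j, j ∈ (search act).wa → j = .mark ∨ j = .queue ∨ j ∈ act.wa := by
  intro j hj
  have h1 : (search act).wa = bfs.wa ++ [.mark] ++ act.wa ++ [.mark] := by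
    simp [search, forNb, loop, inc, Cmd.wa, visit, forTo]
  have h2 : ∀ j, j ∈ bfs.wa ++ [.mark] → j = .mark ∨ j = .queue := by decide
  rw [h1, List.mem_append, List.mem_append] at hj
  rcases hj with (hj | hj) | hj
  · rcases h2 j hj with h | h
    · exact .inl h
    · exact .inr (.inl h)
  · exact .inr (.inr hj)
  · exact .inl (by simpa using hj)

theorem wp_searchA (hE : Env D W N) (hact : IsAct act) (hJ : ∀ T, Stable (J T))
    (step : ∀ T s x y z, J T s → Ctx D s → s.v .x = x → s.v .y = y → s.v .z = z → x ∉ A → y ∈ A →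
      Hit D.G₁ x y z → (∀ v < D.n, 0 < s.a .inA v ↔ v ∈ A) → (x, y, z) ∉ T →
      wp W N act s fun t s' => t ≤ 8 ∧ J (insert (x, y, z) T) s')
    {s : St} (hM : Mid D A s) (hA : AList D A s) (hJs : J ∅ s) :
    wp W N (searchA act) s fun t s' => t ≤ s.v .na * (63 * (D.n * (D.M + 1))) + 2 ∧ Mid D A s' ∧
      ∃ T', J T' s' ∧ ∀ x y z, (x, y, z) ∈ T' ↔ x ∉ A ∧ y ∈ A ∧ Hit D.G₁ x y z := by
  have hW := hE.n_le
  have hle := hA.le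
  refine wp_mono (wp_forTo_const (s.v .na) (60 * (D.n * (D.M + 1)) + 1)
    (fun j s' => Mid D A s' ∧ s'.v .na = s.v .na ∧ s'.a .alist = s.a .alist ∧
      ∃ T', J T' s' ∧ ∀ x y z, (x, y, z) ∈ T' ↔ x ∉ A ∧ (∃ i < j, s.a .alist i = y) ∧
        Hit D.G₁ x y z) (by omega) ?_ ?_ ?_ ?_) ?_
  · have h1 := @search_wv act .ia
    have h2 := hact.v .ia (by decide)
    simp only [Cmd.wv, List.mem_append, List.mem_singleton, reduceCtorEq, false_or]
    intro h
    rcases h1 h with h | h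
    · revert h; decide
    · exact h2 h
  · refine ⟨⟨hM.toCtx.congr (by simp) (by simp) rfl rfl rfl, hM.inA, hM.mark⟩, by simp, rfl, ∅,
      hJ _ s _ (fun v hv => ?_) (fun _ _ _ => rfl) hJs, by simp⟩
    have : v ≠ .ia := by rintro rfl; exact hv (by decide)
    simp [this]
  · rintro j s' ⟨-, h, -⟩
    exact h
  · rintro j s' hj ⟨hM', hna, hal, T', hJ', hT'⟩ hia
    set b := s.a .alist j with hb
    have hbn : b < D.n := hA.lt j hj
    simp only [wp_seq, wp_set, Exp.chk, Exp.eval, true_and, hia, hal, ← hb]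
    have hM1 : Mid D A (s'.setV .y b) :=
      ⟨hM'.toCtx.congr (by simp) (by simp) rfl rfl rfl, hM'.inA, hM'.mark⟩
    have hJ1 : J T' (s'.setV .y b) := by
      refine hJ _ s' _ (fun v hv => ?_) (fun _ _ _ => rfl) hJ'
      have : v ≠ .y := by rintro rfl; exact hv (by decide)
      simp [this]
    refine wp_mono (wp_frame (wp_search hE hact hJ step hM1 hbn
      ((hA.mem b).2 ⟨j, hj, hb.symm⟩) (by simp) (fun x z => ?_) hJ1)) ?_
    · rw [hT']
      rintro ⟨-, ⟨i, hi, h⟩, -⟩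
      exact hA.inj i j hi hj h
    · rintro t s₂ ⟨⟨ht, hM2, T₂, hJ2, hT2⟩, hk⟩
      refine ⟨by omega, ⟨hM2.toCtx.congr (by simp) (by simp) rfl rfl rfl, hM2.inA, hM2.mark⟩,
        ?_, ?_, T₂, hJ _ s₂ _ (fun v hv => ?_) (fun _ _ _ => rfl) hJ2, fun x y z => ?_⟩
      · have : Var.na ∉ (search act).wv := fun h => by
          rcases search_wv _ h with h | h
          · revert h; decide
          · exact hact.v .na (by decide) h
        simp [hk.v _ this, hna]
      · have : Arr.alist ∉ (search act).wa := fun h => by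
          rcases search_wa _ h with h | h | h
          · cases h
          · cases h
          · exact hact.a .alist (by decide) h
        simp [hk.a _ this, hal]
      · have : v ≠ .ia := by rintro rfl; exact hv (by decide)
        simp [this]
      · rw [hT2, hT']
        constructor
        · rintro (⟨h1, ⟨i, hi, h2⟩, h3⟩ | ⟨h1, rfl, h3⟩)
          · exact ⟨h1, ⟨i, by omega, h2⟩, h3⟩
          · exact ⟨h1, ⟨j, by omega, hb.symm⟩, h3⟩
        · rintro ⟨h1, ⟨i, hi, h2⟩, h3⟩
          rcases Nat.lt_succ_iff_lt_or_eq.1 hi with hi | rfl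
          · exact .inl ⟨h1, ⟨i, hi, h2⟩, h3⟩
          · rw [← hb] at h2; subst h2
            exact .inr ⟨h1, rfl, h3⟩
  · rintro t s' ⟨ht, ⟨hM', hna, hal, T', hJ', hT'⟩, -⟩
    refine ⟨?_, hM', T', hJ', fun x y z => ?_⟩
    · rcases Nat.eq_zero_or_pos (s.v .na) with h0 | h0
      · simp [h0] at ht ⊢; omega
      · have := hA.lt 0 h0
        refine ht.trans (Nat.add_le_add_right (Nat.mul_le_mul_left _ ?_) _)
        -- If `A` is nonempty there is a vertex, so the overhead of the loop is absorbed by the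
        -- bound for the body.
        have : 1 ≤ D.n * (D.M + 1) := Nat.mul_pos (by omega) (by omega)
        omega
    · rw [hT', hA.mem y]

end

/-! ### Maximum cardinality search -/

theorem numBefore_zero {V : Type*} (G : SimpleGraph V) (o : ℕ → V) (v : V) :
    numBefore G o 0 v = 0 := by simp [numBefore]

theorem numBefore_congr {V : Type*} (G : SimpleGraph V) {o o' : ℕ → V} {i : ℕ} (v : V)
    (h : ∀ a < i, o a = o' a) : numBefore G o i v = numBefore G o' i v := by
  unfold numBefore
  congr 1
  ext a
  simp only [Finset.mem_filter, Finset.mem_range]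
  exact and_congr_right fun ha => by rw [h a ha]

open Classical in
theorem numBefore_succ {V : Type*} (G : SimpleGraph V) (o : ℕ → V) (i : ℕ) (v : V) :
    numBefore G o (i + 1) v = numBefore G o i v + if G.Adj v (o i) then 1 else 0 := by
  unfold numBefore
  rw [Finset.range_add_one, Finset.filter_insert]
  split_ifs with h
  · rw [Finset.card_insert_of_notMem (by simp)]
  · rw [add_zero]

/-- The array `ni` lists the vertices that are not isolated. -/
structure NIs (D : Input) (s : St) : Prop where
  deg : ∀ i < s.v .ni, ∃ v, D.G₁.Adj (s.a .ni i) v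
  inj : ∀ i j, i < j → j < s.v .ni → s.a .ni i ≠ s.a .ni j
  mem : ∀ u v, D.G₁.Adj u v → ∃ i < s.v .ni, s.a .ni i = u

theorem NIs.lt {D : Input} {s : St} (h : NIs D s) : ∀ i < s.v .ni, s.a .ni i < D.n :=
  fun i hi => (D.lt' (h.deg i hi).choose_spec).1

theorem NIs.congr {D : Input} {s s' : St} (h : NIs D s) (h1 : s'.v .ni = s.v .ni)
    (h2 : s'.a .ni = s.a .ni) : NIs D s' where
  deg := by rw [h1, h2]; exact h.deg
  inj := by rw [h1, h2]; exact h.inj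
  mem := by rw [h1, h2]; exact h.mem

theorem NIs.le_n {D : Input} {s : St} (h : NIs D s) : s.v .ni ≤ D.n := le_of_inj h.lt h.inj

/-- Every listed vertex has positive degree. Loops over this list therefore take at most `M` passes,
where loops over all vertices would give `n²` instead of `n M`. -/
theorem NIs.le_M {D : Input} {s : St} (h : NIs D s) : s.v .ni ≤ D.M := by
  refine le_trans ?_ (D.sum_length_le h.inj h.lt)
  calc s.v .ni = ∑ i ∈ Finset.range (s.v .ni), 1 := by simp
    _ ≤ _ := Finset.sum_le_sum fun i hi => by
      obtain ⟨v, hv⟩ := h.deg i (Finset.mem_range.1 hi)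
      exact List.length_pos_of_mem ((D.mem₁ _ _).2 hv)

/-- The state in the first phase of the algorithm. -/
structure Base (D : Input) (A : Set ℕ) (s : St) : Prop where
  mid : Mid D A s
  al : AList D A s
  ni : NIs D s

theorem Base.congr {D : Input} {A : Set ℕ} {s s' : St} (h : Base D A s)
    (hv : ∀ v ∈ [Var.lb, .n, .na, .ni], s'.v v = s.v v)
    (ha : ∀ j ∈ [Arr.row, .mat, .mark, .inA, .alist, .ni], s'.a j = s.a j)
    (hio : s'.io = s.io) : Base D A s' where
  mid := ⟨h.mid.toCtx.congr (hv _ (by decide)) (hv _ (by decide)) (ha _ (by decide))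
    (ha _ (by decide)) hio, by rw [ha _ (by decide)]; exact h.mid.inA,
    by rw [ha _ (by decide)]; exact h.mid.mark⟩
  al := h.al.congr (hv _ (by decide)) (ha _ (by decide))
  ni := h.ni.congr (hv _ (by decide)) (ha _ (by decide))

theorem Base.keeps {D : Input} {A : Set ℕ} {s s' : St} {c : Cmd} (h : Base D A s)
    (hk : Keeps c s s') (hv : ∀ v ∈ [Var.lb, .n, .na, .ni], v ∉ c.wv)
    (ha : ∀ j ∈ [Arr.row, .mat, .mark, .inA, .alist, .ni], j ∉ c.wa)
    (hio : c.wio = false) : Base D A s' :=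
  h.congr (fun v hv' => hk.v v (hv v hv')) (fun j hj => hk.a j (ha j hj)) (hk.io hio)

theorem Base.setV {D : Input} {A : Set ℕ} {s : St} (h : Base D A s) (v : Var) (c : ℕ)
    (hv : v ∉ [Var.lb, .n, .na, .ni]) : Base D A (s.setV v c) :=
  h.congr (fun v' hv' => by
    have : v' ≠ v := by rintro rfl; exact hv hv'
    simp [this]) (fun _ _ => rfl) rfl

theorem Base.setA {D : Input} {A : Set ℕ} {s : St} (h : Base D A s) (j : Arr) (i c : ℕ)
    (hj : j ∉ [Arr.row, .mat, .mark, .inA, .alist, .ni]) : Base D A (s.setA j i c) :=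
  h.congr (fun _ _ => rfl) (fun j' hj' => by
    have : j' ≠ j := by rintro rfl; exact hj hj'
    simp [this]) rfl

/-- Find a vertex `b` that maximizes `mc`, among the vertices that have no position yet. -/
def select : Cmd :=
  .set .bc (.c 0) ;; forTo .i (.v .ni) (.set .w (.a .ni (.v .i)) ;;
    .ite (.a .inA (.v .w)) (.c 1) (.ite (.a .pos (.v .w)) (.c 1)
      (.ite (.v .bc) (.add (.a .mc (.v .w)) (.c 1))
        (.set .bc (.add (.a .mc (.v .w)) (.c 1)) ;; .set .b (.v .w)) .skip) .skip) .skip)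

/-- Increase `mc` for the neighbours of `b`. -/
def bump : Cmd := forNb .p .e .x .b (.put .mc (.v .x) (.add (.a .mc (.v .x)) (.c 1)))

/-- Maximum cardinality search outside of `A`. -/
def mcsOrder : Cmd :=
  forTo .i (.v .ni) (.set .b (.a .ni (.v .i)) ;; .put .mc (.v .b) (.c 0) ;;
    .put .pos (.v .b) (.c 0)) ;;
  .set .cnt (.c 0) ;;
  forTo .j (.v .ni) (select ;;
    .ite (.c 0) (.v .bc) (.put .ord (.v .cnt) (.v .b) ;; inc .cnt ;;
      .put .pos (.v .b) (.v .cnt) ;; bump) .skip)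

/-- The search order. -/
structure Ord (D : Input) (A : Set ℕ) (s : St) : Prop where
  adj : ∀ i < s.v .cnt, ∃ v, D.G₁.Adj (s.a .ord i) v
  notMem : ∀ i < s.v .cnt, s.a .ord i ∉ A
  inj : ∀ i j, i < j → j < s.v .cnt → s.a .ord i ≠ s.a .ord j
  le : ∀ i < s.v .cnt, ∀ v u, D.G₁.Adj v u → v ∉ A → (∀ j < i, s.a .ord j ≠ v) →
    numBefore D.G₁ (s.a .ord) i v ≤ numBefore D.G₁ (s.a .ord) i (s.a .ord i)
  pos : ∀ i < s.v .cnt, s.a .pos (s.a .ord i) = i + 1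
  zero : ∀ v u, D.G₁.Adj v u → (∀ i < s.v .cnt, s.a .ord i ≠ v) → s.a .pos v = 0

theorem Ord.congr {D : Input} {A : Set ℕ} {s s' : St} (h : Ord D A s)
    (h1 : s'.v .cnt = s.v .cnt) (h2 : s'.a .ord = s.a .ord) (h3 : s'.a .pos = s.a .pos) :
    Ord D A s' := by
  constructor <;> rw [h1, h2]
  · exact h.adj
  · exact h.notMem
  · exact h.inj
  · exact h.le
  · rw [h3]; exact h.pos
  · rw [h3]; exact h.zero

theorem Ord.lt {D : Input} {A : Set ℕ} {s : St} (h : Ord D A s) :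
    ∀ i < s.v .cnt, s.a .ord i < D.n :=
  fun i hi => (D.lt' (h.adj i hi).choose_spec).1

theorem Ord.maxCard {D : Input} {A : Set ℕ} {s : St} (h : Ord D A s) :
    MaxCard D.G₁ (s.a .ord) (s.v .cnt) where
  ne := h.inj
  le i j hij hj := by
    obtain ⟨v, hv⟩ := h.adj j hj
    exact h.le i (by omega) _ v hv (h.notMem j hj) fun i' hi' => h.inj i' j (by omega) hj

section
variable {D : Input} {W N : ℕ} {A : Set ℕ}

theorem wp_select (hE : Env D W N) {s : St} (hB : Base D A s)
    (hmc : ∀ i < s.v .ni, s.a .mc (s.a .ni i) ≤ D.n) :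
    wp W N select s fun t s' => t ≤ 8 * s.v .ni + 4 ∧ s'.a = s.a ∧
      (s'.v .bc = 0 → ∀ i < s.v .ni, s.a .ni i ∈ A ∨ 0 < s.a .pos (s.a .ni i)) ∧
      (0 < s'.v .bc → (∃ i < s.v .ni, s.a .ni i = s'.v .b) ∧ s'.v .b ∉ A ∧
        s.a .pos (s'.v .b) = 0 ∧ ∀ i < s.v .ni, s.a .ni i ∉ A → s.a .pos (s.a .ni i) = 0 →
          s.a .mc (s.a .ni i) ≤ s.a .mc (s'.v .b)) := by
  have hW := hE.n_le
  have hni := hB.ni.le_n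
  rw [select, wp_seq, wp_set]
  -- `bc` holds one more than the best value found, so that 0 can mean that there is no candidate
  -- yet.
  refine ⟨Nat.zero_le _, wp_mono (wp_forTo_const (s.v .ni) 6 (fun j s' => s'.a = s.a ∧
    s'.v .ni = s.v .ni ∧
      (s'.v .bc = 0 → ∀ i < j, s.a .ni i ∈ A ∨ 0 < s.a .pos (s.a .ni i)) ∧
      (0 < s'.v .bc → (∃ i < s.v .ni, s.a .ni i = s'.v .b) ∧ s'.v .b ∉ A ∧
        s.a .pos (s'.v .b) = 0 ∧ s'.v .bc = s.a .mc (s'.v .b) + 1 ∧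
        ∀ i < j, s.a .ni i ∉ A → s.a .pos (s.a .ni i) = 0 →
          s.a .mc (s.a .ni i) ≤ s.a .mc (s'.v .b))) (by omega)
    (by simp [Cmd.wv]) (by simp) (fun j s' h => h.2.1) ?_) ?_⟩
  · rintro j s' hj ⟨ha, hn, h0, h1⟩ hi
    set w := s.a .ni j with hw
    have hwn : w < D.n := hB.ni.lt j hj
    have hinA := hB.mid.inA w hwn
    have hmcw : s.a .mc w ≤ D.n := hmc j hj
    have hlast : ∀ {P : ℕ → Prop}, (∀ i < j, P i) → P j → ∀ i < j + 1, P i := by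
      intro P h1 h2 i hi
      rcases Nat.lt_succ_iff_lt_or_eq.1 hi with h | rfl
      · exact h1 i h
      · exact h2
    simp only [wp_seq, wp_set, wp_ite, wp_skip, Exp.eval, Exp.chk, St.setV_v, St.setV_a, ha, hi,
      ← hw, if_true, true_and, reduceCtorEq, if_false, hn]
    refine ⟨fun h2 => ⟨fun h3 => ⟨fun h4 => ⟨by omega, by omega, by simp, fun _ => ?_⟩,
      fun h4 => ⟨by omega, fun h5 => ?_, fun h5 => ?_⟩⟩, fun h3 => ⟨by omega, fun h5 => ?_, fun h5 => ?_⟩⟩,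
      fun h2 => ⟨by omega, fun h5 => ?_, fun h5 => ?_⟩⟩
    · refine ⟨⟨j, hj, rfl⟩, fun h => by have := hinA.2 h; omega, by omega, hlast ?_ (by simp [← hw])⟩
      intro i hij h5 h6
      by_cases h7 : 0 < s'.v .bc
      · obtain ⟨-, -, -, h8, h9⟩ := h1 h7
        have := h9 i hij h5 h6
        omega
      · rcases h0 (by omega) i hij with h | h
        · exact absurd h h5
        · omega
    · omega
    · obtain ⟨h6, h7, h8, h9, h10⟩ := h1 h5
      exact ⟨h6, h7, h8, h9, hlast h10 fun _ _ => by rw [← hw]; omega⟩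
    · exact hlast (h0 h5) (.inr (by rw [← hw]; omega))
    · obtain ⟨h6, h7, h8, h9, h10⟩ := h1 h5
      exact ⟨h6, h7, h8, h9, hlast h10 fun _ h => by rw [← hw] at h; omega⟩
    · exact hlast (h0 h5) (.inl (hinA.1 (by omega)))
    · obtain ⟨h6, h7, h8, h9, h10⟩ := h1 h5
      exact ⟨h6, h7, h8, h9, hlast h10 fun h => absurd (hinA.1 (by omega)) h⟩
  · rintro t s' ⟨ht, ⟨ha, hn, h0, h1⟩, -⟩
    refine ⟨by omega, ha, h0, fun h => ?_⟩
    obtain ⟨h6, h7, h8, h9, h10⟩ := h1 h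
    exact ⟨h6, h7, h8, h10⟩

open Classical in
theorem wp_bump (hE : Env D W N) {s : St} {b : ℕ} (hI : Io D s) (hb : s.v .b = b) (hbn : b < D.n)
    (hmc : ∀ v, D.G₁.Adj b v → s.a .mc v ≤ D.n) :
    wp W N bump s fun t s' => t ≤ 4 * D.n + 3 ∧
      ∀ v, s'.a .mc v = s.a .mc v + if D.G₁.Adj b v then 1 else 0 := by
  have hW := hE.n_le
  have hdeg := D.length_nb₁_le b
  refine wp_mono (wp_forNb_const hE hbn hb hI (fun j s' => Io D s' ∧ ∀ v, s'.a .mc v = s.a .mc v +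
    if ∃ i < j, D.nbr b i = v then 1 else 0) 1 (by simp) (by simp) (by simp) (by simp)
    (by simp [Cmd.wv]) (by simp [Cmd.wv]) (by simp) (by simp) ⟨hI, by simp⟩
    (fun j s' c h => ⟨h.1.congr (by simp) rfl, h.2⟩)
    (fun j s' c h => ⟨h.1.congr (by simp) rfl, h.2⟩) (fun j s' h => h.1) ?_) ?_
  · rintro j s' hj ⟨hI', hmc'⟩
    have hadj := D.getD_adj hj
    -- Neighbour lists have no repetitions, so this counter has not been increased before.
    have h1 : s'.a .mc (D.nbr b j) = s.a .mc (D.nbr b j) := by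
      rw [hmc', if_neg, add_zero]
      rintro ⟨i, hi, h⟩
      exact absurd (D.getD_inj (by omega) hj h) (by omega)
    have := hmc _ hadj
    simp only [wp_put, Exp.eval, Exp.chk, St.setV_v, St.setV_a, if_true, h1]
    refine ⟨by omega, le_rfl, hI'.congr (by simp) rfl, fun v => ?_⟩
    simp only [St.setA_a, if_true, Function.update_apply, St.setV_a]
    by_cases hv : v = D.nbr b j
    · subst hv
      rw [if_pos rfl, if_pos ⟨j, by omega, rfl⟩]
    · rw [if_neg hv, hmc']
      congr 2
      simp only [eq_iff_iff]
      constructor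
      · rintro ⟨i, hi, h⟩
        exact ⟨i, by omega, h⟩
      · rintro ⟨i, hi, h⟩
        rcases Nat.lt_succ_iff_lt_or_eq.1 hi with hi | rfl
        · exact ⟨i, hi, h⟩
        · exact absurd h.symm hv
  · rintro t s' ⟨ht, hI', hmc'⟩
    refine ⟨by omega, fun v => ?_⟩
    rw [hmc']
    congr 2
    simp only [eq_iff_iff]
    exact ⟨fun ⟨i, hi, h⟩ => h ▸ D.getD_adj hi, D.exists_getD⟩

theorem numBefore_le {G : SimpleGraph ℕ} {o : ℕ → ℕ} {i v : ℕ} : numBefore G o i v ≤ i := by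
  classical
  induction i with
  | zero => rw [numBefore_zero]
  | succ i ih => rw [numBefore_succ]; split_ifs <;> omega

/-- The array `mc` is kept equal to the number of neighbours already ordered. Positions are stored
shifted by one, so that 0 marks a vertex which is still to be ordered. -/
theorem wp_mcsOrder (hE : Env D W N) {s : St} (hB : Base D A s) :
    wp W N mcsOrder s fun t s' => t ≤ 30 * (D.n * (D.M + 1)) + 5 ∧ Base D A s' ∧ Ord D A s' ∧
      ∀ v u, D.G₁.Adj v u → v ∉ A → ∃ i < s'.v .cnt, s'.a .ord i = v := by
  have hW := hE.n_le
  have hni := hB.ni.le_n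
  have hniM := hB.ni.le_M
  simp only [mcsOrder, wp_seq]
  refine wp_mono (wp_forTo_const (s.v .ni) 3 (fun j s' => Base D A s' ∧ s'.v .ni = s.v .ni ∧
    s'.a .ni = s.a .ni ∧ ∀ i < j, s'.a .mc (s.a .ni i) = 0 ∧ s'.a .pos (s.a .ni i) = 0)
    (by omega) (by simp [Cmd.wv]) ⟨hB.setV _ _ (by decide), by simp, rfl, by simp⟩
    (fun j s' h => h.2.1) ?_) ?_
  · rintro j s' hj ⟨hB', hn, ha, h0⟩ hi
    simp only [wp_seq, wp_set, wp_put, Exp.eval, Exp.chk, true_and, hi, ha, St.setV_v,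
      St.setV_a, if_true, St.setA_v]
    refine ⟨Nat.zero_le _, Nat.zero_le _, by omega, ?_, by simpa, by simpa, fun i hij => ?_⟩
    · exact (((hB'.setV _ _ (by decide)).setA _ _ _ (by decide)).setA _ _ _ (by decide)).setV _ _
        (by decide)
    · rcases Nat.lt_succ_iff_lt_or_eq.1 hij with h | rfl
      · simp [Function.update_apply, h0 i h]
      · simp
  rintro t₁ s₁ ⟨ht1, ⟨hB1, hn1, ha1, h01⟩, -⟩
  have hz1 : ∀ v u, D.G₁.Adj v u → s₁.a .mc v = 0 ∧ s₁.a .pos v = 0 := by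
    intro v u huv
    obtain ⟨i, hi, rfl⟩ := hB.ni.mem v u huv
    exact h01 i hi
  rw [wp_set]
  refine ⟨Nat.zero_le _, ?_⟩
  -- The last clause of the invariant: either every pass so far has ordered a vertex, or all
  -- nonisolated vertices outside `A` are ordered and the remaining passes are idle.
  refine wp_mono (wp_forTo_const (s.v .ni) (12 * D.n + 12) (fun j s' => Base D A s' ∧
    s'.v .ni = s.v .ni ∧ Ord D A s' ∧
    (∀ v u, D.G₁.Adj v u → s'.a .mc v = numBefore D.G₁ (s'.a .ord) (s'.v .cnt) v) ∧
    (s'.v .cnt = j ∨ ∀ v u, D.G₁.Adj v u → v ∉ A → ∃ i < s'.v .cnt, s'.a .ord i = v))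
    (by omega) (by decide) ⟨(hB1.setV _ _ (by decide)).setV _ _ (by decide), by simpa,
      ?_, ?_, by simp⟩ (fun j s' h => h.2.1) ?_) ?_
  · constructor <;> simp
    exact fun v u h => (hz1 v u h).2
  · intro v u h
    simp [numBefore_zero, (hz1 v u h).1]
  · rintro j s₂ hj ⟨hB2, hn2, hO2, hmc2, hj2⟩ -
    have hcnt : s₂.v .cnt ≤ D.n := le_of_inj hO2.lt hO2.inj
    have hmcn : ∀ v u, D.G₁.Adj v u → s₂.a .mc v ≤ D.n := fun v u h => by
      rw [hmc2 v u h]; exact numBefore_le.trans hcnt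
    rw [wp_seq]
    refine wp_mono (wp_frame (wp_select hE hB2 fun i hi => ?_)) ?_
    · obtain ⟨u, hu⟩ := hB2.ni.deg i hi
      exact hmcn _ u hu
    rintro t₃ s₃ ⟨⟨ht3, ha3, hz3, hp3⟩, hk3⟩
    have hB3 := hB2.keeps hk3 (by decide) (by decide) rfl
    have hcnt3 : s₃.v .cnt = s₂.v .cnt := hk3.v _ (by decide)
    have hn3 : s₃.v .ni = s₂.v .ni := hk3.v _ (by decide)
    have hO3 : Ord D A s₃ := hO2.congr hcnt3 (by rw [ha3]) (by rw [ha3])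
    rw [wp_ite]
    constructor
    · intro hbc
      simp only [Exp.eval] at hbc
      obtain ⟨⟨i, hi, hib⟩, hbA, hpb, hmax⟩ := hp3 hbc
      set b := s₃.v .b with hb
      obtain ⟨u, hbu⟩ := hB2.ni.deg i hi
      rw [hib] at hbu
      have hbn := (D.lt' hbu).1
      have hbnew : ∀ i < s₂.v .cnt, s₂.a .ord i ≠ b := fun i hi h => by
        have := hO2.pos i hi
        rw [h] at this
        omega
      have hcnt' : s₂.v .cnt < D.n := by
        by_contra h
        have hlt : ∀ i < s₂.v .cnt + 1, (if i = s₂.v .cnt then b else s₂.a .ord i) < D.n := by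
          intro i hi
          split_ifs with h1
          · exact hbn
          · exact hO2.lt i (by omega)
        have := le_of_inj hlt fun i j hij hj => by
          rw [if_neg (by omega)]
          split_ifs with h1
          · exact hbnew i (by omega)
          · exact hO2.inj i j hij (by omega)
        omega
      simp only [wp_seq, wp_put, inc, wp_set, Exp.eval, Exp.chk, true_and, St.setA_v, St.setV_v,
        if_true, reduceCtorEq, if_false, hcnt3, ← hb]
      refine ⟨by omega, ?_⟩
      set s₄ := (((s₃.setA .ord (s₂.v .cnt) b).setV .cnt (s₂.v .cnt + 1)).setA .pos b
        (s₂.v .cnt + 1)) with hs4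
      have hB4 : Base D A s₄ := ((hB3.setA _ _ _ (by decide)).setV _ _ (by decide)).setA _ _ _
        (by decide)
      have hord4 : s₄.a .ord = Function.update (s₂.a .ord) (s₂.v .cnt) b := by simp [s₄, ha3]
      have hmc4 : s₄.a .mc = s₂.a .mc := by simp [s₄, ha3]
      refine wp_mono (wp_frame (wp_bump hE hB4.mid.toIo (b := b) (by simp [s₄, hb]) hbn
        fun v hv => ?_)) ?_
      · rw [hmc4]; exact hmcn v b hv.symm
      rintro t₅ s₅ ⟨⟨ht5, hmc5⟩, hk5⟩
      have hord5 : s₅.a .ord = Function.update (s₂.a .ord) (s₂.v .cnt) b := by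
        rw [hk5.a _ (by decide), hord4]
      have hcnt5 : s₅.v .cnt = s₂.v .cnt + 1 := by
        rw [hk5.v _ (by decide)]; simp [s₄]
      have hpos5 : s₅.a .pos = Function.update (s₂.a .pos) b (s₂.v .cnt + 1) := by
        rw [hk5.a _ (by decide)]; simp [s₄, ha3]
      have hold : ∀ a < s₂.v .cnt, s₅.a .ord a = s₂.a .ord a := fun a ha => by
        rw [hord5, Function.update_of_ne (by omega)]
      have hnew : s₅.a .ord (s₂.v .cnt) = b := by rw [hord5, Function.update_self]
      have hnumold : ∀ i ≤ s₂.v .cnt, ∀ v, numBefore D.G₁ (s₅.a .ord) i v =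
          numBefore D.G₁ (s₂.a .ord) i v := fun i hi v =>
        numBefore_congr _ _ fun a ha => hold a (by omega)
      refine ⟨by omega, (hB4.keeps hk5 (by decide) (by decide) rfl).setV _ _ (by decide), ?_, ?_,
        ?_, ?_⟩
      · simp [hk5.v .ni (by decide), s₄, hn3, hn2]
      · refine Ord.congr (s := s₅) ?_ (by simp) rfl rfl
        constructor <;> rw [hcnt5]
        · intro i hi
          rcases Nat.lt_succ_iff_lt_or_eq.1 hi with hi | rfl
          · rw [hold i hi]; exact hO2.adj i hi
          · rw [hnew]; exact ⟨u, hbu⟩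
        · intro i hi
          rcases Nat.lt_succ_iff_lt_or_eq.1 hi with hi | rfl
          · rw [hold i hi]; exact hO2.notMem i hi
          · rwa [hnew]
        · intro i j hij hj
          rw [hold i (by omega)]
          rcases Nat.lt_succ_iff_lt_or_eq.1 hj with hj | rfl
          · rw [hold j hj]; exact hO2.inj i j hij hj
          · rw [hnew]; exact hbnew i hij
        · intro i hi v w hvw hvA hne
          rw [hnumold i (by omega), hnumold i (by omega)]
          rcases Nat.lt_succ_iff_lt_or_eq.1 hi with hi | rfl
          · rw [hold i hi]
            refine hO2.le i hi v w hvw hvA fun j hj => ?_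
            rw [← hold j (by omega)]; exact hne j hj
          · rw [hnew, ← hmc2 v w hvw, ← hmc2 b u hbu]
            obtain ⟨i', hi', rfl⟩ := hB2.ni.mem v w hvw
            refine hmax i' hi' hvA (hO2.zero _ w hvw fun j hj => ?_)
            rw [← hold j hj]; exact hne j hj
        · intro i hi
          rw [hpos5]
          rcases Nat.lt_succ_iff_lt_or_eq.1 hi with hi | rfl
          · rw [hold i hi, Function.update_of_ne (hbnew i hi), hO2.pos i hi]
          · rw [hnew, Function.update_self]
        · intro v w hvw hne
          have : v ≠ b := by
            rintro rfl
            exact hne _ (Nat.lt_succ_self _) hnew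
          rw [hpos5, Function.update_of_ne this]
          refine hO2.zero v w hvw fun i hi => ?_
          rw [← hold i hi]; exact hne i (by omega)
      · intro v w hvw
        simp only [St.setV_a, St.setV_v, reduceCtorEq, if_false]
        classical
        rw [hmc5, hmc4, hmc2 v w hvw, hcnt5, numBefore_succ, hnumold _ le_rfl, hnew]
        simp only [D.G₁.adj_comm v b]
      · simp only [St.setV_a, St.setV_v, reduceCtorEq, if_false]
        rcases hj2 with h | h
        · exact .inl (by omega)
        · right
          intro v w hvw hvA
          obtain ⟨i, hi, h⟩ := h v w hvw hvA
          exact ⟨i, by omega, by rw [hold i hi, h]⟩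
    · intro hbc
      simp only [Exp.eval] at hbc
      have hz := hz3 (by omega)
      rw [wp_skip]
      refine ⟨by omega, hB3.setV _ _ (by decide), by simp [hn3, hn2],
        hO3.congr (by simp) rfl rfl, ?_, .inr ?_⟩
      · simpa [ha3, hcnt3] using hmc2
      · intro v u hvu hvA
        simp only [St.setV_v, reduceCtorEq, if_false, St.setV_a, ha3, hcnt3]
        obtain ⟨i, hi, rfl⟩ := hB2.ni.mem v u hvu
        rcases hz i hi with h | h
        · exact absurd h hvA
        · by_contra hc
          push Not at hc
          have := hO2.zero _ u hvu hc
          omega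
  · rintro t₂ s₂ ⟨ht2, ⟨hB2, hn2, hO2, -, hj2⟩, -⟩
    refine ⟨?_, hB2, hO2, fun v u hvu hvA => ?_⟩
    · have h1 : s.v .ni * (12 * D.n + 12 + 2) ≤ D.M * (12 * D.n) + 14 * D.n := by nlinarith
      have h2 : s.v .ni * (3 + 2) ≤ 5 * D.n := by omega
      nlinarith
    · rcases hj2 with h | h
      · by_contra hc
        push Not at hc
        obtain ⟨i, hi, rfl⟩ := hB2.ni.mem v u hvu
        -- If every pass ordered a vertex and one were still missing, there would be more
        -- nonisolated vertices than the list has entries.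
        have := Finset.card_le_card_of_injOn (s := Finset.range (s₂.v .cnt + 1))
          (t := (Finset.range (s₂.v .ni)).image (s₂.a .ni))
          (fun a => if a = s₂.v .cnt then s₂.a .ni i else s₂.a .ord a) ?_ ?_
        · have h3 := Finset.card_image_le (s := Finset.range (s₂.v .ni)) (f := s₂.a .ni)
          simp only [Finset.card_range] at this h3
          omega
        · intro a ha
          simp only [Finset.coe_range, Set.mem_Iio] at ha
          simp only [Finset.coe_image, Set.mem_image, Finset.coe_range, Set.mem_Iio]
          split_ifs with h1
          · exact ⟨i, hi, rfl⟩
          · obtain ⟨w, hw⟩ := hO2.adj a (by omega)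
            exact hB2.ni.mem _ w hw
        · intro a ha a' ha' he
          simp only [Finset.coe_range, Set.mem_Iio] at ha ha'
          simp only at he
          split_ifs at he with h1 h2 h2
          · omega
          · exact absurd he.symm (hc a' (by omega))
          · exact absurd he (hc a (by omega))
          · rcases lt_trichotomy a a' with h3 | h3 | h3
            · exact absurd he (hO2.inj a a' h3 (by omega))
            · exact h3
            · exact absurd he.symm (hO2.inj a' a h3 (by omega))
      · exact h v u hvu hvA

end

/-! ### The first phase -/

/-- Look for two earlier neighbours of `b` that are not adjacent. -/
def checkAt : Cmd :=
  forNb .p .e .x .b (.ite (.c 0) (.a .pos (.v .x)) (.ite (.a .pos (.v .x)) (.v .q)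
    (forNb .p' .e' .w .b (.ite (.c 0) (.a .pos (.v .w)) (.ite (.a .pos (.v .w)) (.v .q)
      (.ite (.v .x) (.v .w) (.ite (.entry .mat .x .w) (.c 1)
        (.set .bad (.c 1) ;; .set .bv (.v .b)) .skip) .skip) .skip) .skip)) .skip) .skip)

/-- Look for the first vertex whose earlier neighbours are not a clique. -/
def check : Cmd :=
  .set .bad (.c 0) ;; forTo .j (.v .cnt) (.ite (.v .bad) (.c 1)
    (.set .b (.a .ord (.v .j)) ;; .set .q (.add (.v .j) (.c 1)) ;; checkAt) .skip)

/-- The vertex `x` is an earlier neighbour of `o i`. -/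
def Earlier (G : SimpleGraph ℕ) (o : ℕ → ℕ) (i x : ℕ) : Prop := G.Adj (o i) x ∧ ∃ a < i, o a = x

/-- The earlier neighbours of `o i` are a clique. -/
def EarlierClique (G : SimpleGraph ℕ) (o : ℕ → ℕ) (i : ℕ) : Prop :=
  ∀ x w, Earlier G o i x → Earlier G o i w → x < w → G.Adj x w

section
variable {D : Input} {W N : ℕ} {A : Set ℕ}

theorem Ord.earlier_iff {s : St} (h : Ord D A s) {i x : ℕ} (hi : i < s.v .cnt)
    (hx : D.G₁.Adj (s.a .ord i) x) :
    0 < s.a .pos x ∧ s.a .pos x < i + 1 ↔ Earlier D.G₁ (s.a .ord) i x := by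
  unfold Earlier
  constructor
  · rintro ⟨h1, h2⟩
    by_contra hc
    by_cases h3 : ∃ a < s.v .cnt, s.a .ord a = x
    · obtain ⟨a, ha, rfl⟩ := h3
      rw [h.pos a ha] at h2
      exact hc ⟨hx, a, by omega, rfl⟩
    · push Not at h3
      have := h.zero x _ hx.symm h3
      omega
  · rintro ⟨-, a, ha, rfl⟩
    rw [h.pos a (by omega)]
    omega

/-- All pairs of neighbours are inspected, with `x < w` to leave out the diagonal. The cost is
degree times degree, and bounding only one factor by `n` lets the sum over all vertices stay within
`n M`. -/
theorem wp_checkAt (hE : Env D W N) {s : St} {i : ℕ} (hB : Base D A s) (hO : Ord D A s)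
    (hi : i < s.v .cnt) (hb : s.v .b = s.a .ord i) (hq : s.v .q = i + 1) (hbad : s.v .bad = 0) :
    wp W N checkAt s fun t s' => t ≤ (D.nb₁ (s.a .ord i)).length * (9 * D.n + 8) + 3 ∧
      (s'.v .bad = 0 → EarlierClique D.G₁ (s.a .ord) i) ∧
      (0 < s'.v .bad → ¬ EarlierClique D.G₁ (s.a .ord) i ∧ s'.v .bv = s.a .ord i) := by
  have hW := hE.n_le
  have hbn := hO.lt i hi
  have hdeg := D.length_nb₁_le (s.a .ord i)
  set o := s.a .ord with ho
  set b := o i with hbo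
  let P : List Var → St → Prop := fun l s' => s'.a = s.a ∧ s'.io = s.io ∧
    ∀ v ∉ l, s'.v v = s.v v
  have hPset : ∀ l s' v c, v ∈ l → P l s' → P l (s'.setV v c) := by
    rintro l s' v c hv ⟨h1, h2, h3⟩
    refine ⟨h1, h2, fun v' hv' => ?_⟩
    have : v' ≠ v := by rintro rfl; exact hv' hv
    simp [this, h3 v' hv']
  have hPB : ∀ l s', (∀ v ∈ [Var.lb, .n, .na, .ni], v ∉ l) → P l s' → Base D A s' :=
    fun l s' hl h => hB.congr (fun v hv => h.2.2 v (hl v hv)) (fun j _ => by rw [h.1]) h.2.1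
  let l₀ : List Var := [.p, .e, .x, .p', .e', .w, .bad, .bv]
  let B : St → Prop := fun s' => 0 < s'.v .bad → ¬ EarlierClique D.G₁ o i ∧ s'.v .bv = b
  refine wp_mono (wp_forNb_const hE hbn hb hB.mid.toIo (fun j s' => P l₀ s' ∧ B s' ∧
    (s'.v .bad = 0 → ∀ a < j, ∀ w, Earlier D.G₁ o i (D.nbr b a) → Earlier D.G₁ o i w →
      D.nbr b a < w → D.G₁.Adj (D.nbr b a) w)) (9 * D.n + 5)
    (by simp) (by simp) (by simp) (by simp) (by decide) (by decide) (by simp) (by simp)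
    ⟨⟨rfl, rfl, fun _ _ => rfl⟩, by simp [B, hbad], by simp⟩
    (fun j s' c h => ⟨hPset _ _ _ _ (by decide) h.1, by simpa [B] using h.2.1, by simpa using h.2.2⟩)
    (fun j s' c h => ⟨hPset _ _ _ _ (by decide) h.1, by simpa [B] using h.2.1, by simpa using h.2.2⟩)
    (fun j s' h => (hPB l₀ s' (by decide) h.1).mid.toIo) ?_) ?_
  · rintro j s' hj ⟨hP, hBs, hz⟩
    set x := D.nbr b j with hx
    have hbx : D.G₁.Adj b x := D.getD_adj hj
    have hxn := (D.lt' hbx).2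
    have hP1 : P l₀ (s'.setV .x x) := hPset _ _ _ _ (by decide) hP
    have hlast : ∀ {Q : ℕ → Prop}, (∀ i < j, Q i) → Q j → ∀ i < j + 1, Q i := by
      intro Q h1 h2 i hi
      rcases Nat.lt_succ_iff_lt_or_eq.1 hi with h | rfl
      · exact h1 i h
      · exact h2
    have hearl := hO.earlier_iff hi hbx
    have hqs : s'.v .q = i + 1 := by rw [hP.2.2 _ (by decide), hq]
    have hskip : ¬ Earlier D.G₁ o i x → ∀ {t}, t ≤ 9 * D.n + 5 → t ≤ 9 * D.n + 5 ∧
        P l₀ (s'.setV .x x) ∧ B (s'.setV .x x) ∧ ((s'.setV .x x).v .bad = 0 → ∀ a < j + 1, ∀ w,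
        Earlier D.G₁ o i (D.nbr b a) → Earlier D.G₁ o i w → D.nbr b a < w →
          D.G₁.Adj (D.nbr b a) w) := by
      refine fun hn {t} ht => ⟨ht, hP1, by simpa [B] using hBs, fun h => ?_⟩
      exact hlast (hz (by simpa using h)) fun w hw => absurd hw hn
    have hpos : (s'.setV .x x).a .pos = s.a .pos := by simp [hP.1]
    have hx1 : (s'.setV .x x).v .x = x := by simp
    have hq1 : (s'.setV .x x).v .q = i + 1 := by simpa
    have hb1 : (s'.setV .x x).v .b = b := by rw [hP1.2.2 _ (by decide), hb]
    have hbad1 : (s'.setV .x x).v .bad = s'.v .bad := by simp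
    generalize hs₁ : s'.setV .x x = s₁ at *
    rw [wp_ite]
    simp only [wp_ite, wp_skip, Exp.eval, hpos, hx1, hq1]
    refine ⟨fun h1 => ⟨fun h2 => ?_, fun h2 => ?_⟩, fun h1 => ?_⟩
    · have hxe := hearl.1 ⟨h1, h2⟩
      refine wp_mono (wp_forNb_const hE hbn hb1 (hPB l₀ s₁ (by decide) hP1).mid.toIo
        (fun j' s'' => P l₀ s'' ∧ B s'' ∧ s''.v .x = x ∧
          (s''.v .bad = 0 → s₁.v .bad = 0 ∧ ∀ a < j', Earlier D.G₁ o i (D.nbr b a) →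
            x < D.nbr b a → D.G₁.Adj x (D.nbr b a))) 6
        (by simp) (by simp) (by simp) (by simp) (by decide) (by decide) (by simp) (by simp)
        ⟨hP1, by rw [← hs₁]; simpa [B] using hBs, hx1, by simp⟩
        (fun j s' c h => ⟨hPset _ _ _ _ (by decide) h.1, by simpa [B] using h.2.1,
          by simpa using h.2.2⟩)
        (fun j s' c h => ⟨hPset _ _ _ _ (by decide) h.1, by simpa [B] using h.2.1,
          by simpa using h.2.2⟩)
        (fun j s' h => (hPB l₀ s' (by decide) h.1).mid.toIo) ?_) ?_
      · rintro j' s₂ hj' ⟨hP2, hB2, hx2, hz2⟩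
        set w := D.nbr b j' with hw
        have hbw : D.G₁.Adj b w := D.getD_adj hj'
        have hwn := (D.lt' hbw).2
        have hearlw := hO.earlier_iff hi hbw
        have hlast : ∀ {Q : ℕ → Prop}, (∀ i < j', Q i) → Q j' → ∀ i < j' + 1, Q i := by
          intro Q h1 h2 i hi
          rcases Nat.lt_succ_iff_lt_or_eq.1 hi with h | rfl
          · exact h1 i h
          · exact h2
        have hP3 : P l₀ (s₂.setV .w w) := hPset _ _ _ _ (by decide) hP2
        have hskip2 : ¬ (Earlier D.G₁ o i w ∧ x < w ∧ ¬ D.G₁.Adj x w) → ∀ {t}, t ≤ 6 → t ≤ 6 ∧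
            P l₀ (s₂.setV .w w) ∧ B (s₂.setV .w w) ∧ True ∧
            ((s₂.setV .w w).v .bad = 0 → s₁.v .bad = 0 ∧ ∀ a < j' + 1,
              Earlier D.G₁ o i (D.nbr b a) → x < D.nbr b a → D.G₁.Adj x (D.nbr b a)) := by
          refine fun hn {t} ht => ⟨ht, hP3, by simpa [B] using hB2, trivial, fun h => ?_⟩
          obtain ⟨h3, h4⟩ := hz2 (by simpa using h)
          exact ⟨h3, hlast h4 fun h5 h6 => by
            rw [← hw] at h5 h6 ⊢
            by_contra h7
            exact hn ⟨h5, h6, h7⟩⟩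
        have hpos3 : (s₂.setV .w w).a .pos = s.a .pos := by simp [hP2.1]
        have hw3 : (s₂.setV .w w).v .w = w := by simp
        have hx3 : (s₂.setV .w w).v .x = x := by simpa
        have hq3 : (s₂.setV .w w).v .q = i + 1 := by rw [hP3.2.2 _ (by decide), hq]
        have hb3 : (s₂.setV .w w).v .b = b := by rw [hP3.2.2 _ (by decide), hb]
        generalize hs₃ : s₂.setV .w w = s₃ at *
        have hmat := (hPB l₀ s₃ (by decide) hP3).mid.mat x w hxn hwn
        have hrow := (hPB l₀ s₃ (by decide) hP3).mid.row x hxn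
        rw [wp_ite]
        simp only [wp_ite, wp_skip, Exp.eval, Exp.eval_entry, hpos3, hw3, hq3, hx3, hrow]
        refine ⟨fun h3 => ⟨fun h4 => ⟨fun h5 => ⟨fun h6 => ?_, fun h6 => ?_⟩, fun h5 => ?_⟩,
          fun h4 => ?_⟩, fun h3 => ?_⟩
        · have hwe := hearlw.1 ⟨h3, h4⟩
          have hna : ¬ D.G₁.Adj x w := by rw [← hmat]; omega
          simp only [wp_seq, wp_set, Exp.eval, Exp.chk, St.setV_v, reduceCtorEq, if_false, hb3]
          refine ⟨by omega, trivial, by omega, hPset _ _ _ _ (by decide)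
            (hPset _ _ _ _ (by decide) hP3), ?_, by simpa, by simp⟩
          intro _
          exact ⟨fun h => hna (h x w hxe hwe h5), by simp⟩
        · refine hskip2 (fun h => h.2.2 (hmat.1 (by omega))) ?_; omega
        · refine hskip2 (fun h => h5 h.2.1) ?_; omega
        · refine hskip2 (fun h => h4 (hearlw.2 h.1).2) ?_; omega
        · refine hskip2 (fun h => h3 (hearlw.2 h.1).1) ?_; omega
      · rintro t s₂ ⟨ht, hP2, hB2, hx2, hz2⟩
        refine ⟨by omega, hP2, hB2, fun h => ?_⟩
        obtain ⟨h3, h4⟩ := hz2 h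
        refine hlast (hz (by omega)) fun w _ hw hxw => ?_
        obtain ⟨a, ha, rfl⟩ := D.exists_getD hw.1
        exact h4 a ha hw hxw
    · refine hskip (fun h => h2 (hearl.2 h).2) ?_; omega
    · refine hskip (fun h => h1 (hearl.2 h).1) ?_; omega
  · rintro t s' ⟨ht, hP, hBs, hz⟩
    refine ⟨by nlinarith, fun h x w hx hw hxw => ?_, hBs⟩
    obtain ⟨a, ha, rfl⟩ := D.exists_getD hx.1
    exact hz h a ha w hx hw hxw

theorem Input.M_le (D : Input) : D.M ≤ D.n * D.M := by
  rcases Nat.eq_zero_or_pos D.n with h | h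
  · have : D.M = 0 := by rw [Input.M, h]; rfl
    omega
  · exact Nat.le_mul_of_pos_left _ h

theorem wp_check (hE : Env D W N) {s : St} (hB : Base D A s) (hO : Ord D A s) :
    wp W N check s fun t s' => t ≤ 30 * (D.n * (D.M + 1)) + 3 ∧
      (s'.v .bad = 0 → ∀ i < s.v .cnt, EarlierClique D.G₁ (s.a .ord) i) ∧
      (0 < s'.v .bad → ∃ i < s.v .cnt, s'.v .bv = s.a .ord i ∧
        (∀ i' < i, EarlierClique D.G₁ (s.a .ord) i') ∧ ¬ EarlierClique D.G₁ (s.a .ord) i) := by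
  have hW := hE.n_le
  have hcnt : s.v .cnt ≤ D.n := le_of_inj hO.lt hO.inj
  rw [check, wp_seq, wp_set]
  refine ⟨Nat.zero_le _, wp_mono (wp_forTo (s.v .cnt) (fun j s' => Base D A s' ∧
    s'.v .cnt = s.v .cnt ∧ s'.a = s.a ∧
      (s'.v .bad = 0 → ∀ i < j, EarlierClique D.G₁ (s.a .ord) i) ∧
      (0 < s'.v .bad → ∃ i < s.v .cnt, s'.v .bv = s.a .ord i ∧
        (∀ i' < i, EarlierClique D.G₁ (s.a .ord) i') ∧ ¬ EarlierClique D.G₁ (s.a .ord) i))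
    (fun j => (D.nb₁ (s.a .ord j)).length * (9 * D.n + 8) + 6) (by omega) (by decide)
    ⟨(hB.setV _ _ (by decide)).setV _ _ (by decide), by simp, rfl, by simp⟩
    (fun j s' h => h.2.1) ?_) ?_⟩
  · rintro j s' hj ⟨hB', hcnt', ha', h0, h1⟩ hjv
    rw [wp_ite]
    simp only [wp_seq, wp_set, wp_skip, Exp.eval, Exp.chk, true_and, St.setV_v, reduceCtorEq,
      if_false, hjv, ha']
    refine ⟨fun h => ⟨by omega, ?_⟩, fun h => ⟨by omega, hB'.setV _ _ (by decide), by simpa,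
      by simpa, by simp; omega, by simpa using h1⟩⟩
    set s₁ := (s'.setV .b (s.a .ord j)).setV .q (j + 1) with hs1
    have hB1 : Base D A s₁ := (hB'.setV _ _ (by decide)).setV _ _ (by decide)
    have hO1 : Ord D A s₁ := hO.congr (by simp [s₁, hcnt']) (by simp [s₁, ha'])
      (by simp [s₁, ha'])
    have hord : s₁.a .ord = s.a .ord := by simp [s₁, ha']
    refine wp_mono (wp_frame (wp_checkAt hE hB1 hO1 (i := j) (by simpa [s₁, hcnt'])
      (by simp [s₁, ha']) (by simp [s₁]) (by simp [s₁]; omega))) ?_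
    rw [hord]
    rintro t s₂ ⟨⟨ht, h2, h3⟩, hk⟩
    refine ⟨by omega, (hB1.keeps hk (by decide) (by decide) rfl).setV _ _ (by decide), ?_, ?_, ?_,
      ?_⟩
    · simp [hk.v .cnt (by decide), s₁, hcnt']
    · funext j'
      simp [hk.a j' (by revert j'; simp [checkAt, forNb, loop, inc, Cmd.wa]), s₁, ha']
    · intro h4 i hi
      rcases Nat.lt_succ_iff_lt_or_eq.1 hi with hi | rfl
      · exact h0 (by omega) i hi
      · exact h2 h4
    · intro h4
      exact ⟨j, hj, (h3 h4).2, h0 (by omega), (h3 h4).1⟩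
  · rintro t s' ⟨ht, ⟨hB', hcnt', ha', h0, h1⟩, -⟩
    refine ⟨?_, h0, h1⟩
    simp only [Finset.sum_add_distrib, ← Finset.sum_mul, Finset.sum_const, Finset.card_range,
      smul_eq_mul] at ht
    have h2 := D.sum_length_le hO.inj hO.lt
    have h3 := D.M_le
    have h4 := Nat.mul_le_mul_right (9 * D.n + 8) h2
    have h5 : D.M * (9 * D.n + 8) = 9 * (D.n * D.M) + 8 * D.M := by ring
    have h6 : D.n * (D.M + 1) = D.n * D.M + D.n := by ring
    omega

/-- Look for two vertices outside of `A` that are consecutive on a chordless cycle. -/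
def round : Cmd :=
  .set .found (.c 0) ;;
  .ite (.c 0) (.v .bad)
    (.set .y (.v .bv) ;; search (.set .found (.c 1) ;; .set .px (.v .x) ;; .set .py (.v .y)))
    (searchA (.ite (.a .inA (.v .z)) (.c 1)
      (.set .found (.c 1) ;; .set .px (.v .x) ;; .set .py (.v .z)) .skip))

theorem earlierClique_iff {G : SimpleGraph ℕ} {o : ℕ → ℕ} {i : ℕ} :
    EarlierClique G o i ↔ ∀ a b, a < i → b < i → o a ≠ o b → G.Adj (o i) (o a) →
      G.Adj (o i) (o b) → G.Adj (o a) (o b) := by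
  constructor
  · intro h a b ha hb hab hia hib
    rcases lt_or_gt_of_ne hab with h1 | h1
    · exact h _ _ ⟨hia, a, ha, rfl⟩ ⟨hib, b, hb, rfl⟩ h1
    · exact (h _ _ ⟨hib, b, hb, rfl⟩ ⟨hia, a, ha, rfl⟩ h1).symm
  · rintro h _ _ ⟨h1, a, ha, rfl⟩ ⟨h2, b, hb, rfl⟩ hab
    exact h a b ha hb hab.ne h1 h2

/-- Minimality of the failing index makes the prefix chordal, which is what `MaxCard.exists_hit`
needs. The vertex it returns is an ordered one, hence outside `A`. -/
theorem Ord.exists_hit {s : St} (hO : Ord D A s) {i : ℕ} (hi : i < s.v .cnt)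
    (hc : ∀ i' < i, EarlierClique D.G₁ (s.a .ord) i')
    (hn : ¬ EarlierClique D.G₁ (s.a .ord) i) :
    ∃ x z, x ∉ A ∧ Hit D.G₁ x (s.a .ord i) z := by
  rw [earlierClique_iff] at hn
  push Not at hn
  obtain ⟨a, b, ha, hb, hab, hia, hib, hn⟩ := hn
  have hm : MaxCard D.G₁ (s.a .ord) (i + 1) :=
    ⟨fun i' j' h1 h2 => hO.maxCard.ne i' j' h1 (by omega),
      fun i' j' h1 h2 => hO.maxCard.le i' j' h1 (by omega)⟩
  have hch : IsChordal (restr D.G₁ (s.a .ord '' Set.Iio i)) :=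
    isChordal_restr_image i fun i' hi' a b ha hb hab h1 h2 =>
      earlierClique_iff.1 (hc i' hi') a b ha hb (by
        intro h
        rcases lt_or_gt_of_ne hab with h3 | h3
        · exact hO.inj a b h3 (by omega) h
        · exact hO.inj b a h3 (by omega) h.symm) h1 h2
  obtain ⟨j, hj, z, hz⟩ := hm.exists_hit hch ha hb (fun h => hab (h ▸ rfl)) hia hib hn
  exact ⟨_, z, hO.notMem j (by omega), hz⟩

/-- Isolated vertices are absent from the order, but restricting to the ordered vertices and to the
complement of `A` leaves the same edges. -/
theorem Ord.isChordal {s : St} (hO : Ord D A s)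
    (hall : ∀ v u, D.G₁.Adj v u → v ∉ A → ∃ i < s.v .cnt, s.a .ord i = v)
    (hc : ∀ i < s.v .cnt, EarlierClique D.G₁ (s.a .ord) i) : IsChordal (restr D.G₁ Aᶜ) := by
  have hch : IsChordal (restr D.G₁ (s.a .ord '' Set.Iio (s.v .cnt))) :=
    isChordal_restr_image _ fun i' hi' a b ha hb hab h1 h2 =>
      earlierClique_iff.1 (hc i' hi') a b ha hb (by
        intro h
        rcases lt_or_gt_of_ne hab with h3 | h3
        · exact hO.inj a b h3 (by omega) h
        · exact hO.inj b a h3 (by omega) h.symm) h1 h2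
  convert hch using 1
  ext u v
  simp only [restr_adj]
  constructor
  · rintro ⟨h, hu, hv⟩
    obtain ⟨i, hi, h1⟩ := hall u v h hu
    obtain ⟨j, hj, h2⟩ := hall v u h.symm hv
    exact ⟨h, ⟨i, hi, h1⟩, ⟨j, hj, h2⟩⟩
  · rintro ⟨h, ⟨i, hi, rfl⟩, ⟨j, hj, rfl⟩⟩
    exact ⟨h, hO.notMem i hi, hO.notMem j hj⟩

/-- After a failed clique check, a search around the failing vertex must succeed. After a successful
check, it is enough to look around the vertices of `A` for hits whose third vertex is outside `A`.
-/
theorem wp_round (hE : Env D W N) {s : St} (hB : Base D A s) (hO : Ord D A s)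
    (hall : ∀ v u, D.G₁.Adj v u → v ∉ A → ∃ i < s.v .cnt, s.a .ord i = v)
    (h0 : s.v .bad = 0 → ∀ i < s.v .cnt, EarlierClique D.G₁ (s.a .ord) i)
    (h1 : 0 < s.v .bad → ∃ i < s.v .cnt, s.v .bv = s.a .ord i ∧
        (∀ i' < i, EarlierClique D.G₁ (s.a .ord) i') ∧ ¬ EarlierClique D.G₁ (s.a .ord) i) :
    wp W N round s fun t s' => t ≤ (s.v .na + 1) * (63 * (D.n * (D.M + 1))) + 4 ∧ Mid D A s' ∧
      (s'.v .found = 0 → ∀ x y z, x ∉ A → y ∉ A → ¬ Hit D.G₁ x y z) ∧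
      (0 < s'.v .found → s'.v .px ∉ A ∧ s'.v .py ∉ A ∧ ∃ z, Hit D.G₁ (s'.v .px) (s'.v .py) z) := by
  have hW := hE.n_le
  have hB1 : Base D A (s.setV .found 0) := hB.setV _ _ (by decide)
  rw [round, wp_seq, wp_set]
  refine ⟨Nat.zero_le _, ?_⟩
  rw [wp_ite]
  simp only [Exp.eval, wp_seq, wp_set, St.setV_v, reduceCtorEq, if_false]
  refine ⟨fun hbad => ⟨trivial, ?_⟩, fun hbad => ?_⟩
  · obtain ⟨i, hi, hbv, hc, hn⟩ := h1 hbad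
    obtain ⟨x₀, z₀, hx₀, hz₀⟩ := hO.exists_hit hi hc hn
    rw [← hbv] at hz₀
    have hB2 := hB1.setV .y (s.v .bv) (by decide)
    have hbA : s.v .bv ∉ A := by rw [hbv]; exact hO.notMem i hi
    refine wp_mono (wp_search (A := A) (Y := Set.univ) (J := fun T s' => (s'.v .found = 0 → T = ∅) ∧
      (0 < s'.v .found → ∃ z, (s'.v .px, s'.v .py, z) ∈ T)) (T := ∅) (b := s.v .bv) hE
      ⟨by decide, by decide, rfl⟩ ?_ ?_ hB2.mid (by rw [hbv]; exact hO.lt i hi) (Set.mem_univ _)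
      (by simp) (by simp) (by simp)) ?_
    · intro T s₁ s₂ hv ha
      simp only [hv .found (by decide), hv .px (by decide), hv .py (by decide)]
      exact id
    · intro T s₁ x y z hJ hC hx hy hz hxA hyA hh hA hT
      simp [hx, hy]
      omega
    · rintro t s' ⟨ht, hM, T', ⟨hJ0, hJ1⟩, hT'⟩
      refine ⟨?_, hM, fun h => ?_, fun h => ?_⟩
      · rw [add_mul]; omega
      · have := (hT' x₀ _ z₀).2 (.inr ⟨hx₀, rfl, hz₀⟩)
        rw [hJ0 h] at this
        simp at this
      · obtain ⟨z, hz⟩ := hJ1 h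
        rcases (hT' _ _ _).1 hz with h | ⟨h2, h3, h4⟩
        · simp at h
        · rw [h3]
          exact ⟨h2, hbA, z, h4⟩
  · refine wp_mono (wp_searchA (A := A) (J := fun T s' => (s'.v .found = 0 → ∀ t ∈ T, t.2.2 ∈ A) ∧
      (0 < s'.v .found → ∃ y, (s'.v .px, y, s'.v .py) ∈ T ∧ s'.v .py ∉ A)) hE
      ⟨by decide, by decide, rfl⟩ ?_ ?_ hB1.mid hB1.al (by simp)) ?_
    · intro T s₁ s₂ hv ha
      simp only [hv .found (by decide), hv .px (by decide), hv .py (by decide)]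
      exact id
    · intro T s₁ x y z hJ hC hx hy hz hxA hyA hh hA hT
      have hzA := hA z (D.lt' hh.2.1).2
      rw [wp_ite]
      simp only [wp_seq, wp_set, wp_skip, Exp.eval, Exp.chk, St.setV_v, if_true, reduceCtorEq,
        if_false, hx, hz, true_and]
      refine ⟨fun h => ⟨by omega, by omega, by simp, fun _ => ⟨y, by simp, ?_⟩⟩,
        fun h => ⟨by omega, fun h2 => ?_, fun h2 => ?_⟩⟩
      · rw [← hzA]; omega
      · intro t ht
        rcases Finset.mem_insert.1 ht with rfl | ht
        · exact hzA.1 (by omega)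
        · exact hJ.1 h2 t ht
      · obtain ⟨y', hy', h3⟩ := hJ.2 h2
        exact ⟨y', Finset.mem_insert_of_mem hy', h3⟩
    · rintro t s' ⟨ht, hM, T', ⟨hJ0, hJ1⟩, hT'⟩
      refine ⟨?_, hM, fun h x y z hx hy => ?_, fun h => ?_⟩
      · simp at ht
        rw [add_mul]; omega
      · refine no_hit_of_chordal (hO.isChordal hall (h0 (by omega))) ?_ hx hy
        intro a ha x hx z hz hh
        exact hz (hJ0 h _ ((hT' x a z).2 ⟨hx, ha, hh⟩))
      · obtain ⟨y, hy, h3⟩ := hJ1 h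
        obtain ⟨h4, h5, h6⟩ := (hT' _ _ _).1 hy
        exact ⟨h4, h3, y, h6.symm⟩

end

/-- Move the pair that has been found to `A`. -/
def moveOne (v : Var) : Cmd :=
  .put .inA (.v v) (.c 1) ;; .put .inK (.v v) (.c 1) ;; .put .alist (.v .na) (.v v) ;; inc .na

/-- Move pairs of vertices that are consecutive on a chordless cycle to `A`, until there are none
or too many of them. -/
def phase1 : Cmd :=
  .set .na (.c 0) ;; .set .no (.c 0) ;; .set .found (.c 1) ;;
  .while (.c 0) (.v .found) (mcsOrder ;; check ;; round ;;
    .ite (.c 0) (.v .found) (moveOne .px ;; moveOne .py ;;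
      .ite (.add (.add (.v .k) (.v .k)) (.add (.v .k) (.v .k))) (.v .na)
        (.set .found (.c 0) ;; .set .no (.c 1)) .skip) .skip)

/-- The arrays `inA` and `inK` agree. -/
def KEq (D : Input) (A : Set ℕ) (s : St) : Prop := ∀ v < D.n, 0 < s.a .inK v ↔ v ∈ A

section
variable {D : Input} {W N : ℕ} {A : Set ℕ}

theorem wp_moveOne (hE : Env D W N) {s : St} {x : Var} {v : ℕ} (hB : Base D A s) (hx : s.v x = v)
    (hv : v < D.n) (hvA : v ∉ A) (hK : KEq D A s) (hxna : x ≠ .na) :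
    wp W N (moveOne x) s fun t s' => t = 4 ∧ Base D (insert v A) s' ∧ KEq D (insert v A) s' ∧
      s'.v .na = s.v .na + 1 ∧ s'.a .alist (s.v .na) = v ∧
      ∀ i < s.v .na, s'.a .alist i = s.a .alist i := by
  have hW := hE.n_le
  have hna := hB.al.le
  simp only [moveOne, inc, wp_seq, wp_put, wp_set, Exp.eval, Exp.chk, St.setA_v, hx, true_and]
  refine ⟨by omega, by omega, by omega, ⟨⟨hB.mid.toCtx.congr (by simp) (by simp) (by simp) (by simp)
    rfl, ?_, by simpa using hB.mid.mark⟩, ⟨?_, ?_, ?_⟩, hB.ni.congr (by simp) (by simp)⟩, ?_,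
    by simp, by simp, ?_⟩
  · intro u hu
    by_cases huv : u = v
    · simp [huv]
    · simp [Function.update_apply, huv, hB.mid.inA u hu]
  · simp only [St.setV_v, if_true, St.setV_a, St.setA_a, reduceCtorEq, if_false,
      Function.update_apply]
    intro i hi
    split_ifs
    · exact hv
    · exact hB.al.lt i (by omega)
  · simp only [St.setV_v, if_true, St.setV_a, St.setA_a, reduceCtorEq, if_false,
      Function.update_apply]
    intro i j hij hj
    rw [if_neg (by omega)]
    split_ifs
    · intro h
      exact hvA ((hB.al.mem v).2 ⟨i, by omega, h⟩)
    · exact hB.al.inj i j hij (by omega)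
  · simp only [St.setV_v, if_true, St.setV_a, St.setA_a, reduceCtorEq, if_false,
      Function.update_apply]
    intro u
    rw [Set.mem_insert_iff, hB.al.mem]
    constructor
    · rintro (rfl | ⟨i, hi, h⟩)
      · exact ⟨s.v .na, by omega, by simp⟩
      · exact ⟨i, by omega, by rw [if_neg (by omega), h]⟩
    · rintro ⟨i, hi, h⟩
      split_ifs at h with h1
      · exact .inl h.symm
      · exact .inr ⟨i, by omega, h⟩
  · intro u hu
    by_cases huv : u = v
    · simp [huv]
    · simp [Function.update_apply, huv, hK u hu]
  · intro i hi
    simp [Function.update_apply, hi.ne]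

/-- The pairs stand next to each other in `alist`, so after `r` successful rounds `na = 2 r`. The
loop gives up as soon as `na > 4k`, which means that `2k + 1` disjoint pairs have been found;
otherwise it stops after a round without a find. -/
theorem wp_phase1 (hE : Env D W N) (hn : 1 ≤ D.n) {s : St} (hM : Mid D ∅ s) (hNI : NIs D s)
    (hk : s.v .k = D.k) (hK : KEq D ∅ s) :
    wp W N phase1 s fun t s' => t ≤ 3000 * ((D.k + 1) ^ 2 * (D.n * (D.M + 1))) ∧
      ∃ A, Base D A s' ∧ KEq D A s' ∧ (∀ v ∈ A, ∃ u, D.G₁.Adj v u) ∧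
        (s'.v .no = 0 → s'.v .na ≤ 4 * D.k ∧ ∀ x y z, x ∉ A → y ∉ A → ¬ Hit D.G₁ x y z) ∧
        (0 < s'.v .no → ¬ Sandwich D.G₁ D.G₂ D.k) := by
  have hW := hE.n_le
  have hlim := hE.lim
  have hX : 1 ≤ D.n * (D.M + 1) := Nat.mul_pos hn (by omega)
  set X := D.n * (D.M + 1) with hXdef
  -- A bound for one round: ordering, checking and a search around at most `4k` vertices. The
  -- potential allots `C` to each of the rounds that may still follow.
  set C := 320 * ((D.k + 1) * X) with hC
  simp only [phase1, wp_seq, wp_set, Exp.chk, Exp.eval, Nat.zero_le, true_and]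
  refine ⟨by omega, ?_⟩
  refine wp_mono (wp_while (fun s => s.v .k = D.k ∧ ∃ A r, Base D A s ∧ KEq D A s ∧ s.v .na = 2 * r ∧
    (∀ i < r, ∃ z, Hit D.G₁ (s.a .alist (2 * i)) (s.a .alist (2 * i + 1)) z) ∧
    (s.v .no = 0 → r ≤ 2 * D.k) ∧ r ≤ 2 * D.k + 1 ∧ (0 < s.v .no → s.v .found = 0 ∧ 2 * D.k < r) ∧
    (s.v .found = 0 → s.v .no = 0 → ∀ x y z, x ∉ A → y ∉ A → ¬ Hit D.G₁ x y z))
    (fun s => if s.v .found = 0 then 0 else (2 * D.k + 2 - s.v .na / 2) * C) ?_ ?_) ?_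
  · refine ⟨by simpa, ∅, 0, ⟨⟨hM.toCtx.congr (by simp) (by simp) rfl rfl rfl, hM.inA, hM.mark⟩,
      ⟨by simp, by simp, by simp⟩, hNI.congr (by simp) rfl⟩, hK, by simp, by simp, by simp,
      by omega, by simp, by simp⟩
  · rintro s₁ ⟨hk1, A, r, hB1, hK1, hna1, hp1, hr1, hr1', hno1, -⟩ hf1
    simp only [Exp.eval] at hf1
    have hno0 : s₁.v .no = 0 := by
      by_contra h
      have := (hno1 (by omega)).1
      omega
    have hr := hr1 hno0
    rw [wp_seq]
    refine wp_mono (wp_frame (wp_mcsOrder hE hB1)) ?_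
    rintro t₂ s₂ ⟨⟨ht2, hB2, hO2, hall2⟩, hk2⟩
    rw [wp_seq]
    refine wp_mono (wp_frame (wp_check hE hB2 hO2)) ?_
    rintro t₃ s₃ ⟨⟨ht3, h0, h1⟩, hk3⟩
    have hB3 : Base D A s₃ := hB2.keeps hk3 (by decide) (by decide) rfl
    have hord3 : s₃.a .ord = s₂.a .ord := hk3.a _ (by decide)
    have hcnt3 : s₃.v .cnt = s₂.v .cnt := hk3.v _ (by decide)
    have hO3 : Ord D A s₃ := hO2.congr hcnt3 hord3 (hk3.a _ (by decide))
    rw [wp_seq]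
    refine wp_mono (wp_frame (wp_round hE hB3 hO3 (by rw [hcnt3, hord3]; exact hall2)
      (by rw [hcnt3, hord3]; exact h0) (by rw [hcnt3, hord3]; exact h1))) ?_
    rintro t₄ s₄ ⟨⟨ht4, hM4, hf0, hf1'⟩, hk4⟩
    have hna4 : s₄.v .na = s₁.v .na := by
      rw [hk4.v _ (by decide), hk3.v _ (by decide), hk2.v _ (by decide)]
    have hal4 : s₄.a .alist = s₁.a .alist := by
      rw [hk4.a _ (by decide), hk3.a _ (by decide), hk2.a _ (by decide)]
    have hK4' : s₄.a .inK = s₁.a .inK := by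
      rw [hk4.a _ (by decide), hk3.a _ (by decide), hk2.a _ (by decide)]
    have hkk4 : s₄.v .k = D.k := by
      rw [hk4.v _ (by decide), hk3.v _ (by decide), hk2.v _ (by decide), hk1]
    have hno4 : s₄.v .no = 0 := by
      rw [hk4.v _ (by decide), hk3.v _ (by decide), hk2.v _ (by decide), hno0]
    have hB4 : Base D A s₄ := ⟨hM4, hB1.al.congr hna4 hal4,
      hB3.ni.congr (hk4.v _ (by decide)) (hk4.a _ (by decide))⟩
    have hK4 : KEq D A s₄ := fun v hv => by rw [hK4']; exact hK1 v hv
    have hna3 : s₃.v .na = s₁.v .na := by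
      rw [hk3.v _ (by decide), hk2.v _ (by decide)]
    have hcost : t₂ + t₃ + t₄ + 15 ≤ C := by
      rw [hna3, hna1, ← hXdef] at ht4
      have : (2 * r + 1) * (63 * X) ≤ (4 * D.k + 1) * (63 * X) :=
        Nat.mul_le_mul_right _ (by omega)
      have h2 : (4 * D.k + 1) * (63 * X) = 252 * (D.k * X) + 63 * X := by ring
      have h3 : C = 320 * (D.k * X) + 320 * X := by rw [hC]; ring
      omega
    have hif : (if s₁.v .found = 0 then 0 else (2 * D.k + 2 - s₁.v .na / 2) * C) =
        C + (2 * D.k + 1 - r) * C := by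
      rw [if_neg (by omega), hna1, show 2 * D.k + 2 - 2 * r / 2 = 1 + (2 * D.k + 1 - r) by omega]
      ring
    rw [hif, wp_ite]
    constructor
    · intro hf4
      simp only [Exp.eval] at hf4
      obtain ⟨hpx, hpy, z, hz⟩ := hf1' hf4
      obtain ⟨hpxn, hpyn⟩ := D.lt' hz.1
      have hne : s₄.v .px ≠ s₄.v .py := hz.1.ne
      rw [wp_seq]
      refine wp_mono (wp_frame (wp_moveOne hE hB4 rfl hpxn hpx hK4 (by decide))) ?_
      rintro t₅ s₅ ⟨⟨ht5, hB5, hK5, hna5, hl5, ho5⟩, hk5⟩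
      have hpy5 : s₅.v .py = s₄.v .py := hk5.v _ (by decide)
      rw [wp_seq]
      refine wp_mono (wp_frame (wp_moveOne hE hB5 hpy5 hpyn (by simp [hpy, hne.symm]) hK5
        (by decide))) ?_
      rintro t₆ s₆ ⟨⟨ht6, hB6, hK6, hna6, hl6, ho6⟩, hk6⟩
      have hna6' : s₆.v .na = 2 * (r + 1) := by omega
      have hk6' : s₆.v .k = D.k := by
        rw [hk6.v _ (by decide), hk5.v _ (by decide), hkk4]
      have hno6 : s₆.v .no = 0 := by
        rw [hk6.v _ (by decide), hk5.v _ (by decide), hno4]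
      have hf6 : s₆.v .found = s₄.v .found := by
        rw [hk6.v _ (by decide), hk5.v _ (by decide)]
      have hp6 : ∀ i < r + 1, ∃ z, Hit D.G₁ (s₆.a .alist (2 * i)) (s₆.a .alist (2 * i + 1)) z := by
        intro i hi
        rcases Nat.lt_succ_iff_lt_or_eq.1 hi with hi | rfl
        · rw [ho6 _ (by omega), ho6 _ (by omega), ho5 _ (by omega), ho5 _ (by omega), hal4]
          exact hp1 i hi
        · rw [show 2 * i + 1 = s₅.v .na by omega, hl6, ho6 _ (by omega),
            show 2 * i = s₄.v .na by omega, hl5]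
          exact ⟨z, hz⟩
      simp only [wp_ite, wp_seq, wp_set, wp_skip, Exp.eval, Exp.chk, St.setV_v, if_true,
        reduceCtorEq, if_false, hk6', hna6', hno6, hf6]
      refine ⟨fun h => ⟨by omega, by omega, ⟨trivial, _, r + 1,
        (hB6.setV _ _ (by decide)).setV _ _ (by decide), hK6, by omega, hp6, by simp, by omega,
        fun _ => ⟨trivial, by omega⟩, by simp⟩, by omega⟩, fun h => ⟨⟨trivial, _, r + 1, hB6, hK6,
        by omega, hp6, by omega, by omega, by omega, by omega⟩, ?_⟩⟩
      rw [if_neg (by omega), show 2 * D.k + 2 - 2 * (r + 1) / 2 = 2 * D.k + 1 - r by omega]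
      omega
    · intro hf4
      simp only [Exp.eval] at hf4
      rw [wp_skip]
      refine ⟨⟨hkk4, A, r, hB4, hK4, by omega, by rw [hal4]; exact hp1, by omega, by omega,
        by omega, fun _ _ => hf0 (by omega)⟩, ?_⟩
      rw [if_pos (by omega)]
      omega
  · rintro t s' ⟨ht, ⟨hk', A, r, hB', hK', hna', hp', hr', hr'', hno', hf'⟩, hn'⟩
    simp only [Exp.eval] at hn'
    refine ⟨?_, A, hB', hK', fun v hv => ?_,
      fun h => ⟨by have := hr' h; omega, hf' (by omega) h⟩, fun h hs => ?_⟩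
    · simp at ht
      have h1 : (2 * D.k + 2) * C = 640 * ((D.k + 1) ^ 2 * X) := by rw [hC]; ring
      have h2 : 1 ≤ (D.k + 1) ^ 2 * X := Nat.mul_pos (by positivity) hX
      omega
    · obtain ⟨i, hi, rfl⟩ := (hB'.al.mem v).1 hv
      -- Entry `i` of `alist` belongs to pair number `i / 2`; both members of a pair have a
      -- neighbour because they are adjacent to each other.
      obtain ⟨z, hz⟩ := hp' (i / 2) (by omega)
      rcases Nat.mod_two_eq_zero_or_one i with h | h
      · rw [show 2 * (i / 2) = i by omega] at hz
        exact ⟨_, hz.1⟩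
      · rw [show 2 * (i / 2) + 1 = i by omega] at hz
        exact ⟨_, hz.1.symm⟩
    · have := hs.le_of_hits r (s'.a .alist) (fun i j hij hj => hB'.al.inj i j hij (by omega)) hp'
      have := (hno' h).2
      omega

end

/-! ### The kernel -/

namespace Input
variable (D : Input) (A : Set ℕ)

/-- The number of vertices outside of `A` that have `y` and `z` as neighbours on a chordless
cycle. -/
noncomputable def hits (y z : ℕ) : ℕ := {x | x ∉ A ∧ Hit D.G₁ x y z}.ncard

/-- The essential edges. -/
def ess : SimpleGraph ℕ where
  Adj y z := y ∈ A ∧ z ∈ A ∧ y ≠ z ∧ 2 * D.k < D.hits A y z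
  symm := ⟨fun y z h => ⟨h.2.1, h.1, h.2.2.1.symm, by
    have : D.hits A z y = D.hits A y z := by
      unfold hits
      congr 1
      ext x
      exact and_congr_right fun _ => ⟨Hit.symm, Hit.symm⟩
    rw [this]; exact h.2.2.2⟩⟩
  loopless := ⟨fun y h => h.2.2.1 rfl⟩

/-- The vertices of the kernel. -/
def ker : Set ℕ := A ∪ {x | ∃ y ∈ A, ∃ z ∈ A, Hit D.G₁ x y z ∧ D.hits A y z ≤ 2 * D.k}

variable {D A}

theorem finite_hits (y z : ℕ) : {x | x ∉ A ∧ Hit D.G₁ x y z}.Finite :=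
  (Set.finite_Iio D.n).subset fun _ hx => (D.lt' hx.2.1).1

theorem hits_comm (y z : ℕ) : D.hits A y z = D.hits A z y := by
  unfold hits
  congr 1
  ext x
  exact and_congr_right fun _ => ⟨Hit.symm, Hit.symm⟩

theorem isKernel (h : ∀ x y z, x ∉ A → y ∉ A → ¬ Hit D.G₁ x y z) :
    IsKernel D.G₁ (D.ess A) A (D.ker A) D.k where
  no_hit := h
  many y z hyz := ⟨(finite_hits y z).toFinset, by
    rw [← Set.ncard_eq_toFinset_card _ (finite_hits y z)]
    exact hyz.2.2.2, fun x hx => by simpa using hx⟩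
  mem y z hyz := hyz.1
  subset := Set.subset_union_left
  adj x y z hx hy hz hh := by
    refine ⟨hy, hz, hh.2.2.1, ?_⟩
    by_contra hc
    exact hx (.inr ⟨y, hy, z, hz, hh, by omega⟩)

/-- Each of at most `r²` ordered pairs that are not essential contributes at most `2k` vertices
outside `A`. For `r = 4k` this is `32k³ + 4k`. -/
theorem ncard_ker_le {r : ℕ} (hA : A.Finite) (hr : A.ncard ≤ r) :
    (D.ker A).ncard ≤ r + r * r * (2 * D.k) := by
  classical
  have hsub : D.ker A ⊆ A ∪ ⋃ t ∈ (hA.toFinset ×ˢ hA.toFinset).filter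
      (fun t => D.hits A t.1 t.2 ≤ 2 * D.k), {x | x ∉ A ∧ Hit D.G₁ x t.1 t.2} := by
    rintro x (hx | ⟨y, hy, z, hz, hh, hk⟩)
    · exact .inl hx
    · by_cases hxA : x ∈ A
      · exact .inl hxA
      · right
        simp only [Set.mem_iUnion]
        exact ⟨(y, z), by simp [hy, hz, hk], hxA, hh⟩
  have hfin : (⋃ t ∈ (hA.toFinset ×ˢ hA.toFinset).filter
      (fun t => D.hits A t.1 t.2 ≤ 2 * D.k), {x | x ∉ A ∧ Hit D.G₁ x t.1 t.2}).Finite :=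
    Set.Finite.biUnion (Finset.finite_toSet _) fun t _ => finite_hits _ _
  refine (Set.ncard_le_ncard hsub (hA.union hfin)).trans ((Set.ncard_union_le _ _).trans ?_)
  refine Nat.add_le_add hr ?_
  refine (Finset.set_ncard_biUnion_le _ _).trans ?_
  refine (Finset.sum_le_card_nsmul _ _ (2 * D.k) fun t ht => (Finset.mem_filter.1 ht).2).trans ?_
  rw [smul_eq_mul]
  refine Nat.mul_le_mul_right _ ((Finset.card_filter_le _ _).trans ?_)
  rw [Finset.card_product, ← Set.ncard_eq_toFinset_card _ hA]
  exact Nat.mul_le_mul hr hr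

end Input

/-! ### Marking the kernel -/

/-- Count the vertices that hit each pair. -/
def count : Cmd :=
  searchA (.ite (.c 0) (.a .inA (.v .z)) (.ite (.v .y) (.v .z)
    (.put .cnt (.add (.a .row (.v .y)) (.v .z)) (.add (.entry .cnt .y .z) (.c 1))) .skip) .skip)

/-- Mark the vertices that hit a pair that is not essential. -/
def markK : Cmd :=
  searchA (.ite (.c 0) (.a .inA (.v .z)) (.ite (.v .y) (.v .z)
    (.ite (.add (.v .k) (.v .k)) (.entry .cnt .y .z) .skip (.put .inK (.v .x) (.c 1)))
    .skip) .skip)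

theorem index_inj {n u v u' v' : ℕ} (hv : v < n) (hv' : v' < n) :
    u * n + v = u' * n + v' ↔ u = u' ∧ v = v' := by
  constructor
  · intro h
    have h1 : (u * n + v) / n = u := by
      rw [mul_comm, Nat.mul_add_div (by omega), Nat.div_eq_of_lt hv, add_zero]
    have h2 : (u' * n + v') / n = u' := by
      rw [mul_comm, Nat.mul_add_div (by omega), Nat.div_eq_of_lt hv', add_zero]
    have : u = u' := by rw [← h1, ← h2, h]
    subst this
    exact ⟨rfl, by omega⟩
  · rintro ⟨rfl, rfl⟩; rfl

section
variable {D : Input} {W N : ℕ} {A : Set ℕ}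

/-- Hits come in both orders of `y` and `z`; counting only `y < z` counts each vertex once per pair.
Up to projection to the first coordinate, the ghost set of handled hits is the set whose cardinality
is `hits`. -/
theorem wp_count (hE : Env D W N) {s : St} (hB : Base D A s)
    (h0 : ∀ i, s.a .cnt i = 0) :
    wp W N count s fun t s' => t ≤ s.v .na * (63 * (D.n * (D.M + 1))) + 2 ∧ Mid D A s' ∧
      ∀ y z, y ∈ A → z ∈ A → y < z → s'.a .cnt (y * D.n + z) = D.hits A y z := by
  classical
  have hW := hE.n_le
  have hAn : ∀ v ∈ A, v < D.n := fun v hv => by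
    obtain ⟨i, hi, rfl⟩ := (hB.al.mem v).1 hv
    exact hB.al.lt i hi
  refine wp_mono (wp_searchA (A := A) (J := fun T s' => (∀ t ∈ T, t.1 < D.n) ∧
    ∀ y z, y ∈ A → z ∈ A → y < z →
      s'.a .cnt (y * D.n + z) = (T.filter fun t => t.2 = (y, z)).card) hE
    ⟨by decide, by decide, rfl⟩ ?_ ?_ hB.mid hB.al (by simp [h0])) ?_
  · rintro T s₁ s₂ hv ha h
    rwa [ha .cnt (by decide) (by decide)]
  · rintro T s₁ x y z ⟨hJ0, hJ⟩ hC hx hy hz hxA hyA hh hA hT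
    obtain ⟨hxn, hyn⟩ := D.lt' hh.1
    have hzn := (D.lt' hh.2.1).2
    have hzA := hA z hzn
    have hJ0' : ∀ t ∈ insert (x, y, z) T, t.1 < D.n := by
      intro t ht
      rcases Finset.mem_insert.1 ht with rfl | ht
      · exact hxn
      · exact hJ0 t ht
    have hskip : ¬ (z ∈ A ∧ y < z) → ∀ y' z', y' ∈ A → z' ∈ A → y' < z' →
        s₁.a .cnt (y' * D.n + z') = ((insert (x, y, z) T).filter fun t => t.2 = (y', z')).card := by
      intro hn y' z' hy' hz' hyz'
      rw [Finset.filter_insert, if_neg, hJ y' z' hy' hz' hyz']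
      rintro h
      obtain ⟨rfl, rfl⟩ := Prod.mk.inj h
      exact hn ⟨hz', hyz'⟩
    -- Bounds the counter, so that incrementing it does not overflow.
    have hcard : ∀ y z, (T.filter fun t => t.2 = (y, z)).card ≤ D.n := by
      intro y z
      have := Finset.card_le_card_of_injOn (s := T.filter fun t => t.2 = (y, z))
        (t := Finset.range D.n) (fun t => t.1) (fun t ht => by
          simpa using hJ0 t (Finset.mem_filter.1 ht).1) (fun t ht t' ht' he => by
          simp only [Finset.coe_filter, Set.mem_ofPred_eq] at ht ht'
          exact Prod.ext he (by rw [ht.2, ht'.2]))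
      simpa using this
    simp only [wp_ite, wp_put, wp_skip, Exp.eval, Exp.eval_entry, Exp.chk, hz, hy, hC.row y hyn]
    refine ⟨fun h1 => ⟨fun h2 => ?_, fun h2 => ⟨by omega, hJ0', hskip fun h => h2 h.2⟩⟩,
      fun h1 => ⟨by omega, hJ0', hskip fun h => h1 (hzA.2 h.1)⟩⟩
    have hc := hJ y z hyA (hzA.1 h1) h2
    have hle := hcard y z
    refine ⟨by omega, by omega, hJ0', fun y' z' hy' hz' hyz' => ?_⟩
    simp only [St.setA_a, if_true, Function.update_apply, index_inj (hAn _ hz') hzn,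
      Finset.filter_insert]
    by_cases he : y' = y ∧ z' = z
    · obtain ⟨rfl, rfl⟩ := he
      rw [if_pos ⟨rfl, rfl⟩, if_pos rfl, Finset.card_insert_of_notMem (by simp [hT]), hc]
    · rw [if_neg he, if_neg (fun h => he (by
        obtain ⟨rfl, rfl⟩ := Prod.mk.inj h; exact ⟨rfl, rfl⟩)), hJ y' z' hy' hz' hyz']
  · rintro t s' ⟨ht, hM, T, ⟨-, hJ⟩, hT⟩
    refine ⟨ht, hM, fun y z hy hz hyz => ?_⟩
    rw [hJ y z hy hz hyz, Input.hits, ← Set.ncard_coe_finset]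
    refine Set.ncard_congr (fun t _ => t.1) ?_ ?_ ?_
    · rintro ⟨x, y', z'⟩ ht
      simp only [Finset.coe_filter, Set.mem_ofPred_eq, hT, Prod.mk.injEq] at ht
      obtain ⟨⟨h1, h2, h3⟩, rfl, rfl⟩ := ht
      exact ⟨h1, h3⟩
    · rintro t t' ht ht' he
      simp only [Finset.coe_filter, Set.mem_ofPred_eq] at ht ht'
      exact Prod.ext he (by rw [ht.2, ht'.2])
    · rintro x ⟨h1, h2⟩
      exact ⟨(x, y, z), by simp [hT, h1, hy, h2], rfl⟩

theorem wp_markK (hE : Env D W N) {s : St} (hB : Base D A s) (hK : KEq D A s)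
    (hk : s.v .k = D.k) (hc : ∀ y z, y ∈ A → z ∈ A → y < z →
      s.a .cnt (y * D.n + z) = D.hits A y z) :
    wp W N markK s fun t s' => t ≤ s.v .na * (63 * (D.n * (D.M + 1))) + 2 ∧ Mid D A s' ∧
      ∀ v < D.n, 0 < s'.a .inK v ↔ v ∈ D.ker A := by
  have hW := hE.n_le
  have hAn : ∀ v ∈ A, v < D.n := fun v hv => by
    obtain ⟨i, hi, rfl⟩ := (hB.al.mem v).1 hv
    exact hB.al.lt i hi
  refine wp_mono (wp_searchA (A := A) (J := fun T s' => s'.v .k = D.k ∧ s'.a .cnt = s.a .cnt ∧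
    ∀ v < D.n, 0 < s'.a .inK v ↔ v ∈ A ∨
      ∃ y z, (v, y, z) ∈ T ∧ z ∈ A ∧ y < z ∧ D.hits A y z ≤ 2 * D.k) hE
    ⟨by decide, by decide, rfl⟩ ?_ ?_ hB.mid hB.al ⟨hk, rfl, fun v hv => by simp [hK v hv]⟩) ?_
  · rintro T s₁ s₂ hv ha h
    rwa [ha .cnt (by decide) (by decide), ha .inK (by decide) (by decide), hv .k (by decide)]
  · rintro T s₁ x y z ⟨hk', hcnt, hJ⟩ hC hx hy hz hxA hyA hh hA hT
    obtain ⟨hxn, hyn⟩ := D.lt' hh.1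
    have hzn := (D.lt' hh.2.1).2
    have hzA := hA z hzn
    have hlim := hE.lim
    have hskip : ¬ (z ∈ A ∧ y < z ∧ D.hits A y z ≤ 2 * D.k) → ∀ v < D.n, 0 < s₁.a .inK v ↔
        v ∈ A ∨ ∃ y' z', (v, y', z') ∈ insert (x, y, z) T ∧ z' ∈ A ∧ y' < z' ∧
          D.hits A y' z' ≤ 2 * D.k := by
      intro hn v hv
      rw [hJ v hv]
      refine or_congr_right ⟨fun ⟨y', z', h1, h2⟩ => ⟨y', z', Finset.mem_insert_of_mem h1, h2⟩,
        fun ⟨y', z', h1, h2⟩ => ?_⟩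
      rcases Finset.mem_insert.1 h1 with h | h
      · simp only [Prod.mk.injEq] at h
        obtain ⟨-, rfl, rfl⟩ := h
        exact absurd h2 hn
      · exact ⟨y', z', h, h2⟩
    simp only [wp_ite, wp_put, wp_skip, Exp.eval, Exp.eval_entry, Exp.chk, hz, hy, hx, hC.row y hyn,
      hcnt, hk']
    refine ⟨fun h1 => ⟨fun h2 => ?_, fun h2 => ⟨by omega, trivial, trivial, hskip fun h => h2 h.2.1⟩⟩,
      fun h1 => ⟨by omega, trivial, trivial, hskip fun h => h1 (hzA.2 h.1)⟩⟩
    rw [hc y z hyA (hzA.1 h1) h2]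
    refine ⟨fun h3 => ⟨by omega, trivial, trivial, hskip fun h => by have := h.2.2; omega⟩,
      fun h3 => ⟨by omega, by omega, by simpa using hk', by simpa using hcnt, fun v hv => ?_⟩⟩
    by_cases hvx : v = x
    · subst hvx
      simp only [St.setA_a, if_true, Function.update_self, Nat.zero_lt_one, true_iff]
      exact .inr ⟨y, z, Finset.mem_insert_self _ _, hzA.1 h1, h2, by omega⟩
    · simp [Function.update_apply, hvx, hJ v hv]
  · rintro t s' ⟨ht, hM, T, ⟨-, -, hJ⟩, hT⟩
    refine ⟨ht, hM, fun v hv => ?_⟩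
    rw [hJ v hv, Input.ker, Set.mem_union]
    by_cases hvA : v ∈ A
    · simp [hvA]
    refine or_congr_right ⟨?_, ?_⟩
    · rintro ⟨y, z, h, hz, hyz, hh⟩
      obtain ⟨h1, h2, h3⟩ := (hT _ _ _).1 h
      exact ⟨y, h2, z, hz, h3, hh⟩
    · rintro ⟨y, hy, z, hz, hh, hle⟩
      -- Symmetry of hits reduces an arbitrary pair to an increasing one, the only kind the program
      -- looks at.
      rcases lt_or_gt_of_ne hh.2.2.1 with h | h
      · exact ⟨y, z, (hT _ _ _).2 ⟨hvA, hy, hh⟩, hz, h, hle⟩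
      · exact ⟨z, y, (hT _ _ _).2 ⟨hvA, hz, hh.symm⟩, hy, h, by rwa [Input.hits_comm]⟩

end

/-! ### The vertices and edges of the kernel -/

/-- Enter the neighbours of `b` in the second graph into the matrix `mat'`. -/
def scan : Cmd :=
  .get .p (.add (.v .fin) (.v .b)) ;; .get .e (.add (.add (.v .fin) (.v .b)) (.c 1)) ;;
  loop .p (.v .e) (.get .x (.add (.sub (.add (.v .fin) (.v .lb)) (.c 2)) (.v .p)) ;;
    .put .mat' (.add (.a .row (.v .b)) (.v .x)) (.c 1))

/-- List the marked vertices, and compute the adjacency matrix of the second graph for them. -/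
def collect : Cmd :=
  .set .nk (.c 0) ;; forTo .i (.v .ni) (.set .b (.a .ni (.v .i)) ;;
    .ite (.c 0) (.a .inK (.v .b)) (.put .klist (.v .nk) (.v .b) ;; inc .nk ;; scan) .skip)

/-- Add the essential edges to the first graph, unless they are too many or are not in the second
graph. -/
def addEss : Cmd :=
  .set .kk (.v .k) ;; forTo .i (.v .na) (forTo .j (.v .na)
    (.set .y (.a .alist (.v .i)) ;; .set .z (.a .alist (.v .j)) ;;
      .ite (.v .y) (.v .z) (.ite (.add (.v .k) (.v .k)) (.entry .cnt .y .z)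
        (.ite (.entry .mat' .y .z) (.c 1) (.set .no (.c 1)) .skip ;;
          .ite (.c 0) (.v .kk) (.set .kk (.sub (.v .kk) (.c 1))) (.set .no (.c 1)) ;;
          .put .mat (.add (.a .row (.v .y)) (.v .z)) (.c 1) ;;
          .put .mat (.add (.a .row (.v .z)) (.v .y)) (.c 1)) .skip) .skip))

/-- The array `klist` lists the vertices of the kernel. -/
structure KList (D : Input) (K : Set ℕ) (s : St) : Prop where
  lt : ∀ i < s.v .nk, s.a .klist i < D.n
  inj : ∀ i j, i < j → j < s.v .nk → s.a .klist i ≠ s.a .klist j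
  mem : ∀ v, v ∈ K ↔ ∃ i < s.v .nk, s.a .klist i = v

section
variable {D : Input} {W N : ℕ} {A : Set ℕ}

open Classical in
theorem wp_scan (hE : Env D W N) {s : St} {b : ℕ} (hC : Ctx D s) (hf : s.v .fin = D.n + 3 + D.M)
    (hb : s.v .b = b) (hbn : b < D.n) :
    wp W N scan s fun t s' => t ≤ 4 * D.n + 3 ∧ ∀ i, s'.a .mat' i =
      if ∃ w, D.G₂.Adj b w ∧ i = b * D.n + w then 1 else s.a .mat' i := by
  have hW := hE.n_le
  have hlen := hE.len
  have hN := hE.N_le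
  have hl := D.length_list
  have hM : D.off₂ (b + 1) ≤ D.off₂ D.n := D.off₂_mono hbn
  have hs1 := D.off₂_succ b
  have hdeg := D.length_nb₂_le b
  have io1 := hC.io (D.n + 3 + D.M + b) (by omega)
  rw [D.list_off₂ hbn.le] at io1
  have io2 := hC.io (D.n + 3 + D.M + (b + 1)) (by omega)
  rw [D.list_off₂ (by omega), hs1] at io2
  simp only [scan, wp_seq, wp_get, Exp.eval, hf, hb, St.setV_v, reduceCtorEq, if_false, St.setV_io]
  refine ⟨by omega, by omega, ?_⟩
  rw [io1, add_assoc (D.n + 3 + D.M), io2]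
  refine wp_mono (wp_loop (D.off₂ b) (D.nb₂ b).length (fun j s' => Ctx D s' ∧
    s'.v .fin = D.n + 3 + D.M ∧ s'.v .b = b ∧ s'.v .e = D.off₂ b + (D.nb₂ b).length ∧
    ∀ i, s'.a .mat' i = if ∃ j' < j, i = b * D.n + (D.nb₂ b).getD j' 0 then 1 else s.a .mat' i)
    (fun _ => 2) (by omega) (by simp [Cmd.wv]) (by simp)
    ⟨hC.congr (by simp) (by simp) rfl rfl rfl, by simpa, by simpa, by simp, by simp⟩
    (fun j s' h => by simpa using h.2.2.2.1) ?_) ?_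
  · rintro j s' hj ⟨hC', hf', hb', he', hm'⟩ hp'
    have io3 := hC'.io (2 * D.n + 4 + D.M + (D.off₂ b + j)) (by omega)
    rw [D.list_nb₂ hbn hj] at io3
    simp only [wp_seq, wp_get, wp_put, Exp.eval, Exp.chk, hf', hC'.lb, hp', St.setV_v,
      reduceCtorEq, if_false, if_true, hb', St.setV_a, hC'.row b hbn]
    rw [show D.n + 3 + D.M + (D.n + 3) - 2 + (D.off₂ b + j) =
      2 * D.n + 4 + D.M + (D.off₂ b + j) by omega, io3]
    refine ⟨by omega, by omega, le_rfl, hC'.congr (by simp) (by simp) (by simp) (by simp) rfl,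
      by simpa, by simpa, by simpa using he', fun i => ?_⟩
    simp only [St.setV_a, St.setA_a, if_true, Function.update_apply]
    by_cases h : i = b * D.n + (D.nb₂ b).getD j 0
    · rw [if_pos h, if_pos ⟨j, by omega, h⟩]
    · rw [if_neg h, hm']
      congr 1
      simp only [eq_iff_iff]
      constructor
      · rintro ⟨j', hj', h'⟩
        exact ⟨j', by omega, h'⟩
      · rintro ⟨j', hj', h'⟩
        rcases Nat.lt_succ_iff_lt_or_eq.1 hj' with hj' | rfl
        · exact ⟨j', hj', h'⟩
        · exact absurd h' h
  · rintro t s' ⟨ht, ⟨-, -, -, -, hm'⟩, -⟩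
    refine ⟨by simp at ht; omega, fun i => ?_⟩
    rw [hm']
    congr 1
    simp only [eq_iff_iff, ← D.mem₂]
    constructor
    · rintro ⟨j, hj, h⟩
      refine ⟨_, ?_, h⟩
      rw [List.getD_eq_getElem _ _ hj]
      exact List.getElem_mem _
    · rintro ⟨w, hw, h⟩
      obtain ⟨j, hj, rfl⟩ := List.mem_iff_getElem.1 hw
      exact ⟨j, hj, by rw [List.getD_eq_getElem _ _ hj]; exact h⟩

/-- Kernel vertices are not isolated, so running through `ni` finds all of them. Only their rows of
the second graph are read, at most `M` rows of length at most `n`; reading the whole second graph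
would not fit the time bound. -/
theorem wp_collect (hE : Env D W N) {s : St} {K : Set ℕ} (hC : Ctx D s) (hNI : NIs D s)
    (hf : s.v .fin = D.n + 3 + D.M) (hK : ∀ v < D.n, 0 < s.a .inK v ↔ v ∈ K)
    (hKadj : ∀ v ∈ K, ∃ u, D.G₁.Adj v u) (hm : ∀ i, s.a .mat' i = 0) :
    wp W N collect s fun t s' => t ≤ 14 * (D.n * (D.M + 1)) + 3 ∧ KList D K s' ∧
      s'.v .nk ≤ D.M ∧ ∀ u ∈ K, ∀ v < D.n, 0 < s'.a .mat' (u * D.n + v) ↔ D.G₂.Adj u v := by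
  classical
  have hW := hE.n_le
  have hni := hNI.le_n
  have hniM := hNI.le_M
  rw [collect, wp_seq, wp_set]
  refine ⟨Nat.zero_le _, wp_mono (wp_forTo_const (s.v .ni) (4 * D.n + 7) (fun j s' => Ctx D s' ∧
    s'.v .ni = s.v .ni ∧ s'.a .ni = s.a .ni ∧ s'.a .inK = s.a .inK ∧ s'.v .fin = D.n + 3 + D.M ∧
    s'.v .nk ≤ j ∧ (∀ i < s'.v .nk, ∃ i' < j, s'.a .klist i = s.a .ni i' ∧ s.a .ni i' ∈ K) ∧
    (∀ i j, i < j → j < s'.v .nk → s'.a .klist i ≠ s'.a .klist j) ∧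
    (∀ i' < j, s.a .ni i' ∈ K → ∃ i < s'.v .nk, s'.a .klist i = s.a .ni i') ∧
    (∀ u v, u < D.n → v < D.n → (0 < s'.a .mat' (u * D.n + v) ↔ D.G₂.Adj u v ∧ u ∈ K ∧
      ∃ i' < j, s.a .ni i' = u)))
    (by omega) (by decide) ⟨hC.congr (by simp) (by simp) rfl rfl rfl, by simp, rfl, rfl, by simpa,
      by simp, by simp, by simp, by simp, by simp [hm]⟩ (fun j s' h => h.2.1) ?_) ?_⟩
  · rintro j s' hj ⟨hC', hni', hna', hinK', hf', hnk', hk1, hk2, hk3, hm'⟩ hi'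
    set b := s.a .ni j with hb
    have hbn : b < D.n := hNI.lt j hj
    have hbK := hK b hbn
    simp only [wp_seq, wp_set, wp_ite, wp_skip, wp_put, inc, Exp.eval, Exp.chk, hi', hna', ← hb,
      St.setV_v, reduceCtorEq, if_false, if_true, true_and, St.setV_a, hinK', St.setA_v]
    refine ⟨fun h => ⟨by omega, ?_⟩, fun h => ⟨by omega, hC'.congr (by simp) (by simp) rfl rfl rfl,
      by simpa, by simpa, by omega, fun i hi => ?_, by simpa using hk2, fun i' hi' hiK => ?_,
      fun u v hu hv => ?_⟩⟩
    · set s₁ := (((s'.setV .b b).setA .klist (s'.v .nk) b).setV .nk (s'.v .nk + 1)) with hs1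
      have hC1 : Ctx D s₁ := hC'.congr (by simp [s₁]) (by simp [s₁]) (by simp [s₁]) (by simp [s₁])
        rfl
      refine wp_mono (wp_frame (wp_scan hE hC1 (by simpa [s₁]) (b := b) (by simp [s₁]) hbn)) ?_
      rintro t s₂ ⟨⟨ht, hm2⟩, hk⟩
      have hnk2 : s₂.v .nk = s'.v .nk + 1 := by rw [hk.v _ (by decide)]; simp [s₁]
      have hkl2 : ∀ i, s₂.a .klist i = if i = s'.v .nk then b else s'.a .klist i := fun i => by
        rw [hk.a _ (by decide)]; simp [s₁, Function.update_apply]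
      have hm1 : s₁.a .mat' = s'.a .mat' := by simp [s₁]
      have hbk := hbK.1 h
      simp only [hnk2, hkl2]
      refine ⟨by omega, hC1.congr ?_ ?_ ?_ ?_ ?_, ?_, ?_, ?_, ?_, by omega, ?_, ?_, ?_, ?_⟩
      · simp [hk.v .lb (by decide)]
      · simp [hk.v .n (by decide)]
      · simp [hk.a .row (by decide)]
      · simp [hk.a .mat (by decide)]
      · simp [hk.io rfl]
      · rw [hk.v _ (by decide)]; simpa [s₁] using hni'
      · rw [hk.a _ (by decide)]; simpa [s₁] using hna'
      · rw [hk.a _ (by decide)]; simpa [s₁] using hinK'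
      · rw [hk.v _ (by decide)]; simpa [s₁] using hf'
      · intro i hi
        split_ifs with h1
        · exact ⟨j, by omega, hb, hb ▸ hbk⟩
        · obtain ⟨i', h2, h3⟩ := hk1 i (by omega)
          exact ⟨i', by omega, h3⟩
      · intro i j' hij hj'
        rw [if_neg (by omega)]
        split_ifs with h1
        · obtain ⟨i', h2, h3, -⟩ := hk1 i (by omega)
          rw [h3]
          exact hNI.inj i' j h2 hj
        · exact hk2 i j' hij (by omega)
      · intro i' hi' hiK
        rcases Nat.lt_succ_iff_lt_or_eq.1 hi' with hi' | rfl
        · obtain ⟨i, h2, h3⟩ := hk3 i' hi' hiK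
          exact ⟨i, by omega, by rw [if_neg (by omega), h3]⟩
        · exact ⟨s'.v .nk, by omega, by simp [hb]⟩
      · intro u v hu hv
        rw [hm2, hm1]
        by_cases hub : u = b
        · subst hub
          have h4 : (∃ w, D.G₂.Adj b w ∧ b * D.n + v = b * D.n + w) ↔ D.G₂.Adj b v :=
            ⟨fun ⟨w, h1, h2⟩ => by rwa [show v = w by omega], fun h => ⟨v, h, rfl⟩⟩
          simp only [h4]
          split_ifs with h5
          · simp only [Nat.zero_lt_one, true_iff]
            exact ⟨h5, hbk, j, by omega, hb.symm⟩
          · rw [hm' b v hbn hv]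
            simp [h5]
        · rw [if_neg, hm' u v hu hv]
          · refine and_congr_right fun _ => and_congr_right fun _ =>
              ⟨fun ⟨i, h1, h2⟩ => ⟨i, by omega, h2⟩, fun ⟨i, h1, h2⟩ => ?_⟩
            rcases Nat.lt_succ_iff_lt_or_eq.1 h1 with h1 | rfl
            · exact ⟨i, h1, h2⟩
            · exact absurd h2.symm hub
          · rintro ⟨w, h1, h2⟩
            exact hub ((index_inj hv (D.lt _ _ h1.symm)).1 h2).1
    · obtain ⟨i', h2, h3⟩ := hk1 i hi
      exact ⟨i', by omega, h3⟩
    · rcases Nat.lt_succ_iff_lt_or_eq.1 hi' with hi' | rfl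
      · exact hk3 i' hi' hiK
      · exact absurd (hbK.2 hiK) h
    · rw [hm' u v hu hv]
      refine and_congr_right fun _ => and_congr_right fun huK =>
        ⟨fun ⟨i, h1, h2⟩ => ⟨i, by omega, h2⟩, fun ⟨i, h1, h2⟩ => ?_⟩
      rcases Nat.lt_succ_iff_lt_or_eq.1 h1 with h1 | rfl
      · exact ⟨i, h1, h2⟩
      · rw [← hb] at h2
        subst h2
        exact absurd (hbK.2 huK) h
  · rintro t s' ⟨ht, ⟨hC', hni', hna', hinK', hf', hnk', hk1, hk2, hk3, hm'⟩, -⟩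
    refine ⟨?_, ⟨fun i hi => ?_, hk2, fun v => ⟨fun hv => ?_, ?_⟩⟩, by omega, fun u hu v hv => ?_⟩
    · have h1 : s.v .ni * (4 * D.n + 7 + 2) ≤ D.M * (4 * D.n) + 9 * D.n := by nlinarith
      have h2 : D.M * (4 * D.n) = 4 * (D.n * D.M) := by ring
      have h3 : D.n * (D.M + 1) = D.n * D.M + D.n := by ring
      omega
    · obtain ⟨i', h2, h3, -⟩ := hk1 i hi
      rw [h3]; exact hNI.lt i' h2
    · obtain ⟨u, hu⟩ := hKadj v hv
      obtain ⟨i', hi', rfl⟩ := hNI.mem v u hu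
      exact hk3 i' hi' hv
    · rintro ⟨i, hi, rfl⟩
      obtain ⟨i', h2, h3, h4⟩ := hk1 i hi
      rwa [h3]
    · obtain ⟨w, hw⟩ := hKadj u hu
      rw [hm' u v (D.lt' hw).1 hv]
      obtain ⟨i', hi', h⟩ := hNI.mem u w hw
      exact ⟨fun h => h.1, fun h' => ⟨h', hu, i', hi', h⟩⟩

-- Each essential edge costs one unit of the budget `kk`. The flag `no` is raised by an essential
-- edge outside the second graph or by an exhausted budget; either one rules out a solution. The
-- matrix is updated regardless.
set_option maxHeartbeats 400000 in
theorem wp_addEss (hE : Env D W N) {s : St} (hC : Ctx D s) (hA : AList D A s)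
    (hk : s.v .k = D.k) (hno : s.v .no = 0)
    (hcnt : ∀ y z, y ∈ A → z ∈ A → y < z → s.a .cnt (y * D.n + z) = D.hits A y z)
    (hm : ∀ u ∈ A, ∀ v < D.n, 0 < s.a .mat' (u * D.n + v) ↔ D.G₂.Adj u v) :
    wp W N addEss s fun t s' => t ≤ s.v .na * (s.v .na * 14 + 4) + 3 ∧
      ∃ EF : Finset (Sym2 ℕ), (∀ e, e ∈ EF ↔ e ∈ (D.ess A).edgeSet) ∧
        (∀ u v, u < D.n → v < D.n →
          (0 < s'.a .mat (u * D.n + v) ↔ (D.G₁ ⊔ D.ess A).Adj u v)) ∧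
        (s'.v .no = 0 → D.ess A ≤ D.G₂ ∧ EF.card ≤ D.k ∧ s'.v .kk = D.k - EF.card) ∧
        (0 < s'.v .no → ¬ (D.ess A ≤ D.G₂ ∧ EF.card ≤ D.k)) := by
  classical
  have hW := hE.n_le
  have hlim := hE.lim
  have hna := hA.le
  set o := s.a .alist with ho
  set r := s.v .na with hr
  have hoA : ∀ i < r, o i ∈ A := fun i hi => (hA.mem _).2 ⟨i, hi, rfl⟩
  have hoinj : ∀ i j, i < r → j < r → o i = o j → i = j := fun i j hi hj h => by
    rcases lt_trichotomy i j with h1 | h1 | h1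
    · exact absurd h (hA.inj i j h1 hj)
    · exact h1
    · exact absurd h.symm (hA.inj j i h1 hi)
  let cond : ℕ → ℕ → Prop := fun y z => y < z ∧ 2 * D.k < D.hits A y z
  -- `bef` says which index pairs have been processed; both nested loops use the same invariant with
  -- different choices of it.
  let Inv : (ℕ → ℕ → Prop) → St → Prop := fun bef s' => (∀ j, j ≠ .mat → s'.a j = s.a j) ∧
    s'.v .na = r ∧ s'.v .k = D.k ∧ ∃ EF : Finset (Sym2 ℕ),
      (∀ e, e ∈ EF ↔ ∃ i' j', bef i' j' ∧ i' < r ∧ j' < r ∧ cond (o i') (o j') ∧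
        e = s(o i', o j')) ∧
      (∀ u v, u < D.n → v < D.n →
        (0 < s'.a .mat (u * D.n + v) ↔ D.G₁.Adj u v ∨ s(u, v) ∈ EF)) ∧
      (s'.v .no = 0 → (∀ e ∈ EF, e ∈ D.G₂.edgeSet) ∧ EF.card ≤ D.k ∧
        s'.v .kk = D.k - EF.card) ∧
      (0 < s'.v .no → (∃ e ∈ EF, e ∉ D.G₂.edgeSet) ∨ D.k < EF.card)
  have hInv : ∀ bef bef' s' s'', Inv bef s' → (∀ i' j', i' < r → j' < r →
      cond (o i') (o j') → (bef i' j' ↔ bef' i' j')) → s''.a = s'.a → s''.v .na = s'.v .na →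
      s''.v .k = s'.v .k → s''.v .no = s'.v .no → s''.v .kk = s'.v .kk → Inv bef' s'' := by
    rintro bef bef' s' s'' ⟨h1, h2, h3, EF, h4, h5, h6, h7⟩ hb ha e1 e2 e3 e4
    refine ⟨by rwa [ha], by rwa [e1], by rwa [e2], EF, fun e => ?_, by rwa [ha], by rwa [e3, e4],
      by rwa [e3]⟩
    rw [h4]
    constructor
    · rintro ⟨i', j', g1, g2, g3, g4, g5⟩
      exact ⟨i', j', (hb i' j' g2 g3 g4).1 g1, g2, g3, g4, g5⟩
    · rintro ⟨i', j', g1, g2, g3, g4, g5⟩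
      exact ⟨i', j', (hb i' j' g2 g3 g4).2 g1, g2, g3, g4, g5⟩
  rw [addEss, wp_seq, wp_set]
  refine ⟨trivial, wp_mono (wp_forTo_const r (r * 14 + 2) (fun i => Inv fun i' _ => i' < i)
    (by omega) (by decide) ?_ (fun j s' h => h.2.1) ?_) ?_⟩
  · refine ⟨fun _ _ => rfl, by simp [hr], by simpa, ∅, by simp, fun u v hu hv => ?_, ?_, ?_⟩
    · simpa using hC.mat u v hu hv
    · simp [hk]
    · simp [hno]
  · intro i s₁ hi hs₁ hiv
    refine wp_mono (wp_forTo_const r 12 (fun j s' => s'.v .i = i ∧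
      Inv (fun i' j' => i' < i ∨ (i' = i ∧ j' < j)) s') (by omega) (by decide) ?_
      (fun j s' h => h.2.2.1) ?_) ?_
    · exact ⟨by simpa, hInv _ _ s₁ _ hs₁ (by simp) rfl (by simp) (by simp) (by simp) (by simp)⟩
    · rintro j s₂ hj ⟨hi2, hI⟩ hj2
      have hskip : ¬ cond (o i) (o j) → ∀ s₃, s₃.a = s₂.a → s₃.v .na = s₂.v .na →
          s₃.v .k = s₂.v .k → s₃.v .no = s₂.v .no → s₃.v .kk = s₂.v .kk →
          Inv (fun i' j' => i' < i ∨ (i' = i ∧ j' < j + 1)) s₃ := by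
        intro hc s₃ e1 e2 e3 e4 e5
        refine hInv _ _ s₂ _ hI (fun i' j' _ _ hc' => ?_) e1 e2 e3 e4 e5
        refine or_congr_right (and_congr_right fun h => ⟨fun h' => by omega, fun h' => ?_⟩)
        rcases Nat.lt_succ_iff_lt_or_eq.1 h' with h' | rfl
        · exact h'
        · rw [h] at hc'; exact absurd hc' hc
      obtain ⟨ha2, hna2, hk2, EF, hEF, hmat, hn0, hn1⟩ := hI
      set y := o i with hy
      set z := o j with hz
      have hyA : y ∈ A := hoA i hi
      have hzA : z ∈ A := hoA j hj
      have hyn : y < D.n := hA.lt i hi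
      have hzn : z < D.n := hA.lt j hj
      have hm2 := hm y hyA z hzn
      rw [wp_seq, wp_set]
      refine ⟨trivial, ?_⟩
      rw [wp_seq, wp_set]
      refine ⟨trivial, ?_⟩
      have hval : ((s₂.setV .y (Exp.eval s₂ (.a .alist (.v .i)))).setV .z
          (Exp.eval (s₂.setV .y (Exp.eval s₂ (.a .alist (.v .i)))) (.a .alist (.v .j)))) =
          (s₂.setV .y y).setV .z z := by
        simp [hi2, hj2, ha2, hy, hz, ho]
      rw [hval]
      set s₃ := (s₂.setV .y y).setV .z z with hs3
      have hy3 : s₃.v .y = y := by simp [s₃]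
      have hz3 : s₃.v .z = z := by simp [s₃]
      have hk3 : s₃.v .k = D.k := by simpa [s₃]
      have hrow3 : ∀ u < D.n, s₃.a .row u = u * D.n := fun u hu => by
        simp [s₃, ha2, hC.row u hu]
      have hcnt3 : s₃.a .cnt = s.a .cnt := by simp [s₃, ha2]
      have hmat3 : s₃.a .mat' = s.a .mat' := by simp [s₃, ha2]
      have hno3 : s₃.v .no = s₂.v .no := by simp [s₃]
      have hkk3 : s₃.v .kk = s₂.v .kk := by simp [s₃]
      have hend : ¬ cond y z → (s₃.setV .j (j + 1)).v .i = i ∧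
          Inv (fun i' j' => i' < i ∨ (i' = i ∧ j' < j + 1)) (s₃.setV .j (j + 1)) := fun h =>
        ⟨by simpa [s₃], hskip h _ rfl (by simp [s₃]) (by simp [s₃]) (by simp [s₃]) (by simp [s₃])⟩
      rw [wp_ite]
      simp only [Exp.eval, hy3, hz3]
      refine ⟨fun h1 => ?_, fun h1 => by
        rw [wp_skip]; exact ⟨by omega, hend fun h => h1 h.1⟩⟩
      have hc := hcnt y z hyA hzA h1
      rw [wp_ite]
      simp only [Exp.eval, Exp.eval_entry, hy3, hz3, hk3, hrow3 y hyn, hcnt3, hc]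
      refine ⟨fun h2 => ?_, fun h2 => by
        rw [wp_skip]; exact ⟨by omega, hend fun h => h2 (by have := h.2; omega)⟩⟩
      have hcond : cond y z := ⟨h1, by omega⟩
      -- The restriction `y < z` and the injectivity of `alist` ensure that no essential edge is
      -- paid for twice.
      have hnew : s(y, z) ∉ EF := by
        rw [hEF]
        rintro ⟨i', j', hb, hi', hj', hc', he⟩
        rw [Sym2.eq_iff] at he
        rcases he with ⟨e1, e2⟩ | ⟨e1, e2⟩
        · have := hoinj i i' hi hi' e1
          have := hoinj j j' hj hj' e2
          omega
        · have := hc'.1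
          omega
      -- the two tests
      rw [wp_seq]
      have hA1 : wp W N (.ite (.entry .mat' .y .z) (.c 1) (.set .no (.c 1)) .skip) s₃
          fun t s₄ => t = 2 ∧ (s₄.v .no = 0 ↔ s₂.v .no = 0 ∧ D.G₂.Adj y z) ∧
            s₄.v .kk = s₂.v .kk := by
        rw [wp_ite]
        simp only [Exp.eval, Exp.eval_entry, hy3, hz3, hrow3 y hyn, hmat3, wp_set, wp_skip,
          Exp.chk, St.setV_v, if_true, reduceCtorEq, if_false, hkk3, hno3]
        refine ⟨fun h3 => ⟨by omega, ?_⟩, fun h3 => ?_⟩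
        · have : ¬ D.G₂.Adj y z := by rw [← hm2]; omega
          simp [this]
        · have : D.G₂.Adj y z := by rw [← hm2]; omega
          simp [this]
      refine wp_mono (wp_frame hA1) ?_
      rintro t₄ s₄ ⟨⟨ht4, hno4, hkk4⟩, hf4⟩
      rw [wp_seq]
      have hA2 : wp W N (.ite (.c 0) (.v .kk) (.set .kk (.sub (.v .kk) (.c 1))) (.set .no (.c 1)))
          s₄ fun t s₅ => t = 2 ∧ (s₅.v .no = 0 ↔ s₄.v .no = 0 ∧ 0 < s₂.v .kk) ∧
            (0 < s₂.v .kk → s₅.v .kk = s₂.v .kk - 1) := by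
        rw [wp_ite]
        simp only [Exp.eval, hkk4, wp_set, Exp.chk, St.setV_v, if_true, reduceCtorEq, if_false]
        refine ⟨fun h3 => ⟨trivial, ?_⟩, fun h3 => ⟨by omega, ?_⟩⟩ <;> simp [h3]
      refine wp_mono (wp_frame hA2) ?_
      rintro t₅ s₅ ⟨⟨ht5, hno5, hkk5⟩, hf5⟩
      have ha5 : s₅.a = s₂.a := by
        funext j'
        rw [hf5.a j' (by simp [Cmd.wa]), hf4.a j' (by simp [Cmd.wa])]
        simp [s₃]
      have hv5 : ∀ v, v ≠ .no → v ≠ .kk → s₅.v v = s₃.v v := fun v g1 g2 => by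
        rw [hf5.v v (by simp [Cmd.wv, g1, g2]), hf4.v v (by simp [Cmd.wv, g1])]
      have hrow5 : ∀ u < D.n, s₅.a .row u = u * D.n := fun u hu => by
        simp [ha5, ha2, hC.row u hu]
      simp only [wp_seq, wp_put, Exp.eval, Exp.chk, St.setA_v, St.setA_a, reduceCtorEq, if_false,
        hv5 .y (by decide) (by decide), hv5 .z (by decide) (by decide), hy3, hz3, hrow5 y hyn,
        hrow5 z hzn]
      refine ⟨by omega, by omega, by omega, by simp [hv5, s₃, hi2], ?_⟩
      refine ⟨fun j' hj' => by simp [hj', ha5, ha2], by simp [hv5, s₃, hna2],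
        by simp [hv5, s₃, hk2], insert s(y, z) EF, fun e => ?_, fun u v hu hv => ?_, ?_, ?_⟩
      · rw [Finset.mem_insert, hEF]
        constructor
        · rintro (rfl | ⟨i', j', g1, g2⟩)
          · exact ⟨i, j, .inr ⟨rfl, by omega⟩, hi, hj, hcond, rfl⟩
          · exact ⟨i', j', g1.imp_right fun g => ⟨g.1, by omega⟩, g2⟩
        · rintro ⟨i', j', g1, g2, g3, g4, g5⟩
          rcases g1 with g1 | ⟨rfl, g1⟩
          · exact .inr ⟨i', j', .inl g1, g2, g3, g4, g5⟩
          · rcases Nat.lt_succ_iff_lt_or_eq.1 g1 with g1 | rfl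
            · exact .inr ⟨i', j', .inr ⟨rfl, g1⟩, g2, g3, g4, g5⟩
            · exact .inl g5
      · simp only [St.setV_a, St.setA_a, if_true, Function.update_apply, index_inj hv hyn,
          index_inj hv hzn, ha5, Finset.mem_insert, Sym2.eq_iff]
        have := hmat u v hu hv
        split_ifs with g1 g2
        · simp [g1]
        · simp [g2]
        · rw [this]
          exact or_congr_right ⟨.inr, fun h => h.resolve_left fun h' => h'.elim g2 g1⟩
      · simp only [St.setV_v, St.setA_v, reduceCtorEq, if_false]
        intro hn
        obtain ⟨g1, g2⟩ := hno5.1 hn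
        obtain ⟨g3, g4⟩ := hno4.1 g1
        obtain ⟨g5, g6, g7⟩ := hn0 g3
        rw [Finset.card_insert_of_notMem hnew]
        refine ⟨fun e he => ?_, by omega, by rw [hkk5 g2]; omega⟩
        rcases Finset.mem_insert.1 he with rfl | he
        · exact g4
        · exact g5 e he
      · simp only [St.setV_v, St.setA_v, reduceCtorEq, if_false]
        intro hn
        rw [Finset.card_insert_of_notMem hnew]
        by_cases g1 : s₂.v .no = 0
        · by_cases g2 : D.G₂.Adj y z
          · obtain ⟨g5, g6, g7⟩ := hn0 g1
            have : ¬ 0 < s₂.v .kk := fun g3 => by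
              have := hno5.2 ⟨hno4.2 ⟨g1, g2⟩, g3⟩
              omega
            right; omega
          · exact .inl ⟨_, Finset.mem_insert_self _ _, g2⟩
        · rcases hn1 (by omega) with ⟨e, g3, g4⟩ | g3
          · exact .inl ⟨e, Finset.mem_insert_of_mem g3, g4⟩
          · right; omega
    · rintro t s' ⟨ht, ⟨hi', hI⟩, hj'⟩
      refine ⟨by omega, hInv _ _ s' _ hI (fun i' j' h1 h2 _ => ?_) rfl (by simp) (by simp)
        (by simp) (by simp)⟩
      omega
  · rintro t s' ⟨ht, ⟨ha', hna', hk', EF, hEF, hmat, hn0, hn1⟩, -⟩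
    have hEF' : ∀ e, e ∈ EF ↔ e ∈ (D.ess A).edgeSet := by
      intro e
      rw [hEF]
      constructor
      · rintro ⟨i', j', -, g2, g3, g4, rfl⟩
        exact ⟨hoA i' g2, hoA j' g3, g4.1.ne, g4.2⟩
      · induction e with
        | _ y z =>
          rintro ⟨g1, g2, g3, g4⟩
          obtain ⟨i, hi, rfl⟩ := (hA.mem y).1 g1
          obtain ⟨j, hj, rfl⟩ := (hA.mem z).1 g2
          rcases lt_or_gt_of_ne g3 with g5 | g5
          · exact ⟨i, j, hi, hi, hj, ⟨g5, g4⟩, rfl⟩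
          · exact ⟨j, i, hj, hj, hi, ⟨g5, by rwa [Input.hits_comm]⟩, Sym2.eq_swap⟩
    have hle : (∀ e ∈ EF, e ∈ D.G₂.edgeSet) ↔ D.ess A ≤ D.G₂ := by
      simp only [hEF', ← SimpleGraph.edgeSet_subset_edgeSet]
      rfl
    rw [show r * 14 + 2 + 2 = r * 14 + 4 from rfl] at ht
    refine ⟨by omega, EF, hEF', fun u v hu hv => ?_, fun h => ?_, fun h hc => ?_⟩
    · rw [hmat u v hu hv, hEF', SimpleGraph.mem_edgeSet, SimpleGraph.sup_adj]
    · rw [← hle]; exact hn0 h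
    · rw [← hle] at hc
      rcases hn1 h with ⟨e, g1, g2⟩ | g1
      · exact g2 (hc.1 e g1)
      · omega

end

/-! ### Output -/

/-- The list `l` stands at the position `p`. -/
def At (io : ℕ → ℕ) (p : ℕ) (l : List ℕ) : Prop := ∀ i < l.length, io (p + i) = l.getD i 0

theorem At.nil (io : ℕ → ℕ) (p : ℕ) : At io p [] := fun i hi => absurd hi (Nat.not_lt_zero _)

theorem At.append {io : ℕ → ℕ} {p : ℕ} {l l' : List ℕ} (h : At io p l)
    (h' : At io (p + l.length) l') : At io p (l ++ l') := by
  intro i hi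
  rcases lt_or_ge i l.length with h1 | h1
  · rw [List.getD_append _ _ _ _ h1, h i h1]
  · rw [List.getD_append_right _ _ _ _ h1]
    rw [List.length_append] at hi
    have := h' (i - l.length) (by omega)
    rwa [show p + l.length + (i - l.length) = p + i by omega] at this

theorem At.congr {io io' : ℕ → ℕ} {p : ℕ} {l : List ℕ} (h : At io p l)
    (he : ∀ a, p ≤ a → a < p + l.length → io' a = io a) : At io' p l := fun i hi => by
  rw [he _ (by omega) (by omega), h i hi]

theorem At.snoc {io : ℕ → ℕ} {p : ℕ} {l : List ℕ} (h : At io p l) {c a : ℕ}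
    (hc : c = p + l.length) : At (Function.update io c a) p (l ++ [a]) := by
  subst hc
  refine (h.congr fun b _ hb => Function.update_of_ne (by omega) _ _).append ?_
  intro i hi
  obtain rfl : i = 0 := by simpa using hi
  simp

theorem At.update {io : ℕ → ℕ} {p : ℕ} {l : List ℕ} (h : At io p l) {c : ℕ} (a : ℕ)
    (hc : c < p ∨ p + l.length ≤ c) : At (Function.update io c a) p l :=
  h.congr fun b _ _ => Function.update_of_ne (by omega) _ _

/-- Write the adjacency lists that correspond to the matrix. -/
def emit (m : Arr) : Cmd :=
  .set .off (.c 0) ;; .set .q (.add (.add (.v .pos) (.v .nk)) (.c 1)) ;;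
  forTo .i (.v .nk) (.wr (.v .pos) (.v .off) ;; inc .pos ;; .set .u (.a .klist (.v .i)) ;;
    forTo .j (.v .nk) (.set .w (.a .klist (.v .j)) ;;
      .ite (.c 0) (.entry m .u .w) (.wr (.v .q) (.v .j) ;; inc .q ;; inc .off) .skip)) ;;
  .wr (.v .pos) (.v .off) ;; .set .pos (.v .q)

/-- The adjacency list of number `i`. -/
def outNb (s : St) (n : ℕ) (m : Arr) (i : ℕ) : List ℕ :=
  (List.range (s.v .nk)).filter fun j => 0 < s.a m (s.a .klist i * n + s.a .klist j)

/-- Count the edges of the second graph that are not in the first one. -/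
def countFree : Cmd :=
  .set .free (.c 0) ;; forTo .i (.v .nk) (.set .u (.a .klist (.v .i)) ;;
    forTo .j (.v .nk) (.set .w (.a .klist (.v .j)) ;;
      .ite (.v .i) (.v .j) (.ite (.c 0) (.entry .mat' .u .w)
        (.ite (.entry .mat .u .w) (.c 1) (inc .free) .skip) .skip) .skip))

/-- Write the kernel behind the input. -/
def output : Cmd :=
  countFree ;; .ite (.v .free) (.v .kk) (.set .kk (.v .free)) .skip ;;
  .wr (.v .len) (.v .nk) ;; .wr (.add (.v .len) (.c 1)) (.v .kk) ;;
  .set .pos (.add (.v .len) (.c 2)) ;; emit .mat ;; emit .mat' ;; .set .out (.v .len)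

/-- Write a fixed list. -/
def writeList : List ℕ → Cmd
  | [] => .skip
  | a :: l => .wr (.v .pos) (.c a) ;; inc .pos ;; writeList l

/-- The edges that may be added to the kernel. -/
def outFree (s : St) (n : ℕ) : ℕ :=
  ∑ i ∈ Finset.range (s.v .nk), ∑ j ∈ Finset.range (s.v .nk),
    if i < j ∧ 0 < s.a .mat' (s.a .klist i * n + s.a .klist j) ∧
      s.a .mat (s.a .klist i * n + s.a .klist j) = 0 then 1 else 0

section
variable {D : Input} {W N : ℕ} {K : Set ℕ}

/-- Two positions advance in parallel: `pos` through the offsets and `q` through the lists behind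
them. So the offsets need no separate pass over the matrix. -/
theorem wp_emit (hE : Env D W N) {s : St} {m : Arr} (hrow : ∀ u < D.n, s.a .row u = u * D.n)
    (hKL : KList D K s)
    (hpos : s.v .pos + (listArray (s.v .nk) (outNb s D.n m)).length ≤ N) :
    wp W N (emit m) s fun t s' => t ≤ s.v .nk * (s.v .nk * 7 + 7) + 6 ∧
      At s'.io (s.v .pos) (listArray (s.v .nk) (outNb s D.n m)) ∧
      s'.v .pos = s.v .pos + (listArray (s.v .nk) (outNb s D.n m)).length ∧
      ∀ a < s.v .pos, s'.io a = s.io a := by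
  have hW := hE.n_le
  have hN := hE.N_le
  set r := s.v .nk with hr
  set nb := outNb s D.n m with hnb
  set o := s.a .klist with ho
  set p₀ := s.v .pos with hp0
  have hrn : r ≤ D.n := le_of_inj hKL.lt hKL.inj
  let fl : ℕ → List ℕ := fun i => (List.range i).flatMap nb
  have hfl : ∀ i, fl (i + 1) = fl i ++ nb i := fun i => by
    simp [fl, List.range_succ]
  have hflmono : ∀ i ≤ r, (fl i).length ≤ (fl r).length := by
    intro i hi
    simp only [fl, length_flatMap_range]
    exact Finset.sum_le_sum_of_subset fun a ha => by
      simp only [Finset.mem_range] at ha ⊢; omega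
  have hlist : listArray r nb = (List.range (r + 1)).map (fun i => (fl i).length) ++ fl r := by
    simp only [listArray, fl, length_flatMap_range]
  have hlen : (listArray r nb).length = r + 1 + (fl r).length := by
    rw [hlist]; simp
  rw [hlen] at hpos ⊢
  let S : St → Prop := fun s' => s'.a = s.a ∧ s'.v .nk = r ∧ ∀ a < p₀, s'.io a = s.io a
  simp only [emit, wp_seq, wp_set, Exp.eval, Exp.chk, ← hr, ← hp0, St.setV_v, reduceCtorEq, if_false]
  refine ⟨by omega, by omega, ?_⟩
  refine wp_mono (wp_forTo_const r (r * 7 + 5) (fun i s' => S s' ∧ s'.v .pos = p₀ + i ∧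
    s'.v .q = p₀ + r + 1 + (fl i).length ∧ s'.v .off = (fl i).length ∧
    At s'.io p₀ ((List.range i).map fun i => (fl i).length) ∧ At s'.io (p₀ + r + 1) (fl i))
    (by omega) (by simp [Cmd.wv, forTo, loop, inc]) ?_ (fun j s' h => h.1.2.1) ?_) ?_
  · exact ⟨⟨rfl, by simp [hr], fun _ _ => rfl⟩, by simp [hp0], by simp [fl], by simp [fl],
      by simpa using At.nil _ _, by simpa [fl] using At.nil _ _⟩
  · rintro i s₁ hi ⟨⟨ha1, hnk1, hio1⟩, hpos1, hq1, hoff1, hat1, hat1'⟩ hiv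
    have hfi := hflmono (i + 1) (by omega)
    rw [hfl] at hfi
    rw [List.length_append] at hfi
    simp only [wp_seq, wp_wr, wp_set, inc, Exp.eval, Exp.chk, hpos1, hoff1, St.setCell_v, St.setV_v,
      if_true, reduceCtorEq, if_false, true_and, hiv, St.setV_a, St.setCell_a, ha1, ← ho]
    refine ⟨by omega, by omega, ?_⟩
    refine wp_mono (wp_forTo_const r 5 (fun j s' => S s' ∧ s'.v .i = i ∧ s'.v .u = o i ∧
      s'.v .pos = p₀ + i + 1 ∧ ∃ l, l = (List.range j).filter
          (fun j => 0 < s.a m (o i * D.n + o j)) ∧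
      s'.v .q = p₀ + r + 1 + (fl i ++ l).length ∧ s'.v .off = (fl i ++ l).length ∧
      At s'.io p₀ ((List.range (i + 1)).map fun i => (fl i).length) ∧
      At s'.io (p₀ + r + 1) (fl i ++ l))
      (by omega) (by simp [Cmd.wv, forTo, loop, inc]) ?_ (fun j s' h => h.1.2.1) ?_) ?_
    · refine ⟨⟨by simpa using ha1, by simp [hnk1], fun a ha => ?_⟩, by simp [hiv], by simp, by simp,
        [], by simp, by simp [hq1], by simp [hoff1], ?_, ?_⟩
      · simp [Function.update_apply, hio1 a ha]; omega
      · rw [List.range_succ, List.map_append]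
        simpa using hat1.snoc (by simp)
      · simpa using hat1'.update _ (.inl (by omega))
    · rintro j s₂ hj ⟨⟨ha2, hnk2, hio2⟩, hi2, hu2, hpos2, l, hl, hq2, hoff2, hat2, hat2'⟩ hjv
      have hll : (l ++ if 0 < s.a m (o i * D.n + o j) then [j] else []) =
          (List.range (j + 1)).filter fun j => 0 < s.a m (o i * D.n + o j) := by
        rw [List.range_succ, List.filter_append, ← hl]
        simp [List.filter_singleton]
      have hlen2 : (l ++ if 0 < s.a m (o i * D.n + o j) then [j] else []).length ≤
          (nb i).length := by
        rw [hll, hnb, outNb, ← List.countP_eq_length_filter, ← List.countP_eq_length_filter]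
        refine List.Sublist.countP_le ?_
        exact List.range_sublist.2 (by omega)
      have hrowi : s.a .row (o i) = o i * D.n := hrow _ (hKL.lt i hi)
      simp only [wp_seq, wp_set, wp_ite, wp_skip, wp_wr, inc, Exp.eval, Exp.eval_entry, Exp.chk,
        hjv, St.setV_v, if_true, reduceCtorEq, if_false, true_and, hu2, St.setV_a, ha2, ← ho,
        hrow _ (hKL.lt i hi), hq2, hoff2, St.setCell_v]
      refine ⟨fun h => ?_, fun h => ?_⟩
      · rw [hrowi] at h
        rw [if_pos h] at hll hlen2
        simp only [List.length_append, List.length_singleton] at hlen2 ⊢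
        refine ⟨by omega, by omega, by omega, by omega, ⟨by simpa using ha2, by simpa, fun a ha => ?_⟩,
          hi2, hpos2, l ++ [j], hll, by simp; omega, by simp; omega, ?_, ?_⟩
        · simp [Function.update_apply, hio2 a ha]; omega
        · exact hat2.update _ (.inr (by simp; omega))
        · rw [← List.append_assoc]
          exact hat2'.snoc (by simp)
      · rw [hrowi] at h
        rw [if_neg h, List.append_nil] at hll
        exact ⟨by omega, ⟨by simpa using ha2, by simpa, hio2⟩, hi2, hpos2, l, hll, rfl, rfl,
          hat2, hat2'⟩
    · rintro t s' ⟨ht, ⟨⟨ha', hnk', hio'⟩, hi', hu', hpos', l, hl, hq', hoff', hat, hat'⟩, -⟩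
      have hli : fl i ++ l = fl (i + 1) := by
        rw [hfl, hl]
        rfl
      rw [hli] at hq' hoff' hat'
      exact ⟨by omega, ⟨by simpa using ha', by simpa, hio'⟩, by simp [hpos']; omega, by simpa using hq',
        by simpa using hoff', hat, hat'⟩
  · rintro t s₁ ⟨ht, ⟨⟨ha1, hnk1, hio1⟩, hpos1, hq1, hoff1, hat1, hat1'⟩, -⟩
    rw [show r * 7 + 5 + 2 = r * 7 + 7 from rfl] at ht
    simp only [wp_wr, Exp.eval, Exp.chk, hpos1, hoff1, St.setCell_v, hq1, St.setV_v, if_true,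
      St.setV_io, St.setCell_io, true_and]
    refine ⟨by omega, by omega, ?_, by omega, fun a ha => ?_⟩
    · rw [hlist, List.range_succ, List.map_append]
      refine At.append ?_ ?_
      · simpa using hat1.snoc (by simp)
      · simpa [add_assoc] using hat1'.update _ (.inl (by omega))
    · rw [Function.update_of_ne (by omega), hio1 a ha]

theorem wp_countFree (hE : Env D W N) {s : St} (hrow : ∀ u < D.n, s.a .row u = u * D.n)
    (hKL : KList D K s) :
    wp W N countFree s fun t s' => t ≤ s.v .nk * (s.v .nk * 7 + 5) + 3 ∧
      s'.v .free = outFree s D.n := by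
  have hW := hE.n_le
  set r := s.v .nk with hr
  set o := s.a .klist with ho
  have hrn : r ≤ D.n := le_of_inj hKL.lt hKL.inj
  let g : ℕ → ℕ → ℕ := fun i j => if i < j ∧ 0 < s.a .mat' (o i * D.n + o j) ∧
      s.a .mat (o i * D.n + o j) = 0 then 1 else 0
  have hg : ∀ i j, g i j ≤ 1 := fun i j => by simp only [g]; split_ifs <;> omega
  have hsum : ∀ i j, ∑ b ∈ Finset.range j, g i b ≤ j := fun i j => by
    simpa using Finset.sum_le_card_nsmul (Finset.range j) (g i) 1 fun b _ => hg i b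
  have hsum2 : ∀ i j, ∑ a ∈ Finset.range i, ∑ b ∈ Finset.range j, g a b ≤ i * j := fun i j => by
    simpa using Finset.sum_le_card_nsmul (Finset.range i) _ j fun a _ => hsum a j
  have hrr : r * r ≤ D.n * D.n := Nat.mul_le_mul hrn hrn
  rw [countFree, wp_seq, wp_set]
  refine ⟨by simp, wp_mono (wp_forTo_const r (r * 7 + 3) (fun i s' => s'.a = s.a ∧ s'.v .nk = r ∧
    s'.v .free = ∑ a ∈ Finset.range i, ∑ b ∈ Finset.range r, g a b)
    (by omega) (by decide) (by simp [hr]) (fun j s' h => h.2.1) ?_) ?_⟩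
  · rintro i s₁ hi ⟨ha1, hnk1, hf1⟩ hiv
    rw [wp_seq, wp_set]
    refine ⟨trivial, wp_mono (wp_forTo_const r 5 (fun j s' => s'.a = s.a ∧ s'.v .nk = r ∧
      s'.v .i = i ∧ s'.v .u = o i ∧
      s'.v .free = ∑ a ∈ Finset.range i, ∑ b ∈ Finset.range r, g a b + ∑ b ∈ Finset.range j, g i b)
      (by omega) (by decide) (by simp [hnk1, ha1, hiv, hf1, ho]) (fun j s' h => h.2.1) ?_) ?_⟩
    · rintro j s₂ hj ⟨ha2, hnk2, hi2, hu2, hf2⟩ hjv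
      have h1 := hsum2 i r
      have h2 := hsum i j
      have h3 : (i + 1) * r ≤ r * r := Nat.mul_le_mul_right _ hi
      rw [add_mul, one_mul] at h3
      simp only [wp_seq, wp_set, wp_ite, wp_skip, inc, Exp.eval, Exp.eval_entry, Exp.chk,
        hjv, St.setV_v, if_true, reduceCtorEq, if_false, true_and, hu2, St.setV_a, ha2, ← ho,
        hrow _ (hKL.lt i hi), hi2, Finset.sum_range_succ _ j, hf2, hnk2]
      have hg1 : i < j → 0 < s.a .mat' (o i * D.n + o j) → s.a .mat (o i * D.n + o j) < 1 →
          g i j = 1 := fun a b c => if_pos ⟨a, b, by omega⟩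
      have hg0 : ¬ (i < j ∧ 0 < s.a .mat' (o i * D.n + o j) ∧ s.a .mat (o i * D.n + o j) < 1) →
          g i j = 0 := fun h => if_neg fun h' => h ⟨h'.1, h'.2.1, by omega⟩
      rw [hrow _ (hKL.lt i hi)]
      refine ⟨fun a => ⟨fun b => ⟨fun c => ?_, fun c => ?_⟩, fun b => ?_⟩, fun a => ?_⟩
      · rw [hg1 a b c]
        exact ⟨by omega, by omega, by omega⟩
      · rw [hg0 fun h => c h.2.2]
        exact ⟨by omega, rfl⟩
      · rw [hg0 fun h => b h.2.1]
        exact ⟨by omega, rfl⟩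
      · rw [hg0 fun h => a h.1]
        exact ⟨by omega, rfl⟩
    · rintro t s' ⟨ht, ⟨ha', hnk', hi', hu', hf'⟩, -⟩
      refine ⟨by omega, by simpa using ha', by simpa, ?_⟩
      rw [Finset.sum_range_succ]
      simpa using hf'
  · rintro t s' ⟨ht, ⟨-, -, hf'⟩, -⟩
    rw [show r * 7 + 3 + 2 = r * 7 + 5 from rfl] at ht
    exact ⟨by omega, hf'⟩

theorem wp_writeList (l : List ℕ) {s : St} (hW : s.v .pos + l.length ≤ W) (hl : ∀ a ∈ l, a ≤ W)
    (hN : s.v .pos + l.length ≤ N) :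
    wp W N (writeList l) s fun t s' => t ≤ 2 * l.length + 1 ∧ At s'.io (s.v .pos) l ∧
      ∀ a < s.v .pos, s'.io a = s.io a := by
  induction l generalizing s with
  | nil => simp [writeList, At.nil]
  | cons a l ih =>
    simp only [List.length_cons] at hW hN
    simp only [writeList, inc, wp_seq, wp_wr, wp_set, Exp.eval, Exp.chk, St.setCell_v]
    refine ⟨by omega, hl a (by simp), by omega, ?_⟩
    refine wp_mono (ih (s := (s.setCell (s.v .pos) a).setV .pos (s.v .pos + 1)) (by simp; omega)
      (fun b hb => hl b (by simp [hb])) (by simp; omega)) ?_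
    rintro t s' ⟨ht, hat, hio⟩
    simp only [St.setV_v, if_true, St.setV_io, St.setCell_io] at hat hio
    refine ⟨by simp; omega, ?_, fun b hb => ?_⟩
    · refine At.append (l := [a]) ?_ (by simpa using hat)
      intro i hi
      obtain rfl : i = 0 := by simpa using hi
      rw [hio _ (by omega)]
      simp
    · rw [hio b (by omega), Function.update_of_ne (by omega)]

theorem length_listArray_le {r : ℕ} {nb : ℕ → List ℕ} (h : ∀ i < r, (nb i).length ≤ r) :
    (listArray r nb).length ≤ r + 1 + r * r := by
  rw [length_listArray]
  have : ∑ u ∈ Finset.range r, (nb u).length ≤ r * r := by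
    simpa using Finset.sum_le_card_nsmul (Finset.range r) _ r fun i hi => h i (by simpa using hi)
  omega

theorem length_outNb_le (s : St) (n : ℕ) (m : Arr) (i : ℕ) : (outNb s n m i).length ≤ s.v .nk :=
  (List.length_filter_le _ _).trans (by simp)

theorem wp_output (hE : Env D W N) {s : St} (hrow : ∀ u < D.n, s.a .row u = u * D.n)
    (hKL : KList D K s) (hlen : s.v .len = D.list.length) :
    wp W N output s fun t s' => t ≤ 30 * (s.v .nk * (s.v .nk + 1)) + 40 ∧
      s'.v .out = D.list.length ∧ ∃ L', L' = s.v .nk :: min (s.v .kk) (outFree s D.n) ::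
        (listArray (s.v .nk) (outNb s D.n .mat) ++ listArray (s.v .nk) (outNb s D.n .mat')) ∧
      D.list.length + L'.length ≤ N ∧ At s'.io D.list.length L' := by
  have hW := hE.n_le
  have hN := hE.N_le
  have hl := hE.len
  have hrn : s.v .nk ≤ D.n := le_of_inj hKL.lt hKL.inj
  -- The output has at most `2 + 2 (r + 1 + r²)` cells with `r ≤ n`, which fits into the reserve
  -- behind the input that `Env.len` provides.
  have hrr : s.v .nk * s.v .nk ≤ D.n * D.n := Nat.mul_le_mul hrn hrn
  have hl1 := length_listArray_le (r := s.v .nk) fun i _ => length_outNb_le s D.n .mat i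
  have hl2 := length_listArray_le (r := s.v .nk) fun i _ => length_outNb_le s D.n .mat' i
  rw [output, wp_seq]
  refine wp_mono (wp_frame (wp_countFree hE hrow hKL)) ?_
  rintro t₁ s₁ ⟨⟨ht1, hf1⟩, hk1⟩
  have ha1 : s₁.a = s.a := by funext j; exact hk1.a j (by simp [countFree, forTo, loop, inc, Cmd.wa])
  have hkk1 : s₁.v .kk = s.v .kk := hk1.v _ (by decide)
  rw [wp_seq]
  have hmin : wp W N (.ite (.v .free) (.v .kk) (.set .kk (.v .free)) .skip) s₁ fun t s' =>
      t = 2 ∧ s'.v .kk = min (s.v .kk) (outFree s D.n) := by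
    simp only [wp_ite, wp_set, wp_skip, Exp.eval, Exp.chk, hf1, hkk1, St.setV_v, if_true]
    exact ⟨fun h => ⟨trivial, trivial, by omega⟩, fun h => ⟨trivial, by omega⟩⟩
  refine wp_mono (wp_frame hmin) ?_
  rintro t₂ s₂ ⟨⟨ht2, hkk2⟩, hk2⟩
  have ha2 : s₂.a = s.a := by funext j; rw [hk2.a j (by simp [Cmd.wa]), ha1]
  have hlen2 : s₂.v .len = D.list.length := by
    rw [hk2.v _ (by decide), hk1.v _ (by decide), hlen]
  have hnk2 : s₂.v .nk = s.v .nk := by rw [hk2.v _ (by decide), hk1.v _ (by decide)]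
  simp only [wp_seq, wp_wr, wp_set, Exp.eval, Exp.chk, hlen2, hnk2, hkk2, St.setCell_v]
  refine ⟨by omega, trivial, by omega, trivial, by omega, ?_⟩
  set s₃ := ((s₂.setCell D.list.length (s.v .nk)).setCell (D.list.length + 1)
    (min (s.v .kk) (outFree s D.n))).setV .pos (D.list.length + 2) with hs3
  have ha3 : s₃.a = s.a := by simp [s₃, ha2]
  have hnk3 : s₃.v .nk = s.v .nk := by simp [s₃, hnk2]
  have hpos3 : s₃.v .pos = D.list.length + 2 := by simp [s₃]
  have hKL3 : KList D K s₃ := ⟨by rw [hnk3, ha3]; exact hKL.lt, by rw [hnk3, ha3]; exact hKL.inj,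
    by rw [hnk3, ha3]; exact hKL.mem⟩
  have hout3 : ∀ m, outNb s₃ D.n m = outNb s D.n m := fun m => by
    funext i; simp only [outNb, hnk3, ha3]
  refine wp_mono (wp_frame (wp_emit hE (m := .mat) (by rw [ha3]; exact hrow) hKL3 ?_)) ?_
  · rw [hpos3, hnk3, hout3]; omega
  rw [hpos3, hnk3, hout3]
  rintro t₄ s₄ ⟨⟨ht4, hat4, hpos4, hio4⟩, hk4⟩
  have ha4 : s₄.a = s.a := by
    funext j; rw [hk4.a j (by simp [emit, forTo, loop, inc, Cmd.wa]), ha3]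
  have hnk4 : s₄.v .nk = s.v .nk := by
    rw [hk4.v _ (by simp [emit, forTo, loop, inc, Cmd.wv]), hnk3]
  have hKL4 : KList D K s₄ := ⟨by rw [hnk4, ha4]; exact hKL.lt, by rw [hnk4, ha4]; exact hKL.inj,
    by rw [hnk4, ha4]; exact hKL.mem⟩
  have hout4 : ∀ m, outNb s₄ D.n m = outNb s D.n m := fun m => by
    funext i; simp only [outNb, hnk4, ha4]
  refine wp_mono (wp_frame (wp_emit hE (m := .mat') (by rw [ha4]; exact hrow) hKL4 ?_)) ?_
  · rw [hpos4, hnk4, hout4]; omega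
  rw [hpos4, hnk4, hout4]
  rintro t₅ s₅ ⟨⟨ht5, hat5, hpos5, hio5⟩, hk5⟩
  have hlen5 : s₅.v .len = D.list.length := by
    rw [hk5.v _ (by simp [emit, forTo, loop, inc, Cmd.wv]),
      hk4.v _ (by simp [emit, forTo, loop, inc, Cmd.wv])]
    simp [s₃, hlen2]
  simp only [hlen5, St.setV_v, if_true, St.setV_io, true_and]
  refine ⟨?_, _, rfl, ?_, ?_⟩
  · nlinarith
  · simp only [List.length_cons, List.length_append]; omega
  · refine At.append (l := [s.v .nk, min (s.v .kk) (outFree s D.n)]) ?_ (At.append ?_ ?_)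
    · intro i hi
      rw [hio5 _ (by simp at hi; omega), hio4 _ (by simp at hi; omega)]
      have : i = 0 ∨ i = 1 := by simp at hi; omega
      rcases this with rfl | rfl
      · simp [s₃]
      · simp [s₃]
    · exact hat4.congr fun a _ ha => hio5 a (by simpa using ha)
    · simpa [add_assoc] using hat5

end

/-! ### Preparation -/

/-- Mark the neighbours of `i` in the adjacency matrix. -/
def fillRow : Cmd := forNb .p .e .x .i (.put .mat (.add (.a .row (.v .i)) (.v .x)) (.c 1))

/-- Collect the vertices that are not isolated. -/
def noteVertex : Cmd :=
  .put .row (.v .i) (.v .off) ;; .set .off (.add (.v .off) (.v .n)) ;;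
  .get .p (.add (.v .i) (.c 2)) ;; .get .e (.add (.v .i) (.c 3)) ;;
  .ite (.v .p) (.v .e) (.put .ni (.v .ni) (.v .i) ;; inc .ni) .skip

/-- Compute positions in the input, the list of vertices that are not isolated, and the
adjacency matrix of the first graph. -/
def setup : Cmd :=
  .set .lb (.add (.v .n) (.c 3)) ;; .get .fin (.add (.v .n) (.c 2)) ;;
  .set .fin (.add (.v .lb) (.v .fin)) ;; .get .len (.add (.v .fin) (.v .n)) ;;
  .set .len (.add (.v .len) (.sub (.add (.v .fin) (.v .lb)) (.c 2))) ;;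
  .set .off (.c 0) ;; .set .ni (.c 0) ;; forTo .i (.v .n) (noteVertex ;; fillRow)

/-- The vertices less than `i` have been processed. -/
structure SetupInv (D : Input) (i : ℕ) (s : St) : Prop extends Io D s where
  n : s.v .n = D.n
  off : s.v .off = i * D.n
  fin : s.v .fin = D.n + 3 + D.M
  len : s.v .len = D.list.length
  row : ∀ u < i, s.a .row u = u * D.n
  mat : ∀ u v, u < D.n → v < D.n → (0 < s.a .mat (u * D.n + v) ↔ u < i ∧ D.G₁.Adj u v)
  ni_le : s.v .ni ≤ i
  deg : ∀ j < s.v .ni, s.a .ni j < i ∧ ∃ v, D.G₁.Adj (s.a .ni j) v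
  inj : ∀ j l, j < l → l < s.v .ni → s.a .ni j ≠ s.a .ni l
  mem : ∀ u v, u < i → D.G₁.Adj u v → ∃ j < s.v .ni, s.a .ni j = u

section
variable {D : Input} {W N : ℕ}

theorem wp_fillRow (hE : Env D W N) {s : St} {i : ℕ} (hi : i < D.n) (hiv : s.v .i = i)
    (hIo : Io D s) (hrow : s.a .row i = i * D.n)
    (hmat : ∀ u v, u < D.n → v < D.n → (0 < s.a .mat (u * D.n + v) ↔ u < i ∧ D.G₁.Adj u v)) :
    wp W N fillRow s fun t s' => t ≤ (D.nb₁ i).length * 4 + 3 ∧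
      ∀ u v, u < D.n → v < D.n → (0 < s'.a .mat (u * D.n + v) ↔ u < i + 1 ∧ D.G₁.Adj u v) := by
  have hW := hE.n_le
  refine wp_mono (wp_forNb_const hE hi hiv hIo (fun j s' => Io D s' ∧ s'.v .i = i ∧
    s'.a .row i = i * D.n ∧ ∀ u v, u < D.n → v < D.n → (0 < s'.a .mat (u * D.n + v) ↔
      (u < i ∧ D.G₁.Adj u v) ∨ (u = i ∧ ∃ l < j, D.nbr i l = v))) 1 (by decide) (by decide)
    (by decide) (by decide) (by decide) (by decide) (by decide) (by decide)
    ⟨hIo, hiv, hrow, by simpa using hmat⟩ ?_ ?_ (fun j s h => h.1) ?_) ?_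
  · rintro j s' a ⟨h1, h2, h3, h4⟩
    exact ⟨h1.congr (by simp) rfl, by simpa, h3, h4⟩
  · rintro j s' a ⟨h1, h2, h3, h4⟩
    exact ⟨h1.congr (by simp) rfl, by simpa, h3, h4⟩
  · rintro j s' hj ⟨h1, h2, h3, h4⟩
    have hadj := D.getD_adj hj
    have hlt := (D.lt' hadj).2
    simp only [wp_put, Exp.eval, Exp.chk, St.setV_v, St.setV_a, reduceCtorEq, if_false, if_true,
      h2, h3]
    refine ⟨by omega, by omega, h1.congr (by simp) rfl, by simpa, by simpa using h3, ?_⟩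
    intro u v hu hv
    simp only [St.setA_a, if_true, St.setV_a, Function.update_apply, index_inj hv hlt]
    split_ifs with huv
    · obtain ⟨rfl, rfl⟩ := huv
      exact iff_of_true (by norm_num) (.inr ⟨rfl, j, by omega, rfl⟩)
    · rw [h4 u v hu hv]
      refine or_congr_right (and_congr_right fun hui => ⟨?_, ?_⟩)
      · rintro ⟨l, hl, h⟩; exact ⟨l, by omega, h⟩
      · rintro ⟨l, hl, h⟩
        rcases Nat.lt_succ_iff_lt_or_eq.1 hl with hl | rfl
        · exact ⟨l, hl, h⟩
        · exact absurd ⟨hui, h.symm⟩ huv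
  · rintro t s' ⟨ht, -, -, -, hm⟩
    refine ⟨ht, fun u v hu hv => ?_⟩
    rw [hm u v hu hv]
    constructor
    · rintro (⟨h, h'⟩ | ⟨rfl, l, hl, rfl⟩)
      · exact ⟨by omega, h'⟩
      · exact ⟨by omega, D.getD_adj hl⟩
    · rintro ⟨h, h'⟩
      rcases Nat.lt_succ_iff_lt_or_eq.1 h with h | rfl
      · exact .inl ⟨h, h'⟩
      · exact .inr ⟨rfl, D.exists_getD h'⟩

/-- Row addresses are obtained by adding `n` repeatedly, as there is no multiplication. A vertex is
isolated precisely when two consecutive offsets agree. -/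
theorem wp_noteVertex (hE : Env D W N) {s : St} {i : ℕ} (hi : i < D.n) (hiv : s.v .i = i)
    (h : SetupInv D i s) :
    wp W N noteVertex s fun t s' => t ≤ 7 ∧ Io D s' ∧ s'.v .off = (i + 1) * D.n ∧
      (∀ u < i + 1, s'.a .row u = u * D.n) ∧ s'.v .ni ≤ i + 1 ∧
      (∀ j < s'.v .ni, s'.a .ni j < i + 1 ∧ ∃ v, D.G₁.Adj (s'.a .ni j) v) ∧
      (∀ j l, j < l → l < s'.v .ni → s'.a .ni j ≠ s'.a .ni l) ∧
      (∀ u v, u < i + 1 → D.G₁.Adj u v → ∃ j < s'.v .ni, s'.a .ni j = u) := by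
  have hW := hE.n_le
  have hlen := hE.len
  have hN := hE.N_le
  have hl := D.length_list
  have io1 := h.io (i + 2) (by omega)
  rw [D.list_off₁ hi.le] at io1
  have io2 := h.io (i + 3) (by omega)
  rw [D.list_off₁ (i := i + 1) (by omega), D.off₁_succ] at io2
  have hmul : (i + 1) * D.n ≤ D.n * D.n := Nat.mul_le_mul_right _ hi
  have hmul' : (i + 1) * D.n = i * D.n + D.n := by ring
  have hnile := h.ni_le
  simp only [noteVertex, inc, wp_seq, wp_put, wp_set, wp_get, wp_ite, wp_skip, Exp.eval, Exp.chk,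
    hiv, h.off, h.n, St.setA_v, St.setV_v, reduceCtorEq, if_false, if_true, St.setV_io, St.setA_io,
    io1, io2, true_and]
  refine ⟨by omega, by omega, by omega, fun hd => ?_, fun hd => ?_⟩
  · refine ⟨by omega, by norm_num, h.toIo.congr (by simp) rfl, by omega, ?_, by omega, ?_, ?_, ?_⟩
    · intro u hu
      simp only [St.setV_a, St.setA_a, reduceCtorEq, if_false, if_true, Function.update_apply]
      split_ifs with hui
      · rw [hui]
      · exact h.row u (by omega)
    · intro j hj
      simp only [St.setV_a, St.setA_a, reduceCtorEq, if_false, if_true, Function.update_apply]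
      split_ifs with hji
      · exact ⟨by omega, _, D.getD_adj (j := 0) (by omega)⟩
      · have := h.deg j (by omega)
        exact ⟨by omega, this.2⟩
    · intro j l hjl hl
      simp only [St.setV_a, St.setA_a, reduceCtorEq, if_false, if_true, Function.update_apply]
      rw [if_neg (by omega)]
      split_ifs with hji
      · have := (h.deg j (by omega)).1
        omega
      · exact h.inj j l hjl (by omega)
    · intro u v hu huv
      simp only [St.setV_a, St.setA_a, reduceCtorEq, if_false, if_true, Function.update_apply]
      rcases Nat.lt_succ_iff_lt_or_eq.1 hu with hu | rfl
      · obtain ⟨j, hj, hju⟩ := h.mem u v hu huv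
        exact ⟨j, by omega, by rw [if_neg (by omega), hju]⟩
      · exact ⟨_, Nat.lt_succ_self _, if_pos rfl⟩
  · refine ⟨by norm_num, h.toIo.congr (by simp) rfl, by omega, ?_, by omega, ?_, ?_, ?_⟩
    · intro u hu
      simp only [St.setV_a, St.setA_a, reduceCtorEq, if_false, if_true, Function.update_apply]
      split_ifs with hui
      · rw [hui]
      · exact h.row u (by omega)
    · intro j hj
      have := h.deg j hj
      exact ⟨Nat.lt_succ_of_lt this.1, this.2⟩
    · exact h.inj
    · intro u v hu huv
      rcases Nat.lt_succ_iff_lt_or_eq.1 hu with hu | rfl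
      · exact h.mem u v hu huv
      · obtain ⟨l, hl, -⟩ := D.exists_getD huv
        omega

/-- The matrix is correct without clearing `n²` cells because memory starts out as zero; only the
entries of actual edges are written. -/
theorem wp_setup (hE : Env D W N) {s : St} (hn : s.v .n = D.n)
    (hio : ∀ i < D.list.length, s.io i = D.list.getD i 0) (hmat : ∀ i, s.a .mat i = 0) :
    wp W N setup s fun t s' => t ≤ 20 * ((D.n + 1) * (D.M + 1)) ∧ SetupInv D D.n s' := by
  have hW := hE.n_le
  have hlen := hE.len
  have hN := hE.N_le
  have hl := D.length_list
  have io1 := hio (D.n + 2) (by omega)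
  rw [D.list_off₁ le_rfl] at io1
  have io2 := hio (D.n + 3 + D.M + D.n) (by omega)
  rw [D.list_off₂ le_rfl] at io2
  change s.io (D.n + 2) = D.M at io1
  simp only [setup, wp_seq, wp_set, wp_get, Exp.eval, Exp.chk, hn, St.setV_v, reduceCtorEq,
    if_false, if_true, St.setV_io, io1, io2, true_and]
  refine ⟨by omega, by omega, by omega, by omega, by omega, by omega, by omega, ?_⟩
  refine wp_mono (wp_forTo D.n (SetupInv D) (fun i => (D.nb₁ i).length * 4 + 10) (by omega)
    (by decide) ?_ (fun j s h => h.n) ?_) ?_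
  · refine ⟨⟨by simp, fun i hi => by simpa using hio i hi⟩, by simp [hn], by simp, by simp,
      by simp; omega, by simp, by simp [hmat], by simp, by simp, by simp, by simp⟩
  · intro i s₁ hi hs₁ hiv
    rw [wp_seq]
    refine wp_mono (wp_frame (wp_noteVertex hE hi hiv hs₁)) ?_
    rintro t₂ s₂ ⟨⟨ht2, hio2, hoff2, hrow2, hnile2, hdeg2, hinj2, hmem2⟩, hk2⟩
    have hmat2 : s₂.a .mat = s₁.a .mat := hk2.a _ (by decide)
    refine wp_mono (wp_frame (wp_fillRow hE hi (by rw [hk2.v _ (by decide), hiv]) hio2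
      (hrow2 i (by omega)) (by rw [hmat2]; exact hs₁.mat))) ?_
    rintro t₃ s₃ ⟨⟨ht3, hmat3⟩, hk3⟩
    have e1 : s₃.v .ni = s₂.v .ni := hk3.v _ (by decide)
    have e2 : s₃.a .ni = s₂.a .ni := hk3.a _ (by decide)
    refine ⟨by omega, ⟨(hio2.congr (hk3.v _ (by decide)) (hk3.io rfl)).congr (by simp) rfl, ?_, ?_,
      ?_, ?_, ?_, hmat3, ?_, ?_, ?_, ?_⟩⟩
    · simp only [St.setV_v, reduceCtorEq, if_false]
      rw [hk3.v _ (by decide), hk2.v _ (by decide), hs₁.n]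
    · simp only [St.setV_v, reduceCtorEq, if_false]
      rw [hk3.v _ (by decide), hoff2]
    · simp only [St.setV_v, reduceCtorEq, if_false]
      rw [hk3.v _ (by decide), hk2.v _ (by decide), hs₁.fin]
    · simp only [St.setV_v, reduceCtorEq, if_false]
      rw [hk3.v _ (by decide), hk2.v _ (by decide), hs₁.len]
    · simp only [St.setV_a]
      rw [hk3.a _ (by decide)]
      exact hrow2
    · simpa [e1] using hnile2
    · simpa [e1, e2] using hdeg2
    · simpa [e1, e2] using hinj2
    · simpa [e1, e2] using hmem2
  · rintro t s' ⟨ht, hs', -⟩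
    refine ⟨?_, hs'⟩
    have hM : ∑ u ∈ Finset.range D.n, (D.nb₁ u).length = D.M := rfl
    simp only [add_assoc, Finset.sum_add_distrib, ← Finset.sum_mul, hM, Finset.sum_const,
      Finset.card_range, smul_eq_mul] at ht
    nlinarith [Nat.zero_le (D.n * D.M)]

end

/-! ### The kernel -/

/-- The graphs that `o` induces from `G` and `D.G₂`, together with `κ`, form a kernel. -/
structure Input.Reduces (D : Input) (G : SimpleGraph ℕ) (o : ℕ → ℕ) (r κ : ℕ) : Prop where
  le : G ≤ D.G₂
  inj : ∀ i j, i < j → j < r → o i ≠ o j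
  card_le : r ≤ 32 * D.k ^ 3 + 4 * D.k
  kk_le : κ ≤ D.k
  free : D.k = (D.G₂.edgeSet \ D.G₁.edgeSet).ncard →
    ((restr D.G₂ {v | ∃ i < r, o i = v}).edgeSet \
      (restr G {v | ∃ i < r, o i = v}).edgeSet).ncard ≤ κ
  sandwich : Sandwich (restr G {v | ∃ i < r, o i = v}) (restr D.G₂ {v | ∃ i < r, o i = v}) κ ↔
    Sandwich D.G₁ D.G₂ D.k

theorem Input.finite_edgeSet (D : Input) : D.G₂.edgeSet.Finite := by
  refine (((Set.finite_Iio D.n).prod (Set.finite_Iio D.n)).image fun t => s(t.1, t.2)).subset ?_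
  intro e he
  induction e with
  | _ u v => exact ⟨(u, v), ⟨D.lt _ _ he, D.lt _ _ he.symm⟩, rfl⟩

theorem ncard_eq_of_inj {o : ℕ → ℕ} {r : ℕ} (ho : ∀ i j, i < j → j < r → o i ≠ o j) :
    {v | ∃ i < r, o i = v}.ncard = r := by
  have h : {v | ∃ i < r, o i = v} = o '' ↑(Finset.range r) := by
    ext v; simp
  rw [h, Set.InjOn.ncard_image, Set.ncard_coe_finset, Finset.card_range]
  intro i hi j hj hij
  simp only [Finset.coe_range, Set.mem_Iio] at hi hj
  rcases lt_trichotomy i j with h | h | h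
  · exact absurd hij (ho i j h hj)
  · exact h
  · exact absurd hij.symm (ho j i h hi)

/-- For the parameter clause: essential edges and free edges of the kernel are disjoint sets of free
edges of the given instance. So if `k` equals the number of all free edges, then `k - |EF|` is at
least the number left in the kernel. -/
theorem Input.reduces {D : Input} {A : Set ℕ} (hA : A.Finite) (hr : A.ncard ≤ 4 * D.k)
    (hno : ∀ x y z, x ∉ A → y ∉ A → ¬ Hit D.G₁ x y z) (EF : Finset (Sym2 ℕ))
    (hEF : ∀ e, e ∈ EF ↔ e ∈ (D.ess A).edgeSet) (hE : D.ess A ≤ D.G₂) (hk : EF.card ≤ D.k)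
    {o : ℕ → ℕ} {r : ℕ} (hinj : ∀ i j, i < j → j < r → o i ≠ o j)
    (hmem : ∀ v, v ∈ D.ker A ↔ ∃ i < r, o i = v) :
    D.Reduces (D.G₁ ⊔ D.ess A) o r (D.k - EF.card) := by
  have hK : {v | ∃ i < r, o i = v} = D.ker A := by
    ext v; exact (hmem v).symm
  have hker := Input.isKernel hno
  refine ⟨sup_le D.le hE, hinj, ?_, Nat.sub_le _ _, fun hfree => ?_, ?_⟩
  · rw [← ncard_eq_of_inj hinj, hK]
    exact (Input.ncard_ker_le hA hr).trans (le_of_eq (by ring))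
  · rw [hK]
    have hfin := D.finite_edgeSet.sdiff (t := D.G₁.edgeSet)
    have hfin' : ((restr D.G₂ (D.ker A)).edgeSet \
        (restr (D.G₁ ⊔ D.ess A) (D.ker A)).edgeSet).Finite := by
      refine (D.finite_edgeSet.subset fun e he => ?_).sdiff
      induction e with
      | _ u v => exact he.1
    have hdisj : Disjoint ((restr D.G₂ (D.ker A)).edgeSet \
        (restr (D.G₁ ⊔ D.ess A) (D.ker A)).edgeSet) (EF : Set (Sym2 ℕ)) := by
      rw [Set.disjoint_left]
      rintro e ⟨h1, h2⟩ h3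
      rw [Finset.mem_coe, hEF] at h3
      induction e with
      | _ u v => exact h2 ⟨.inr h3, h1.2.1, h1.2.2⟩
    have hsub : ((restr D.G₂ (D.ker A)).edgeSet \
        (restr (D.G₁ ⊔ D.ess A) (D.ker A)).edgeSet) ∪ (EF : Set (Sym2 ℕ)) ⊆
        D.G₂.edgeSet \ D.G₁.edgeSet := by
      rintro e (⟨h1, h2⟩ | h3)
      · induction e with
        | _ u v => exact ⟨h1.1, fun h => h2 ⟨.inl h, h1.2.1, h1.2.2⟩⟩
      · rw [Finset.mem_coe, hEF] at h3
        induction e with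
        | _ u v =>
          refine ⟨hE h3, fun h => ?_⟩
          -- An essential pair is hit by some vertex, and the two cycle neighbours in a hit are
          -- nonadjacent; thus essential edges are new.
          obtain ⟨S, hS, hS'⟩ := hker.many u v h3
          obtain ⟨x, hx⟩ := Finset.card_pos.1 (lt_of_le_of_lt (Nat.zero_le _) hS)
          exact (hS' x hx).2.2.2.2.1 h
    have := Set.ncard_le_ncard hsub hfin
    rw [Set.ncard_union_eq hdisj hfin' (Finset.finite_toSet _), Set.ncard_coe_finset] at this
    omega
  · rw [hK]
    exact ⟨hker.sandwich_of EF hEF hE hk, fun h => (hker.sandwich EF hEF h).2.2⟩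

theorem listArray_congr {n : ℕ} {nb nb' : ℕ → List ℕ} (h : ∀ i < n, nb i = nb' i) :
    listArray n nb = listArray n nb' := by
  unfold listArray
  congr 1
  · refine List.map_congr_left fun i hi => Finset.sum_congr rfl fun u hu => ?_
    rw [List.mem_range] at hi
    rw [Finset.mem_range] at hu
    rw [h u (by omega)]
  · rw [List.flatMap_def, List.flatMap_def]
    congr 1
    exact List.map_congr_left fun i hi => h i (List.mem_range.1 hi)

open Classical in
/-- The array that represents the graphs that `o` induces from `G` and `H`. -/
noncomputable def kernelList (G H : SimpleGraph ℕ) (o : ℕ → ℕ) (r κ : ℕ) : List ℕ :=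
  r :: min κ (∑ i ∈ Finset.range r, ∑ j ∈ Finset.range r,
    if i < j ∧ H.Adj (o i) (o j) ∧ ¬ G.Adj (o i) (o j) then 1 else 0) ::
    (listArray r (fun i => (List.range r).filter fun j => G.Adj (o i) (o j)) ++
      listArray r (fun i => (List.range r).filter fun j => H.Adj (o i) (o j)))

/-- The array that represents a chordless cycle, to which no edge may be added. -/
def noList : List ℕ :=
  [4, 0, 0, 2, 4, 6, 8, 1, 3, 0, 2, 1, 3, 0, 2, 0, 2, 4, 6, 8, 1, 3, 0, 2, 1, 3, 0, 2]

/-- The output has been written behind the input. -/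
def Input.Written (D : Input) (N : ℕ) (s : St) : Prop :=
  s.v .out = D.list.length ∧ ∃ L, D.list.length + L.length ≤ N ∧ At s.io D.list.length L ∧
    ((L = noList ∧ ¬ Sandwich D.G₁ D.G₂ D.k) ∨
      ∃ G o r κ, D.Reduces G o r κ ∧ L = kernelList G D.G₂ o r κ)

/-- Write an instance without solution. -/
def outputNo : Cmd := .set .pos (.v .len) ;; writeList noList ;; .set .out (.v .len)

/-- Compute the kernel. -/
def reduce : Cmd :=
  count ;; markK ;; collect ;; addEss ;; .ite (.v .no) (.c 1) output outputNo

section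
variable {D : Input} {W N : ℕ} {A : Set ℕ}

theorem wp_outputNo (hE : Env D W N) {s : St} (hlen : s.v .len = D.list.length)
    (hS : ¬ Sandwich D.G₁ D.G₂ D.k) :
    wp W N outputNo s fun t s' => t ≤ 60 ∧ D.Written N s' := by
  have hW := hE.n_le
  have hE1 := hE.len
  have hN := hE.N_le
  have h28 : noList.length = 28 := rfl
  simp only [outputNo, wp_seq, wp_set, Exp.chk, Exp.eval, true_and, hlen]
  refine wp_mono (wp_frame (wp_writeList noList (by simp; omega) ?_ (by simp; omega))) ?_
  · intro a ha
    have h8 : ∀ a ∈ noList, a ≤ 8 := by decide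
    exact (h8 a ha).trans (by omega)
  · rintro t s' ⟨⟨ht, hat, -⟩, hk⟩
    have hl : s'.v .len = D.list.length := by
      rw [hk.v _ (by decide)]; simpa using hlen
    simp only [St.setV_v, if_true] at hat
    refine ⟨by omega, by simp [hl], noList, by omega, by simpa using hat, .inl ⟨rfl, hS⟩⟩

theorem wp_reduce (hE : Env D W N) {s : St} (hB : Base D A s) (hK : KEq D A s)
    (hAdj : ∀ v ∈ A, ∃ u, D.G₁.Adj v u) (hna : s.v .na ≤ 4 * D.k)
    (hno : ∀ x y z, x ∉ A → y ∉ A → ¬ Hit D.G₁ x y z) (hn0 : s.v .no = 0) (hk : s.v .k = D.k)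
    (hf : s.v .fin = D.n + 3 + D.M) (hl : s.v .len = D.list.length)
    (hcnt : ∀ i, s.a .cnt i = 0) (hm' : ∀ i, s.a .mat' i = 0) :
    wp W N reduce s fun t s' => t ≤ 700 * ((D.k + 1) ^ 2 * (D.n * (D.M + 1) + 1)) ∧
      D.Written N s' := by
  classical
  have hW := hE.n_le
  have hAfin : A.Finite := by
    have : A = {v | ∃ i < s.v .na, s.a .alist i = v} := by
      ext v; exact hB.al.mem v
    rw [this]
    exact ((Set.finite_Iio (s.v .na)).image (s.a .alist)).subset
      fun v ⟨i, hi, h⟩ => ⟨i, hi, h⟩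
  have hAcard : A.ncard ≤ 4 * D.k := by
    have : A = {v | ∃ i < s.v .na, s.a .alist i = v} := by
      ext v; exact hB.al.mem v
    rw [this, ncard_eq_of_inj hB.al.inj]
    exact hna
  have hkeradj : ∀ v ∈ D.ker A, ∃ u, D.G₁.Adj v u := by
    rintro v (hv | ⟨y, -, z, -, hh, -⟩)
    · exact hAdj v hv
    · exact ⟨y, hh.1⟩
  rw [reduce, wp_seq]
  refine wp_mono (wp_frame (wp_count hE hB hcnt)) ?_
  rintro t₁ s₁ ⟨⟨ht1, hM1, hc1⟩, k1⟩
  have hB1 : Base D A s₁ := ⟨hM1, hB.al.congr (k1.v _ (by decide)) (k1.a _ (by decide)),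
    hB.ni.congr (k1.v _ (by decide)) (k1.a _ (by decide))⟩
  have hna1 : s₁.v .na = s.v .na := k1.v _ (by decide)
  rw [wp_seq]
  refine wp_mono (wp_frame (wp_markK hE hB1 (by rw [KEq, k1.a _ (by decide)]; exact hK)
    (by rw [k1.v _ (by decide), hk]) hc1)) ?_
  rintro t₂ s₂ ⟨⟨ht2, hM2, hK2⟩, k2⟩
  have hB2 : Base D A s₂ := ⟨hM2, hB1.al.congr (k2.v _ (by decide)) (k2.a _ (by decide)),
    hB1.ni.congr (k2.v _ (by decide)) (k2.a _ (by decide))⟩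
  rw [wp_seq]
  refine wp_mono (wp_frame (wp_collect hE hM2.toCtx hB2.ni
    (by rw [k2.v _ (by decide), k1.v _ (by decide), hf]) hK2 hkeradj
    (by rw [k2.a _ (by decide), k1.a _ (by decide)]; exact hm'))) ?_
  rintro t₃ s₃ ⟨⟨ht3, hKL3, hnk3, hmat3⟩, k3⟩
  have hC3 : Ctx D s₃ := hM2.toCtx.congr (k3.v _ (by decide)) (k3.v _ (by decide))
    (k3.a _ (by decide)) (k3.a _ (by decide)) (k3.io rfl)
  have hna3 : s₃.v .na = s.v .na := by
    rw [k3.v _ (by decide), k2.v _ (by decide), k1.v _ (by decide)]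
  rw [wp_seq]
  refine wp_mono (wp_frame (wp_addEss hE hC3
    (hB2.al.congr (k3.v _ (by decide)) (k3.a _ (by decide)))
    (by rw [k3.v _ (by decide), k2.v _ (by decide), k1.v _ (by decide), hk])
    (by rw [k3.v _ (by decide), k2.v _ (by decide), k1.v _ (by decide), hn0])
    (by rw [k3.a _ (by decide), k2.a _ (by decide)]; exact hc1)
    (fun u hu v hv => hmat3 u (.inl hu) v hv))) ?_
  rintro t₄ s₄ ⟨⟨ht4, EF, hEF, hmat4, hyes, hno4⟩, k4⟩
  have hl4 : s₄.v .len = D.list.length := by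
    rw [k4.v _ (by decide), k3.v _ (by decide), k2.v _ (by decide), k1.v _ (by decide), hl]
  have hrow4 : ∀ u < D.n, s₄.a .row u = u * D.n := by
    rw [k4.a _ (by decide)]; exact hC3.row
  have hnk4 : s₄.v .nk = s₃.v .nk := k4.v _ (by decide)
  have hkl4 : s₄.a .klist = s₃.a .klist := k4.a _ (by decide)
  have hKL4 : KList D (D.ker A) s₄ := ⟨by rw [hnk4, hkl4]; exact hKL3.lt,
    by rw [hnk4, hkl4]; exact hKL3.inj, by rw [hnk4, hkl4]; exact hKL3.mem⟩
  have hmat4' : s₄.a .mat' = s₃.a .mat' := k4.a _ (by decide)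
  have hnkn : s₄.v .nk ≤ D.n := le_of_inj hKL4.lt hKL4.inj
  -- The quadratic cost of the output is within the bound since the number of kernel vertices is at
  -- most `n` and at most `M`.
  have hnkX : s₄.v .nk * (s₄.v .nk + 1) ≤ D.n * (D.M + 1) :=
    Nat.mul_le_mul hnkn (by omega)
  rw [hna1] at ht2
  rw [hna3] at ht4
  set X := D.n * (D.M + 1) with hX
  have b1 : s.v .na * (63 * X) ≤ 4 * D.k * (63 * X) := Nat.mul_le_mul_right _ hna
  have b2 : s.v .na * (s.v .na * 14 + 4) ≤ 4 * D.k * (4 * D.k * 14 + 4) :=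
    Nat.mul_le_mul hna (by omega)
  have b3 : 700 * ((D.k + 1) ^ 2 * (X + 1)) = 700 * (D.k ^ 2 * X) + 1400 * (D.k * X) + 700 * X +
    700 * D.k ^ 2 + 1400 * D.k + 700 := by ring
  have b4 : 4 * D.k * (63 * X) = 252 * (D.k * X) := by ring
  have b5 : 4 * D.k * (4 * D.k * 14 + 4) = 224 * D.k ^ 2 + 16 * D.k := by ring
  rw [wp_ite]
  refine ⟨fun h => ?_, fun h => ?_⟩
  · obtain ⟨hE', hEk, hkk⟩ := hyes (by simpa using h)
    refine wp_mono (wp_output hE hrow4 hKL4 hl4) ?_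
    rintro t₅ s₅ ⟨ht5, hout, L', hL', hlen, hat⟩
    refine ⟨by omega, hout, L', hlen, hat, .inr ⟨D.G₁ ⊔ D.ess A, s₄.a .klist, s₄.v .nk,
      D.k - EF.card, Input.reduces hAfin hAcard hno EF hEF hE' hEk hKL4.inj hKL4.mem, ?_⟩⟩
    have f1 : ∀ i < s₄.v .nk, ∀ j < s₄.v .nk,
        (0 < s₄.a .mat (s₄.a .klist i * D.n + s₄.a .klist j) ↔
          (D.G₁ ⊔ D.ess A).Adj (s₄.a .klist i) (s₄.a .klist j)) := fun i hi j hj =>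
      hmat4 _ _ (hKL4.lt i hi) (hKL4.lt j hj)
    have f2 : ∀ i < s₄.v .nk, ∀ j < s₄.v .nk,
        (0 < s₄.a .mat' (s₄.a .klist i * D.n + s₄.a .klist j) ↔
          D.G₂.Adj (s₄.a .klist i) (s₄.a .klist j)) := fun i hi j hj => by
      rw [hmat4']
      exact hmat3 _ ((hKL4.mem _).2 ⟨i, hi, rfl⟩) _ (hKL4.lt j hj)
    rw [hL', kernelList, hkk]
    congr 2
    · congr 1
      refine Finset.sum_congr rfl fun i hi => Finset.sum_congr rfl fun j hj => ?_
      rw [Finset.mem_range] at hi hj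
      have := f1 i hi j hj
      simp only [f2 i hi j hj, ← this, not_lt, Nat.le_zero]
    · congr 1
      · refine listArray_congr fun i hi => List.filter_congr fun j hj => ?_
        rw [decide_eq_decide]
        exact f1 i hi j (List.mem_range.1 hj)
      · refine listArray_congr fun i hi => List.filter_congr fun j hj => ?_
        rw [decide_eq_decide]
        exact f2 i hi j (List.mem_range.1 hj)
  · refine wp_mono (wp_outputNo hE hl4 fun hS => ?_) ?_
    · have := (Input.isKernel hno).sandwich EF hEF hS
      exact hno4 (by simp at h; omega) ⟨this.1, this.2.1⟩
    · rintro t₅ s₅ ⟨ht5, hwr⟩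
      exact ⟨by omega, hwr⟩

end

/-! ### The whole program -/

/-- Compute the bound for the number of vertices. -/
def bound : Cmd :=
  .set .sq (.c 0) ;; forTo .i (.v .k) (.set .sq (.add (.v .sq) (.v .k))) ;;
  .set .cub (.c 0) ;; forTo .i (.v .k) (.set .cub (.add (.v .cub) (.v .sq))) ;;
  .set .lim (.add (.v .cub) (.v .cub)) ;; .set .lim (.add (.v .lim) (.v .lim)) ;;
  .set .lim (.add (.v .lim) (.v .lim)) ;; .set .lim (.add (.v .lim) (.v .lim)) ;;
  .set .lim (.add (.v .lim) (.v .lim)) ;;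
  .set .lim (.add (.v .lim) (.add (.add (.v .k) (.v .k)) (.add (.v .k) (.v .k)))) ;;
  .ite (.v .lim) (.c 4) (.set .lim (.c 4)) .skip

/-- The kernelization of large instances. -/
def large : Cmd := setup ;; phase1 ;; .ite (.v .no) (.c 1) reduce outputNo

/-- The kernelization. Small instances are left as they are. -/
def kernelize : Cmd :=
  .get .n (.c 0) ;; .get .k (.c 1) ;; bound ;; .ite (.v .lim) (.v .n) large .skip

/-- The state that represents the input. -/
def St.init (L : List ℕ) : St := ⟨fun _ => 0, fun _ _ => 0, fun i => L.getD i 0⟩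

section
variable {D : Input} {W N : ℕ}

/-- Powers of `k` are computed by repeated addition in `O(k)` steps, and five doublings give the
factor 32. -/
theorem wp_bound {s : St} {k : ℕ} (hW : 32 * k ^ 3 + 4 * k + 4 ≤ W) (hk : s.v .k = k) :
    wp W N bound s fun t s' => t ≤ 6 * k + 14 ∧
      s'.v .lim = max 4 (32 * k ^ 3 + 4 * k) := by
  have h3 : k ^ 3 = k * (k * k) := by ring
  rw [h3] at hW ⊢
  have hkk : k * k ≤ k * (k * k) := by
    rcases Nat.eq_zero_or_pos k with rfl | h
    · simp
    · exact Nat.le_mul_of_pos_left _ h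
  rw [bound, wp_seq, wp_set]
  refine ⟨by simp, ?_⟩
  rw [wp_seq]
  refine wp_mono (wp_frame (wp_forTo_const k 1 (fun i s' => s'.v .k = k ∧ s'.v .sq = i * k)
    (by omega) (by decide) (by simp [hk]) (fun j s h => h.1) ?_)) ?_
  · rintro i s₁ hi ⟨hk1, hs1⟩ -
    have h1 : (i + 1) * k ≤ k * k := Nat.mul_le_mul_right _ hi
    have h2 : (i + 1) * k = i * k + k := by ring
    simp only [wp_set, Exp.eval, Exp.chk, hk1, hs1, St.setV_v, reduceCtorEq, if_false, if_true]
    exact ⟨by omega, le_rfl, trivial, by omega⟩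
  rintro t₁ s₁ ⟨⟨ht1, ⟨hk1, hs1⟩, -⟩, -⟩
  rw [wp_seq, wp_set]
  refine ⟨by simp, ?_⟩
  rw [wp_seq]
  refine wp_mono (wp_frame (wp_forTo_const k 1 (fun i s' => s'.v .k = k ∧ s'.v .sq = k * k ∧
    s'.v .cub = i * (k * k))
    (by omega) (by decide) (by simp [hk1, hs1]) (fun j s h => h.1) ?_)) ?_
  · rintro i s₂ hi ⟨hk2, hs2, hc2⟩ -
    have h1 : (i + 1) * (k * k) ≤ k * (k * k) := Nat.mul_le_mul_right _ hi
    have h2 : (i + 1) * (k * k) = i * (k * k) + k * k := by ring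
    simp only [wp_set, Exp.eval, Exp.chk, hk2, hs2, hc2, St.setV_v, reduceCtorEq, if_false,
      if_true]
    exact ⟨by omega, le_rfl, trivial, trivial, by omega⟩
  rintro t₂ s₂ ⟨⟨ht2, ⟨hk2, hs2, hc2⟩, -⟩, -⟩
  simp only [wp_seq, wp_set, wp_ite, wp_skip, Exp.eval, Exp.chk, hk2, hc2, St.setV_v,
    reduceCtorEq, if_false, if_true]
  refine ⟨by omega, by omega, by omega, by omega, by omega, by omega, fun h => ?_, fun h => ?_⟩
  · exact ⟨by omega, by omega, by omega⟩
  · exact ⟨by omega, by omega⟩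

theorem wp_large (hE : Env D W N) (hn1 : 1 ≤ D.n) {s : St} (hn : s.v .n = D.n) (hk : s.v .k = D.k)
    (hio : ∀ i < D.list.length, s.io i = D.list.getD i 0) (ha : ∀ j i, s.a j i = 0) :
    wp W N large s fun t s' => t ≤ 4000 * ((D.k + 1) ^ 2 * ((D.n + 1) * (D.M + 1))) ∧
      D.Written N s' := by
  rw [large, wp_seq]
  refine wp_mono (wp_frame (wp_setup hE hn hio (ha _))) ?_
  rintro t₁ s₁ ⟨⟨ht1, h1⟩, k1⟩
  have hNI : NIs D s₁ := ⟨fun i hi => (h1.deg i hi).2, h1.inj,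
    fun u v huv => h1.mem u v (D.lt' huv).1 huv⟩
  have hM : Mid D ∅ s₁ := ⟨⟨h1.toIo, h1.n, h1.row, fun u v hu hv => by
    simpa [hu] using h1.mat u v hu hv⟩, fun v hv => by
      rw [k1.a _ (by decide)]; simp [ha], fun v hv => by rw [k1.a _ (by decide), ha]⟩
  rw [wp_seq]
  refine wp_mono (wp_frame (wp_phase1 hE hn1 hM hNI (by rw [k1.v _ (by decide), hk])
    (fun v hv => by rw [k1.a _ (by decide)]; simp [ha]))) ?_
  rintro t₂ s₂ ⟨⟨ht2, A, hB, hKE, hadj, hyes, hno⟩, k2⟩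
  have hl2 : s₂.v .len = D.list.length := by rw [k2.v _ (by decide), h1.len]
  have hX : D.n * (D.M + 1) + 1 ≤ (D.n + 1) * (D.M + 1) := by nlinarith
  have b1 : (D.k + 1) ^ 2 * (D.n * (D.M + 1)) ≤ (D.k + 1) ^ 2 * ((D.n + 1) * (D.M + 1)) :=
    Nat.mul_le_mul_left _ (by omega)
  have b2 : (D.k + 1) ^ 2 * (D.n * (D.M + 1) + 1) ≤ (D.k + 1) ^ 2 * ((D.n + 1) * (D.M + 1)) :=
    Nat.mul_le_mul_left _ hX
  have b3 : (D.n + 1) * (D.M + 1) ≤ (D.k + 1) ^ 2 * ((D.n + 1) * (D.M + 1)) :=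
    Nat.le_mul_of_pos_left _ (by positivity)
  have b4 : 1 ≤ (D.n + 1) * (D.M + 1) := Nat.mul_pos (by omega) (by omega)
  rw [wp_ite]
  refine ⟨fun h => ?_, fun h => ?_⟩
  · have h0 : s₂.v .no = 0 := by simpa using h
    obtain ⟨hna, hhit⟩ := hyes h0
    refine wp_mono (wp_reduce hE hB hKE hadj hna hhit h0
      (by rw [k2.v _ (by decide), k1.v _ (by decide), hk])
      (by rw [k2.v _ (by decide), h1.fin]) hl2
      (by rw [k2.a _ (by decide), k1.a _ (by decide)]; exact ha _)
      (by rw [k2.a _ (by decide), k1.a _ (by decide)]; exact ha _)) ?_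
    rintro t₃ s₃ ⟨ht3, h3⟩
    exact ⟨by omega, h3⟩
  · refine wp_mono (wp_outputNo hE hl2 (hno (by simp at h; omega))) ?_
    rintro t₃ s₃ ⟨ht3, h3⟩
    exact ⟨by omega, h3⟩

theorem wp_kernelize (hE : Env D W N) :
    wp W N kernelize (St.init D.list) fun t s' =>
      t ≤ 5000 * ((D.k + 1) ^ 2 * ((D.n + 1) * (D.M + 1))) ∧
      ((D.n ≤ max 4 (32 * D.k ^ 3 + 4 * D.k) ∧ s'.v .out = 0 ∧ At s'.io 0 D.list) ∨
        D.Written N s') := by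
  have hlim := hE.lim
  have hlen := hE.len
  simp only [kernelize, wp_seq, wp_get, Exp.eval]
  refine ⟨by omega, by omega, ?_⟩
  refine wp_mono (wp_frame (wp_bound (k := D.k) hlim (by simpa [St.init] using D.list_one))) ?_
  rintro t₁ s₁ ⟨⟨ht1, h1⟩, k1⟩
  have hn1 : s₁.v .n = D.n := by rw [k1.v _ (by decide)]; simpa [St.init] using D.list_zero
  have hk1 : s₁.v .k = D.k := by rw [k1.v _ (by decide)]; simpa [St.init] using D.list_one
  have hout1 : s₁.v .out = 0 := by rw [k1.v _ (by decide)]; simp [St.init]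
  have hio1 : s₁.io = fun i => D.list.getD i 0 := by rw [k1.io rfl]; rfl
  have ha1 : ∀ j i, s₁.a j i = 0 := fun j i => by
    rw [k1.a j (by simp [bound, forTo, loop, inc, Cmd.wa])]; rfl
  have b4 : 1 ≤ (D.n + 1) * (D.M + 1) := Nat.mul_pos (by omega) (by omega)
  have b5 : D.k + 1 ≤ (D.k + 1) ^ 2 * ((D.n + 1) * (D.M + 1)) := by
    rw [pow_two, mul_assoc]
    exact Nat.le_mul_of_pos_right _ (by positivity)
  rw [wp_ite]
  refine ⟨fun h => ?_, fun h => ?_⟩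
  · simp only [Exp.eval, h1, hn1] at h
    refine wp_mono (wp_large hE (by omega) hn1 hk1 (fun i hi => by rw [hio1]) ha1) ?_
    rintro t₂ s₂ ⟨ht2, h2⟩
    exact ⟨by omega, .inr h2⟩
  · simp only [Exp.eval, h1, hn1, not_lt] at h
    rw [wp_skip]
    refine ⟨by omega, .inl ⟨h, hout1, fun i hi => ?_⟩⟩
    rw [hio1, zero_add]

end

/-! ### The output instances -/

theorem map_comap_eq_restr (G : SimpleGraph ℕ) {r : ℕ} {o : ℕ → ℕ} (f : Fin r ↪ ℕ)
    (hf : ∀ i, f i = o i) : (G.comap f).map f = restr G {v | ∃ i < r, o i = v} := by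
  ext u v
  simp only [SimpleGraph.map_adj, SimpleGraph.comap_adj, restr_adj, Set.mem_ofPred_eq]
  constructor
  · rintro ⟨a, b, h, rfl, rfl⟩
    exact ⟨h, ⟨a, a.2, (hf a).symm⟩, ⟨b, b.2, (hf b).symm⟩⟩
  · rintro ⟨h, ⟨a, ha, rfl⟩, ⟨b, hb, rfl⟩⟩
    refine ⟨⟨a, ha⟩, ⟨b, hb⟩, ?_, hf _, hf _⟩
    rw [hf, hf]
    exact h

open Classical in
theorem sum_eq_ncard (G H : SimpleGraph ℕ) {r : ℕ} {o : ℕ → ℕ}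
    (ho : ∀ i j, i < j → j < r → o i ≠ o j) :
    (∑ i ∈ Finset.range r, ∑ j ∈ Finset.range r,
      if i < j ∧ H.Adj (o i) (o j) ∧ ¬ G.Adj (o i) (o j) then 1 else 0) =
    ((restr H {v | ∃ i < r, o i = v}).edgeSet \ (restr G {v | ∃ i < r, o i = v}).edgeSet).ncard := by
  have hinj : ∀ i j, i < r → j < r → o i = o j → i = j := by
    intro i j hi hj h
    rcases lt_trichotomy i j with h' | h' | h'
    · exact absurd h (ho i j h' hj)
    · exact h'
    · exact absurd h.symm (ho j i h' hi)
  rw [← Finset.sum_product' (Finset.range r) (Finset.range r) (fun i j =>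
    if i < j ∧ H.Adj (o i) (o j) ∧ ¬ G.Adj (o i) (o j) then 1 else 0), ← Finset.card_filter,
    ← Set.ncard_coe_finset]
  rw [← Set.InjOn.ncard_image (f := fun t : ℕ × ℕ => s(o t.1, o t.2))]
  · congr 1
    ext e
    induction e with
    | _ u v =>
      simp only [Set.mem_image, Finset.coe_filter, Finset.mem_product, Finset.mem_range,
        Set.mem_ofPred_eq, Set.mem_sdiff, SimpleGraph.mem_edgeSet, restr_adj, Prod.exists]
      constructor
      · rintro ⟨i, j, ⟨⟨hi, hj⟩, -, h1, h2⟩, he⟩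
        rcases Sym2.eq_iff.1 he with ⟨rfl, rfl⟩ | ⟨rfl, rfl⟩
        · exact ⟨⟨h1, ⟨i, hi, rfl⟩, ⟨j, hj, rfl⟩⟩, fun h => h2 h.1⟩
        · exact ⟨⟨h1.symm, ⟨j, hj, rfl⟩, ⟨i, hi, rfl⟩⟩, fun h => h2 h.1.symm⟩
      · rintro ⟨⟨h1, ⟨i, hi, rfl⟩, ⟨j, hj, rfl⟩⟩, h2⟩
        have h3 : ¬ G.Adj (o i) (o j) := fun h => h2 ⟨h, ⟨i, hi, rfl⟩, ⟨j, hj, rfl⟩⟩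
        rcases lt_trichotomy i j with h | rfl | h
        · exact ⟨i, j, ⟨⟨hi, hj⟩, h, h1, h3⟩, rfl⟩
        · exact absurd rfl h1.ne
        · exact ⟨j, i, ⟨⟨hj, hi⟩, h, h1.symm, fun h => h3 h.symm⟩, Sym2.eq_swap⟩
  · rintro ⟨i, j⟩ h ⟨i', j'⟩ h' he
    simp only [Finset.coe_filter, Finset.mem_product, Finset.mem_range, Set.mem_ofPred_eq] at h h'
    rcases Sym2.eq_iff.1 he with ⟨h1, h2⟩ | ⟨h1, h2⟩
    · rw [hinj _ _ h.1.1 h'.1.1 h1, hinj _ _ h.1.2 h'.1.2 h2]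
    · have e1 := hinj _ _ h.1.1 h'.1.2 h1
      have e2 := hinj _ _ h.1.2 h'.1.1 h2
      omega

open Classical in
theorem exists_isAdjList (G : SimpleGraph ℕ) {r : ℕ} {o : ℕ → ℕ} (f : Fin r ↪ ℕ)
    (hf : ∀ i, f i = o i) : ∃ adj : Fin r → List (Fin r), IsAdjList (G.comap f) adj ∧
      adjArray adj = listArray r fun i => (List.range r).filter fun j => G.Adj (o i) (o j) := by
  refine ⟨fun i => (List.finRange r).filter fun j => G.Adj (o i) (o j), fun v => ⟨?_, fun w => ?_⟩,
    ?_⟩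
  · exact (List.nodup_finRange r).filter _
  · simp [hf]
  · rw [adjArray_eq_listArray]
    refine listArray_congr fun i hi => ?_
    rw [numLists, dif_pos hi, ← List.map_coe_finRange_eq_range, List.filter_map]
    rfl

/-- Taking the minimum of the remaining budget and the number of free edges does not change the
answer, by `Sandwich.mono_min`, and it yields both parameter clauses. -/
theorem Input.Reduces.exists_instance {D : Input} {G : SimpleGraph ℕ} {o : ℕ → ℕ} {r κ : ℕ}
    (h : D.Reduces G o r κ) : ∃ I : Instance, I.RepresentedBy (kernelList G D.G₂ o r κ) ∧
      (I.IsYes ↔ Sandwich D.G₁ D.G₂ D.k) ∧ I.k ≤ D.k ∧ I.k ≤ I.numFree ∧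
      (D.k = (D.G₂.edgeSet \ D.G₁.edgeSet).ncard → I.k = I.numFree) ∧
      I.n ≤ 32 * D.k ^ 3 + 4 * D.k := by
  classical
  let f : Fin r ↪ ℕ := ⟨fun i => o i, fun i j hij => by
    have hij' : o i = o j := hij
    rcases lt_trichotomy i j with h' | h' | h'
    · exact absurd hij' (h.inj i j h' j.2)
    · exact h'
    · exact absurd hij'.symm (h.inj j i h' i.2)⟩
  have hf : ∀ i, f i = o i := fun i => rfl
  let S := ∑ i ∈ Finset.range r, ∑ j ∈ Finset.range r,
    if i < j ∧ D.G₂.Adj (o i) (o j) ∧ ¬ G.Adj (o i) (o j) then 1 else 0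
  have hS : S = ((restr D.G₂ {v | ∃ i < r, o i = v}).edgeSet \
      (restr G {v | ∃ i < r, o i = v}).edgeSet).ncard := sum_eq_ncard G D.G₂ h.inj
  have hfin : ((restr D.G₂ {v | ∃ i < r, o i = v}).edgeSet \
      (restr G {v | ∃ i < r, o i = v}).edgeSet).Finite := by
    refine (D.finite_edgeSet.subset fun e he => ?_).sdiff
    induction e with
    | _ u v => exact he.1
  let I : Instance := ⟨r, G.comap f, D.G₂.comap f, SimpleGraph.comap_monotone _ h.le, min κ S⟩
  have hfree : I.numFree = S := by
    rw [I.numFree_eq f, hS]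
    simp only [I, map_comap_eq_restr _ f hf]
  refine ⟨I, ?_, ?_, (min_le_left _ _).trans h.kk_le, ?_, fun hk => ?_, h.card_le⟩
  · obtain ⟨adj₁, h1, h1'⟩ := exists_isAdjList G f hf
    obtain ⟨adj₂, h2, h2'⟩ := exists_isAdjList D.G₂ f hf
    refine ⟨adj₁, adj₂, h1, h2, ?_⟩
    rw [h1', h2']
    rfl
  · rw [I.isYes_iff f]
    simp only [I, map_comap_eq_restr _ f hf]
    rw [hS, Sandwich.mono_min hfin, h.sandwich]
  · rw [hfree]
    exact min_le_right _ _
  · rw [hfree]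
    exact min_eq_right (hS ▸ h.free hk)

/-- A four-cycle as both graphs. With parameter 0 and no free edges it meets the parameter clauses
for every input; its size explains the 4 in the vertex bound. -/
theorem exists_noInstance : ∃ I : Instance, I.RepresentedBy noList ∧ ¬ I.IsYes ∧ I.k = 0 ∧
    I.numFree = 0 ∧ I.n = 4 := by
  let I : Instance := ⟨4, SimpleGraph.cycleGraph 4, SimpleGraph.cycleGraph 4, le_rfl, 0⟩
  let adj : Fin 4 → List (Fin 4) := ![[1, 3], [0, 2], [1, 3], [0, 2]]
  have hadj : IsAdjList (SimpleGraph.cycleGraph 4) adj := by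
    unfold IsAdjList
    simp only [SimpleGraph.cycleGraph_adj]
    decide
  refine ⟨I, ⟨adj, adj, hadj, hadj, by decide⟩, ?_, rfl, by simp [Instance.numFree, I], rfl⟩
  rintro ⟨F, hF, -, hc⟩
  have hF0 : F = ∅ := by simpa [I] using hF
  rw [hF0, Set.union_empty, SimpleGraph.fromEdgeSet_edgeSet] at hc
  exact (hc 4 le_rfl).false SimpleGraph.Embedding.refl

/-! ### The compiled program -/

/-- Compute the address at which the arrays begin. -/
def prelude : Prog :=
  .seq (.load 5 3) <| .seq (.const 9 1) <|
  .seq (.while 7 5 (.seq (.add 1 1 5) (.add 7 7 9))) <| .seq (.add 1 1 1) <|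
  .seq (.const 11 2) <| .seq (.add 11 11 5) <| .seq (.load 13 11) <| .seq (.add 1 1 13) <|
  .seq (.add 11 11 13) <| .seq (.add 11 11 5) <| .seq (.add 11 11 9) <| .seq (.load 15 11) <|
  .seq (.add 1 1 15) <| .seq (.add 1 1 5) <| .seq (.add 1 1 5) <| .seq (.add 1 1 5) <|
  .seq (.add 1 1 5) <| .seq (.const 13 44) (.add 1 1 13)

/-- Squares `n` by `n` additions; `d` is the number of passes that remain. -/
theorem exec_square {Wr n : ℕ} (hW : n * n + n + 1 ≤ Wr) (d : ℕ) (σ : State) (hd : d ≤ n)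
    (h1 : σ.reg 1 = (n - d) * n) (h5 : σ.reg 5 = n) (h7 : σ.reg 7 = n - d) (h9 : σ.reg 9 = 1) :
    ∃ σ', Exec Wr (.while 7 5 (.seq (.add 1 1 5) (.add 7 7 9))) σ (3 * d + 1) σ' ∧
      σ'.mem = σ.mem ∧ σ'.reg 1 = n * n ∧ ∀ r, r ≠ 1 → r ≠ 7 → σ'.reg r = σ.reg r := by
  induction d generalizing σ with
  | zero =>
    exact ⟨σ, .while_false (by omega), rfl, by simpa using h1, fun _ _ _ => rfl⟩
  | succ d ih =>
    have e : n - d = n - (d + 1) + 1 := by omega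
    have e2 : (n - d) * n = (n - (d + 1)) * n + n := by rw [e]; ring
    have e3 : (n - d) * n ≤ n * n := Nat.mul_le_mul_right _ (by omega)
    have x1 := Exec.add (W := Wr) 1 1 5 σ (by omega)
    have x2 := Exec.add (W := Wr) 7 7 9 (σ.setReg 1 (σ.reg 1 + σ.reg 5))
      (by simp [State.setReg]; omega)
    obtain ⟨σ', x, m, v, hr⟩ := ih ((σ.setReg 1 (σ.reg 1 + σ.reg 5)).setReg 7
      ((σ.setReg 1 (σ.reg 1 + σ.reg 5)).reg 7 + (σ.setReg 1 (σ.reg 1 + σ.reg 5)).reg 9))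
      (by omega) (by simp [State.setReg]; omega) (by simpa [State.setReg])
      (by simp [State.setReg]; omega) (by simpa [State.setReg])
    refine ⟨σ', ?_, m, v, fun r h1 h7 => ?_⟩
    · have := Exec.while_true (by omega : σ.reg 7 < σ.reg 5) (.seq x1 x2) x
      rwa [show 1 + 1 + (3 * d + 1) + 1 = 3 * (d + 1) + 1 by ring] at this
    · rw [hr r h1 h7]
      simp [State.setReg, h1, h7]

/-- The base address is `2n² + M + off₂ n + 4n + 44`: the length of the input, which is `2n + 4`
plus the two total list lengths, and the reserve. Only odd registers are used, so all variables
still start with 0. -/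
theorem exec_prelude {D : Input} {N Wr : ℕ}
    (hN : N = D.list.length + 2 * (D.n * D.n) + 2 * D.n + 40) (hW : N ≤ Wr) :
    ∃ t σ, Exec Wr prelude (State.init D.list) t σ ∧ t = 3 * D.n + 19 ∧
      σ.mem = (State.init D.list).mem ∧ σ.reg 1 = N ∧ ∀ r, σ.reg (2 * r) = 0 := by
  have hl := D.length_list
  have m0 : D.list.getD 0 0 = D.n := D.list_zero
  have m1 : D.list.getD (2 + D.n) 0 = D.M := by rw [add_comm]; exact D.list_off₁ le_rfl
  have m2 : D.list.getD (2 + D.n + D.M + D.n + 1) 0 = D.off₂ D.n := by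
    rw [← D.list_off₂ le_rfl]
    congr 1
    ring
  set n := D.n with hn
  have x1 := Exec.load (W := Wr) 5 3 (State.init D.list)
  rw [show (State.init D.list).mem ((State.init D.list).reg 3) = n from m0] at x1
  have x2 := Exec.const (W := Wr) 9 1 ((State.init D.list).setReg 5 n) (by omega)
  obtain ⟨σ, x3, m, v, hr⟩ := exec_square (Wr := Wr) (n := n) (by omega) n
    (((State.init D.list).setReg 5 n).setReg 9 1) le_rfl
    (by simp [State.setReg, State.init]) (by simp [State.setReg]) (by simp [State.setReg, State.init])
    (by simp [State.setReg])
  have h5 : σ.reg 5 = n := by rw [hr _ (by decide) (by decide)]; simp [State.setReg]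
  have h9 : σ.reg 9 = 1 := by rw [hr _ (by decide) (by decide)]; simp [State.setReg]
  have hm1 : σ.mem (2 + n) = D.M := by rw [m]; exact m1
  have hm2 : σ.mem (2 + n + D.M + n + 1) = D.off₂ n := by rw [m]; exact m2
  have he : ∀ i, σ.reg (2 * i) = 0 := fun i => by
    rw [hr _ (by omega) (by omega)]
    have h1 : 2 * i ≠ 5 := by omega
    have h2 : 2 * i ≠ 9 := by omega
    simp [State.setReg, h1, h2, State.init]
  have step : ∀ {τ : State} (x y z a : ℕ) (_ : τ.reg y + τ.reg z = a) (_ : a ≤ N),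
      Exec Wr (.add x y z) τ 1 (τ.setReg x a) := by
    rintro τ x y z a rfl h
    exact .add _ _ _ _ (h.trans hW)
  have stepL : ∀ {τ : State} (x y a : ℕ) (_ : τ.mem (τ.reg y) = a),
      Exec Wr (.load x y) τ 1 (τ.setReg x a) := by
    rintro τ x y a rfl
    exact .load _ _ _
  refine ⟨_, _, (Exec.seq x1 <| .seq x2 <| .seq x3 <|
    .seq (step 1 1 1 (2 * (n * n)) (by rw [v]; ring) (by omega)) <|
    .seq (.const 11 2 _ (by omega)) <| .seq (step 11 11 5 (2 + n) ?_ (by omega)) <|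
    .seq (stepL 13 11 D.M ?_) <| .seq (step 1 1 13 (2 * (n * n) + D.M) ?_ (by omega)) <|
    .seq (step 11 11 13 (2 + n + D.M) ?_ (by omega)) <|
    .seq (step 11 11 5 (2 + n + D.M + n) ?_ (by omega)) <|
    .seq (step 11 11 9 (2 + n + D.M + n + 1) ?_ (by omega)) <|
    .seq (stepL 15 11 (D.off₂ n) ?_) <|
    .seq (step 1 1 15 (2 * (n * n) + D.M + D.off₂ n) ?_ (by omega)) <|
    .seq (step 1 1 5 (2 * (n * n) + D.M + D.off₂ n + n) ?_ (by omega)) <|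
    .seq (step 1 1 5 (2 * (n * n) + D.M + D.off₂ n + n + n) ?_ (by omega)) <|
    .seq (step 1 1 5 (2 * (n * n) + D.M + D.off₂ n + n + n + n) ?_ (by omega)) <|
    .seq (step 1 1 5 (2 * (n * n) + D.M + D.off₂ n + n + n + n + n) ?_ (by omega)) <|
    .seq (.const 13 44 _ (by omega)) (step 1 1 13 N ?_ le_rfl)), by ring, ?_, ?_, ?_⟩
  any_goals simp [State.setReg, Function.update_apply, h5, h9, hm1, hm2]
  · omega
  · exact m
  · intro i
    rw [if_neg (by omega), if_neg (by omega), if_neg (by omega), if_neg (by omega),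
      if_neg (by omega)]
    exact he i

theorem Input.le_of_mem_list {D : Input} {a : ℕ} (h : a ∈ D.list) : a ≤ D.list.length + D.k := by
  have hl := D.length_list
  simp only [Input.list, listArray, List.mem_cons, List.mem_append, List.mem_map, List.mem_range,
    List.mem_flatMap] at h
  rcases h with rfl | rfl | (⟨i, hi, rfl⟩ | ⟨u, hu, ha⟩) | ⟨i, hi, rfl⟩ | ⟨u, hu, ha⟩
  · omega
  · omega
  · have : D.off₁ i ≤ D.M := D.off₁_mono (by omega)
    change D.off₁ i ≤ _
    omega
  · have := (D.lt' ((D.mem₁ _ _).1 ha)).2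
    omega
  · have : D.off₂ i ≤ D.off₂ D.n := D.off₂_mono (by omega)
    change D.off₂ i ≤ _
    omega
  · have := D.lt _ _ ((D.mem₂ _ _).1 ha).symm
    omega

/-- The machine program. -/
def program : Prog := .seq prelude kernelize.comp

/-- The input has at least four cells, so powers of `l + k` absorb constants: the sixth power bounds
all stored values, and further powers cover the factor that depends on the program. An exponent
independent of the input means words of logarithmic length. -/
theorem word_bounds {l n k c : ℕ} (hn : 2 * n + 4 ≤ l) :
    l + 2 * (n * n) + 2 * n + 40 ≤ (l + k) ^ 6 ∧ 32 * k ^ 3 + 4 * k + 4 ≤ (l + k) ^ 6 ∧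
      l + k ≤ (l + k) ^ 6 ∧
      l + 2 * (n * n) + 2 * n + 40 + 16 * (c * (l + k) ^ 6) + 16 ≤ (l + k) ^ (c + 10) := by
  set S := l + k with hS
  have h4 : 4 ≤ S := by omega
  have hSS : 4 * S ≤ S * S := Nat.mul_le_mul_right _ h4
  have hSSS : 4 * (S * S) ≤ S * (S * S) := Nat.mul_le_mul_right _ h4
  have h64 : 64 ≤ S * (S * S) := by omega
  have h6 : S ^ 6 = S * (S * S) * (S * (S * S)) := by ring
  have h6' : 64 * (S * (S * S)) ≤ S ^ 6 := h6 ▸ Nat.mul_le_mul_right _ h64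
  have hnn : 2 * n * (2 * n) ≤ S * S := Nat.mul_le_mul (by omega) (by omega)
  have hnn' : 2 * n * (2 * n) = 4 * (n * n) := by ring
  have hk3 : k ^ 3 ≤ S * (S * S) := by
    calc k ^ 3 ≤ S ^ 3 := Nat.pow_le_pow_left (by omega) 3
      _ = S * (S * S) := by ring
  have hN : l + 2 * (n * n) + 2 * n + 40 ≤ S ^ 6 := by omega
  refine ⟨hN, by omega, by omega, ?_⟩
  have hc : c + 1 ≤ S ^ c := Nat.lt_pow_self (by omega)
  have h256 : 256 ≤ S ^ 4 := by
    calc 256 = 4 ^ 4 := by norm_num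
      _ ≤ S ^ 4 := Nat.pow_le_pow_left h4 4
  have h1 : S ^ (c + 10) = S ^ c * (S ^ 4 * S ^ 6) := by ring
  have h2 : (c + 1) * (256 * S ^ 6) ≤ S ^ (c + 10) := by
    rw [h1]
    exact Nat.mul_le_mul hc (Nat.mul_le_mul_right _ h256)
  have h3 : (c + 1) * (256 * S ^ 6) = 256 * (c * S ^ 6) + 256 * S ^ 6 := by ring
  omega

theorem time_bound {k n m : ℕ} : (k + 1) ^ 2 * ((n + 1) * (2 * m + 1)) ≤
    24 * (max 1 k ^ 2 * max 1 n * max 1 m) := by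
  have h1 : k + 1 ≤ 2 * max 1 k := by omega
  have h2 : n + 1 ≤ 2 * max 1 n := by omega
  have h3 : 2 * m + 1 ≤ 3 * max 1 m := by omega
  calc (k + 1) ^ 2 * ((n + 1) * (2 * m + 1))
      ≤ (2 * max 1 k) ^ 2 * (2 * max 1 n * (3 * max 1 m)) :=
        Nat.mul_le_mul (Nat.pow_le_pow_left h1 2) (Nat.mul_le_mul h2 h3)
    _ = 24 * (max 1 k ^ 2 * max 1 n * max 1 m) := by ring

theorem exec_program (D : Input) {Z : ℕ} (hZ : kernelize.size ≤ Z) : ∃ t σ,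
    Exec ((D.list.length + D.k) ^ (Z + 10)) program (State.init D.list) t σ ∧
    t ≤ (120000 * Z + 28) * ((D.k + 1) ^ 2 * ((D.n + 1) * (D.M + 1))) ∧
    ((D.n ≤ max 4 (32 * D.k ^ 3 + 4 * D.k) ∧ σ.HasOutput D.list) ∨
      ∃ L, σ.HasOutput L ∧ ((L = noList ∧ ¬ Sandwich D.G₁ D.G₂ D.k) ∨
        ∃ G o r κ, D.Reduces G o r κ ∧ L = kernelList G D.G₂ o r κ)) := by
  obtain ⟨w1, w2, w3, w4⟩ := word_bounds (l := D.list.length) (n := D.n) (k := D.k)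
    (c := Z) (by rw [D.length_list]; omega)
  set W := (D.list.length + D.k) ^ 6 with hW
  set N := D.list.length + 2 * (D.n * D.n) + 2 * D.n + 40 with hN
  obtain ⟨t₁, σ₁, x1, ht1, m1, v1, r1⟩ := exec_prelude (D := D) (Wr :=
    (D.list.length + D.k) ^ (Z + 10)) hN (by omega)
  have hE : Env D W N := ⟨by omega, w1, w2⟩
  obtain ⟨t, s, hx, ht, hres⟩ := wp_kernelize hE
  have hle : ∀ i, D.list.getD i 0 ≤ W := fun i => by
    rcases lt_or_ge i D.list.length with h | h
    · rw [List.getD_eq_getElem _ _ h]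
      exact (Input.le_of_mem_list (List.getElem_mem h)).trans w3
    · rw [List.getD_eq_default _ _ h]
      exact Nat.zero_le _
  -- The arrays begin behind the input, where the memory is zero, so the machine state represents
  -- arrays filled with zeros.
  have hSim : Sim W N (St.init D.list) σ₁ := ⟨fun x => r1 _, v1, fun i _ => by rw [m1]; rfl,
    fun j i => by
      rw [m1]
      exact List.getD_eq_default _ _ (by omega),
    fun _ => Nat.zero_le _, fun _ _ => Nat.zero_le _, fun i _ => hle i⟩
  obtain ⟨t₂, σ₂, x2, ht2, S2⟩ := hx.sim (by omega) w4 hZ σ₁ hSim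
  have hout : σ₂.reg 0 = s.v .out := S2.var .out
  have hhas : ∀ p L, s.v .out = p → p + L.length ≤ N → At s.io p L → σ₂.HasOutput L := by
    intro p L hp hl hat i hi
    rw [hout, hp, S2.io _ (by omega), hat i hi, List.getD_eq_getElem _ _ hi]
  refine ⟨_, σ₂, .seq x1 x2, ?_, ?_⟩
  · set Y := (D.k + 1) ^ 2 * ((D.n + 1) * (D.M + 1)) with hY
    have hY1 : D.n + 1 ≤ Y :=
      (Nat.le_mul_of_pos_right _ (Nat.succ_pos _)).trans (Nat.le_mul_of_pos_left _ (by positivity))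
    calc t₁ + t₂ ≤ 28 * Y + 24 * Z * (5000 * Y) := by
          have := Nat.mul_le_mul_left (24 * Z) ht
          omega
      _ = (120000 * Z + 28) * Y := by ring
  · rcases hres with ⟨h1, h2, h3⟩ | ⟨h1, L, h2, h3, h4⟩
    · exact .inl ⟨h1, hhas 0 _ h2 (by omega) h3⟩
    · exact .inr ⟨L, hhas _ _ h1 h2 h3, h4⟩

end ChordalSandwich

/-! ### The kernelization theorem -/

theorem mainTheorem6 :
    ∃ (p : ChordalSandwich.Prog) (C c : ℕ),
      ∀ (I : ChordalSandwich.Instance) (L : List ℕ), I.RepresentedBy L →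
        ∃ (t : ℕ) (s : ChordalSandwich.State) (I' : ChordalSandwich.Instance) (L' : List ℕ),
          -- the program halts, on words of `O(log (|L| + k))` bits
          ChordalSandwich.Exec ((L.length + I.k) ^ c) p (ChordalSandwich.State.init L) t s ∧
          -- within `O(k² n m)` steps
          t ≤ C * (max 1 I.k ^ 2 * max 1 I.n * max 1 I.m) ∧
          -- and outputs an instance
          s.HasOutput L' ∧ I'.RepresentedBy L' ∧
          -- that is equivalent to the given one and has a parameter that is no larger
          (I'.IsYes ↔ I.IsYes) ∧ I'.k ≤ I.k ∧
          (I.k ≤ I.numFree → I'.k ≤ I'.numFree) ∧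
          (I.k = I.numFree → I'.k = I'.numFree) ∧
          -- and `O(k³)` vertices
          I'.n ≤ max 4 (32 * I.k ^ 3 + 4 * I.k) := by
  refine ⟨ChordalSandwich.program, (120000 * ChordalSandwich.kernelize.size + 28) * 24,
    ChordalSandwich.kernelize.size + 10, fun I L hL => ?_⟩
  obtain ⟨D, hn, hk, h1, h2, rfl, hM⟩ := hL.exists_input
  obtain ⟨t, s, hx, ht, hres⟩ := ChordalSandwich.exec_program D le_rfl
  have hfree := I.numFree_eq Fin.valEmbedding
  have hyes := I.isYes_iff Fin.valEmbedding
  rw [← h1, ← h2] at hfree hyes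
  rw [hM, hk, hn] at ht
  rw [hk] at hx hres
  have ht' := ht.trans (Nat.mul_le_mul_left _ ChordalSandwich.time_bound)
  rw [← mul_assoc] at ht'
  -- There are three outcomes: the small input itself, the four-cycle when there is no solution, and
  -- the kernel.
  rcases hres with ⟨h3, h4⟩ | ⟨L', h4, ⟨rfl, h5⟩ | ⟨G, o, r, κ, h5, rfl⟩⟩
  · exact ⟨t, s, I, D.list, hx, ht', h4, hL, Iff.rfl, le_rfl, id, id, hn ▸ h3⟩
  · obtain ⟨I', g1, g2, g3, g4, g5⟩ := ChordalSandwich.exists_noInstance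
    refine ⟨t, s, I', _, hx, ht', h4, g1, iff_of_false g2 fun h => h5 (hyes.1 h),
      by omega, fun _ => by omega, fun _ => by omega, ?_⟩
    rw [g5]
    exact le_max_left _ _
  · obtain ⟨I', g1, g2, g3, g4, g5, g6⟩ := h5.exists_instance
    rw [hk] at g2 g3 g5 g6
    exact ⟨t, s, I', _, hx, ht', h4, g1, g2.trans hyes.symm, g3, fun _ => g4,
      fun h => g5 (h.trans hfree), g6.trans (le_max_right _ _)⟩
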